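/- **Setting.** Let $k$ be an algebraically closed field with characteristic exponent $p\ge 1$. Let $P$ be a closed point of a nonsingular threefold $W$ over $k$ with completed local ring $\widehat{\mathcal O}$ (a power series ring in three variables over $k$) and maximal ideal $\mathfrak m$. Let $\mathcal R=(\mathcal I_n)_{n\ge 0}$ be an idealistic filtration on $\widehat{\mathcal O}$, i.e. $\mathcal I_0=\widehat{\mathcal O}\supset \mathcal I_1\supset\cdots$ with $\bigoplus_n \mathcal I_n$ a finitely generated graded algebra, and let $E$ be the set of boundary components through $P$ (all of them "young"), with distinct indices. $\mathrm{Sing}(\mathcal R)$ is the set of points $Q$ with $\mathrm{ord}_Q\mathcal I_n\ge n$ for all $n$; assume $P\in\mathrm{Sing}(\mathcal R)$. The invariant $\sigma(P)$ is the sequence $(3-\dim_k L^{\rm pure}_{p^i})_{i\ge 0}$, where $L^{\rm pure}_{p^i}$ is the space of $p^i$-th powers of linear forms that occur as degree $p^i$ initial forms of elements of level $p^i$ in the differential saturation of $\mathcal R$. $P$ is in the *monomial case with $\tau=1$* if there are a regular system of parameters $X=(z,x,y)$, a number $q=p^e$, an element $h=z^{q}+a_1z^{q-1}+\dots+a_{q}$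 with $a_i\in k[[x,y]]$, $\mathrm{ord}(a_i)>i$, and a monomial $M=\prod_{D\in E}x_D^{m_D}$ at a level $a>0$ with $\sum m_D>a$, each $D\in E$ being defined by $x_D=x$ or $x_D=y$, such that: (1) $\{(h,q)\}$ is a leading generator system of $\mathcal R$: $h\in\mathcal I_q$, and $L^{\rm pure}_{p^i}$ is $0$ for $i<e$ and is spanned by the initial form $z^{p^i}$ of $h^{p^{i-e}}$ for $i\ge e$; (2) $M\in\mathcal I_a$; (3) if $f\in\mathcal I_\lambda$ and $c_0$ is the constant term of the expansion $f=\sum_b c_bh^b$ ($\deg_z c_b<q$), then $x_D^{\lceil m_D\lambda/a\rceil}\mid c_0$ for all $D\in E$; (4) $f\in\mathcal I_\lambda$ implies $\partial_z^{[n]}f\in\mathcal I_{\max(0,\lambda-n)}$ for all Hasse derivatives $\partial_z^{[n]}$. Put $\mu(\xi_D)=m_D/a$ and $\mu(P)=\sum_D m_D/a$. The element $h$ is *well-adapted* at $P$ (resp. at the generic point $\xi_D$ of $D$) if its slope $s=\min\{\mathrm{ord}_\bullet(a_q)/q,\mu(\bullet)\}$ at $\bullet=P$ (resp. $\xi_D$)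 equals $\mu(\bullet)$, or $s<\mu(\bullet)$ and the initial form of $a_q$ at $\bullet$ is not a $q$-th power; then $\mathrm H(\bullet)=s$. Assume that $h$ is well-adapted at $P$ and at all $\xi_D$, $D\in E$, simultaneously. $P$ (resp. $D$) is *good* if $\mathrm H=\mu$ there, *bad* if $\mathrm H<\mu$. Put $T=\sum_{D}\mathrm H(\xi_D)$, the order of the tight monomial. For bad $D$ let $w\text{-}\rho_D(P)=\frac1q\,\mathrm{res\text{-}ord}(\mathrm{In}_{\xi_D}a_q)-T$, where $\mathrm{res\text{-}ord}$ is the lowest degree of a nonzero term that is not a $q$-th power. The word $A$ lists the $w\text{-}\rho_D(P)$, $D$ bad, in increasing order ($A=0$, the smallest word, if one of them is $0$ or there is no bad $D$); $B=\mu(P)-T$. Words are ordered lexicographically. The invariant $\mathrm{inv}_{\mathrm{MON},\spadesuit}(P)$ is the pair of the words $A,B$ lined up in increasing order, and it is $0$, the smallest pair, if $A=0$ or $B=0$; pairs are ordered lexicographically. The *tight monomial case* means $\mathrm H(P)=T$. Configurations: ① one component, good; ② two components, both good; ③ one component, bad; ④ two components, exactly one bad; ⑤ two components, both bad. **Proposition.**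 1. In configurations ① and ②, $\mathrm{inv}_{\mathrm{MON},\spadesuit}(P)=0$, and $P$ is in the tight monomial case. 2. Let $P$ be in configuration ③, ④ or ⑤ with $\mathrm{inv}_{\mathrm{MON},\spadesuit}(P)\ne 0$. Let $\pi$ be the blow-up with the center $C$ of the algorithm: if $\dim\mathrm{Sing}(\mathcal R)_P=1$, then $C$ is a curve $V(z,x_D)\subset\mathrm{Sing}(\mathcal R)$, $D\in E$ (if there are two such curves, the one with the bigger $\mathrm H(\xi_D)$, and in case of equality the one where $D$ has the bigger index); otherwise $C=P$. Let $\widetilde{\mathcal R}$ be the transform of $\mathcal R$ (generated by the $(\pi^*f/t^{n},n)$, $f\in\mathcal I_n$, with $t$ an equation of the exceptional divisor), let $\widetilde P\in\pi^{-1}(P)\cap\mathrm{Sing}(\widetilde{\mathcal R})$ be a closed point with $\sigma(\widetilde P)=\sigma(P)$, and let $\widetilde E$ consist of the exceptional divisor and of the strict transforms of the components of $E$ that pass through $\widetilde P$. Then $\widetilde P$ is again in the monomial case with $\tau=1$ (with well-adapted data), and the following holds for all such data at $\widetilde P$. (a) If $C=V(z,x_D)$ is a curve, then $\mathrm{inv}_{\mathrm{MON},\spadesuit}(\widetilde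 P)=\mathrm{inv}_{\mathrm{MON},\spadesuit}(P)$, and the exceptional divisor $\widetilde D$ satisfies $\mu(\xi_{\widetilde D})=\mu(\xi_D)-1<\mu(\xi_D)$. (b) Let $C=P$. Call $\pi$ esoteric at $\widetilde P$ if $\widetilde P$ is in configuration ③, ④ or ⑤ and $A<\widetilde A$, where $\widetilde A$ is the word $A$ at $\widetilde P$. If $\pi$ is not esoteric, then $\mathrm{inv}_{\mathrm{MON},\spadesuit}(\widetilde P)<\mathrm{inv}_{\mathrm{MON},\spadesuit}(P)$. If $\pi$ is esoteric, then either $P$ is in configuration ④ or ⑤ and $\widetilde P$ is in configuration ③; or $P$ is a good point in configuration ⑤ and $\widetilde P$ is in configuration ④, and in this second case still $\mathrm{inv}_{\mathrm{MON},\spadesuit}(\widetilde P)<\mathrm{inv}_{\mathrm{MON},\spadesuit}(P)$. In particular, the strict decrease can fail only from ④ or ⑤ to ③. -/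

import Mathlib

/-! ## Idealistic filtrations on a complete local ring

Throughout, `k` is the base field, `O` is (isomorphic to) a power series ring in three variables
over `k`, i.e. the completed local ring of a nonsingular 3-fold at a closed point, and an
idealistic filtration is the family `R n` (`n : ℕ`) of its ideals at level `n`. -/

namespace Idealistic

open IsLocalRing

/-- `O = R 0 ⊇ R 1 ⊇ R 2 ⊇ ⋯` and `⨁ R n` is a graded algebra. -/
def IsFiltration {O : Type*} [CommRing O] (R : ℕ → Ideal O) : Prop :=
  R 0 = ⊤ ∧ Antitone R ∧ ∀ m n, R m * R n ≤ R (m + n)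

/-- An idealistic filtration (of i.f.g. type): a filtration for which the graded `O`-algebra
`⨁ R n tⁿ ⊆ O[t]` is finitely generated. -/
def IsIdealisticFiltration {O : Type*} [CommRing O] (R : ℕ → Ideal O) : Prop :=
  IsFiltration R ∧
    ∃ S : Subalgebra O (Polynomial O), S.FG ∧ ∀ f, f ∈ S ↔ ∀ n, f.coeff n ∈ R n

/-- `Sing(R)`: the points `𝔭` with `ord_𝔭 (R n) ≥ n` for all `n`. -/
def singLocus {O : Type*} [CommRing O] (R : ℕ → Ideal O) : Set (PrimeSpectrum O) :=
  {P | ∀ n, (R n).map (algebraMap O (Localization.AtPrime P.asIdeal)) ≤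
    maximalIdeal (Localization.AtPrime P.asIdeal) ^ n}

/-- `k`-linear differential operators of order `≤ n` (Grothendieck's definition). -/
def IsDiffOp (k : Type*) {O : Type*} [Field k] [CommRing O] [Algebra k O] :
    ℕ → (O →ₗ[k] O) → Prop
  | 0, D => ∀ f : O, D ∘ₗ LinearMap.mulLeft k f - LinearMap.mulLeft k f ∘ₗ D = 0
  | n + 1, D => ∀ f : O, IsDiffOp k n (D ∘ₗ LinearMap.mulLeft k f - LinearMap.mulLeft k f ∘ₗ D)

/-- Closed under differentiation: a differential operator of order `≤ t` lowers the level
by at most `t`. -/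
def IsDiffClosed (k : Type*) {O : Type*} [Field k] [CommRing O] [Algebra k O]
    (S : ℕ → Ideal O) : Prop :=
  ∀ (t : ℕ) (D : O →ₗ[k] O), IsDiffOp k t D → ∀ n, ∀ f ∈ S n, D f ∈ S (n - t)

/-- The differential saturation: the smallest filtration containing `R` that is closed under
differentiation. -/
def diffSat (k : Type*) {O : Type*} [Field k] [CommRing O] [Algebra k O]
    (R : ℕ → Ideal O) (n : ℕ) : Ideal O :=
  sInf {I | ∃ S : ℕ → Ideal O, IsFiltration S ∧ (∀ m, R m ≤ S m) ∧ IsDiffClosed k S ∧ I = S n}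

/-- The degree `n` part of the pure part of the leading algebra of `S`, inside `O / 𝔪ⁿ⁺¹`: the
classes of those `f ∈ S n` that agree with an `n`-th power `ℓⁿ`, `ℓ ∈ 𝔪`, modulo `𝔪ⁿ⁺¹`.  It is
used only when `n` is a power of the characteristic exponent; over a perfect field this set of
classes is then already a subspace. -/
def leadPure (k : Type*) {O : Type*} [Field k] [CommRing O] [IsLocalRing O] [Algebra k O]
    (S : ℕ → Ideal O) (n : ℕ) : Submodule k (O ⧸ maximalIdeal O ^ (n + 1)) :=
  Submodule.span k {c | ∃ f ∈ S n, (∃ l ∈ maximalIdeal O, f - l ^ n ∈ maximalIdeal O ^ (n + 1)) ∧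
    c = Ideal.Quotient.mk (maximalIdeal O ^ (n + 1)) f}

/-- The invariant `σ = (3 - dim L^pure_{p^0}, 3 - dim L^pure_{p^1}, …)` at the closed point of the
three-dimensional ring `O`, computed from the leading algebra of the differential saturation. -/
noncomputable def sigma (k : Type*) (p : ℕ) {O : Type*} [Field k] [CommRing O] [IsLocalRing O]
    [Algebra k O] (R : ℕ → Ideal O) (e : ℕ) : ℤ :=
  3 - (Module.finrank k (leadPure k (diffSat k R) (p ^ e)) : ℤ)

/-- `{(h, p ^ e)}` is a leading generator system of `R` (with a single element): `(h, p ^ e) ∈ R`,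
and, for every `i`, the powers `h ^ (p ^ (i - e))` with `e ≤ i` give a basis of the pure part of
degree `p ^ i` of the leading algebra. -/
def IsLGS (k : Type*) (p : ℕ) {O : Type*} [Field k] [CommRing O] [IsLocalRing O] [Algebra k O]
    (R : ℕ → Ideal O) (h : O) (e : ℕ) : Prop :=
  h ∈ R (p ^ e) ∧
  (∃ l ∈ maximalIdeal O, h - l ^ p ^ e ∈ maximalIdeal O ^ (p ^ e + 1)) ∧
  (∀ i < e, leadPure k (diffSat k R) (p ^ i) = ⊥) ∧
  ∀ i, e ≤ i →
    h ^ p ^ (i - e) ∉ maximalIdeal O ^ (p ^ i + 1) ∧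
    leadPure k (diffSat k R) (p ^ i) =
      Submodule.span k {Ideal.Quotient.mk (maximalIdeal O ^ (p ^ i + 1)) (h ^ p ^ (i - e))}

/-! ## Blow-ups and transforms -/

/-- `φ : O → O'` is the homomorphism of completed local rings induced by the blow-up of the
nonsingular center with ideal `I`, at a closed point lying over the closed point of `O`, and
`exc` is an equation of the exceptional divisor.  Namely, there are regular systems of parameters
`u` of `O` (with `I` generated by the `u i`, `i ∈ J`) and `v` of `O'` such that `φ` is given by
`u j = v j`, `u i = v j * v i` for `i ∈ J \ {j}` and `u i = v i` for `i ∉ J`.  (A regular system of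
parameters is given as an isomorphism from the power series ring.  By a linear change of the `u i`,
`i ∈ J`, every closed point of the exceptional fibre becomes the origin of such a chart, as the
residue field is algebraically closed.) -/
def IsBlowupGerm {k O O' : Type*} [Field k] [CommRing O] [Algebra k O] [CommRing O'] [Algebra k O']
    (φ : O →ₐ[k] O') (I : Ideal O) (exc : O') : Prop :=
  ∃ (u : MvPowerSeries (Fin 3) k ≃ₐ[k] O) (v : MvPowerSeries (Fin 3) k ≃ₐ[k] O')
    (J : Finset (Fin 3)) (j : Fin 3), 2 ≤ J.card ∧ j ∈ J ∧
    I = Ideal.span {f | ∃ i ∈ J, f = u (MvPowerSeries.X i)} ∧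
    exc = v (MvPowerSeries.X j) ∧
    φ (u (MvPowerSeries.X j)) = v (MvPowerSeries.X j) ∧
    (∀ i ∈ J, i ≠ j →
      φ (u (MvPowerSeries.X i)) = v (MvPowerSeries.X j) * v (MvPowerSeries.X i)) ∧
    ∀ i, i ∉ J → φ (u (MvPowerSeries.X i)) = v (MvPowerSeries.X i)

/-- The transform of an idealistic filtration: generated by all `(φ f / exc ^ m, m)` with
`(f, m) ∈ R`. -/
def transformFiltration {k O O' : Type*} [Field k] [CommRing O] [Algebra k O] [CommRing O']
    [Algebra k O'] (φ : O →ₐ[k] O') (exc : O') (R : ℕ → Ideal O) (n : ℕ) : Ideal O' :=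
  Ideal.span {g | ∃ m, n ≤ m ∧ ∃ f ∈ R m, φ f = exc ^ m * g}

/-- The ideal of the strict transform of the subscheme with ideal `D`. -/
def strictTransform {k O O' : Type*} [Field k] [CommRing O] [Algebra k O] [CommRing O']
    [Algebra k O'] (φ : O →ₐ[k] O') (exc : O') (D : Ideal O) : Ideal O' :=
  Ideal.span {g | ∃ n : ℕ, exc ^ n * g ∈ D.map φ}

/-- The transform of the boundary: the strict transforms passing through the new point, and the
exceptional divisor. -/
def transformBoundary {k O O' : Type*} [Field k] [CommRing O] [Algebra k O] [CommRing O']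
    [Algebra k O'] (φ : O →ₐ[k] O') (exc : O') (E : Set (Ideal O)) : Set (Ideal O') :=
  {D' | D' = Ideal.span {exc} ∨ ∃ D ∈ E, D' = strictTransform φ exc D ∧ D' ≠ ⊤}

/-! ## Orders and initial forms of power series -/

/-- The Hasse derivative of order `n` with respect to the variable with index `0`. -/
noncomputable def hasseZ {k : Type*} [Field k] (n : ℕ) (f : MvPowerSeries (Fin 3) k) :
    MvPowerSeries (Fin 3) k :=
  fun s => ((s 0 + n).choose n : k) * MvPowerSeries.coeff (s + Finsupp.single 0 n) f

/-- `min {n / q, c}` for an order `n`, which is `∞` for the zero series. -/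
noncomputable def slopeVal : ℕ∞ → ℕ → ℚ → ℚ
  | ⊤, _, c => c
  | (n : ℕ), q, c => min ((n : ℚ) / q) c

/-- The order of `f` along the divisor `{x_i = 0}`. -/
noncomputable def ordAlong {k : Type*} [Field k] (i : Fin 3) (f : MvPowerSeries (Fin 3) k) : ℕ∞ :=
  emultiplicity (MvPowerSeries.X i) f

/-- The initial form of `f` at the closed point. -/
noncomputable def initPoint {k : Type*} [Field k] (f : MvPowerSeries (Fin 3) k) :
    MvPowerSeries (Fin 3) k :=
  MvPowerSeries.homogeneousComponent f.order.toNat f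

/-- The initial form `x_i ^ r * g` of `f` at the generic point of `{x_i = 0}`, where
`f = x_i ^ r * (g + x_i * ω)` with `r` the order along `x_i` and `g` not involving `x_i`. -/
noncomputable def initAlong {k : Type*} [Field k] (i : Fin 3) (f : MvPowerSeries (Fin 3) k) :
    MvPowerSeries (Fin 3) k :=
  open Classical in
  fun s => if s i = (ordAlong i f).toNat then MvPowerSeries.coeff s f else 0

/-- `res-ord^(q)`: the lowest degree of a nonzero term that is not a `q`-th power.  (The base field
is perfect, so a term is a `q`-th power iff all its exponents are multiples of `q`.) -/
noncomputable def resOrd {k : Type*} [Field k] (q : ℕ) (f : MvPowerSeries (Fin 3) k) : ℕ :=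
  sInf {n | ∃ s : Fin 3 →₀ ℕ, MvPowerSeries.coeff s f ≠ 0 ∧ ¬ (∀ i, q ∣ s i) ∧ n = s.degree}

/-! ## The monomial case with `τ = 1` in dimension 3 -/

/-- The data entering the description of the monomial case with `τ = 1`: a regular system of
parameters `X = (z, x, y)` (the images of the variables with indices `0, 1, 2`), the exponent `e`
and the coefficients `a_i` of the unique element `h` of the leading generator system in
Weierstrass form, the set of the indices of those parameters that define the components of
`E_young`, and the monomial `M = ∏ x_i ^ m i` at level `a`. -/
structure MonomialDatum (k : Type*) (p : ℕ) (O : Type*) [Field k] [CommRing O] [Algebra k O] where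
  X : MvPowerSeries (Fin 3) k ≃ₐ[k] O
  e : ℕ
  coef : ℕ → MvPowerSeries (Fin 3) k
  young : Finset (Fin 3)
  m : Fin 3 → ℕ
  a : ℕ

namespace MonomialDatum

variable {k : Type*} {p : ℕ} {O : Type*} [Field k] [CommRing O] [Algebra k O]

/-- The regular parameters `z = x 0`, `x = x 1`, `y = x 2`. -/
noncomputable def x (d : MonomialDatum k p O) (i : Fin 3) : O := d.X (MvPowerSeries.X i)

/-- `p ^ e`. -/
def q (d : MonomialDatum k p O) : ℕ := p ^ d.e

/-- `h = z^(p^e) + a_1 z^(p^e - 1) + ⋯ + a_(p^e)`. -/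
noncomputable def h (d : MonomialDatum k p O) : O :=
  d.x 0 ^ d.q + ∑ i ∈ Finset.Icc 1 d.q, d.X (d.coef i) * d.x 0 ^ (d.q - i)

/-- `M`. -/
noncomputable def M (d : MonomialDatum k p O) : O := ∏ i ∈ d.young, d.x i ^ d.m i

/-- `f = ∑ c_b h^b` is the power series expansion of `f` with respect to `h` and `X`: each `c_b`
has degree `< p^e` in `z`. -/
def IsExpansion (d : MonomialDatum k p O) (f : O) (c : ℕ → O) : Prop :=
  (∀ b s, MvPowerSeries.coeff s (d.X.symm (c b)) ≠ 0 → s 0 < d.q) ∧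
  ∀ N, d.h ^ N ∣ f - ∑ b ∈ Finset.range N, c b * d.h ^ b

/-- The setting of the monomial case with `τ = 1` at the closed point of `O`, for the idealistic
filtration `R` and the set `E` of (ideals of) components of the boundary through the point, all of
which belong to `E_young`. -/
structure IsMonomialCase [IsLocalRing O] (d : MonomialDatum k p O) (R : ℕ → Ideal O)
    (E : Set (Ideal O)) : Prop where
  /-- the components of `E_young` are defined by `x` or `y` -/
  z_notMem : (0 : Fin 3) ∉ d.young
  boundary : E = {D | ∃ i ∈ d.young, D = Ideal.span {d.x i}}
  /-- Weierstrass form: `a_i ∈ k[[x, y]]` and `ord a_i > i` -/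
  coef_xy : ∀ i ∈ Finset.Icc 1 d.q, ∀ s : Fin 3 →₀ ℕ, MvPowerSeries.coeff s (d.coef i) ≠ 0 → s 0 = 0
  coef_order : ∀ i ∈ Finset.Icc 1 d.q, (i : ℕ∞) < (d.coef i).order
  /-- condition 1: `{(h, p^e)}` is an L.G.S. and `h = z^(p^e)` modulo `𝔪^(p^e + 1)` -/
  lgs : IsLGS k p R d.h d.e
  lgs_initial : d.h - d.x 0 ^ d.q ∈ maximalIdeal O ^ (d.q + 1)
  /-- condition 2: the monomial -/
  a_pos : 0 < d.a
  monomial_mem : d.M ∈ R d.a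
  monomial_order : d.a < ∑ i ∈ d.young, d.m i
  /-- condition 3: `(M^(1/a))^l` divides the constant term of the expansion of `f`, `(f, l) ∈ R` -/
  control : ∀ l, ∀ f ∈ R l, ∀ c : ℕ → O, d.IsExpansion f c →
    ∀ i ∈ d.young, d.x i ^ ⌈(d.m i * l : ℚ) / d.a⌉₊ ∣ c 0
  /-- condition 4: closed under the (Hasse) partial derivatives with respect to `z` -/
  deriv_mem : ∀ l, ∀ f ∈ R l, ∀ n, d.X (hasseZ n (d.X.symm f)) ∈ R (l - n)

/-- The last coefficient `a_(p^e)`. -/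
def lastCoef (d : MonomialDatum k p O) : MvPowerSeries (Fin 3) k := d.coef d.q

/-- `μ(ξ_D)` for `D = {x_i = 0}`. -/
def mu (d : MonomialDatum k p O) (i : Fin 3) : ℚ := d.m i / d.a

/-- `μ(P) = ord_P(M_usual)`. -/
def muPoint (d : MonomialDatum k p O) : ℚ := ∑ i ∈ d.young, d.mu i

/-- The slope at `P`; equal to `H(P)` when `h` is well-adapted at `P`. -/
noncomputable def slopePoint (d : MonomialDatum k p O) : ℚ :=
  slopeVal d.lastCoef.order d.q d.muPoint

/-- The slope at `ξ_D`, `D = {x_i = 0}`; equal to `H(ξ_D)` when `h` is well-adapted at `ξ_D`. -/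
noncomputable def slope (d : MonomialDatum k p O) (i : Fin 3) : ℚ :=
  slopeVal (ordAlong i d.lastCoef) d.q (d.mu i)

/-- `h` is well-adapted at `P` with respect to `X`. -/
def WellAdaptedPoint (d : MonomialDatum k p O) : Prop :=
  d.slopePoint = d.muPoint ∨
    (d.slopePoint < d.muPoint ∧ ¬ ∃ g, g ^ d.q = initPoint d.lastCoef)

/-- `h` is well-adapted at the generic point of `{x_i = 0}` with respect to `X`. -/
def WellAdaptedAlong (d : MonomialDatum k p O) (i : Fin 3) : Prop :=
  d.slope i = d.mu i ∨
    (d.slope i < d.mu i ∧ ¬ ∃ g, g ^ d.q = initAlong i d.lastCoef)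

/-- The monomial case with `τ = 1`, where `h` is well-adapted with respect to `X` simultaneously
at `P` and at the generic points of all the components of `E_young` through `P`. -/
def IsWellAdaptedCase [IsLocalRing O] (d : MonomialDatum k p O) (R : ℕ → Ideal O)
    (E : Set (Ideal O)) : Prop :=
  d.IsMonomialCase R E ∧ d.WellAdaptedPoint ∧ ∀ i ∈ d.young, d.WellAdaptedAlong i

/-! The definitions below are meant for well-adapted data. -/

/-- `ord_P(M_tight)`. -/
noncomputable def ordTight (d : MonomialDatum k p O) : ℚ := ∑ i ∈ d.young, d.slope i

/-- The bad divisors: `H(ξ_D) < μ(ξ_D)`.  The other components of `E_young` are good. -/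
noncomputable def badDivisors (d : MonomialDatum k p O) : Finset (Fin 3) :=
  open Classical in d.young.filter fun i => d.slope i < d.mu i

/-- `P` is a good point: `H(P) = μ(P)`. -/
def IsGoodPoint (d : MonomialDatum k p O) : Prop := d.slopePoint = d.muPoint

/-- `w-ρ_D(P)` for a bad divisor `D = {x_i = 0}`. -/
noncomputable def wrho (d : MonomialDatum k p O) (i : Fin 3) : ℚ :=
  (resOrd d.q (initAlong i d.lastCoef) : ℚ) / d.q - d.ordTight

/-- The letters `w-ρ_D(P)`, `D` bad, with multiplicity. -/
noncomputable def letters (d : MonomialDatum k p O) : Multiset ℚ := d.badDivisors.val.map d.wrho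

/-- The word `A`.  Words are lists with the lexicographical order, in which the empty list is the
smallest word `0`. -/
noncomputable def wordA (d : MonomialDatum k p O) : List ℚ :=
  open Classical in if (0 : ℚ) ∈ d.letters then [] else d.letters.sort (· ≤ ·)

/-- The word `B = ord_P(M_usual) - ord_P(M_tight)`. -/
noncomputable def wordB (d : MonomialDatum k p O) : List ℚ :=
  open Classical in if d.muPoint - d.ordTight = 0 then [] else [d.muPoint - d.ordTight]

/-- The smallest pair of words. -/
def zeroPair : List ℚ ×ₗ List ℚ := toLex ([], [])

/-- The invariant `inv_{MON,♠}(P)`: the two words lined up in increasing order, or `0` if one of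
them is `0`; pairs of words carry the lexicographical order. -/
noncomputable def invSpade (d : MonomialDatum k p O) : List ℚ ×ₗ List ℚ :=
  open Classical in
  if d.wordA = [] ∨ d.wordB = [] then zeroPair
  else toLex (min d.wordA d.wordB, max d.wordA d.wordB)

/-- The invariant `inv_{MON,♥}(P) = H(P) - ord_P(M_tight)`. -/
noncomputable def invHeart (d : MonomialDatum k p O) : ℚ := d.slopePoint - d.ordTight

/-- The tight monomial case. -/
def IsTight (d : MonomialDatum k p O) : Prop := d.invHeart = 0

/-- The number of the configuration, `1, …, 5` (and `0` if there is none). -/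
noncomputable def config (d : MonomialDatum k p O) : ℕ :=
  match d.young.card, d.badDivisors.card with
  | 1, 0 => 1
  | 2, 0 => 2
  | 1, 1 => 3
  | 2, 1 => 4
  | 2, 2 => 5
  | _, _ => 0

/-- The ideal `(z, x_i)` of the curve `V(z, x_i)`. -/
noncomputable def curve (d : MonomialDatum k p O) (i : Fin 3) : Ideal O :=
  Ideal.span {d.x 0, d.x i}

/-- `C` is the center chosen by the algorithm at a point that is not in the tight monomial case:
if `dim Sing(R)_P = 1`, a curve `V(z, x_i) ⊆ Sing(R)`, `{x_i = 0} ∈ E_young`, where among several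
such curves the one with the biggest `H(ξ_D)` is taken, and among those with the same `H(ξ_D)` the
one where `D` has the biggest index `idx D`; otherwise, the point `P`. -/
def IsAlgorithmCenter [IsLocalRing O] (d : MonomialDatum k p O) (R : ℕ → Ideal O)
    (idx : Ideal O → ℕ) (C : Ideal O) : Prop :=
  (topologicalKrullDim (singLocus R) = 1 ∧
    ∃ i ∈ d.young, C = d.curve i ∧ PrimeSpectrum.zeroLocus (d.curve i : Set O) ⊆ singLocus R ∧
      ∀ j ∈ d.young, PrimeSpectrum.zeroLocus (d.curve j : Set O) ⊆ singLocus R →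
        d.slope j < d.slope i ∨ (d.slope j = d.slope i ∧
          idx (Ideal.span {d.x j}) ≤ idx (Ideal.span {d.x i}))) ∨
  (topologicalKrullDim (singLocus R) ≠ 1 ∧ C = maximalIdeal O)

/-- A transformation from a point with datum `d` in configuration 3, 4 or 5 to a point with datum
`d'` in configuration 3, 4 or 5 is esoteric if the word `A` strictly increases (and standard
otherwise). -/
def IsEsoteric {O' : Type*} [CommRing O'] [Algebra k O'] (d : MonomialDatum k p O)
    (d' : MonomialDatum k p O') : Prop :=
  3 ≤ d.config ∧ 3 ≤ d'.config ∧ d.wordA < d'.wordA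

end MonomialDatum

end Idealistic

/-!
Everything is computed in coordinates `O ≃ k[[z, x₁, x₂]]`, the boundary components being
`{x₁ = 0}` and/or `{x₂ = 0}`.

**Existence of the data after the blow-up.** By Weierstrass division by `h`, the condition on constant
terms of `h`-adic expansions is equivalent to a condition on one division with remainder modulo `h`.
The resulting weak form of the monomial case, `MonomialDatum.IsPreCase`, says nothing about initial
forms; it is therefore stable under arbitrary changes `z ↦ z + b(x₁, x₂)` (`IsPreCase.shift`) and under
blow-ups (`IsPreCase.blowup`). Removing the `q`-th powers from `a_q` finitely often makes `a_q`
adapted for all weights at once (`IsPreCase.exists_adapted`). Since `σ` determines that the pure part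
of the leading algebra still has a single generator, in degree `q` (`HasPureRank.of_sigma_eq`), the
full monomial case can be recovered from the weak one (`IsPreCase.exists_wellAdapted`).

**Independence of the data.** Two choices `h₁`, `h₂` for the same filtration satisfy
`h₂ = g h₁ + c` with `g` a unit and `c` at least as divisible along the boundary as the `q`-th power of
`∏ x_D ^ μ(ξ_D)` (`IsPreCase.h_eq`). If `x_i ^ r x_j ^ n` is the lowest term of the initial form of `a_q`
along a bad divisor `{x_i = 0}`, not a `q`-th power and with the `q`-th powers removed, then the orders
of `h` along the arcs `z = 0`, `x_i = T ^ K`, `x_j = T` are `K r + n` for large `K`. As `K` can be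
chosen such that `q` does not divide `K r + n`, no other choice of `h` and `z` gives a higher order
(`IsPreCase.exists_arc_le`). Hence `μ`, the slope `r / q` and the residual order `r + n` along each
boundary component depend on the filtration only (`MuAt.unique`, `RedAt.unique`,
`RedAt.not_goodAt`), and may be computed from any convenient datum after the blow-up.

**Transformation laws.** At a point of `Sing` with the same `σ`, the blow-up has the form
`z = x_i' z'`, `x_i = x_i'`, `x_j = x_i' ^ κ (x_j' + c)`, with `κ = 1` for the center `P` and
`κ = c = 0` for the curve `V(z, x_i)` (`IsPreCase.exists_point_chart`, `IsPreCase.exists_curve_chart`).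
From this one reads off (`IsPreCase.blowup_laws`) that `μ` and the slope of a strict transform do not
change. When `P` is blown up, the exceptional divisor has `μ = μ(P) - 1`; it is good if `P` is good,
and otherwise has slope `H(P) - 1`. The crucial estimate bounds its residual order: the initial form
of `a_q` at `P`, dehomogenized and translated by `c`, is a polynomial of the same degree that is still
not a `q`-th power, because `q` is a power of the characteristic (`exists_isLead_point`). When a
curve is blown up, `μ(P)`, `T` and the residual orders divided by `q` all drop by exactly `1`, so that
their differences, and with them the invariant, are unchanged (`IsCurveTransform.invSpade_eq`).

**Comparison of words.** For the blow-up of `P` what remains is arithmetic with at most two letters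
(`IsPointTransform.invSpade_lt`). The word `A` can increase only if a boundary component of `P` is lost
or if two bad components are turned into a good and a bad one; these are the exceptional transitions in
the theorem. In characteristic zero `q = 1`, every series is a `q`-th power, and there are no bad
divisors at all (`badDivisors_eq_empty_of_eq_one`).
-/

namespace Idealistic

open MvPowerSeries IsLocalRing

/-! ### Weighted orders of power series -/

section Orders

variable {σ τ k : Type*} [Field k]

/-- `f` has order at least `c` for the monomial valuation with weights `w`; rational thresholds
avoid all rounding. -/
def OrdGE (w : σ → ℕ) (c : ℚ) (f : MvPowerSeries σ k) : Prop :=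
  ∀ s, coeff s f ≠ 0 → c ≤ (Finsupp.weight w s : ℕ)

namespace OrdGE

variable {w : σ → ℕ} {c c' : ℚ} {f g : MvPowerSeries σ k}

theorem mono (hf : OrdGE w c f) (h : c' ≤ c) : OrdGE w c' f := fun s hs => h.trans (hf s hs)

theorem of_nonpos (hc : c ≤ 0) : OrdGE w c f := fun s _ => hc.trans (by positivity)

theorem zero : OrdGE w c (0 : MvPowerSeries σ k) := fun s hs => absurd (coeff_zero s) hs

theorem add (hf : OrdGE w c f) (hg : OrdGE w c g) : OrdGE w c (f + g) := by
  intro s hs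
  by_cases h : coeff s f = 0
  · exact hg s fun h' => hs (by rw [map_add, h, h', add_zero])
  · exact hf s h

theorem neg (hf : OrdGE w c f) : OrdGE w c (-f) := fun s hs => hf s fun h => hs (by simp [h])

theorem sub (hf : OrdGE w c f) (hg : OrdGE w c g) : OrdGE w c (f - g) := by
  rw [sub_eq_add_neg]; exact hf.add hg.neg

theorem sum {ι : Type*} {t : Finset ι} {F : ι → MvPowerSeries σ k}
    (h : ∀ i ∈ t, OrdGE w c (F i)) : OrdGE w c (∑ i ∈ t, F i) :=
  Finset.sum_induction F (OrdGE w c) (fun _ _ => add) zero h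

theorem mul (hf : OrdGE w c f) (hg : OrdGE w c' g) : OrdGE w (c + c') (f * g) := by
  classical
  intro s hs
  rw [coeff_mul] at hs
  obtain ⟨⟨a, b⟩, hab, hne⟩ := Finset.exists_ne_zero_of_sum_ne_zero hs
  rw [Finset.HasAntidiagonal.mem_antidiagonal] at hab
  dsimp only at hab hne
  have h1 := hf a (left_ne_zero_of_mul hne)
  have h2 := hg b (right_ne_zero_of_mul hne)
  rw [← hab, map_add]; push_cast; linarith

theorem mul_right (hf : OrdGE w c f) : OrdGE w c (f * g) := by
  have := hf.mul (of_nonpos (w := w) (f := g) le_rfl); rwa [add_zero] at this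

theorem mul_left (hf : OrdGE w c f) : OrdGE w c (g * f) := by
  rw [mul_comm]; exact hf.mul_right

theorem pow (hf : OrdGE w c f) (n : ℕ) : OrdGE w (n * c) (f ^ n) := by
  induction n with
  | zero => exact of_nonpos (by simp)
  | succ n ih => rw [pow_succ]; exact (ih.mul hf).mono (by push_cast; linarith)

theorem coeff_eq_zero (hf : OrdGE w c f) {s : σ →₀ ℕ} (hs : (Finsupp.weight w s : ℚ) < c) :
    coeff s f = 0 := by
  by_contra h; exact absurd (hf s h) (not_le.mpr hs)

end OrdGE

theorem ordGE_nat_iff {w : σ → ℕ} {n : ℕ} {f : MvPowerSeries σ k} :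
    OrdGE w n f ↔ (n : ℕ∞) ≤ f.weightedOrder w := by
  constructor
  · intro h
    refine nat_le_weightedOrder w fun d hd => h.coeff_eq_zero (by exact_mod_cast hd)
  · intro h s hs
    have := h.trans (weightedOrder_le w hs)
    exact_mod_cast this

theorem weight_single_one [DecidableEq σ] (i : σ) (s : σ →₀ ℕ) :
    Finsupp.weight (Pi.single i 1 : σ → ℕ) s = s i := by
  rw [Finsupp.weight_apply, Finsupp.sum, Finset.sum_eq_single i]
  · simp
  · intro b _ hb; simp [hb]
  · intro h; simp [Finsupp.notMem_support_iff.mp h]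

theorem X_pow_dvd_iff_ordGE [DecidableEq σ] {i : σ} {n : ℕ} {f : MvPowerSeries σ k} :
    (X i : MvPowerSeries σ k) ^ n ∣ f ↔ OrdGE (Pi.single i 1) n f := by
  rw [X_pow_dvd_iff]
  constructor
  · intro h s hs
    rw [weight_single_one]
    by_contra hlt
    exact hs (h s (by exact_mod_cast not_le.mp hlt))
  · intro h s hs
    exact h.coeff_eq_zero (by rw [weight_single_one]; exact_mod_cast hs)

theorem OrdGE.X_pow_dvd [DecidableEq σ] {i : σ} {c : ℚ} {f : MvPowerSeries σ k}
    (h : OrdGE (Pi.single i 1) c f) : (X i : MvPowerSeries σ k) ^ ⌈c⌉₊ ∣ f := by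
  rw [X_pow_dvd_iff_ordGE]
  intro s hs
  have h1 := h s hs
  exact_mod_cast Nat.ceil_le.mpr h1

theorem X_prime (i : σ) : Prime (X i : MvPowerSeries σ k) := by
  classical
  refine ⟨fun h => ?_, fun h => ?_, fun a b hab => ?_⟩
  · have := congrArg (coeff (Finsupp.single i 1)) h
    simp at this
  · have := (isUnit_iff_constantCoeff.mp h); simp at this
  · by_contra! hcon
    have key : ∀ f : MvPowerSeries σ k, (X i ∣ f) ↔ 1 ≤ f.weightedOrder (Pi.single i 1) := by
      intro f
      have := X_pow_dvd_iff_ordGE (i := i) (n := 1) (f := f)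
      rw [pow_one, ordGE_nat_iff] at this
      simpa using this
    rw [key, key] at hcon
    rw [key, weightedOrder_mul] at hab
    obtain ⟨h1, h2⟩ := hcon
    rw [not_le, Order.lt_one_iff] at h1 h2
    simp [h1, h2] at hab

end Orders

end Idealistic

namespace Idealistic

open MvPowerSeries IsLocalRing

/-! ### Powers of the maximal ideal and homomorphisms of power series rings -/

section PowersOfMaximalIdeal

variable {k : Type*} [Field k] {σ τ : Type*}

theorem mem_maximalIdeal_iff {f : MvPowerSeries σ k} :
    f ∈ maximalIdeal (MvPowerSeries σ k) ↔ constantCoeff f = 0 := by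
  rw [mem_maximalIdeal, mem_nonunits_iff, isUnit_iff_constantCoeff, isUnit_iff_ne_zero, not_not]

theorem monomial_mem_pow (s : σ →₀ ℕ) (c : k) :
    monomial s c ∈ maximalIdeal (MvPowerSeries σ k) ^ s.degree := by
  classical
  induction s using Finsupp.induction generalizing c with
  | zero => simp
  | single_add i b s _ _ ih =>
    have : monomial (Finsupp.single i b + s) c =
        (X i : MvPowerSeries σ k) ^ b * monomial s c := by
      rw [X_pow_eq, monomial_mul_monomial, one_mul]
    rw [this, map_add, Finsupp.degree_single, pow_add]
    exact Ideal.mul_mem_mul (Ideal.pow_mem_pow (mem_maximalIdeal_iff.mpr (constantCoeff_X i)) b)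
      (ih c)

/-- A series of order at least `n + 1` is a combination of the variables with coefficients of order
at least `n`. -/
theorem exists_eq_sum_mul_X [Fintype σ] {n : ℕ} {f : MvPowerSeries σ k}
    (hf : ∀ s : σ →₀ ℕ, s.degree < n + 1 → coeff s f = 0) :
    ∃ g : σ → MvPowerSeries σ k, (∀ i s, s.degree < n → coeff s (g i) = 0) ∧
      f = ∑ i, g i * X i := by
  classical
  -- every nonzero term of `f` involves a variable; group the terms by a chosen variable
  have hpos : ∀ s : σ →₀ ℕ, coeff s f ≠ 0 → ∃ i, s i ≠ 0 := by
    intro s hs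
    by_contra! h
    apply hs; apply hf
    have : s = 0 := Finsupp.ext h
    simp [this]
  let ch : (σ →₀ ℕ) → Option σ := fun s => if h : ∃ i, s i ≠ 0 then some h.choose else none
  have hch : ∀ s i, ch s = some i → s i ≠ 0 := by
    intro s i h
    by_cases h' : ∃ i, s i ≠ 0
    · simp only [ch, h', dite_true, Option.some.injEq] at h
      rw [← h]; exact h'.choose_spec
    · simp [ch, h'] at h
  let g : σ → MvPowerSeries σ k := fun i s =>
    if ch (s + Finsupp.single i 1) = some i then coeff (s + Finsupp.single i 1) f else 0
  have hg : ∀ i s, s.degree < n → coeff s (g i) = 0 := by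
    intro i s hs
    change (if _ then _ else _) = _
    split_ifs
    · apply hf; simp; omega
    · rfl
  have hsum : f = ∑ i, g i * X i := by
    ext s
    rw [map_sum]
    have hterm : ∀ i, coeff s (g i * X i) = if ch s = some i then coeff s f else 0 := by
      intro i
      rw [X, coeff_mul_monomial]
      by_cases hsi : Finsupp.single i 1 ≤ s
      · rw [if_pos hsi]
        have e : s - Finsupp.single i 1 + Finsupp.single i 1 = s := tsub_add_cancel_of_le hsi
        change (if _ then _ else _) * _ = _
        rw [e, mul_one]
      · rw [if_neg hsi, if_neg]
        intro h
        apply hsi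
        rw [Finsupp.single_le_iff]
        exact Nat.one_le_iff_ne_zero.mpr (hch s i h)
    simp_rw [hterm]
    by_cases h : coeff s f = 0
    · simp [h]
    · have h2 := hpos s h
      have h3 : ch s = some h2.choose := by simp only [ch, h2, dite_true]
      rw [h3]; simp
  exact ⟨g, hg, hsum⟩

theorem mem_pow_of_order [Finite σ] {n : ℕ} : ∀ {f : MvPowerSeries σ k},
    (∀ s : σ →₀ ℕ, s.degree < n → coeff s f = 0) →
    f ∈ maximalIdeal (MvPowerSeries σ k) ^ n := by
  have := Fintype.ofFinite σ
  induction n with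
  | zero => intro f _; simp
  | succ n ih =>
    intro f hf
    obtain ⟨g, hg, rfl⟩ := exists_eq_sum_mul_X hf
    rw [pow_succ]
    exact Ideal.sum_mem _ fun i _ =>
      Ideal.mul_mem_mul (ih (hg i)) (mem_maximalIdeal_iff.mpr (constantCoeff_X i))

theorem mem_pow_iff [Finite σ] {n : ℕ} {f : MvPowerSeries σ k} :
    f ∈ maximalIdeal (MvPowerSeries σ k) ^ n ↔ ∀ s : σ →₀ ℕ, s.degree < n → coeff s f = 0 := by
  refine ⟨fun h => ?_, mem_pow_of_order⟩
  have key : ∀ n : ℕ, maximalIdeal (MvPowerSeries σ k) ^ n ≤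
      ({ carrier := {f | (n : ℕ∞) ≤ f.order}
         add_mem' := fun {a b} ha hb => (le_min ha hb).trans min_order_le_add
         zero_mem' := by simp
         smul_mem' := fun c x hx => by
          rw [smul_eq_mul]
          exact (hx.trans le_add_self).trans le_order_mul } : Ideal (MvPowerSeries σ k)) := by
    intro n
    induction n with
    | zero => intro f _; simp
    | succ n ih =>
      rw [pow_succ, Ideal.mul_le]
      intro a ha b hb
      have h1 : (n : ℕ∞) ≤ a.order := ih ha
      have h2 : 1 ≤ b.order := one_le_order_iff_constCoeff_eq_zero.mpr (mem_maximalIdeal_iff.mp hb)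
      change ((n + 1 : ℕ) : ℕ∞) ≤ _
      push_cast
      exact (add_le_add h1 h2).trans le_order_mul
  intro s hs
  have h1 : (n : ℕ∞) ≤ f.order := key n h
  exact coeff_of_lt_order (lt_of_lt_of_le (by exact_mod_cast hs) h1)

theorem mem_pow_iff_order [Finite σ] {n : ℕ} {f : MvPowerSeries σ k} :
    f ∈ maximalIdeal (MvPowerSeries σ k) ^ n ↔ (n : ℕ∞) ≤ f.order := by
  rw [mem_pow_iff]
  exact ⟨fun h => nat_le_order h, fun h s hs => coeff_of_lt_order
    (lt_of_lt_of_le (by exact_mod_cast hs) h)⟩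

/-- Every `k`-algebra homomorphism between power series rings is local. -/
theorem constantCoeff_algHom (φ : MvPowerSeries σ k →ₐ[k] MvPowerSeries τ k)
    (f : MvPowerSeries σ k) : constantCoeff (φ f) = constantCoeff f := by
  by_contra h
  have hc : φ (C (constantCoeff (φ f))) = C (constantCoeff (φ f)) := by
    rw [c_eq_algebraMap, c_eq_algebraMap, AlgHom.commutes]
  have hu : IsUnit (f - C (constantCoeff (φ f))) := by
    rw [isUnit_iff_constantCoeff, isUnit_iff_ne_zero, map_sub, constantCoeff_C]
    exact sub_ne_zero.mpr (Ne.symm h)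
  have := isUnit_iff_constantCoeff.mp (hu.map φ)
  rw [map_sub, map_sub, hc, constantCoeff_C, sub_self] at this
  exact not_isUnit_zero this

theorem algHom_mem_pow (φ : MvPowerSeries σ k →ₐ[k] MvPowerSeries τ k) {n : ℕ}
    {f : MvPowerSeries σ k} (hf : f ∈ maximalIdeal (MvPowerSeries σ k) ^ n) :
    φ f ∈ maximalIdeal (MvPowerSeries τ k) ^ n := by
  have h1 : (maximalIdeal (MvPowerSeries σ k)).map φ ≤ maximalIdeal (MvPowerSeries τ k) := by
    rw [Ideal.map_le_iff_le_comap]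
    intro g hg
    rw [Ideal.mem_comap, mem_maximalIdeal_iff, constantCoeff_algHom]
    exact mem_maximalIdeal_iff.mp hg
  have h2 := Ideal.mem_map_of_mem φ hf
  rw [Ideal.map_pow] at h2
  exact Ideal.pow_right_mono h1 n h2

/-- A linear map that is continuous for the adic topologies and kills all the monomials that occur
in `f` kills `f`. -/
theorem linearMap_eq_zero [Finite σ] (L : MvPowerSeries σ k →ₗ[k] MvPowerSeries τ k)
    (hL : ∀ N, ∃ M, ∀ f : MvPowerSeries σ k, (∀ s, s.degree < M → coeff s f = 0) →
      ∀ t, t.degree < N → coeff t (L f) = 0)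
    (f : MvPowerSeries σ k) (hf : ∀ s, coeff s f ≠ 0 → L (monomial s 1) = 0) : L f = 0 := by
  classical
  ext t
  obtain ⟨M, hM⟩ := hL (t.degree + 1)
  have hfin : {s : σ →₀ ℕ | s.degree < M}.Finite :=
    (Finsupp.finite_of_degree_le M).subset fun s (hs : s.degree < M) => hs.le
  set F : Finset (σ →₀ ℕ) := hfin.toFinset
  set g := ∑ s ∈ F, monomial s (coeff s f) with hg
  have hLg : L g = 0 := by
    rw [hg, map_sum]
    refine Finset.sum_eq_zero fun s _ => ?_
    have : monomial s (coeff s f) = coeff s f • (monomial s (1 : k)) := by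
      rw [← map_smul, smul_eq_mul, mul_one]
    rw [this, map_smul]
    by_cases h : coeff s f = 0
    · rw [h, zero_smul]
    · rw [hf s h, smul_zero]
  have hd : coeff t (L (f - g)) = 0 := by
    refine hM (f - g) (fun s hs => ?_) t (Nat.lt_succ_self _)
    have hsF : s ∈ F := by simpa [F] using hs
    rw [map_sub, hg, map_sum, Finset.sum_eq_single s]
    · rw [coeff_monomial_same, sub_self]
    · intro b _ hb; rw [coeff_monomial_ne hb.symm]
    · intro h; exact absurd hsF h
  rw [map_sub, hLg, sub_zero] at hd
  rw [hd, coeff_zero]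

theorem algHom_monomial [Finite σ] {A : Type*} [CommRing A] [Algebra k A]
    (φ : MvPowerSeries σ k →ₐ[k] A) (s : σ →₀ ℕ) :
    φ (monomial s 1) = s.prod fun i n => φ (X i) ^ n := by
  rw [monomial_one_eq, Finsupp.prod, map_prod]
  simp [Finsupp.prod]

/-- Two homomorphisms that agree on the variables occurring in `f` agree on `f`. -/
theorem algHom_congr [Finite σ] {φ ψ : MvPowerSeries σ k →ₐ[k] MvPowerSeries τ k}
    {f : MvPowerSeries σ k}
    (h : ∀ i, (∃ s, coeff s f ≠ 0 ∧ s i ≠ 0) → φ (X i) = ψ (X i)) [Finite τ] : φ f = ψ f := by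
  rw [← sub_eq_zero, ← AlgHom.toLinearMap_apply, ← AlgHom.toLinearMap_apply, ← LinearMap.sub_apply]
  refine linearMap_eq_zero _ (fun N => ⟨N, fun g hg t ht => ?_⟩) f fun s hs => ?_
  · rw [LinearMap.sub_apply, map_sub, AlgHom.toLinearMap_apply, AlgHom.toLinearMap_apply,
      mem_pow_iff.mp (algHom_mem_pow φ (mem_pow_of_order hg)) t ht,
      mem_pow_iff.mp (algHom_mem_pow ψ (mem_pow_of_order hg)) t ht, sub_zero]
  · rw [LinearMap.sub_apply, AlgHom.toLinearMap_apply, AlgHom.toLinearMap_apply, algHom_monomial,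
      algHom_monomial, sub_eq_zero]
    exact Finsupp.prod_congr fun i hi => by rw [h i ⟨s, hs, Finsupp.mem_support_iff.mp hi⟩]

theorem algHom_ext' [Finite σ] [Finite τ] {φ ψ : MvPowerSeries σ k →ₐ[k] MvPowerSeries τ k}
    (h : ∀ i, φ (X i) = ψ (X i)) : φ = ψ :=
  AlgHom.ext fun _ => algHom_congr fun i _ => h i

end PowersOfMaximalIdeal

section Contraction

variable {k : Type*} [Field k] {σ : Type*}

theorem ordGE_ext [Finite σ] {w : σ → ℕ} {f : MvPowerSeries σ k} (h : ∀ n : ℕ, OrdGE w n f) :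
    f = 0 := by
  ext s
  rw [coeff_zero]
  exact (h (Finsupp.weight w s + 1)).coeff_eq_zero (by push_cast; linarith)

/-- If `N` is additive and raises the order, then `1 + N` is bijective (geometric series). -/
theorem bijective_add_contraction [Finite σ] (w : σ → ℕ)
    (N : MvPowerSeries σ k →+ MvPowerSeries σ k)
    (hN : ∀ (n : ℕ) f, OrdGE w n f → OrdGE w (n + 1 : ℕ) (N f)) :
    Function.Bijective fun f => f + N f := by
  constructor
  · intro f g hfg
    dsimp only at hfg
    have h0 : (f - g) = -N (f - g) := by rw [map_sub]; linear_combination hfg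
    have h : ∀ n : ℕ, OrdGE w n (f - g) := by
      intro n
      induction n with
      | zero => exact OrdGE.of_nonpos (by simp)
      | succ n ih => rw [h0]; exact (hN n _ ih).neg
    exact sub_eq_zero.mp (ordGE_ext h)
  · intro g
    let P : ℕ → MvPowerSeries σ k := fun n => ∑ j ∈ Finset.range n, (fun f => -N f)^[j] g
    have hit : ∀ n : ℕ, OrdGE w n ((fun f => -N f)^[n] g) := by
      intro n
      induction n with
      | zero => exact OrdGE.of_nonpos (by simp)
      | succ n ih => rw [Function.iterate_succ_apply']; exact (hN n _ ih).neg
    have hPP : ∀ n m : ℕ, n ≤ m → OrdGE w n (P m - P n) := by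
      intro n m hnm
      change OrdGE w n (∑ _ ∈ _, _ - ∑ _ ∈ _, _)
      rw [← Finset.sum_Ico_eq_sub _ hnm]
      refine OrdGE.sum fun j hj => (hit j).mono ?_
      exact_mod_cast (Finset.mem_Ico.mp hj).1
    let f : MvPowerSeries σ k := fun s => coeff s (P (Finsupp.weight w s + 1))
    have hfP : ∀ n : ℕ, OrdGE w n (f - P n) := by
      intro n s hs
      by_contra! hlt
      apply hs
      have hlt' : Finsupp.weight w s + 1 ≤ n := by
        have : Finsupp.weight w s < n := by exact_mod_cast hlt
        omega
      have := (hPP _ n hlt').coeff_eq_zero (s := s) (by push_cast; linarith)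
      rw [map_sub, sub_eq_zero] at this
      rw [map_sub, this]
      exact sub_self _
    refine ⟨f, ?_⟩
    dsimp only
    have hPN : ∀ n : ℕ, P n + N (P n) = g - (fun f => -N f)^[n] g := by
      intro n
      induction n with
      | zero => simp [P]
      | succ n ih =>
        have e : P (n + 1) = P n + (fun f => -N f)^[n] g := Finset.sum_range_succ _ _
        rw [e, map_add, Function.iterate_succ_apply']
        linear_combination ih
    refine sub_eq_zero.mp (ordGE_ext (w := w) fun n => ?_)
    have e : f + N f - g = (f - P n) + N (f - P n) - (fun f => -N f)^[n] g := by
      rw [map_sub]; linear_combination hPN n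
    rw [e]
    exact ((hfP n).add ((hN n _ (hfP n)).mono (by push_cast; linarith))).sub (hit n)

end Contraction

end Idealistic

namespace Idealistic

open MvPowerSeries IsLocalRing

/-! ### Regular systems of parameters and Hasse derivatives -/

section Coordinates

variable {k : Type*} [Field k] {σ : Type*}

theorem ordGE_degree_iff [Finite σ] {n : ℕ} {f : MvPowerSeries σ k} :
    OrdGE (fun _ => 1) n f ↔ f ∈ maximalIdeal (MvPowerSeries σ k) ^ n := by
  rw [ordGE_nat_iff, mem_pow_iff_order]; rfl

theorem X_mem_maximalIdeal (i : σ) :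
    (X i : MvPowerSeries σ k) ∈ maximalIdeal (MvPowerSeries σ k) :=
  mem_maximalIdeal_iff.mpr (constantCoeff_X i)

theorem exists_eq_single_of_degree_le {s : σ →₀ ℕ} {i : σ} (h : s.degree ≤ s i) :
    s = Finsupp.single i (s i) := by
  classical
  have e : Finsupp.single i (s i) + (s - Finsupp.single i (s i)) = s :=
    add_tsub_cancel_of_le (Finsupp.single_le_iff.mpr le_rfl)
  have h2 := congrArg Finsupp.degree e
  rw [map_add, Finsupp.degree_single] at h2
  have h3 : (s - Finsupp.single i (s i)).degree = 0 := by omega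
  rw [Finsupp.degree_eq_zero_iff] at h3
  rw [h3, add_zero] at e
  exact e.symm

theorem exists_eq_single_of_degree_eq_one {s : σ →₀ ℕ} (h : s.degree = 1) :
    ∃ i, s = Finsupp.single i 1 := by
  have hs : s ≠ 0 := by rintro rfl; simp at h
  obtain ⟨i, hi⟩ := Finsupp.ne_iff.mp hs
  have h1 : 1 ≤ s i := Nat.one_le_iff_ne_zero.mpr hi
  have e := exists_eq_single_of_degree_le (s := s) (i := i) (by omega)
  have h2 := congrArg Finsupp.degree e
  rw [Finsupp.degree_single, h] at h2
  exact ⟨i, by rw [h2]; exact e⟩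

theorem sub_linear_mem_sq [Fintype σ] {f : MvPowerSeries σ k}
    (hf : f ∈ maximalIdeal (MvPowerSeries σ k)) :
    f - ∑ i, C (coeff (Finsupp.single i 1) f) * X i ∈ maximalIdeal (MvPowerSeries σ k) ^ 2 := by
  classical
  refine mem_pow_of_order fun s hs => ?_
  have hs' : s.degree = 0 ∨ s.degree = 1 := by omega
  rcases hs' with h | h
  · rw [Finsupp.degree_eq_zero_iff] at h
    subst h
    rw [coeff_zero_eq_constantCoeff_apply, map_sub, mem_maximalIdeal_iff.mp hf]
    simp
  · obtain ⟨i, rfl⟩ := exists_eq_single_of_degree_eq_one h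
    rw [map_sub, map_sum, Finset.sum_eq_single i]
    · simp
    · intro j _ hj
      rw [coeff_C_mul, coeff_index_single_X, if_neg (Ne.symm hj), mul_zero]
    · simp

/-- An endomorphism that is the identity to first order is an automorphism. -/
theorem bijective_of_near_id [Fintype σ] (θ : MvPowerSeries σ k →ₐ[k] MvPowerSeries σ k)
    (h : ∀ i, θ (X i) - X i ∈ maximalIdeal (MvPowerSeries σ k) ^ 2) : Function.Bijective θ := by
  have h0 : ∀ f, θ f - f ∈ maximalIdeal (MvPowerSeries σ k) := fun f => by
    rw [mem_maximalIdeal_iff, map_sub, constantCoeff_algHom, sub_self]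
  have h1 : ∀ f ∈ maximalIdeal (MvPowerSeries σ k),
      θ f - f ∈ maximalIdeal (MvPowerSeries σ k) ^ 2 := by
    intro f hf
    set g := ∑ i, C (coeff (Finsupp.single i 1) f) * X i with hg
    have h2 := sub_linear_mem_sq hf
    have h3 : θ g - g ∈ maximalIdeal (MvPowerSeries σ k) ^ 2 := by
      rw [hg, map_sum, ← Finset.sum_sub_distrib]
      refine Ideal.sum_mem _ fun i _ => ?_
      rw [map_mul, c_eq_algebraMap, AlgHom.commutes, ← mul_sub]
      exact Ideal.mul_mem_left _ _ (h i)
    have e : θ f - f = θ (f - g) + (θ g - g) - (f - g) := by rw [map_sub]; ring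
    rw [e]
    exact Ideal.sub_mem _ (Ideal.add_mem _ (algHom_mem_pow θ h2) h3) h2
  have h2 : ∀ n : ℕ, ∀ f ∈ maximalIdeal (MvPowerSeries σ k) ^ n,
      θ f - f ∈ maximalIdeal (MvPowerSeries σ k) ^ (n + 1) := by
    intro n
    induction n with
    | zero => intro f _; rw [zero_add, pow_one]; exact h0 f
    | succ n ih =>
      intro f hf
      rw [pow_succ] at hf
      refine Submodule.mul_induction_on hf (fun a ha b hb => ?_) fun a b ha hb => ?_
      · have e : θ (a * b) - a * b = θ a * (θ b - b) + (θ a - a) * b := by rw [map_mul]; ring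
        rw [e]
        refine Ideal.add_mem _ ?_ ?_
        · rw [show n + 1 + 1 = n + 2 from rfl, pow_add]
          exact Ideal.mul_mem_mul (algHom_mem_pow θ ha) (h1 b hb)
        · rw [pow_succ _ (n + 1)]
          exact Ideal.mul_mem_mul (ih a ha) hb
      · have e : θ (a + b) - (a + b) = (θ a - a) + (θ b - b) := by rw [map_add]; ring
        rw [e]; exact Ideal.add_mem _ ha hb
  have := bijective_add_contraction (fun _ : σ => 1)
    ((θ : MvPowerSeries σ k →+ MvPowerSeries σ k) - AddMonoidHom.id _) (fun n f hf => by
      rw [ordGE_degree_iff] at hf ⊢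
      exact h2 n f hf)
  convert this using 1
  funext f
  simp

/-- Formal inverse function theorem: elements of the maximal ideal that generate it form a regular
system of parameters, i.e. are the images of the variables under an isomorphism from the power
series ring. -/
theorem exists_coords [Fintype σ] [DecidableEq σ] {O : Type*} [CommRing O] [Algebra k O]
    (v : MvPowerSeries σ k ≃ₐ[k] O) (f : σ → O) (hf : ∀ i, constantCoeff (v.symm (f i)) = 0)
    (hspan : ∀ i, v (X i) ∈ Ideal.span (Set.range f)) :
    ∃ u : MvPowerSeries σ k ≃ₐ[k] O, ∀ i, u (X i) = f i := by
  set F : σ → MvPowerSeries σ k := fun i => v.symm (f i) with hF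
  have hFm : ∀ i, F i ∈ maximalIdeal (MvPowerSeries σ k) := fun i => mem_maximalIdeal_iff.mpr (hf i)
  have hc : ∀ i, ∃ c : σ → MvPowerSeries σ k, ∑ j, c j * F j = X i := by
    intro i
    obtain ⟨c, hc⟩ := (Submodule.mem_span_range_iff_exists_fun _).mp (hspan i)
    refine ⟨fun j => v.symm (c j), ?_⟩
    have := congrArg v.symm hc
    rw [AlgEquiv.symm_apply_apply, map_sum] at this
    simpa [hF] using this
  choose c hc using hc
  let A : Matrix σ σ k := fun j l => coeff (Finsupp.single l 1) (F j)
  let B : Matrix σ σ k := fun i j => constantCoeff (c i j)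
  have hcoef : ∀ (a b : MvPowerSeries σ k) l, constantCoeff b = 0 →
      coeff (Finsupp.single l 1) (a * b) = constantCoeff a * coeff (Finsupp.single l 1) b := by
    intro a b l hb
    have hb2 := sub_linear_mem_sq (mem_maximalIdeal_iff.mpr hb)
    have e : a * b = (a - C (constantCoeff a)) * b + C (constantCoeff a) * b := by ring
    have h1 : (a - C (constantCoeff a)) * b ∈ maximalIdeal (MvPowerSeries σ k) ^ 2 := by
      rw [pow_two]
      refine Ideal.mul_mem_mul (mem_maximalIdeal_iff.mpr ?_) (mem_maximalIdeal_iff.mpr hb)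
      simp
    rw [e, map_add, mem_pow_iff.mp h1 _ (by simp), zero_add, coeff_C_mul]
  have hBA : B * A = 1 := by
    ext i l
    rw [Matrix.mul_apply]
    have h1 := congrArg (coeff (Finsupp.single l 1)) (hc i)
    rw [map_sum] at h1
    simp_rw [fun j => hcoef (c i j) (F j) l (hf j)] at h1
    rw [Matrix.one_apply]
    change ∑ j, constantCoeff (c i j) * coeff (Finsupp.single l 1) (F j) = _
    rw [h1, coeff_index_single_X]
    simp only [eq_comm]
  have hAB : A * B = 1 := mul_eq_one_comm.mp hBA
  have hFs : HasSubst F := hasSubst_of_constantCoeff_zero hf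
  have hGs : HasSubst fun i => ∑ j, C (B i j) * (X j : MvPowerSeries σ k) :=
    hasSubst_of_constantCoeff_zero fun i => by simp
  let Φ : MvPowerSeries σ k →ₐ[k] MvPowerSeries σ k := substAlgHom hFs
  let Ψ : MvPowerSeries σ k →ₐ[k] MvPowerSeries σ k := substAlgHom hGs
  have hΦX : ∀ i, Φ (X i) = F i := substAlgHom_X hFs
  have hΨX : ∀ i, Ψ (X i) = ∑ j, C (B i j) * X j := substAlgHom_X hGs
  have hΦC : ∀ a, Φ (C a) = C a := fun a => by rw [c_eq_algebraMap, AlgHom.commutes]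
  have hΨC : ∀ a, Ψ (C a) = C a := fun a => by rw [c_eq_algebraMap, AlgHom.commutes]
  -- the linear part of a combination of series
  have hlin : ∀ i (M N : Matrix σ σ k) (G : σ → MvPowerSeries σ k), M * N = 1 →
      (∀ j, G j - ∑ l, C (N j l) * X l ∈ maximalIdeal (MvPowerSeries σ k) ^ 2) →
      ∑ j, C (M i j) * G j - X i ∈ maximalIdeal (MvPowerSeries σ k) ^ 2 := by
    intro i M N G hMN hG
    have e : ∑ j, C (M i j) * G j - X i = ∑ j, C (M i j) * (G j - ∑ l, C (N j l) * X l) := by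
      simp_rw [mul_sub, Finset.sum_sub_distrib, Finset.mul_sum]
      rw [Finset.sum_comm]
      congr 1
      simp_rw [← mul_assoc, ← Finset.sum_mul, ← map_mul, ← map_sum, ← Matrix.mul_apply, hMN]
      rw [Finset.sum_eq_single i]
      · simp
      · intro b _ hb; simp [Matrix.one_apply_ne (Ne.symm hb)]
      · simp
    rw [e]
    exact Ideal.sum_mem _ fun j _ => Ideal.mul_mem_left _ _ (hG j)
  have b1 : Function.Bijective (Φ.comp Ψ) := by
    apply bijective_of_near_id
    intro i
    rw [AlgHom.comp_apply, hΨX, map_sum]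
    simp_rw [map_mul, hΦC, hΦX]
    exact hlin i B A F hBA fun j => sub_linear_mem_sq (hFm j)
  have b2 : Function.Bijective (Ψ.comp Φ) := by
    apply bijective_of_near_id
    intro i
    rw [AlgHom.comp_apply, hΦX]
    have h1 := algHom_mem_pow Ψ (sub_linear_mem_sq (hFm i))
    rw [map_sub, map_sum] at h1
    simp_rw [map_mul, hΨC, hΨX] at h1
    have h2 := hlin i A B (fun j => ∑ l, C (B j l) * X l) hAB fun j => by simp
    have := Ideal.add_mem _ h1 h2
    rwa [sub_add_sub_cancel] at this
  have hb : Function.Bijective Φ := by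
    refine ⟨Function.Injective.of_comp (f := Ψ) ?_, Function.Surjective.of_comp (g := Ψ) ?_⟩
    · simpa using b2.1
    · simpa using b1.2
  refine ⟨(AlgEquiv.ofBijective Φ hb).trans v, fun i => ?_⟩
  rw [AlgEquiv.trans_apply, AlgEquiv.ofBijective_apply, hΦX, hF, AlgEquiv.apply_symm_apply]

end Coordinates

section Hasse

variable {k : Type*} [Field k] {σ : Type*}

/-- The Hasse derivative of order `n` with respect to the variable with index `i`. -/
noncomputable def hasse (i : σ) (n : ℕ) : MvPowerSeries σ k →ₗ[k] MvPowerSeries σ k where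
  toFun f := fun s => ((s i + n).choose n : k) * coeff (s + Finsupp.single i n) f
  map_add' f g := by
    ext s
    change ((s i + n).choose n : k) * coeff _ (f + g) =
      ((s i + n).choose n : k) * coeff _ f + ((s i + n).choose n : k) * coeff _ g
    rw [map_add, mul_add]
  map_smul' c f := by
    ext s
    change ((s i + n).choose n : k) * coeff _ (c • f) = c * (((s i + n).choose n : k) * coeff _ f)
    rw [coeff_smul, mul_left_comm]

theorem coeff_hasse (i : σ) (n : ℕ) (f : MvPowerSeries σ k) (s : σ →₀ ℕ) :
    coeff s (hasse i n f) = ((s i + n).choose n : k) * coeff (s + Finsupp.single i n) f := rfl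

theorem hasseZ_eq (n : ℕ) (f : MvPowerSeries (Fin 3) k) : hasseZ n f = hasse 0 n f := rfl

theorem hasse_zero (i : σ) (f : MvPowerSeries σ k) : hasse i 0 f = f := by
  ext s; simp [coeff_hasse]

theorem hasse_monomial (i : σ) (n : ℕ) (s : σ →₀ ℕ) (c : k) :
    hasse i n (monomial s c) = ((s i).choose n : k) • monomial (s - Finsupp.single i n) c := by
  classical
  ext t
  rw [coeff_hasse, coeff_smul, coeff_monomial, coeff_monomial]
  by_cases h : t + Finsupp.single i n = s
  · subst h; simp
  · rw [if_neg h, mul_zero]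
    by_cases h2 : t = s - Finsupp.single i n
    · rw [Nat.choose_eq_zero_of_lt, Nat.cast_zero, zero_mul]
      by_contra! hle
      apply h
      rw [h2]
      exact tsub_add_cancel_of_le (Finsupp.single_le_iff.mpr hle)
    · rw [if_neg h2, mul_zero]

theorem hasse_order (i : σ) (n N : ℕ) (f : MvPowerSeries σ k)
    (hf : ∀ s, s.degree < N + n → coeff s f = 0) (t : σ →₀ ℕ) (ht : t.degree < N) :
    coeff t (hasse i n f) = 0 := by
  rw [coeff_hasse, hf _ (by simpa using ht), mul_zero]

/-- The Leibniz rule for Hasse derivatives. -/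
theorem hasse_mul [Finite σ] (i : σ) (n : ℕ) (f g : MvPowerSeries σ k) :
    hasse i n (f * g) =
      ∑ ab ∈ Finset.HasAntidiagonal.antidiagonal n, hasse i ab.1 f * hasse i ab.2 g := by
  -- both sides are linear and continuous in each argument, so monomials suffice
  let L : MvPowerSeries σ k → MvPowerSeries σ k →ₗ[k] MvPowerSeries σ k := fun g =>
    hasse i n ∘ₗ LinearMap.mulRight k g -
      ∑ ab ∈ Finset.HasAntidiagonal.antidiagonal n, LinearMap.mulRight k (hasse i ab.2 g) ∘ₗ hasse i ab.1
  have hLapp : ∀ g f, L g f = hasse i n (f * g) -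
      ∑ ab ∈ Finset.HasAntidiagonal.antidiagonal n, hasse i ab.1 f * hasse i ab.2 g := by
    intro g f; simp [L]
  have hord : ∀ N (f g : MvPowerSeries σ k), (∀ s, s.degree < N + n → coeff s f = 0) →
      ∀ t, t.degree < N → coeff t (hasse i n (f * g) -
        ∑ ab ∈ Finset.HasAntidiagonal.antidiagonal n, hasse i ab.1 f * hasse i ab.2 g) = 0 := by
    intro N f g hf t ht
    have hf' := mem_pow_of_order hf
    rw [map_sub, hasse_order i n N _ (mem_pow_iff.mp (Ideal.mul_mem_right _ _ hf')) t ht, map_sum,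
      Finset.sum_eq_zero, sub_zero]
    intro ab hab
    rw [Finset.HasAntidiagonal.mem_antidiagonal] at hab
    refine mem_pow_iff.mp (Ideal.mul_mem_right _ _ (mem_pow_of_order fun s hs => ?_)) t ht
    exact hasse_order i _ N _ (fun u hu => hf u (by omega)) s hs
  have hmono : ∀ s t : σ →₀ ℕ, L (monomial t 1) (monomial s 1) = 0 := by
    intro s t
    rw [hLapp, sub_eq_zero, monomial_mul_monomial, one_mul, hasse_monomial, Finsupp.add_apply,
      Nat.add_choose_eq, Nat.cast_sum, Finset.sum_smul]
    refine Finset.sum_congr rfl fun ab hab => ?_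
    rw [Finset.HasAntidiagonal.mem_antidiagonal] at hab
    rw [hasse_monomial, hasse_monomial, smul_mul_smul_comm, monomial_mul_monomial, one_mul]
    by_cases h1 : ab.1 ≤ s i
    · by_cases h2 : ab.2 ≤ t i
      · have e : s + t - Finsupp.single i n =
            s - Finsupp.single i ab.1 + (t - Finsupp.single i ab.2) := by
          ext j
          by_cases hj : j = i
          · subst hj; simp; omega
          · simp [Ne.symm hj]
        rw [e, Nat.cast_mul]
      · simp [Nat.choose_eq_zero_of_lt (not_le.mp h2)]
    · simp [Nat.choose_eq_zero_of_lt (not_le.mp h1)]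
  have h1 : ∀ s g, L g (monomial s 1) = 0 := by
    intro s g
    let L' : MvPowerSeries σ k →ₗ[k] MvPowerSeries σ k :=
      hasse i n ∘ₗ LinearMap.mulLeft k (monomial s 1) -
        ∑ ab ∈ Finset.HasAntidiagonal.antidiagonal n,
          LinearMap.mulLeft k (hasse i ab.1 (monomial s 1)) ∘ₗ hasse i ab.2
    have hL' : ∀ g, L' g = L g (monomial s 1) := by
      intro g; rw [hLapp]; simp [L']
    rw [← hL']
    refine linearMap_eq_zero L' (fun N => ⟨N + n, fun f hf t ht => ?_⟩) g fun t _ => ?_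
    · rw [hL', hLapp]
      have := hord N f (monomial s 1) hf t ht
      rw [mul_comm, ← Finset.Nat.sum_antidiagonal_swap]
      simpa only [Prod.fst_swap, Prod.snd_swap, mul_comm] using this
    · rw [hL']; exact hmono s t
  rw [← sub_eq_zero, ← hLapp]
  refine linearMap_eq_zero (L g) (fun N => ⟨N + n, fun f hf t ht => ?_⟩) f fun s _ => h1 s g
  rw [hLapp]; exact hord N f g hf t ht

end Hasse

section DiffOps

variable {k O : Type*} [Field k] [CommRing O] [Algebra k O]

theorem isDiffOp_zero (n : ℕ) : IsDiffOp k n (0 : O →ₗ[k] O) := by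
  induction n with
  | zero => intro f; simp
  | succ n ih => intro f; simpa using ih

theorem IsDiffOp.add {n : ℕ} : ∀ {D D' : O →ₗ[k] O}, IsDiffOp k n D → IsDiffOp k n D' →
    IsDiffOp k n (D + D') := by
  induction n with
  | zero =>
    intro D D' h h' f
    rw [LinearMap.add_comp, LinearMap.comp_add, add_sub_add_comm, h f, h' f, add_zero]
  | succ n ih =>
    intro D D' h h' f
    rw [LinearMap.add_comp, LinearMap.comp_add, add_sub_add_comm]
    exact ih (h f) (h' f)

theorem IsDiffOp.sum {n : ℕ} {ι : Type*} {t : Finset ι} {D : ι → O →ₗ[k] O}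
    (h : ∀ i ∈ t, IsDiffOp k n (D i)) : IsDiffOp k n (∑ i ∈ t, D i) :=
  Finset.sum_induction D (IsDiffOp k n) (fun _ _ => IsDiffOp.add) (isDiffOp_zero n) h

theorem IsDiffOp.mulLeft_comp {n : ℕ} (g : O) : ∀ {D : O →ₗ[k] O}, IsDiffOp k n D →
    IsDiffOp k n (LinearMap.mulLeft k g ∘ₗ D) := by
  have key : ∀ (D : O →ₗ[k] O) f, (LinearMap.mulLeft k g ∘ₗ D) ∘ₗ LinearMap.mulLeft k f -
      LinearMap.mulLeft k f ∘ₗ (LinearMap.mulLeft k g ∘ₗ D) =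
      LinearMap.mulLeft k g ∘ₗ (D ∘ₗ LinearMap.mulLeft k f - LinearMap.mulLeft k f ∘ₗ D) := by
    intro D f; ext a; simp; ring
  induction n with
  | zero => intro D h f; rw [key, h f, LinearMap.comp_zero]
  | succ n ih => intro D h f; rw [key]; exact ih (h f)

theorem IsDiffOp.conj {O' : Type*} [CommRing O'] [Algebra k O'] (X : O ≃ₐ[k] O') {n : ℕ} :
    ∀ {D : O →ₗ[k] O}, IsDiffOp k n D → IsDiffOp k n (X.toLinearEquiv.conj D) := by
  have key : ∀ (D : O →ₗ[k] O) f, (X.toLinearEquiv.conj D) ∘ₗ LinearMap.mulLeft k f -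
      LinearMap.mulLeft k f ∘ₗ (X.toLinearEquiv.conj D) =
      X.toLinearEquiv.conj
        (D ∘ₗ LinearMap.mulLeft k (X.symm f) - LinearMap.mulLeft k (X.symm f) ∘ₗ D) := by
    intro D f; ext a; simp [LinearEquiv.conj_apply]
  induction n with
  | zero => intro D h f; rw [key, h, map_zero]
  | succ n ih => intro D h f; rw [key]; exact ih (h _)

theorem isDiffOp_hasse {σ : Type*} [Finite σ] (i : σ) {n m : ℕ} (hnm : n ≤ m) :
    IsDiffOp k m (hasse i n : MvPowerSeries σ k →ₗ[k] MvPowerSeries σ k) := by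
  have key : ∀ n (f : MvPowerSeries σ k),
      (hasse i n : MvPowerSeries σ k →ₗ[k] MvPowerSeries σ k) ∘ₗ LinearMap.mulLeft k f -
      LinearMap.mulLeft k f ∘ₗ hasse i n =
      ∑ j ∈ Finset.range n, LinearMap.mulLeft k (hasse i (n - j) f) ∘ₗ hasse i j := by
    intro n f
    ext1 g
    rw [LinearMap.sub_apply, LinearMap.comp_apply, LinearMap.mulLeft_apply, hasse_mul,
      ← Finset.Nat.sum_antidiagonal_swap, Finset.Nat.sum_antidiagonal_eq_sum_range_succ_mk,
      Finset.sum_range_succ]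
    simp [hasse_zero]
  induction m generalizing n with
  | zero =>
    intro f
    rw [key, Nat.le_zero.mp hnm]; simp
  | succ m ih =>
    intro f
    rw [key]
    refine IsDiffOp.sum fun j hj => (ih ?_).mulLeft_comp _
    have := Finset.mem_range.mp hj
    omega

end DiffOps

end Idealistic

namespace Idealistic

open MvPowerSeries IsLocalRing

/-! ### The pure part of the leading algebra -/

section Transport

variable {k σ O : Type*} [Field k] [CommRing O] [IsLocalRing O] [Algebra k O]

theorem map_mem_maximalIdeal_pow (X : MvPowerSeries σ k ≃ₐ[k] O) {n : ℕ} {f : MvPowerSeries σ k} :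
    X f ∈ maximalIdeal O ^ n ↔ f ∈ maximalIdeal (MvPowerSeries σ k) ^ n := by
  have h1 : (maximalIdeal (MvPowerSeries σ k)).map X.toRingEquiv = maximalIdeal O := by
    ext g
    rw [Ideal.mem_map_of_equiv]
    constructor
    · rintro ⟨f, hf, rfl⟩
      rw [mem_maximalIdeal, mem_nonunits_iff] at hf ⊢
      exact fun h => hf ((MulEquiv.isUnit_map X.toRingEquiv).mp h)
    · intro hg
      refine ⟨X.symm g, ?_, X.apply_symm_apply g⟩
      rw [mem_maximalIdeal, mem_nonunits_iff] at hg ⊢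
      exact fun h => hg ((MulEquiv.isUnit_map X.toRingEquiv.symm).mp h)
  rw [← h1, ← Ideal.map_pow, Ideal.mem_map_of_equiv]
  constructor
  · rintro ⟨g, hg, e⟩
    rwa [← X.injective e]
  · intro h; exact ⟨f, h, rfl⟩

theorem map_mem_maximalIdeal (X : MvPowerSeries σ k ≃ₐ[k] O) {f : MvPowerSeries σ k} :
    X f ∈ maximalIdeal O ↔ constantCoeff f = 0 := by
  have := map_mem_maximalIdeal_pow X (n := 1) (f := f)
  rwa [pow_one, pow_one, mem_maximalIdeal_iff] at this

end Transport

section DiffSat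

variable {k O : Type*} [Field k] [CommRing O] [Algebra k O] {R : ℕ → Ideal O}

theorem le_diffSat (n : ℕ) : R n ≤ diffSat k R n := by
  refine le_sInf ?_
  rintro _ ⟨S, _, hS, _, rfl⟩
  exact hS n

theorem isDiffClosed_diffSat : IsDiffClosed k (diffSat k R) := by
  intro t D hD n f hf
  rw [diffSat, Submodule.mem_sInf] at hf ⊢
  rintro _ ⟨S, h1, h2, h3, rfl⟩
  exact h3 t D hD n f (hf _ ⟨S, h1, h2, h3, rfl⟩)

end DiffSat

/-- `p ^ l` and `p ^ l * t` have a binomial coefficient prime to `p` if `t` is prime to `p`. -/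
theorem not_dvd_choose_pow {p : ℕ} (hp : p.Prime) (l : ℕ) {t : ℕ} (ht : ¬ p ∣ t) :
    ¬ p ∣ (p ^ l * t).choose (p ^ l) := by
  have := Fact.mk hp
  induction l with
  | zero => simpa using ht
  | succ l ih =>
    have h := Choose.choose_modEq_choose_mod_mul_choose_div_nat (n := p ^ (l + 1) * t)
      (k := p ^ (l + 1)) (p := p)
    have e1 : p ^ (l + 1) * t = p * (p ^ l * t) := by ring
    have e2 : p ^ (l + 1) = p * p ^ l := by ring
    rw [e1, e2, Nat.mul_mod_right, Nat.mul_mod_right, Nat.mul_div_cancel_left _ hp.pos,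
      Nat.mul_div_cancel_left _ hp.pos, Nat.choose_self, one_mul] at h
    rw [e1, e2]
    exact fun hd => ih ((Nat.ModEq.dvd_iff h (dvd_refl p)).mp hd)

section Multi

variable {k : Type*} [Field k]

/-- The composition of the Hasse derivatives of orders `α 0`, `α 1`, `α 2`. -/
noncomputable def hasseMulti (α : Fin 3 →₀ ℕ) (f : MvPowerSeries (Fin 3) k) :
    MvPowerSeries (Fin 3) k :=
  hasse 0 (α 0) (hasse 1 (α 1) (hasse 2 (α 2) f))

theorem coeff_hasseMulti (α : Fin 3 →₀ ℕ) (f : MvPowerSeries (Fin 3) k) (s : Fin 3 →₀ ℕ) :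
    coeff s (hasseMulti α f) =
      ((∏ i, (s i + α i).choose (α i) : ℕ) : k) * coeff (s + α) f := by
  have e : s + Finsupp.single 0 (α 0) + Finsupp.single 1 (α 1) + Finsupp.single 2 (α 2) =
      s + α := by
    ext i; fin_cases i <;> simp
  rw [hasseMulti, coeff_hasse, coeff_hasse, coeff_hasse, e, Fin.prod_univ_three]
  simp
  ring

variable {O : Type*} [CommRing O] [Algebra k O] {L : ℕ → Ideal O}

theorem map_hasse_mem (hL : IsDiffClosed k L) (X : MvPowerSeries (Fin 3) k ≃ₐ[k] O) (i : Fin 3)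
    {n t : ℕ} {f : MvPowerSeries (Fin 3) k} (hf : X f ∈ L n) : X (hasse i t f) ∈ L (n - t) := by
  have := hL t _ ((isDiffOp_hasse (k := k) i le_rfl).conj X) n _ hf
  simpa [LinearEquiv.conj_apply] using this

theorem map_hasseMulti_mem (hL : IsDiffClosed k L) (X : MvPowerSeries (Fin 3) k ≃ₐ[k] O)
    (α : Fin 3 →₀ ℕ) {n : ℕ} {f : MvPowerSeries (Fin 3) k} (hf : X f ∈ L n) :
    X (hasseMulti α f) ∈ L (n - α.degree) := by
  have := map_hasse_mem hL X 0 (t := α 0) (map_hasse_mem hL X 1 (t := α 1)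
    (map_hasse_mem hL X 2 (t := α 2) hf))
  have e : n - α 2 - α 1 - α 0 = n - α.degree := by
    rw [Finsupp.degree_eq_sum, Fin.sum_univ_three]; omega
  rwa [e] at this

theorem hasseMulti_mem_pow {α : Fin 3 →₀ ℕ} {n m : ℕ} (hnm : n + α.degree ≤ m)
    {f : MvPowerSeries (Fin 3) k} (hf : f ∈ maximalIdeal (MvPowerSeries (Fin 3) k) ^ m) :
    hasseMulti α f ∈ maximalIdeal (MvPowerSeries (Fin 3) k) ^ n := by
  refine mem_pow_of_order fun s hs => ?_
  rw [coeff_hasseMulti, mem_pow_iff.mp hf, mul_zero]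
  rw [map_add]; omega

variable {p : ℕ} [hp : Fact p.Prime] [CharP k p]

/-- An element of level `n` whose degree `n` form has a term divisible by the variable `i` can be
differentiated down to an element of level `p ^ l` whose form contains `(X i) ^ (p ^ l)`. -/
theorem exists_hasse_descent (hL : IsDiffClosed k L) (X : MvPowerSeries (Fin 3) k ≃ₐ[k] O)
    {n : ℕ} {f : MvPowerSeries (Fin 3) k} (hf : X f ∈ L n)
    (hfn : f ∈ maximalIdeal (MvPowerSeries (Fin 3) k) ^ n) {s : Fin 3 →₀ ℕ} (hs : s.degree = n)
    (hsf : coeff s f ≠ 0) {i : Fin 3} (hi : s i ≠ 0) :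
    ∃ (l : ℕ) (α : Fin 3 →₀ ℕ), p ^ l ≤ s i ∧ α + Finsupp.single i (p ^ l) = s ∧
      X (hasseMulti α f) ∈ L (p ^ l) ∧
      hasseMulti α f ∈ maximalIdeal (MvPowerSeries (Fin 3) k) ^ (p ^ l) ∧
      coeff (Finsupp.single i (p ^ l)) (hasseMulti α f) ≠ 0 := by
  obtain ⟨l, t, ht, e⟩ := Nat.exists_eq_pow_mul_and_not_dvd hi p hp.out.ne_one
  have hle : p ^ l ≤ s i := Nat.le_of_dvd (Nat.pos_of_ne_zero hi) ⟨t, e⟩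
  set α := s - Finsupp.single i (p ^ l) with hα
  have hs' : α + Finsupp.single i (p ^ l) = s :=
    tsub_add_cancel_of_le (Finsupp.single_le_iff.mpr hle)
  have hdeg : α.degree + p ^ l = n := by
    rw [← hs, ← hs', map_add, Finsupp.degree_single]
  refine ⟨l, α, hle, hs', ?_, hasseMulti_mem_pow (by omega) hfn, ?_⟩
  · have := map_hasseMulti_mem hL X α hf
    rwa [show n - α.degree = p ^ l by omega] at this
  · rw [coeff_hasseMulti, add_comm _ α, hs']
    refine mul_ne_zero ?_ hsf
    rw [Ne, CharP.cast_eq_zero_iff k p]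
    intro hdvd
    rw [Prime.dvd_finsetProd_iff hp.out.prime] at hdvd
    obtain ⟨j, -, hj⟩ := hdvd
    by_cases hji : j = i
    · subst hji
      have e3 : α j = s j - p ^ l := by simp [hα]
      rw [Finsupp.single_eq_same, e3, Nat.add_sub_cancel' hle, Nat.choose_symm hle, e] at hj
      exact not_dvd_choose_pow hp.out l ht hj
    · rw [Finsupp.single_eq_of_ne hji, zero_add, Nat.choose_self] at hj
      exact hp.out.one_lt.ne' (Nat.dvd_one.mp hj)

end Multi

section Finrank

variable {k O : Type*} [Field k] [CommRing O] [IsLocalRing O] [Algebra k O] {L : ℕ → Ideal O}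

/-- The quotient `O / 𝔪 ^ (n + 1)` is finite-dimensional, so a vanishing `finrank` really means that the
space is zero. -/
theorem leadPure_eq_bot_of_finrank_eq_zero (X : MvPowerSeries (Fin 3) k ≃ₐ[k] O) {n : ℕ}
    (h : Module.finrank k (leadPure k L n) = 0) : leadPure k L n = ⊥ := by
  classical
  have hfin : {s : Fin 3 →₀ ℕ | s.degree < n + 1}.Finite :=
    (Finsupp.finite_of_degree_le (n + 1)).subset fun s (hs : s.degree < n + 1) => hs.le
  let Q : (hfin.toFinset → k) →ₗ[k] O ⧸ maximalIdeal O ^ (n + 1) :=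
    (Ideal.Quotient.mkₐ k (maximalIdeal O ^ (n + 1))).toLinearMap ∘ₗ X.toLinearMap ∘ₗ
      ∑ s : hfin.toFinset, monomial (s : Fin 3 →₀ ℕ) ∘ₗ LinearMap.proj s
  have hQ : Function.Surjective Q := by
    intro y
    obtain ⟨y, rfl⟩ := Ideal.Quotient.mk_surjective y
    obtain ⟨y, rfl⟩ := X.surjective y
    refine ⟨fun s => coeff s y, ?_⟩
    change Ideal.Quotient.mk _ (X _) = _
    rw [Ideal.Quotient.mk_eq_mk_iff_sub_mem]
    rw [← map_sub, map_mem_maximalIdeal_pow]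
    refine mem_pow_of_order fun s hs => ?_
    have hs' : s ∈ hfin.toFinset := by simpa using hs
    rw [map_sub, sub_eq_zero]
    simp only [LinearMap.sum_apply, LinearMap.comp_apply, LinearMap.proj_apply, map_sum]
    rw [Finset.sum_eq_single ⟨s, hs'⟩]
    · rw [coeff_monomial_same]
    · intro b _ hb
      rw [coeff_monomial_ne]
      exact fun h => hb (Subtype.ext h.symm)
    · simp
  have := Module.Finite.of_surjective Q hQ
  exact Submodule.finrank_eq_zero.mp h

end Finrank

section LeadPure

variable {k O : Type*} [Field k] [IsAlgClosed k] [CommRing O] [IsLocalRing O] [Algebra k O]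
  {L : ℕ → Ideal O} {p : ℕ} [hp : Fact p.Prime] [CharP k p] {e : ℕ}

/-- A form all of whose terms are pure powers `(X i) ^ (p ^ l)` is the `p ^ l`-th power of a linear
form. -/
theorem exists_linear_pow {l : ℕ} {f : MvPowerSeries (Fin 3) k}
    (hf : f ∈ maximalIdeal (MvPowerSeries (Fin 3) k) ^ p ^ l)
    (hs : ∀ s : Fin 3 →₀ ℕ, s.degree = p ^ l → coeff s f ≠ 0 → ∃ i, s = Finsupp.single i (p ^ l)) :
    ∃ g ∈ maximalIdeal (MvPowerSeries (Fin 3) k),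
      f - g ^ p ^ l ∈ maximalIdeal (MvPowerSeries (Fin 3) k) ^ (p ^ l + 1) := by
  have hpos : 0 < p ^ l := pow_pos hp.out.pos l
  have hroot : ∀ i : Fin 3, ∃ c : k, c ^ p ^ l = coeff (Finsupp.single i (p ^ l)) f := fun i =>
    IsAlgClosed.exists_pow_nat_eq _ hpos
  choose c hc using hroot
  have : CharP (MvPowerSeries (Fin 3) k) p := by
    refine ⟨fun x => ?_⟩
    rw [← map_natCast (C : k →+* MvPowerSeries (Fin 3) k) x, map_eq_zero_iff _ C_injective,
      CharP.cast_eq_zero_iff k p]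
  have hpow : (∑ i, C (c i) * (X i : MvPowerSeries (Fin 3) k)) ^ p ^ l =
      ∑ i, monomial (Finsupp.single i (p ^ l)) (coeff (Finsupp.single i (p ^ l)) f) := by
    rw [sum_pow_char_pow]
    refine Finset.sum_congr rfl fun i _ => ?_
    rw [mul_pow, ← map_pow, hc, X_pow_eq, ← monomial_zero_eq_C_apply, monomial_mul_monomial,
      zero_add, mul_one]
  refine ⟨∑ i, C (c i) * X i, Ideal.sum_mem _ fun i _ =>
    Ideal.mul_mem_left _ _ (X_mem_maximalIdeal i), mem_pow_of_order fun s hs' => ?_⟩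
  rw [hpow, map_sub, map_sum]
  by_cases hlt : s.degree < p ^ l
  · rw [mem_pow_iff.mp hf s hlt, Finset.sum_eq_zero, sub_zero]
    intro i _
    rw [coeff_monomial_ne]
    rintro rfl
    simp at hlt
  · by_cases h : ∃ i, s = Finsupp.single i (p ^ l)
    · obtain ⟨i, rfl⟩ := h
      rw [Finset.sum_eq_single i, coeff_monomial_same, sub_self]
      · intro j _ hj
        rw [coeff_monomial_ne]
        intro h'
        exact hj ((Finsupp.single_left_inj hpos.ne').mp h').symm
      · simp
    · have h0 : coeff s f = 0 := by
        by_contra h'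
        exact h (hs s (by omega) h')
      rw [h0, Finset.sum_eq_zero, sub_zero]
      intro i _
      rw [coeff_monomial_ne]
      exact fun h' => h ⟨i, h'⟩

/-- An element of level and order `p ^ l` is pure as soon as its initial form has no mixed terms. -/
theorem mk_mem_leadPure (X : MvPowerSeries (Fin 3) k ≃ₐ[k] O) {l : ℕ}
    {f : MvPowerSeries (Fin 3) k} (hfL : X f ∈ L (p ^ l))
    (hf : f ∈ maximalIdeal (MvPowerSeries (Fin 3) k) ^ p ^ l)
    (hs : ∀ s : Fin 3 →₀ ℕ, s.degree = p ^ l → coeff s f ≠ 0 → ∃ i, s = Finsupp.single i (p ^ l)) :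
    Ideal.Quotient.mk (maximalIdeal O ^ (p ^ l + 1)) (X f) ∈ leadPure k L (p ^ l) := by
  obtain ⟨g, hg, hfg⟩ := exists_linear_pow hf hs
  refine Submodule.subset_span ⟨X f, hfL, ⟨X g, ?_, ?_⟩, rfl⟩
  · rw [map_mem_maximalIdeal]; exact mem_maximalIdeal_iff.mp hg
  · rw [← map_pow, ← map_sub, map_mem_maximalIdeal_pow]; exact hfg

/-- If there are no pure elements of level `p ^ i` for `i < e`, the elements of level `n < p ^ e`
have order `> n`. -/
theorem mem_pow_succ_of_lt (hL : IsDiffClosed k L) (X : MvPowerSeries (Fin 3) k ≃ₐ[k] O)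
    (h0 : ∀ i < e, leadPure k L (p ^ i) = ⊥) {n : ℕ} (hn0 : 0 < n) (hn : n < p ^ e)
    {f : MvPowerSeries (Fin 3) k} (hf : X f ∈ L n)
    (hfn : f ∈ maximalIdeal (MvPowerSeries (Fin 3) k) ^ n) :
    f ∈ maximalIdeal (MvPowerSeries (Fin 3) k) ^ (n + 1) := by
  induction n using Nat.strong_induction_on generalizing f with
  | _ n ih =>
    have hsupp : ∀ s : Fin 3 →₀ ℕ, s.degree = n → coeff s f ≠ 0 →
        ∃ i l, n = p ^ l ∧ s = Finsupp.single i n := by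
      intro s hs hsf
      have hs0 : s ≠ 0 := by rintro rfl; simp at hs; omega
      obtain ⟨i, hi⟩ := Finsupp.ne_iff.mp hs0
      obtain ⟨l, α, hle, -, h1, h2, h3⟩ := exists_hasse_descent (p := p) hL X hf hfn hs hsf hi
      have hsi : s i ≤ n := hs ▸ Finsupp.le_degree i s
      rcases lt_or_eq_of_le (hle.trans hsi) with hlt | heq
      · exact absurd (mem_pow_iff.mp (ih _ hlt (pow_pos hp.out.pos l) (hlt.trans hn) h1 h2) _
          (by simp)) h3
      · refine ⟨i, l, heq.symm, ?_⟩
        have : s i = n := by omega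
        rw [← this]; exact exists_eq_single_of_degree_le (by omega)
    by_contra hcon
    have : ∃ s : Fin 3 →₀ ℕ, s.degree = n ∧ coeff s f ≠ 0 := by
      by_contra! h
      refine hcon (mem_pow_of_order fun s hs => ?_)
      rcases Nat.lt_succ_iff_lt_or_eq.mp hs with h' | h'
      · exact mem_pow_iff.mp hfn s h'
      · exact h s h'
    obtain ⟨s, hs, hsf⟩ := this
    obtain ⟨i, l, rfl, -⟩ := hsupp s hs hsf
    have hl : l < e := (Nat.pow_lt_pow_iff_right hp.out.one_lt).mp hn
    have hmem := mk_mem_leadPure X hf hfn fun s h1 h2 =>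
      let ⟨i, _, _, h⟩ := hsupp s h1 h2; ⟨i, h⟩
    rw [h0 l hl, Submodule.mem_bot, Ideal.Quotient.eq_zero_iff_mem, map_mem_maximalIdeal_pow] at hmem
    exact hcon hmem

/-- In the first degree `p ^ e` with pure elements, the initial form of an element of the same level has
no mixed terms: differentiating a mixed term would give a pure element of lower degree. -/
theorem form_additive (hL : IsDiffClosed k L) (X : MvPowerSeries (Fin 3) k ≃ₐ[k] O)
    (h0 : ∀ i < e, leadPure k L (p ^ i) = ⊥) {f : MvPowerSeries (Fin 3) k} (hf : X f ∈ L (p ^ e))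
    (hfn : f ∈ maximalIdeal (MvPowerSeries (Fin 3) k) ^ p ^ e) (s : Fin 3 →₀ ℕ)
    (hs : s.degree = p ^ e) (hsf : coeff s f ≠ 0) : ∃ i, s = Finsupp.single i (p ^ e) := by
  have hpos : 0 < p ^ e := pow_pos hp.out.pos e
  have hs0 : s ≠ 0 := by rintro rfl; simp at hs; omega
  obtain ⟨i, hi⟩ := Finsupp.ne_iff.mp hs0
  obtain ⟨l, α, hle, -, h1, h2, h3⟩ := exists_hasse_descent (p := p) hL X hf hfn hs hsf hi
  have hsi : s i ≤ p ^ e := hs ▸ Finsupp.le_degree i s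
  rcases lt_or_eq_of_le (hle.trans hsi) with hlt | heq
  · exact absurd (mem_pow_iff.mp (mem_pow_succ_of_lt hL X h0 (pow_pos hp.out.pos l) hlt h1 h2) _
      (by simp)) h3
  · refine ⟨i, ?_⟩
    have : s i = p ^ e := by omega
    rw [← this]; exact exists_eq_single_of_degree_le (by omega)

/-- If the pure part of the leading algebra is spanned by the powers of a form involving the
variable `0`, no monomial in the other variables has order equal to its level. -/
theorem degree_ne_of_monomial_mem (hL : IsDiffClosed k L) (X : MvPowerSeries (Fin 3) k ≃ₐ[k] O)
    (h0 : ∀ i < e, leadPure k L (p ^ i) = ⊥)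
    (h1 : ∀ i, e ≤ i → Module.finrank k (leadPure k L (p ^ i)) = 1)
    {h : MvPowerSeries (Fin 3) k} (hh : ∀ i, X (h ^ p ^ i) ∈ L (p ^ (e + i)))
    (hhn : h ∈ maximalIdeal (MvPowerSeries (Fin 3) k) ^ p ^ e)
    (hhc : coeff (Finsupp.single 0 (p ^ e)) h = 1) {s : Fin 3 →₀ ℕ} (hs0 : s 0 = 0) {n : ℕ}
    (hn : 0 < n) (hs : X (monomial s 1) ∈ L n) : s.degree ≠ n := by
  intro hdeg
  have hs' : s ≠ 0 := by rintro rfl; simp at hdeg; omega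
  obtain ⟨i, hi⟩ := Finsupp.ne_iff.mp hs'
  have hi0 : i ≠ 0 := by rintro rfl; exact hi hs0
  have hmn : (monomial s (1 : k)) ∈ maximalIdeal (MvPowerSeries (Fin 3) k) ^ n :=
    hdeg ▸ monomial_mem_pow s 1
  -- a derivative of the monomial is the pure power `x_i ^ (p ^ l)`, up to a factor
  obtain ⟨l, α, -, hα, m1, m2, m3⟩ := exists_hasse_descent (p := p) hL X hs hmn hdeg
    (by rw [coeff_monomial_same]; exact one_ne_zero) hi
  have hmono : ∀ t, coeff t (hasseMulti α (monomial s (1 : k))) ≠ 0 →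
      t = Finsupp.single i (p ^ l) := by
    classical
    intro t ht
    rw [coeff_hasseMulti] at ht
    have := right_ne_zero_of_mul ht
    rw [coeff_monomial] at this
    have h2 : t + α = s := by by_contra h; rw [if_neg h] at this; exact this rfl
    rw [← hα, add_comm] at h2
    exact add_left_cancel h2
  set g := hasseMulti α (monomial s (1 : k))
  have hle : e ≤ l := by
    by_contra! hlt
    exact m3 (mem_pow_iff.mp (mem_pow_succ_of_lt hL X h0 (pow_pos hp.out.pos l)
      (Nat.pow_lt_pow_right hp.out.one_lt hlt) m1 m2) _ (by simp))
  obtain ⟨j, rfl⟩ := Nat.exists_eq_add_of_le hle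
  have mg := mk_mem_leadPure X m1 m2 fun t _ ht => ⟨i, hmono t ht⟩
  -- `h ^ p ^ j` is another pure element of the same level
  obtain ⟨u, hu, hhu⟩ := exists_linear_pow hhn
    (form_additive hL X h0 (by simpa using hh 0) hhn)
  have : CharP (MvPowerSeries (Fin 3) k) p := by
    refine ⟨fun x => ?_⟩
    rw [← map_natCast (C : k →+* MvPowerSeries (Fin 3) k) x, map_eq_zero_iff _ C_injective,
      CharP.cast_eq_zero_iff k p]
  have hdiff : h ^ p ^ j - u ^ p ^ (e + j) ∈
      maximalIdeal (MvPowerSeries (Fin 3) k) ^ (p ^ (e + j) + 1) := by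
    have e1 : h ^ p ^ j - u ^ p ^ (e + j) = (h - u ^ p ^ e) ^ p ^ j := by
      rw [sub_pow_char_pow, ← pow_mul, ← pow_add]
    rw [e1]
    have h3 := Ideal.pow_mem_pow hhu (p ^ j)
    rw [← pow_mul] at h3
    refine Ideal.pow_le_pow_right ?_ h3
    have : 0 < p ^ j := pow_pos hp.out.pos j
    rw [pow_add]; nlinarith
  have mh : Ideal.Quotient.mk (maximalIdeal O ^ (p ^ (e + j) + 1)) (X (h ^ p ^ j)) ∈
      leadPure k L (p ^ (e + j)) := by
    refine Submodule.subset_span ⟨_, hh j, ⟨X u, ?_, ?_⟩, rfl⟩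
    · rw [map_mem_maximalIdeal]; exact mem_maximalIdeal_iff.mp hu
    · rw [← map_pow, ← map_sub, map_mem_maximalIdeal_pow]; exact hdiff
  have hne : (⟨_, mg⟩ : leadPure k L (p ^ (e + j))) ≠ 0 := by
    intro h
    rw [Submodule.mk_eq_zero, Ideal.Quotient.eq_zero_iff_mem, map_mem_maximalIdeal_pow] at h
    exact m3 (mem_pow_iff.mp h _ (by simp))
  -- the two are proportional, although only one of them contains a power of `x_0`
  obtain ⟨c, hc⟩ := (finrank_eq_one_iff_of_nonzero' _ hne).mp (h1 _ hle) ⟨_, mh⟩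
  have hc' := congrArg Subtype.val hc
  change c • Ideal.Quotient.mk _ (X g) = Ideal.Quotient.mk _ (X (h ^ p ^ j)) at hc'
  have e2 : Ideal.Quotient.mk (maximalIdeal O ^ (p ^ (e + j) + 1)) (X (h ^ p ^ j - c • g)) = 0 := by
    rw [map_sub, map_smul, map_sub, ← hc', sub_eq_zero]
    rfl
  rw [Ideal.Quotient.eq_zero_iff_mem, map_mem_maximalIdeal_pow] at e2
  have e3 := mem_pow_iff.mp e2 (Finsupp.single 0 (p ^ (e + j))) (by simp)
  have e4 : coeff (Finsupp.single (0 : Fin 3) (p ^ (e + j))) g = 0 := by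
    by_contra h
    have := hmono _ h
    exact hi0 ((Finsupp.single_left_inj (pow_pos hp.out.pos _).ne').mp this).symm
  have e5 : coeff (Finsupp.single (0 : Fin 3) (p ^ (e + j))) (h ^ p ^ j) = 1 := by
    have := map_iterateFrobenius_expand p hp.out.ne_zero h j
    rw [← this]
    have e6 : Finsupp.single (0 : Fin 3) (p ^ (e + j)) = p ^ j • Finsupp.single 0 (p ^ e) := by
      rw [Finsupp.smul_single, smul_eq_mul, pow_add, mul_comm]
    rw [coeff_map, e6, coeff_expand_smul, hhc, map_one]
  rw [map_sub, e5, coeff_smul, e4, mul_zero, sub_zero] at e3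
  exact one_ne_zero e3

end LeadPure

end Idealistic

namespace Idealistic

open MvPowerSeries IsLocalRing

/-! ### Weierstrass division and the weak form of the monomial case -/

section ZFree

variable {k : Type*} [Field k]

/-- The power series that do not involve the variable `z = X 0`. -/
def zFree (k : Type*) [Field k] : Subalgebra k (MvPowerSeries (Fin 3) k) where
  carrier := {f | ∀ s, coeff s f ≠ 0 → s 0 = 0}
  mul_mem' {f g} hf hg s hs := by
    classical
    rw [coeff_mul] at hs
    obtain ⟨⟨a, b⟩, hab, hne⟩ := Finset.exists_ne_zero_of_sum_ne_zero hs
    rw [Finset.HasAntidiagonal.mem_antidiagonal] at hab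
    dsimp only at hab hne
    rw [← hab, Finsupp.add_apply, hf a (left_ne_zero_of_mul hne), hg b (right_ne_zero_of_mul hne)]
  add_mem' {f g} hf hg s hs := by
    by_cases h : coeff s f = 0
    · exact hg s fun h' => hs (by rw [map_add, h, h', add_zero])
    · exact hf s h
  algebraMap_mem' c s hs := by
    classical
    rw [← c_eq_algebraMap, coeff_C] at hs
    have : s = 0 := by by_contra h; rw [if_neg h] at hs; exact hs rfl
    simp [this]

theorem X_mem_zFree {i : Fin 3} (hi : i ≠ 0) : (X i : MvPowerSeries (Fin 3) k) ∈ zFree k := by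
  classical
  intro s hs
  rw [coeff_X] at hs
  have : s = Finsupp.single i 1 := by by_contra h; rw [if_neg h] at hs; exact hs rfl
  rw [this, Finsupp.single_eq_of_ne (Ne.symm hi)]

theorem C_mem_zFree (c : k) : (C c : MvPowerSeries (Fin 3) k) ∈ zFree k := by
  rw [c_eq_algebraMap]; exact Subalgebra.algebraMap_mem _ c

theorem coeff_mul_X_zero_pow {a : MvPowerSeries (Fin 3) k} (ha : a ∈ zFree k) (n : ℕ)
    (s : Fin 3 →₀ ℕ) :
    coeff s (a * X 0 ^ n) = if s 0 = n then coeff (s.erase 0) a else 0 := by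
  classical
  rw [X_pow_eq, coeff_mul_monomial, mul_one]
  by_cases h : Finsupp.single 0 n ≤ s
  · rw [if_pos h]
    rw [Finsupp.single_le_iff] at h
    split_ifs with h2
    · congr 2
      ext i
      by_cases hi : i = 0
      · subst hi; simp [h2]
      · simp [hi]
    · by_contra h3
      have := ha _ h3
      simp at this
      omega
  · rw [if_neg h, if_neg]
    rintro rfl
    exact h (Finsupp.single_le_iff.mpr le_rfl)

theorem erase_zero_of_zero {s : Fin 3 →₀ ℕ} (h : s 0 = 0) : s.erase 0 = s := by
  rw [Finsupp.erase_of_notMem_support]; simpa using h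

/-- A homomorphism that maps `x₁` and `x₂` to series not involving `z` preserves the subalgebra of
such series. -/
theorem map_mem_zFree (φ : MvPowerSeries (Fin 3) k →ₐ[k] MvPowerSeries (Fin 3) k)
    (hφ : ∀ i, i ≠ 0 → φ (X i) ∈ zFree k) {f : MvPowerSeries (Fin 3) k} (hf : f ∈ zFree k) :
    φ f ∈ zFree k := by
  classical
  -- compare `φ` with its composition with `z ↦ 0`
  have hs : HasSubst (S := k) (fun i : Fin 3 => if i = 0 then (0 : MvPowerSeries (Fin 3) k) else X i) :=
    hasSubst_of_constantCoeff_zero fun i => by split_ifs <;> simp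
  let ε : MvPowerSeries (Fin 3) k →ₐ[k] MvPowerSeries (Fin 3) k := substAlgHom hs
  have hεX : ∀ i, ε (X i) = if i = 0 then (0 : MvPowerSeries (Fin 3) k) else X i := substAlgHom_X hs
  have hε : ∀ g ∈ zFree k, ε g = g := fun g hg =>
    algHom_congr (ψ := AlgHom.id k _) fun i ⟨s, hs1, hs2⟩ => by
      rw [hεX, if_neg, AlgHom.id_apply]
      rintro rfl
      exact hs2 (hg s hs1)
  have hεz : ∀ g, ε g ∈ zFree k := by
    intro g s hs
    by_contra hs0
    apply hs
    let L : MvPowerSeries (Fin 3) k →ₗ[k] MvPowerSeries (Fin 3) k :=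
      { toFun := fun g t => if t 0 = 0 then 0 else coeff t (ε g)
        map_add' := fun a b => by
          ext t
          change (if t 0 = 0 then 0 else coeff t (ε (a + b))) =
            (if t 0 = 0 then 0 else coeff t (ε a)) + (if t 0 = 0 then 0 else coeff t (ε b))
          split_ifs <;> simp
        map_smul' := fun c a => by
          ext t
          change (if t 0 = 0 then 0 else coeff t (ε (c • a))) =
            c * (if t 0 = 0 then 0 else coeff t (ε a))
          split_ifs <;> simp }
    have hL : ∀ g t, coeff t (L g) = if t 0 = 0 then 0 else coeff t (ε g) := fun _ _ => rfl
    have h0 : L g = 0 := by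
      refine linearMap_eq_zero L (fun N => ⟨N, fun f hf t ht => ?_⟩) g fun u _ => ?_
      · rw [hL, mem_pow_iff.mp (algHom_mem_pow ε (mem_pow_of_order hf)) t ht, ite_self]
      · ext t
        rw [hL, coeff_zero]
        split_ifs with h
        · rfl
        · by_contra hne
          have : ε (monomial u 1) ∈ zFree k := by
            rw [algHom_monomial]
            refine Subalgebra.prod_mem _ fun i _ => pow_mem ?_ _
            rw [hεX]
            split_ifs with hi
            · exact zero_mem _
            · exact X_mem_zFree hi
          exact h (this t hne)
    have := hL g s
    rw [h0, if_neg hs0, coeff_zero] at this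
    exact this.symm
  have : φ f = ε (φ f) := by
    have h1 : φ f = (ε.comp φ) f := algHom_congr fun i ⟨s, hs1, hs2⟩ => by
      rw [AlgHom.comp_apply, hε _ (hφ i _)]
      rintro rfl
      exact hs2 (hf s hs1)
    exact h1
  rw [this]
  exact hεz _

end ZFree

section Weierstrass

variable {k : Type*} [Field k]

/-- The quotient of the division by `z ^ q`. -/
noncomputable def divZ (q : ℕ) : MvPowerSeries (Fin 3) k →+ MvPowerSeries (Fin 3) k where
  toFun f := fun s => coeff (s + Finsupp.single 0 q) f
  map_zero' := by ext s; exact coeff_zero _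
  map_add' f g := by
    ext s
    change coeff _ (f + g) = coeff _ f + coeff _ g
    rw [map_add]

theorem coeff_divZ (q : ℕ) (f : MvPowerSeries (Fin 3) k) (s : Fin 3 →₀ ℕ) :
    coeff s (divZ q f) = coeff (s + Finsupp.single 0 q) f := rfl

theorem divZ_eq_zero_iff {q : ℕ} {f : MvPowerSeries (Fin 3) k} :
    divZ q f = 0 ↔ ∀ s, coeff s f ≠ 0 → s 0 < q := by
  constructor
  · intro h s hs
    by_contra! hle
    apply hs
    have := congrArg (coeff (s - Finsupp.single 0 q)) h
    rwa [coeff_divZ, tsub_add_cancel_of_le (Finsupp.single_le_iff.mpr hle), coeff_zero] at this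
  · intro h
    ext s
    rw [coeff_divZ, coeff_zero]
    by_contra hne
    have := h _ hne
    simp at this

theorem divZ_X_pow_mul (q : ℕ) (f : MvPowerSeries (Fin 3) k) : divZ q (X 0 ^ q * f) = f := by
  ext s
  rw [coeff_divZ, X_pow_eq, add_comm, coeff_add_monomial_mul, one_mul]

/-- The weights for which `z ^ q` is the initial form of a distinguished polynomial of degree
`q`. -/
def distWeight (q : ℕ) : Fin 3 → ℕ := fun i => if i = 0 then 1 else q + 1

/-- Multiplication by `A` followed by division by `z ^ q` raises the order for the weights
`distWeight q`, so that adding the identity gives a bijection. -/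
theorem bijective_division {q : ℕ} {A : MvPowerSeries (Fin 3) k}
    (hA : OrdGE (distWeight q) (q + 1) A) :
    Function.Bijective fun g => g + divZ q (A * g) := by
  refine bijective_add_contraction (distWeight q)
    ((divZ q).comp (AddMonoidHom.mulLeft A)) fun n g hg s hs => ?_
  have h1 := (hA.mul hg) _ hs
  rw [map_add, Finsupp.weight_single] at h1
  have h2 : distWeight q 0 = 1 := if_pos rfl
  rw [h2] at h1
  push_cast at h1 ⊢
  simp only [smul_eq_mul, mul_one] at h1
  linarith

/-- Division with remainder by `z ^ q + A`. -/
theorem exists_weierstrass_div {q : ℕ} {A : MvPowerSeries (Fin 3) k}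
    (hA : OrdGE (distWeight q) (q + 1) A) (f : MvPowerSeries (Fin 3) k) :
    ∃ g r, f = g * (X 0 ^ q + A) + r ∧ ∀ s, coeff s r ≠ 0 → s 0 < q := by
  obtain ⟨g, hg⟩ := (bijective_division hA).2 (divZ q f)
  refine ⟨g, f - g * (X 0 ^ q + A), by ring, divZ_eq_zero_iff.mp ?_⟩
  have e : f - g * (X 0 ^ q + A) = f - X 0 ^ q * g - A * g := by ring
  rw [e, map_sub, map_sub, divZ_X_pow_mul, ← hg]
  ring

/-- Uniqueness of the remainder of the division by `z ^ q + A`. -/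
theorem eq_zero_of_dvd_of_deg {q : ℕ} {A r : MvPowerSeries (Fin 3) k}
    (hA : OrdGE (distWeight q) (q + 1) A) (hr : ∀ s, coeff s r ≠ 0 → s 0 < q)
    (hdvd : X 0 ^ q + A ∣ r) : r = 0 := by
  obtain ⟨g, rfl⟩ := hdvd
  have h1 := divZ_eq_zero_iff.mpr hr
  rw [add_mul, map_add, divZ_X_pow_mul] at h1
  have : g = 0 := (bijective_division hA).1 (by simpa using h1)
  rw [this, mul_zero]

end Weierstrass

namespace MonomialDatum

variable {k : Type*} {p : ℕ} {O : Type*} [Field k] [CommRing O] [Algebra k O]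

/-- The series `h - z ^ q` in the coordinates of the datum. -/
noncomputable def tail (d : MonomialDatum k p O) : MvPowerSeries (Fin 3) k :=
  ∑ l ∈ Finset.Icc 1 d.q, d.coef l * MvPowerSeries.X 0 ^ (d.q - l)

/-- The series `h` in the coordinates of the datum. -/
noncomputable def hS (d : MonomialDatum k p O) : MvPowerSeries (Fin 3) k := MvPowerSeries.X 0 ^ d.q + d.tail

theorem X_hS (d : MonomialDatum k p O) : d.X d.hS = d.h := by
  simp [hS, tail, h, x]

theorem coeff_hS (d : MonomialDatum k p O) (hc : ∀ l ∈ Finset.Icc 1 d.q, d.coef l ∈ zFree k)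
    {l : ℕ} (hl : l ∈ Finset.Icc 1 d.q) {s : Fin 3 →₀ ℕ} (hs : s 0 = d.q - l) :
    coeff s d.hS = coeff (s.erase 0) (d.coef l) := by
  classical
  have hl' := Finset.mem_Icc.mp hl
  rw [hS, map_add, coeff_X_pow, if_neg, zero_add, tail, map_sum, Finset.sum_eq_single l]
  · rw [coeff_mul_X_zero_pow (hc l hl), if_pos hs]
  · intro m hm hne
    have hm' := Finset.mem_Icc.mp hm
    rw [coeff_mul_X_zero_pow (hc m hm), if_neg]
    omega
  · intro h; exact absurd hl h
  · rintro rfl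
    simp at hs; omega

theorem coeff_hS_top (d : MonomialDatum k p O) (hc : ∀ l ∈ Finset.Icc 1 d.q, d.coef l ∈ zFree k) :
    coeff (Finsupp.single 0 d.q) d.hS = 1 := by
  rw [hS, map_add, X_pow_eq, coeff_monomial_same, tail, map_sum, Finset.sum_eq_zero, add_zero]
  intro m hm
  have hm' := Finset.mem_Icc.mp hm
  rw [coeff_mul_X_zero_pow (hc m hm), if_neg]
  simp; omega

theorem coeff_hS_of_le (d : MonomialDatum k p O) (hc : ∀ l ∈ Finset.Icc 1 d.q, d.coef l ∈ zFree k)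
    {s : Fin 3 →₀ ℕ} (hs : d.q ≤ s 0) (hne : s ≠ Finsupp.single 0 d.q) : coeff s d.hS = 0 := by
  classical
  rw [hS, map_add, coeff_X_pow, if_neg hne, zero_add, tail, map_sum, Finset.sum_eq_zero]
  intro m hm
  have hm' := Finset.mem_Icc.mp hm
  rw [coeff_mul_X_zero_pow (hc m hm), if_neg]
  omega

/-- The part of the monomial case that is preserved by blow-ups and by arbitrary changes of `z`:
no condition is imposed on the initial form of `h`, and the divisibility of constant terms is
expressed through congruences modulo `h`. -/
structure IsPreCase [IsLocalRing O] (d : MonomialDatum k p O) (R : ℕ → Ideal O)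
    (E : Set (Ideal O)) : Prop where
  z_notMem : (0 : Fin 3) ∉ d.young
  boundary : E = {D | ∃ i ∈ d.young, D = Ideal.span {d.x i}}
  coef_xy : ∀ l ∈ Finset.Icc 1 d.q, d.coef l ∈ zFree k
  h_mem : d.h ∈ R d.q
  h_order : d.h ∈ maximalIdeal O ^ d.q
  a_pos : 0 < d.a
  monomial_mem : d.M ∈ R d.a
  control : ∀ l, ∀ f ∈ R l, ∃ c, d.h ∣ f - c ∧
    ∀ i ∈ d.young, d.x i ^ ⌈(d.m i * l : ℚ) / d.a⌉₊ ∣ c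
  deriv_mem : ∀ l, ∀ f ∈ R l, ∀ n, d.X (hasseZ n (d.X.symm f)) ∈ R (l - n)

theorem x_pow_dvd_X {d : MonomialDatum k p O} {i : Fin 3} {n : ℕ} {f : MvPowerSeries (Fin 3) k} :
    d.x i ^ n ∣ d.X f ↔ MvPowerSeries.X i ^ n ∣ f := by
  rw [x, ← map_pow]; exact map_dvd_iff d.X

theorem coef_order_of_hS {d : MonomialDatum k p O}
    (hc : ∀ l ∈ Finset.Icc 1 d.q, d.coef l ∈ zFree k)
    (hh : d.hS ∈ maximalIdeal (MvPowerSeries (Fin 3) k) ^ d.q) {l : ℕ}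
    (hl : l ∈ Finset.Icc 1 d.q) : d.coef l ∈ maximalIdeal (MvPowerSeries (Fin 3) k) ^ l := by
  refine mem_pow_of_order fun s hs => ?_
  by_contra hne
  have hs0 := hc l hl s hne
  have hl' := Finset.mem_Icc.mp hl
  have e := coeff_hS d hc hl (s := s + Finsupp.single 0 (d.q - l)) (by simp [hs0])
  have e2 : (s + Finsupp.single 0 (d.q - l)).erase 0 = s := by
    rw [Finsupp.erase_add, Finsupp.erase_single, add_zero, erase_zero_of_zero hs0]
  rw [e2, mem_pow_iff.mp hh] at e
  · exact hne e.symm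
  · rw [map_add, Finsupp.degree_single]; omega

theorem tail_ordGE {d : MonomialDatum k p O}
    (hc : ∀ l ∈ Finset.Icc 1 d.q, d.coef l ∈ zFree k)
    (hh : d.hS ∈ maximalIdeal (MvPowerSeries (Fin 3) k) ^ d.q) :
    OrdGE (distWeight d.q) (d.q + 1) d.tail := by
  refine OrdGE.sum fun l hl => ?_
  have hl' := Finset.mem_Icc.mp hl
  have h1 : OrdGE (distWeight d.q) (d.q + 1) (d.coef l) := by
    intro s hs
    have hs0 := hc l hl s hs
    have hsne : s ≠ 0 := by
      rintro rfl
      exact hs (mem_pow_iff.mp (coef_order_of_hS hc hh hl) 0 (by simp; omega))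
    obtain ⟨i, hi⟩ := Finsupp.ne_iff.mp hsne
    have hi0 : i ≠ 0 := by rintro rfl; exact hi hs0
    have h2 : distWeight d.q i * s i ≤ Finsupp.weight (distWeight d.q) s := by
      rw [mul_comm]
      rw [Finsupp.weight_apply, Finsupp.sum]
      exact (Finset.single_le_sum (f := fun j => s j • distWeight d.q j)
        (fun _ _ => Nat.zero_le _) (Finsupp.mem_support_iff.mpr hi)).trans' (by simp)
    have h3 : distWeight d.q i = d.q + 1 := if_neg hi0
    have h4 : 1 ≤ s i := Nat.one_le_iff_ne_zero.mpr hi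
    rw [h3] at h2
    have : d.q + 1 ≤ Finsupp.weight (distWeight d.q) s := by nlinarith
    exact_mod_cast this
  exact h1.mul_right

/-- If `f` has `z`-degree `< q` and is congruent modulo `h` to a multiple of `x_i ^ n`, it is itself
a multiple of `x_i ^ n`. -/
theorem X_pow_dvd_of_congr {q : ℕ} {A : MvPowerSeries (Fin 3) k}
    (hA : OrdGE (distWeight q) (q + 1) A) {i : Fin 3} (hi : i ≠ 0) {n : ℕ}
    {f c : MvPowerSeries (Fin 3) k} (hf : ∀ s, coeff s f ≠ 0 → s 0 < q)
    (hfc : MvPowerSeries.X 0 ^ q + A ∣ f - c) (hc : MvPowerSeries.X i ^ n ∣ c) : MvPowerSeries.X i ^ n ∣ f := by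
  obtain ⟨w, rfl⟩ := hc
  obtain ⟨g, r, rfl, hr⟩ := exists_weierstrass_div hA w
  have hz : f - MvPowerSeries.X i ^ n * r = 0 := by
    apply eq_zero_of_dvd_of_deg hA
    · intro s hs
      by_cases h : coeff s f = 0
      · classical
        have h2 : coeff s (MvPowerSeries.X i ^ n * r) ≠ 0 := fun h' => hs (by rw [map_sub, h, h', sub_zero])
        rw [X_pow_eq, coeff_monomial_mul, one_mul] at h2
        split_ifs at h2 with h3
        · have := hr _ h2
          simpa [Finsupp.single_eq_of_ne (Ne.symm hi)] using this
        · exact absurd rfl h2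
      · exact hf s h
    · have e : f - MvPowerSeries.X i ^ n * r =
          f - MvPowerSeries.X i ^ n * (g * (MvPowerSeries.X 0 ^ q + A) + r) + (MvPowerSeries.X 0 ^ q + A) * (MvPowerSeries.X i ^ n * g) := by ring
      rw [e]
      exact dvd_add hfc (dvd_mul_right _ _)
  exact ⟨r, sub_eq_zero.mp hz⟩

namespace IsPreCase

variable [IsLocalRing O] {d : MonomialDatum k p O} {R : ℕ → Ideal O} {E : Set (Ideal O)}

theorem hS_mem (hd : d.IsPreCase R E) : d.hS ∈ maximalIdeal (MvPowerSeries (Fin 3) k) ^ d.q := by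
  rw [← map_mem_maximalIdeal_pow d.X, X_hS]; exact hd.h_order

theorem coef_mem (hd : d.IsPreCase R E) {l : ℕ} (hl : l ∈ Finset.Icc 1 d.q) :
    d.coef l ∈ maximalIdeal (MvPowerSeries (Fin 3) k) ^ l := coef_order_of_hS hd.coef_xy hd.hS_mem hl

theorem tail_ord (hd : d.IsPreCase R E) : OrdGE (distWeight d.q) (d.q + 1) d.tail :=
  tail_ordGE hd.coef_xy hd.hS_mem

theorem ne_zero (hd : d.IsPreCase R E) {i : Fin 3} (hi : i ∈ d.young) : i ≠ 0 :=
  fun h => hd.z_notMem (h ▸ hi)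

theorem X_pow_dvd (hd : d.IsPreCase R E) {l : ℕ} {f : MvPowerSeries (Fin 3) k}
    {c : O} (hf : ∀ s, coeff s f ≠ 0 → s 0 < d.q) (hfc : d.h ∣ d.X f - c) {i : Fin 3}
    (hi : i ∈ d.young) (hc : d.x i ^ l ∣ c) : MvPowerSeries.X i ^ l ∣ f := by
  have e : c = d.X (d.X.symm c) := (d.X.apply_symm_apply c).symm
  rw [e, x_pow_dvd_X] at hc
  rw [e, ← map_sub, ← X_hS] at hfc
  exact X_pow_dvd_of_congr hd.tail_ord (hd.ne_zero hi) hf ((map_dvd_iff d.X).mp hfc) hc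

/-- The coefficients `a_l`, `l < q`, have at least the order `μ l` along the boundary. -/
theorem coef_dvd (hd : d.IsPreCase R E) {l : ℕ} (hl0 : 0 < l) (hl : l < d.q) {i : Fin 3}
    (hi : i ∈ d.young) : MvPowerSeries.X i ^ ⌈(d.m i * l : ℚ) / d.a⌉₊ ∣ d.coef l := by
  have hlI : l ∈ Finset.Icc 1 d.q := Finset.mem_Icc.mpr ⟨hl0, hl.le⟩
  have h1 := hd.deriv_mem d.q d.h hd.h_mem (d.q - l)
  rw [← X_hS, AlgEquiv.symm_apply_apply, hasseZ_eq, Nat.sub_sub_self hl.le] at h1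
  obtain ⟨c, hc1, hc2⟩ := hd.control l _ h1
  have h2 : MvPowerSeries.X i ^ ⌈(d.m i * l : ℚ) / d.a⌉₊ ∣ hasse 0 (d.q - l) d.hS := by
    refine hd.X_pow_dvd (fun s hs => ?_) hc1 hi (hc2 i hi)
    rw [coeff_hasse] at hs
    by_contra! hle
    by_cases hne : s + Finsupp.single 0 (d.q - l) = Finsupp.single 0 d.q
    · have := DFunLike.congr_fun hne 0
      simp at this
      omega
    · exact right_ne_zero_of_mul hs
        (coeff_hS_of_le d hd.coef_xy (by simp; omega) hne)
  rw [X_pow_dvd_iff] at h2 ⊢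
  intro s hs
  by_cases hs0 : s 0 = 0
  · have h3 := h2 s hs
    have e := coeff_hS d hd.coef_xy hlI (s := s + Finsupp.single 0 (d.q - l)) (by simp [hs0])
    rw [coeff_hasse, e, Finsupp.erase_add, Finsupp.erase_single, add_zero,
      erase_zero_of_zero hs0, hs0] at h3
    simpa using h3
  · by_contra h
    exact hs0 (hd.coef_xy l hlI s h)

theorem coef_ordGE (hd : d.IsPreCase R E) {l : ℕ} (hl0 : 0 < l) (hl : l < d.q) {i : Fin 3}
    (hi : i ∈ d.young) : OrdGE (Pi.single i 1) (d.mu i * l) (d.coef l) := by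
  refine (X_pow_dvd_iff_ordGE.mp (hd.coef_dvd hl0 hl hi)).mono ?_
  refine le_trans (le_of_eq ?_) (Nat.le_ceil _)
  rw [mu]; ring

/-- The divisibility of constant terms in the expansions with respect to `h`. -/
theorem dvd_constant_term (hd : d.IsPreCase R E) {l : ℕ} {f : O} (hf : f ∈ R l)
    {c : ℕ → O} (hc : d.IsExpansion f c) {i : Fin 3} (hi : i ∈ d.young) :
    d.x i ^ ⌈(d.m i * l : ℚ) / d.a⌉₊ ∣ c 0 := by
  obtain ⟨c', h1, h2⟩ := hd.control l f hf
  have h3 := hc.2 1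
  rw [pow_one, Finset.sum_range_one, pow_zero, mul_one] at h3
  have e : c 0 = d.X (d.X.symm (c 0)) := (d.X.apply_symm_apply _).symm
  rw [e, x_pow_dvd_X]
  refine hd.X_pow_dvd (hc.1 0) (c := c') ?_ hi (h2 i hi)
  rw [← e]
  have : c 0 - c' = (f - c') - (f - c 0) := by ring
  rw [this]
  exact dvd_sub h1 h3

end IsPreCase

/-- Repeated division by `h` gives the expansion of `f` in powers of `h`. -/
theorem exists_expansion {d : MonomialDatum k p O}
    (hA : OrdGE (distWeight d.q) (d.q + 1) d.tail) (f : O) : ∃ c, d.IsExpansion f c := by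
  choose g r hgr hr using exists_weierstrass_div hA
  let F : ℕ → MvPowerSeries (Fin 3) k := fun n => g^[n] (d.X.symm f)
  refine ⟨fun b => d.X (r (F b)), fun b s hs => ?_, fun N => ⟨d.X (F N), ?_⟩⟩
  · rw [AlgEquiv.symm_apply_apply] at hs
    exact hr _ s hs
  · induction N with
    | zero => simp [F]
    | succ N ih =>
      have e1 : F N = F (N + 1) * d.hS + r (F N) := by
        have e2 : F (N + 1) = g (F N) := Function.iterate_succ_apply' _ _ _
        rw [e2, hS]; exact hgr (F N)
      have e3 := congrArg d.X e1
      rw [map_add, map_mul, X_hS] at e3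
      rw [Finset.sum_range_succ, ← sub_sub, ih, e3]
      ring

theorem IsMonomialCase.isPreCase [IsLocalRing O] {d : MonomialDatum k p O} {R : ℕ → Ideal O}
    {E : Set (Ideal O)} (hd : d.IsMonomialCase R E) : d.IsPreCase R E := by
  have hord : d.h ∈ maximalIdeal O ^ d.q := by
    have h1 : d.x 0 ^ d.q ∈ maximalIdeal O ^ d.q :=
      Ideal.pow_mem_pow ((map_mem_maximalIdeal d.X).mpr (constantCoeff_X 0)) _
    have := Ideal.add_mem _ (Ideal.pow_le_pow_right (Nat.le_succ _) hd.lgs_initial) h1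
    rwa [sub_add_cancel] at this
  have hS : d.hS ∈ maximalIdeal (MvPowerSeries (Fin 3) k) ^ d.q := by
    rw [← map_mem_maximalIdeal_pow d.X, X_hS]; exact hord
  have hA := tail_ordGE (d := d) hd.coef_xy hS
  refine ⟨hd.z_notMem, hd.boundary, hd.coef_xy, hd.lgs.1, hord, hd.a_pos, hd.monomial_mem, ?_,
    hd.deriv_mem⟩
  intro l f hf
  obtain ⟨c, hc⟩ := exists_expansion hA f
  refine ⟨c 0, ?_, fun i hi => hd.control l f hf c hc i hi⟩
  have h3 := hc.2 1
  rwa [pow_one, Finset.sum_range_one, pow_zero, mul_one] at h3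

end MonomialDatum

end Idealistic

namespace Idealistic

open MvPowerSeries IsLocalRing

/-! ### Changes of the coordinate `z` -/

section ShiftHom

variable {k : Type*} [Field k]

theorem hasse_zero_of_zFree {c : MvPowerSeries (Fin 3) k} (hc : c ∈ zFree k) {n : ℕ} (hn : 0 < n) :
    hasse 0 n c = 0 := by
  ext s
  rw [coeff_hasse, coeff_zero]
  by_contra h
  have := hc _ (right_ne_zero_of_mul h)
  simp at this
  omega

theorem hasse_mul_zFree (F : MvPowerSeries (Fin 3) k) {c : MvPowerSeries (Fin 3) k}
    (hc : c ∈ zFree k) (n : ℕ) : hasse 0 n (F * c) = hasse 0 n F * c := by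
  rw [hasse_mul, Finset.sum_eq_single (n, 0), hasse_zero]
  · intro b hb hne
    rw [Finset.HasAntidiagonal.mem_antidiagonal] at hb
    rw [hasse_zero_of_zFree hc, mul_zero]
    by_contra h
    apply hne
    ext <;> simp <;> omega
  · intro h
    exact absurd (Finset.HasAntidiagonal.mem_antidiagonal.mpr (add_zero n)) h

theorem hasse_linear_pow {α β : MvPowerSeries (Fin 3) k} (hα : α ∈ zFree k) (hβ : β ∈ zFree k)
    (n a : ℕ) : hasse 0 n ((α * X 0 + β) ^ a) =
      (a.choose n : k) • (α ^ n * (α * X 0 + β) ^ (a - n)) := by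
  classical
  have hX1 : hasse 0 1 (X 0 : MvPowerSeries (Fin 3) k) = 1 := by
    rw [X, hasse_monomial]; simp
  have hXn : ∀ n, 2 ≤ n → hasse 0 n (X 0 : MvPowerSeries (Fin 3) k) = 0 := by
    intro n hn
    rw [X, hasse_monomial, Finsupp.single_eq_same, Nat.choose_eq_zero_of_lt (by omega)]
    simp
  have hG1 : hasse 0 1 (α * X 0 + β) = α := by
    rw [map_add, mul_comm α, hasse_mul_zFree _ hα, hX1, hasse_zero_of_zFree hβ one_pos, one_mul,
      add_zero]
  have hGn : ∀ n, 2 ≤ n → hasse 0 n (α * X 0 + β) = 0 := by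
    intro n hn
    rw [map_add, mul_comm α, hasse_mul_zFree _ hα, hXn n hn, hasse_zero_of_zFree hβ (by omega),
      zero_mul, add_zero]
  induction a generalizing n with
  | zero =>
    rcases Nat.eq_zero_or_pos n with rfl | hn
    · simp [hasse_zero]
    · rw [pow_zero, hasse_zero_of_zFree (one_mem _) hn, Nat.choose_eq_zero_of_lt hn]; simp
  | succ a ih =>
    rcases n with _ | n
    · simp [hasse_zero]
    · have hl : hasse 0 (n + 1) ((α * X 0 + β) ^ a * (α * X 0 + β)) =
          hasse 0 (n + 1) ((α * X 0 + β) ^ a) * (α * X 0 + β) +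
            hasse 0 n ((α * X 0 + β) ^ a) * α := by
        have hsub : ({(n + 1, 0), (n, 1)} : Finset (ℕ × ℕ)) ⊆
            Finset.HasAntidiagonal.antidiagonal (n + 1) := by
          intro b hb
          rw [Finset.HasAntidiagonal.mem_antidiagonal]
          rcases Finset.mem_insert.mp hb with rfl | hb
          · rfl
          · rw [Finset.mem_singleton.mp hb]
        rw [hasse_mul, ← Finset.sum_subset hsub, Finset.sum_pair (by simp), hasse_zero, hG1]
        intro b hb hb2
        rw [Finset.HasAntidiagonal.mem_antidiagonal] at hb
        rw [hGn, mul_zero]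
        by_contra hlt
        apply hb2
        have : b.2 = 0 ∨ b.2 = 1 := by omega
        rcases this with h | h
        · have : b = (n + 1, 0) := by ext <;> simp <;> omega
          simp [this]
        · have : b = (n, 1) := by ext <;> simp <;> omega
          simp [this]
      rw [pow_succ, hl, ih, ih, Nat.choose_succ_succ, Nat.add_sub_add_right, Nat.cast_add, add_smul,
        add_comm]
      congr 1
      · rw [smul_mul_assoc, pow_succ]; congr 1; ring
      · rcases Nat.lt_or_ge a (n + 1) with h | h
        · rw [Nat.choose_eq_zero_of_lt h]; simp
        · rw [smul_mul_assoc, mul_assoc, ← pow_succ, show a - (n + 1) + 1 = a - n by omega]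

/-- The `z`-derivatives commute with substitutions that are affine in `z`, up to a power of the
coefficient of `z`. -/
theorem hasse_affine (Θ : MvPowerSeries (Fin 3) k →ₐ[k] MvPowerSeries (Fin 3) k)
    {α β : MvPowerSeries (Fin 3) k} (hα : α ∈ zFree k) (hβ : β ∈ zFree k)
    (h0 : Θ (X 0) = α * X 0 + β) (hi : ∀ i, i ≠ 0 → Θ (X i) ∈ zFree k) (n : ℕ)
    (f : MvPowerSeries (Fin 3) k) : hasse 0 n (Θ f) = α ^ n * Θ (hasse 0 n f) := by
  classical
  rw [← sub_eq_zero]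
  let L : MvPowerSeries (Fin 3) k →ₗ[k] MvPowerSeries (Fin 3) k :=
    hasse 0 n ∘ₗ Θ.toLinearMap - LinearMap.mulLeft k (α ^ n) ∘ₗ Θ.toLinearMap ∘ₗ hasse 0 n
  change L f = 0
  refine linearMap_eq_zero L (fun N => ⟨N + n, fun f hf t ht => ?_⟩) f fun s _ => ?_
  · change coeff t (hasse 0 n (Θ f) - α ^ n * Θ (hasse 0 n f)) = 0
    rw [map_sub, hasse_order 0 n N _ (mem_pow_iff.mp (algHom_mem_pow Θ (mem_pow_of_order hf))) t ht,
      zero_sub, neg_eq_zero]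
    exact mem_pow_iff.mp (Ideal.mul_mem_left _ _
      (algHom_mem_pow Θ (mem_pow_of_order (hasse_order 0 n N f hf)))) t ht
  · change hasse 0 n (Θ (monomial s 1)) - α ^ n * Θ (hasse 0 n (monomial s 1)) = 0
    have hΘ : ∀ s : Fin 3 →₀ ℕ, Θ (monomial s 1) =
        (α * X 0 + β) ^ s 0 * (Θ (X 1) ^ s 1 * Θ (X 2) ^ s 2) := by
      intro s
      rw [algHom_monomial, Finsupp.prod_fintype _ _ (fun i => pow_zero _), Fin.prod_univ_three, h0,
        mul_assoc]
    have hc : ∀ s : Fin 3 →₀ ℕ, Θ (X 1) ^ s 1 * Θ (X 2) ^ s 2 ∈ zFree k := fun s =>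
      mul_mem (pow_mem (hi 1 (by decide)) _) (pow_mem (hi 2 (by decide)) _)
    rw [hasse_monomial, hΘ, hasse_mul_zFree _ (hc s), hasse_linear_pow hα hβ, map_smul, hΘ,
      smul_mul_assoc, mul_smul_comm, ← smul_sub]
    have e0 : (s - Finsupp.single 0 n : Fin 3 →₀ ℕ) 0 = s 0 - n := by simp
    have e1 : (s - Finsupp.single 0 n : Fin 3 →₀ ℕ) 1 = s 1 := by simp
    have e2 : (s - Finsupp.single 0 n : Fin 3 →₀ ℕ) 2 = s 2 := by simp
    rw [e0, e1, e2, ← mul_assoc (α ^ n), sub_self, smul_zero]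

/-- The homomorphism `z ↦ z + b`, fixing the other variables. -/
noncomputable def shiftHom (b : MvPowerSeries (Fin 3) k) (hb : constantCoeff b = 0) :
    MvPowerSeries (Fin 3) k →ₐ[k] MvPowerSeries (Fin 3) k :=
  substAlgHom (a := fun i : Fin 3 => if i = 0 then X 0 + b else X i)
    (hasSubst_of_constantCoeff_zero fun i => by split_ifs <;> simp [hb])

theorem shiftHom_X_zero (b : MvPowerSeries (Fin 3) k) (hb : constantCoeff b = 0) :
    shiftHom b hb (X 0) = X 0 + b := by
  rw [shiftHom, substAlgHom_X, if_pos rfl]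

theorem shiftHom_X (b : MvPowerSeries (Fin 3) k) (hb : constantCoeff b = 0) {i : Fin 3}
    (hi : i ≠ 0) : shiftHom b hb (X i) = X i := by
  rw [shiftHom, substAlgHom_X, if_neg hi]

theorem shiftHom_zFree (b : MvPowerSeries (Fin 3) k) (hb : constantCoeff b = 0)
    {f : MvPowerSeries (Fin 3) k} (hf : f ∈ zFree k) : shiftHom b hb f = f :=
  algHom_congr (ψ := AlgHom.id k _) fun i ⟨s, hs1, hs2⟩ => by
    rw [shiftHom_X, AlgHom.id_apply]
    rintro rfl
    exact hs2 (hf s hs1)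

theorem shiftHom_comp (b : MvPowerSeries (Fin 3) k) (hb : constantCoeff b = 0) (hz : b ∈ zFree k)
    (hb' : constantCoeff (-b) = 0) :
    (shiftHom b hb).comp (shiftHom (-b) hb') = AlgHom.id k _ := by
  refine algHom_ext' fun i => ?_
  rw [AlgHom.comp_apply, AlgHom.id_apply]
  by_cases hi : i = 0
  · subst hi
    rw [shiftHom_X_zero, map_add, shiftHom_X_zero, map_neg, shiftHom_zFree _ _ hz]
    ring
  · rw [shiftHom_X _ _ hi, shiftHom_X _ _ hi]

/-- The automorphism `z ↦ z + b` for a series `b` in the other variables. -/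
noncomputable def shiftEquiv (b : MvPowerSeries (Fin 3) k) (hb : constantCoeff b = 0)
    (hz : b ∈ zFree k) : MvPowerSeries (Fin 3) k ≃ₐ[k] MvPowerSeries (Fin 3) k :=
  AlgEquiv.ofAlgHom (shiftHom b hb) (shiftHom (-b) (by simp [hb])) (shiftHom_comp b hb hz _)
    (by
      have := shiftHom_comp (-b) (by simp [hb]) (neg_mem hz) (by simp [hb])
      simpa using this)

theorem shiftEquiv_apply (b : MvPowerSeries (Fin 3) k) (hb : constantCoeff b = 0)
    (hz : b ∈ zFree k) (f : MvPowerSeries (Fin 3) k) : shiftEquiv b hb hz f = shiftHom b hb f := rfl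

end ShiftHom

namespace MonomialDatum

variable {k : Type*} {p : ℕ} {O : Type*} [Field k] [CommRing O] [Algebra k O]

/-- `h` as a polynomial in `z`. -/
noncomputable def poly (d : MonomialDatum k p O) : Polynomial (MvPowerSeries (Fin 3) k) :=
  Polynomial.X ^ d.q + ∑ l ∈ Finset.Icc 1 d.q, Polynomial.C (d.coef l) * Polynomial.X ^ (d.q - l)

theorem poly_eval (d : MonomialDatum k p O) (g : MvPowerSeries (Fin 3) k) :
    d.poly.eval g = g ^ d.q + ∑ l ∈ Finset.Icc 1 d.q, d.coef l * g ^ (d.q - l) := by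
  simp [poly, Polynomial.eval_finsetSum]

theorem poly_degree (d : MonomialDatum k p O) : d.poly.Monic ∧ d.poly.natDegree = d.q := by
  have h : (∑ l ∈ Finset.Icc 1 d.q, Polynomial.C (d.coef l) *
      Polynomial.X ^ (d.q - l)).degree < (d.q : WithBot ℕ) := by
    refine (Polynomial.degree_sum_le _ _).trans_lt ?_
    rw [Finset.sup_lt_iff (WithBot.bot_lt_coe _)]
    intro l hl
    have := Finset.mem_Icc.mp hl
    refine (Polynomial.degree_C_mul_X_pow_le _ _).trans_lt ?_
    exact_mod_cast (by omega : d.q - l < d.q)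
  refine ⟨Polynomial.monic_X_pow_add h, ?_⟩
  rw [poly, Polynomial.natDegree_add_eq_left_of_degree_lt, Polynomial.natDegree_X_pow]
  rwa [Polynomial.degree_X_pow]

theorem poly_coeff_mem (d : MonomialDatum k p O)
    (hc : ∀ l ∈ Finset.Icc 1 d.q, d.coef l ∈ zFree k) (n : ℕ) : d.poly.coeff n ∈ zFree k := by
  rw [poly, Polynomial.coeff_add, Polynomial.finsetSum_coeff, Polynomial.coeff_X_pow]
  refine add_mem ?_ (sum_mem fun l hl => ?_)
  · split_ifs
    · exact one_mem _
    · exact zero_mem _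
  · rw [Polynomial.coeff_C_mul, Polynomial.coeff_X_pow]
    split_ifs
    · simpa using hc l hl
    · simp

/-- The change of coordinates `z ↦ z + b`; the element `h` stays the same. -/
noncomputable def shift (d : MonomialDatum k p O) (b : MvPowerSeries (Fin 3) k)
    (hb : constantCoeff b = 0) (hz : b ∈ zFree k) : MonomialDatum k p O :=
  { d with
    X := (shiftEquiv b hb hz).trans d.X
    coef := fun l => (Polynomial.taylor (-b) d.poly).coeff (d.q - l) }

variable {d : MonomialDatum k p O} {b : MvPowerSeries (Fin 3) k} {hb : constantCoeff b = 0}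
  {hz : b ∈ zFree k}

theorem shift_x {i : Fin 3} (hi : i ≠ 0) : (d.shift b hb hz).x i = d.x i := by
  change d.X (shiftHom b hb (MvPowerSeries.X i)) = _
  rw [shiftHom_X _ _ hi]; rfl

theorem shift_hS : shiftHom b hb (d.shift b hb hz).hS =
    d.poly.eval (MvPowerSeries.X 0) + ∑ l ∈ Finset.Icc 1 d.q,
      (shiftHom b hb ((d.shift b hb hz).coef l) - (d.shift b hb hz).coef l) *
        (MvPowerSeries.X 0 + b) ^ (d.q - l) := by
  have hdeg : (Polynomial.taylor (-b) d.poly).natDegree = d.q := by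
    rw [Polynomial.natDegree_taylor, (poly_degree d).2]
  have hlead : (Polynomial.taylor (-b) d.poly).coeff d.q = 1 := by
    rw [← (poly_degree d).2, Polynomial.coeff_taylor_natDegree]
    exact (poly_degree d).1
  have e1 : d.poly.eval (MvPowerSeries.X 0) =
      (Polynomial.taylor (-b) d.poly).eval (MvPowerSeries.X 0 + b) := by
    rw [Polynomial.taylor_eval]; simp
  have e2 : (Polynomial.taylor (-b) d.poly).eval (MvPowerSeries.X 0 + b) =
      (MvPowerSeries.X 0 + b) ^ d.q + ∑ l ∈ Finset.Icc 1 d.q,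
        (d.shift b hb hz).coef l * (MvPowerSeries.X 0 + b) ^ (d.q - l) := by
    rw [Polynomial.eval_eq_sum_range, hdeg, Finset.sum_range_succ, hlead, one_mul, add_comm]
    congr 1
    refine Finset.sum_nbij' (fun i => d.q - i) (fun l => d.q - l) ?_ ?_ ?_ ?_ ?_
    · intro i hi; have := Finset.mem_range.mp hi; exact Finset.mem_Icc.mpr ⟨by omega, by omega⟩
    · intro l hl; have := Finset.mem_Icc.mp hl; exact Finset.mem_range.mpr (by omega)
    · intro i hi; have := Finset.mem_range.mp hi; exact Nat.sub_sub_self this.le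
    · intro l hl; have := Finset.mem_Icc.mp hl; exact Nat.sub_sub_self this.2
    · intro i hi
      have := Finset.mem_range.mp hi
      change _ = (Polynomial.taylor (-b) d.poly).coeff (d.q - (d.q - i)) * _
      rw [Nat.sub_sub_self this.le]
  have e3 : shiftHom b hb (d.shift b hb hz).hS = (MvPowerSeries.X 0 + b) ^ d.q +
      ∑ l ∈ Finset.Icc 1 d.q, shiftHom b hb ((d.shift b hb hz).coef l) *
        (MvPowerSeries.X 0 + b) ^ (d.q - l) := by
    rw [hS, tail, map_add, map_pow, shiftHom_X_zero, map_sum]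
    congr 1
    refine Finset.sum_congr rfl fun l _ => ?_
    rw [map_mul, map_pow, shiftHom_X_zero]; rfl
  rw [e3, e1, e2, add_assoc, ← Finset.sum_add_distrib]
  congr 1
  refine Finset.sum_congr rfl fun l _ => ?_
  ring

theorem shift_coef_mem (hc : ∀ l ∈ Finset.Icc 1 d.q, d.coef l ∈ zFree k) (l : ℕ) :
    (d.shift b hb hz).coef l ∈ zFree k := by
  change (Polynomial.taylor (-b) d.poly).coeff (d.q - l) ∈ _
  rw [Polynomial.taylor_coeff, Polynomial.eval_eq_sum_range]
  refine sum_mem fun i _ => mul_mem ?_ (pow_mem (neg_mem hz) _)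
  rw [Polynomial.hasseDeriv_coeff]
  exact mul_mem (natCast_mem _ _) (poly_coeff_mem d hc _)

theorem shift_h (hc : ∀ l ∈ Finset.Icc 1 d.q, d.coef l ∈ zFree k) :
    (d.shift b hb hz).h = d.h := by
  rw [← X_hS, ← X_hS]
  change d.X (shiftHom b hb (d.shift b hb hz).hS) = _
  rw [shift_hS, Finset.sum_eq_zero, add_zero, poly_eval]
  · rfl
  · intro l _
    rw [shiftHom_zFree _ _ (shift_coef_mem hc l), sub_self, zero_mul]

theorem shift_lastCoef (hq : 0 < d.q) : (d.shift b hb hz).lastCoef =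
    (-b) ^ d.q + d.lastCoef + ∑ l ∈ Finset.Ico 1 d.q, d.coef l * (-b) ^ (d.q - l) := by
  change (Polynomial.taylor (-b) d.poly).coeff (d.q - d.q) = _
  rw [Nat.sub_self, Polynomial.taylor_coeff_zero, poly_eval, lastCoef,
    ← Finset.Ico_insert_right (Nat.one_le_iff_ne_zero.mpr hq.ne'), Finset.sum_insert (by simp)]
  simp [add_assoc]

/-- The weak form of the monomial case does not depend on the choice of `z`: `h` and the boundary are
kept, and so is the derivation `∂ / ∂z`, as `b` does not involve `z`. -/
theorem IsPreCase.shift [IsLocalRing O] {R : ℕ → Ideal O} {E : Set (Ideal O)}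
    (hd : d.IsPreCase R E) : (d.shift b hb hz).IsPreCase R E := by
  have hx : ∀ i ∈ d.young, (d.shift b hb hz).x i = d.x i := fun i hi => shift_x (hd.ne_zero hi)
  refine ⟨hd.z_notMem, ?_, fun l _ => shift_coef_mem hd.coef_xy l, ?_, ?_, hd.a_pos, ?_, ?_, ?_⟩
  · rw [hd.boundary]
    ext D
    constructor
    · rintro ⟨i, hi, rfl⟩; exact ⟨i, hi, by rw [hx i hi]⟩
    · rintro ⟨i, hi, rfl⟩; exact ⟨i, hi, by rw [hx i hi]⟩
  · rw [shift_h hd.coef_xy]; exact hd.h_mem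
  · rw [shift_h hd.coef_xy]; exact hd.h_order
  · have : (d.shift b hb hz).M = d.M := Finset.prod_congr rfl fun i hi => by
      rw [hx i hi]; rfl
    rw [this]; exact hd.monomial_mem
  · intro l f hf
    obtain ⟨c, h1, h2⟩ := hd.control l f hf
    refine ⟨c, by rwa [shift_h hd.coef_xy], fun i hi => ?_⟩
    rw [hx i hi]; exact h2 i hi
  · intro l f hf n
    have h1 := hd.deriv_mem l f hf n
    have e : (d.shift b hb hz).X (hasseZ n ((d.shift b hb hz).X.symm f)) =
        d.X (hasseZ n (d.X.symm f)) := by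
      change d.X (shiftEquiv b hb hz (hasseZ n ((shiftEquiv b hb hz).symm (d.X.symm f)))) = _
      congr 1
      obtain ⟨g, hg⟩ := (shiftEquiv b hb hz).surjective (d.X.symm f)
      rw [← hg, AlgEquiv.symm_apply_apply, hasseZ_eq, hasseZ_eq, shiftEquiv_apply, shiftEquiv_apply,
        hasse_affine (shiftHom b hb) (α := 1) (β := b) (one_mem _) hz
          (by rw [shiftHom_X_zero, one_mul])
          (fun i hi => by rw [shiftHom_X _ _ hi]; exact X_mem_zFree hi), one_pow, one_mul]
    rwa [e]

end MonomialDatum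

end Idealistic

namespace Idealistic

open MvPowerSeries IsLocalRing

/-! ### `q`-th roots and adapted series -/

section Roots

variable {σ k : Type*} [Field k] {p : ℕ} [hp : Fact p.Prime] [CharP k p] {e : ℕ}

theorem coeff_smul_pow (b : MvPowerSeries σ k) (s : σ →₀ ℕ) :
    coeff (p ^ e • s) (b ^ p ^ e) = coeff s b ^ p ^ e := by
  rw [← map_iterateFrobenius_expand p hp.out.ne_zero b e, coeff_map, coeff_expand_smul,
    iterateFrobenius_def]

theorem coeff_pow_of_not_dvd (b : MvPowerSeries σ k) {s : σ →₀ ℕ} (hs : ¬ ∀ i, p ^ e ∣ s i) :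
    coeff s (b ^ p ^ e) = 0 := by
  push Not at hs
  obtain ⟨i, hi⟩ := hs
  rw [← map_iterateFrobenius_expand p hp.out.ne_zero b e, coeff_map,
    coeff_expand_of_not_dvd _ _ _ hi, map_zero]

theorem exists_smul_eq [Finite σ] {n : ℕ} {s : σ →₀ ℕ} (hs : ∀ i, n ∣ s i) : ∃ t : σ →₀ ℕ, s = n • t := by
  choose t ht using hs
  exact ⟨Finsupp.equivFunOnFinite.symm t, by ext i; simp [ht]⟩

variable [IsAlgClosed k]

/-- The root of the part of `f` consisting of the terms that are `n`-th powers, when `n` is a power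
of the characteristic. -/
noncomputable def qroot (n : ℕ) (f : MvPowerSeries σ k) : MvPowerSeries σ k := fun s =>
  open Classical in if h : 0 < n then (IsAlgClosed.exists_pow_nat_eq (coeff (n • s) f) h).choose
  else 0

theorem coeff_qroot_pow {n : ℕ} (hn : 0 < n) (f : MvPowerSeries σ k) (s : σ →₀ ℕ) :
    coeff s (qroot n f) ^ n = coeff (n • s) f := by
  change (if h : 0 < n then (IsAlgClosed.exists_pow_nat_eq (coeff (n • s) f) h).choose
    else 0) ^ n = _
  rw [dif_pos hn]
  exact (IsAlgClosed.exists_pow_nat_eq (coeff (n • s) f) hn).choose_spec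

theorem coeff_qroot_ne_zero {n : ℕ} (hn : 0 < n) {f : MvPowerSeries σ k} {s : σ →₀ ℕ}
    (h : coeff s (qroot n f) ≠ 0) : coeff (n • s) f ≠ 0 := by
  rw [← coeff_qroot_pow hn]; exact pow_ne_zero _ h

theorem coeff_qroot_pow_dvd [Finite σ] (f : MvPowerSeries σ k) {s : σ →₀ ℕ} (hs : ∀ i, p ^ e ∣ s i) :
    coeff s (qroot (p ^ e) f ^ p ^ e) = coeff s f := by
  obtain ⟨t, rfl⟩ := exists_smul_eq hs
  rw [coeff_smul_pow, coeff_qroot_pow (pow_pos hp.out.pos e)]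

theorem OrdGE.qroot {n : ℕ} (hn : 0 < n) {w : σ → ℕ} {c : ℚ} {f : MvPowerSeries σ k}
    (h : OrdGE w c f) : OrdGE w (c / n) (Idealistic.qroot n f) := by
  intro s hs
  have := h _ (coeff_qroot_ne_zero hn hs)
  rw [map_nsmul, smul_eq_mul] at this
  push_cast at this
  rw [div_le_iff₀ (by exact_mod_cast hn)]
  linarith

/-- A series is a `q`-th power iff all its terms are. -/
theorem exists_pow_eq_iff [Finite σ] {f : MvPowerSeries σ k} :
    (∃ g, g ^ p ^ e = f) ↔ ∀ s, coeff s f ≠ 0 → ∀ i, p ^ e ∣ s i := by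
  constructor
  · rintro ⟨g, rfl⟩ s hs
    by_contra h
    exact hs (coeff_pow_of_not_dvd g h)
  · intro h
    refine ⟨Idealistic.qroot (p ^ e) f, ?_⟩
    ext s
    by_cases hs : ∀ i, p ^ e ∣ s i
    · exact coeff_qroot_pow_dvd f hs
    · rw [coeff_pow_of_not_dvd _ hs]
      by_contra hne
      exact hs (h s (Ne.symm hne))

end Roots

section Adapted

variable {σ k : Type*} [Field k]

/-- The initial form of `f` for the weights `w` has order at least `c` or is not a `q`-th power. -/
def Adapted (w : σ → ℕ) (q : ℕ) (c : ℚ) (f : MvPowerSeries σ k) : Prop :=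
  OrdGE w c f ∨ ∃ s, coeff s f ≠ 0 ∧ (¬ ∀ i, q ∣ s i) ∧ (Finsupp.weight w s : ℚ) < c ∧
    OrdGE w (Finsupp.weight w s : ℕ) f

theorem slopeVal_le {n : ℕ∞} {q : ℕ} {c : ℚ} : slopeVal n q c ≤ c := by
  induction n using ENat.recTopCoe with
  | top => exact le_rfl
  | coe N => exact min_le_right _ _

variable {w : σ → ℕ} {f : MvPowerSeries σ k} {q : ℕ} {c : ℚ}

theorem weightedOrder_eq_of_ordGE {s : σ →₀ ℕ} (hs : coeff s f ≠ 0)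
    (h : OrdGE w (Finsupp.weight w s : ℕ) f) : f.weightedOrder w = (Finsupp.weight w s : ℕ) :=
  le_antisymm (weightedOrder_le w hs) (ordGE_nat_iff.mp h)

theorem slopeVal_eq_of_ordGE (hq : 0 < q) (h : OrdGE w (q * c) f) :
    slopeVal (f.weightedOrder w) q c = c := by
  rcases eq_or_ne (f.weightedOrder w) ⊤ with h0 | h0
  · rw [h0]; rfl
  · obtain ⟨s, hs, hs'⟩ := exists_coeff_ne_zero_and_weightedOrder w (ENat.natCast_toNat h0)
    rw [← hs']
    refine min_eq_right ?_
    rw [le_div_iff₀ (by exact_mod_cast hq), mul_comm]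
    exact h s hs

theorem slopeVal_eq_div (hq : 0 < q) {s : σ →₀ ℕ} (hs : coeff s f ≠ 0)
    (h : OrdGE w (Finsupp.weight w s : ℕ) f) (hlt : (Finsupp.weight w s : ℚ) < q * c) :
    slopeVal (f.weightedOrder w) q c = (Finsupp.weight w s : ℚ) / q := by
  rw [weightedOrder_eq_of_ordGE hs h]
  refine min_eq_left ?_
  rw [div_le_iff₀ (by exact_mod_cast hq), mul_comm]
  exact hlt.le

theorem ordGE_or_exists (w : σ → ℕ) (c : ℚ) (f : MvPowerSeries σ k) : OrdGE w c f ∨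
    ∃ s, coeff s f ≠ 0 ∧ (Finsupp.weight w s : ℚ) < c ∧ OrdGE w (Finsupp.weight w s : ℕ) f := by
  by_cases h : OrdGE w c f
  · exact Or.inl h
  · right
    rw [OrdGE] at h
    push Not at h
    obtain ⟨t, ht, htc⟩ := h
    have h0 : f.weightedOrder w ≠ ⊤ :=
      ne_top_of_le_ne_top (ENat.natCast_ne_top _) (weightedOrder_le w ht)
    obtain ⟨s, hs, hs'⟩ := exists_coeff_ne_zero_and_weightedOrder w (ENat.natCast_toNat h0)
    refine ⟨s, hs, lt_of_le_of_lt ?_ htc, ordGE_nat_iff.mpr hs'.le⟩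
    have := weightedOrder_le w ht
    rw [← hs'] at this
    exact_mod_cast this

/-- Well-adaptedness in terms of `Adapted`; `G` is the initial form of `f`. -/
theorem adapted_iff [Finite σ] [IsAlgClosed k] {p : ℕ} [Fact p.Prime] [CharP k p] {e : ℕ}
    {G : MvPowerSeries σ k}
    (hG : ∀ s, coeff s G = if Finsupp.weight w s = (f.weightedOrder w).toNat then coeff s f else 0) :
    (slopeVal (f.weightedOrder w) (p ^ e) c = c ∨
      (slopeVal (f.weightedOrder w) (p ^ e) c < c ∧ ¬ ∃ g, g ^ p ^ e = G)) ↔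
    Adapted w (p ^ e) ((p ^ e : ℕ) * c) f := by
  have hq : 0 < p ^ e := pow_pos (Fact.out : p.Prime).pos e
  have hq' : (0 : ℚ) < (p ^ e : ℕ) := by exact_mod_cast hq
  rcases ordGE_or_exists w ((p ^ e : ℕ) * c) f with h | ⟨s, hs, hlt, hs'⟩
  · exact ⟨fun _ => Or.inl h, fun _ => Or.inl (slopeVal_eq_of_ordGE hq h)⟩
  · have h1 := slopeVal_eq_div hq hs hs' hlt
    have h2 : slopeVal (f.weightedOrder w) (p ^ e) c < c := by
      rw [h1, div_lt_iff₀ hq', mul_comm]; exact hlt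
    have h3 : ¬ OrdGE w ((p ^ e : ℕ) * c) f := fun h => absurd (h s hs) (not_le.mpr hlt)
    have h4 := weightedOrder_eq_of_ordGE hs hs'
    rw [exists_pow_eq_iff, Adapted, or_iff_right h2.ne, and_iff_right h2, or_iff_right h3]
    simp only [hG, h4, ENat.toNat_natCast]
    constructor
    · intro h
      push Not at h
      obtain ⟨t, ht, i, hi⟩ := h
      rw [ite_ne_right_iff] at ht
      refine ⟨t, ht.2, fun h => hi (h i), ?_, ?_⟩
      · rw [ht.1]; exact hlt
      · rw [ht.1]; exact hs'
    · rintro ⟨t, ht, htd, htc, htf⟩ h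
      apply htd
      refine h t ?_
      have : Finsupp.weight w t = Finsupp.weight w s := by
        have := weightedOrder_eq_of_ordGE ht htf
        rw [h4] at this
        exact_mod_cast this.symm
      rwa [if_pos this]

end Adapted

section OrdAlong

variable {k : Type*} [Field k]

theorem ordAlong_eq (i : Fin 3) (f : MvPowerSeries (Fin 3) k) :
    ordAlong i f = f.weightedOrder (Pi.single i 1) := by
  refine ENat.eq_of_forall_natCast_le_iff fun n => ?_
  rw [ordAlong, ← ordGE_nat_iff, ← X_pow_dvd_iff_ordGE, pow_dvd_iff_le_emultiplicity]

theorem order_eq_weightedOrder {σ : Type*} (f : MvPowerSeries σ k) :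
    f.order = f.weightedOrder (fun _ => 1) := rfl

theorem coeff_initAlong (i : Fin 3) (f : MvPowerSeries (Fin 3) k) (s : Fin 3 →₀ ℕ) :
    coeff s (initAlong i f) = if Finsupp.weight (Pi.single i 1) s =
      (f.weightedOrder (Pi.single i 1)).toNat then coeff s f else 0 := by
  rw [weight_single_one, ← ordAlong_eq]
  change (if s i = (ordAlong i f).toNat then coeff s f else 0) = _
  congr

theorem weight_one {σ : Type*} (s : σ →₀ ℕ) : Finsupp.weight (fun _ => 1) s = s.degree := by
  rw [Finsupp.degree_eq_weight_one]

theorem coeff_initPoint (f : MvPowerSeries (Fin 3) k) (s : Fin 3 →₀ ℕ) :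
    coeff s (initPoint f) = if Finsupp.weight (fun _ => 1) s =
      (f.weightedOrder (fun _ => 1)).toNat then coeff s f else 0 := by
  rw [initPoint, coeff_homogeneousComponent, weight_one]; congr

end OrdAlong

namespace MonomialDatum

variable {k : Type*} {p : ℕ} {O : Type*} [Field k] [CommRing O] [Algebra k O]
  [IsAlgClosed k] [Fact p.Prime] [CharP k p]

theorem wellAdaptedAlong_iff (d : MonomialDatum k p O) (i : Fin 3) :
    d.WellAdaptedAlong i ↔ Adapted (Pi.single i 1) d.q (d.q * d.mu i) d.lastCoef := by
  rw [WellAdaptedAlong, slope, ordAlong_eq]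
  exact adapted_iff (coeff_initAlong i _)

theorem wellAdaptedPoint_iff (d : MonomialDatum k p O) :
    d.WellAdaptedPoint ↔ Adapted (fun _ => 1) d.q (d.q * d.muPoint) d.lastCoef := by
  rw [WellAdaptedPoint, slopePoint, order_eq_weightedOrder]
  exact adapted_iff (coeff_initPoint _)

end MonomialDatum

end Idealistic

namespace Idealistic

open MvPowerSeries IsLocalRing

/-! ### Elimination of `q`-th powers -/

theorem sum_le_weight {σ : Type*} [Fintype σ] {w : σ → ℕ} {I : Finset σ} (hw : ∀ i ∈ I, 1 ≤ w i)
    (s : σ →₀ ℕ) : ∑ i ∈ I, s i ≤ Finsupp.weight w s := by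
  rw [Finsupp.weight_apply, Finsupp.sum_fintype _ _ (fun i => by simp)]
  calc ∑ i ∈ I, s i ≤ ∑ i ∈ I, s i • w i := Finset.sum_le_sum fun i hi => by
        simpa using Nat.le_mul_of_pos_right _ (hw i hi)
    _ ≤ _ := Finset.sum_le_univ_sum_of_nonneg fun i => Nat.zero_le _

section Step

variable {σ k : Type*} [Field k] {p : ℕ} [hp : Fact p.Prime] [CharP k p] {e : ℕ}

theorem neg_pow_char_pow (r : MvPowerSeries σ k) : (-r) ^ p ^ e = -(r ^ p ^ e) := by
  have : CharP (MvPowerSeries σ k) p := by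
    refine ⟨fun x => ?_⟩
    rw [← map_natCast (C : k →+* MvPowerSeries σ k) x, map_eq_zero_iff _ C_injective,
      CharP.cast_eq_zero_iff k p]
  have := sub_pow_char_pow (p := p) (n := e) 0 r
  rwa [zero_sub, zero_pow (pow_pos hp.out.pos e).ne', zero_sub] at this

variable [IsAlgClosed k]

theorem coeff_clean [Finite σ] (f : MvPowerSeries σ k) (s : σ →₀ ℕ)
    [Decidable (∀ i, p ^ e ∣ s i)] :
    coeff s ((-qroot (p ^ e) f) ^ p ^ e + f) = if ∀ i, p ^ e ∣ s i then 0 else coeff s f := by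
  rw [neg_pow_char_pow, map_add, map_neg]
  split_ifs with h
  · rw [coeff_qroot_pow_dvd f h, neg_add_cancel]
  · rw [coeff_pow_of_not_dvd _ h, neg_zero, zero_add]

/-- Eliminating the `q`-th powers from the last coefficient preserves adaptedness, and raises the
order of a series that is not adapted. -/
theorem adapted_clean [Finite σ] {F : MvPowerSeries σ k} {c : ℕ → MvPowerSeries σ k} {w : σ → ℕ}
    {μ : ℚ} (hc : ∀ l, 0 < l → l < p ^ e → OrdGE w (μ * l) (c l)) {n : ℕ}
    (h : Adapted w (p ^ e) ((p ^ e : ℕ) * μ) F ∨ OrdGE w n F) :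
    Adapted w (p ^ e) ((p ^ e : ℕ) * μ) ((-qroot (p ^ e) F) ^ p ^ e + F +
        ∑ l ∈ Finset.Ico 1 (p ^ e), c l * (-qroot (p ^ e) F) ^ (p ^ e - l)) ∨
      OrdGE w (n + 1 : ℕ) ((-qroot (p ^ e) F) ^ p ^ e + F +
        ∑ l ∈ Finset.Ico 1 (p ^ e), c l * (-qroot (p ^ e) F) ^ (p ^ e - l)) := by
  classical
  have hq : 0 < p ^ e := pow_pos hp.out.pos e
  have hc1 := fun s => coeff_clean (p := p) (e := e) F s
  generalize hqe : p ^ e = q at *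
  have hq' : (0 : ℚ) < (q : ℕ) := by exact_mod_cast hq
  have hterm : ∀ ν : ℚ, OrdGE w ν F → ∀ l ∈ Finset.Ico 1 q,
      OrdGE w (ν + l * (μ - ν / q)) (c l * (-qroot q F) ^ (q - l)) := by
    intro ν hν l hl
    have hl' := Finset.mem_Ico.mp hl
    refine ((hc l hl'.1 hl'.2).mul ((hν.qroot hq).neg.pow (q - l))).mono (le_of_eq ?_)
    rw [Nat.cast_sub hl'.2.le]
    field_simp
    ring
  have hclean : ∀ ν : ℚ, OrdGE w ν F → OrdGE w ν ((-qroot q F) ^ q + F) := by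
    intro ν hν
    refine (((hν.qroot hq).neg.pow q).mono (le_of_eq ?_)).add hν
    field_simp
  have hsum : ∀ N : ℕ, (N : ℚ) < q * μ → OrdGE w N F → OrdGE w (N + 1 : ℕ)
      (∑ l ∈ Finset.Ico 1 q, c l * (-qroot q F) ^ (q - l)) := by
    intro N hN hF
    refine OrdGE.sum fun l hl s hs => ?_
    have h1 := hterm N hF l hl s hs
    have hl' : (0 : ℚ) < l := by exact_mod_cast (Finset.mem_Ico.mp hl).1
    have h2 : (0 : ℚ) < μ - N / q := by
      rw [sub_pos, div_lt_iff₀ hq', mul_comm]; exact hN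
    have h3 : (N : ℚ) < (Finsupp.weight w s : ℕ) := lt_of_lt_of_le (by nlinarith) h1
    have : N < Finsupp.weight w s := by exact_mod_cast h3
    exact_mod_cast this
  -- `F` has order at least the threshold; or its initial form already is not a `q`-th power; or only a
  -- lower bound `n` for the order is known
  rcases h with (h | ⟨s, hs, hsd, hsc, hsF⟩) | h
  · left; left
    refine (hclean _ h).add (OrdGE.sum fun l hl => (hterm _ h l hl).mono (le_of_eq ?_))
    field_simp; ring
  · left; right
    have h1 := hsum _ hsc hsF
    refine ⟨s, ?_, hsd, hsc, (hclean _ hsF).add (h1.mono (by push_cast; linarith))⟩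
    rw [map_add, hc1, if_neg hsd, h1.coeff_eq_zero (by push_cast; linarith), add_zero]
    exact hs
  · by_cases had : OrdGE w (q * μ) F
    · left; left
      refine (hclean _ had).add (OrdGE.sum fun l hl => (hterm _ had l hl).mono (le_of_eq ?_))
      field_simp; ring
    by_cases hex : ∃ s, coeff s F ≠ 0 ∧ (¬ ∀ i, q ∣ s i) ∧ (Finsupp.weight w s : ℚ) < q * μ ∧
        OrdGE w (Finsupp.weight w s : ℕ) F
    · left; right
      obtain ⟨s, hs, hsd, hsc, hsF⟩ := hex
      have h1 := hsum _ hsc hsF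
      refine ⟨s, ?_, hsd, hsc, (hclean _ hsF).add (h1.mono (by push_cast; linarith))⟩
      rw [map_add, hc1, if_neg hsd, h1.coeff_eq_zero (by push_cast; linarith), add_zero]
      exact hs
    · right
      -- all terms of order `n` are `q`-th powers, and are removed
      have hn : (n : ℚ) < q * μ := by
        by_contra! hle
        exact had (h.mono hle)
      refine OrdGE.add (fun s hs => ?_) (hsum n hn h)
      rw [hc1, ite_ne_left_iff] at hs
      obtain ⟨hsd, hs⟩ := hs
      have h2 : n ≤ Finsupp.weight w s := by exact_mod_cast h s hs.symm
      rcases h2.lt_or_eq with h3 | h3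
      · exact_mod_cast h3
      · exact absurd ⟨s, hs.symm, hsd, h3 ▸ hn, h3 ▸ h⟩ hex

end Step

namespace MonomialDatum

variable {k : Type*} {p : ℕ} {O : Type*} [Field k] [CommRing O] [Algebra k O]

theorem q_pos [hp : Fact p.Prime] (d : MonomialDatum k p O) : 0 < d.q := pow_pos hp.out.pos _

variable [IsLocalRing O] {d : MonomialDatum k p O} {R : ℕ → Ideal O} {E : Set (Ideal O)}

theorem IsPreCase.coef_ordGE_weight (hd : d.IsPreCase R E) {l : ℕ} (hl0 : 0 < l) (hl : l < d.q)
    {I : Finset (Fin 3)} (hI : I ⊆ d.young) {w : Fin 3 → ℕ} (hw : ∀ i ∈ I, 1 ≤ w i) :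
    OrdGE w ((∑ i ∈ I, d.mu i) * l) (d.coef l) := by
  intro s hs
  have h1 : ∀ i ∈ I, d.mu i * l ≤ s i := fun i hi => by
    have := hd.coef_ordGE hl0 hl (hI hi) s hs
    rwa [weight_single_one] at this
  calc (∑ i ∈ I, d.mu i) * l = ∑ i ∈ I, d.mu i * l := Finset.sum_mul ..
    _ ≤ ∑ i ∈ I, (s i : ℚ) := Finset.sum_le_sum h1
    _ ≤ _ := by exact_mod_cast sum_le_weight hw s

variable [IsAlgClosed k] [hp : Fact p.Prime] [CharP k p]

/-- Suitable coordinates make `h` adapted with respect to all positive combinations of the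
components of the boundary simultaneously. -/
theorem IsPreCase.exists_adapted (hd : d.IsPreCase R E) : ∃ d' : MonomialDatum k p O,
    d'.IsPreCase R E ∧ d'.e = d.e ∧ d'.young = d.young ∧ d'.m = d.m ∧ d'.a = d.a ∧
    d'.h = d.h ∧ (∀ i ∈ d.young, d'.x i = d.x i) ∧
    ∀ (w : Fin 3 → ℕ) (I : Finset (Fin 3)), I ⊆ d.young → (∀ i ∈ I, 1 ≤ w i) →
      Adapted w d.q (d.q * ∑ i ∈ I, d.mu i) d'.lastCoef := by
  have step : ∀ n : ℕ, ∃ d' : MonomialDatum k p O,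
      d'.IsPreCase R E ∧ d'.e = d.e ∧ d'.young = d.young ∧ d'.m = d.m ∧ d'.a = d.a ∧
      d'.h = d.h ∧ (∀ i ∈ d.young, d'.x i = d.x i) ∧
      ∀ (w : Fin 3 → ℕ) (I : Finset (Fin 3)), I ⊆ d.young → (∀ i ∈ I, 1 ≤ w i) →
        Adapted w d.q (d.q * ∑ i ∈ I, d.mu i) d'.lastCoef ∨ OrdGE w n d'.lastCoef := by
    intro n
    induction n with
    | zero => exact ⟨d, hd, rfl, rfl, rfl, rfl, rfl, fun _ _ => rfl, fun w I _ _ =>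
        Or.inr (OrdGE.of_nonpos (by simp))⟩
    | succ n ih =>
      obtain ⟨d', h1, h2, h3, h4, h5, h6, h7, h8⟩ := ih
      have hq : d'.q = d.q := by rw [q, q, h2]
      have hqI : d'.q ∈ Finset.Icc 1 d'.q := Finset.mem_Icc.mpr ⟨q_pos d', le_rfl⟩
      have hF0 : constantCoeff d'.lastCoef = 0 := by
        rw [← mem_maximalIdeal_iff]
        exact Ideal.pow_le_self (q_pos d').ne' (h1.coef_mem hqI)
      have hb : constantCoeff (qroot d'.q d'.lastCoef) = 0 := by
        by_contra h
        rw [← coeff_zero_eq_constantCoeff_apply] at h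
        have := coeff_qroot_ne_zero (q_pos d') h
        rw [smul_zero, coeff_zero_eq_constantCoeff_apply] at this
        exact this hF0
      have hz : qroot d'.q d'.lastCoef ∈ zFree k := by
        intro s hs
        have := h1.coef_xy _ hqI _ (coeff_qroot_ne_zero (q_pos d') hs)
        have h0 := (q_pos d').ne'
        simpa [h0] using this
      refine ⟨d'.shift _ hb hz, h1.shift, h2, h3, h4, h5, ?_, ?_, ?_⟩
      · rw [shift_h h1.coef_xy, h6]
      · intro i hi
        rw [shift_x (hd.ne_zero hi), h7 i hi]
      · intro w I hI hw
        rw [shift_lastCoef (q_pos d')]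
        have hmu : ∀ i, d'.mu i = d.mu i := fun i => by rw [mu, mu, h4, h5]
        have h9 := h8 w I hI hw
        rw [← hq] at h9 ⊢
        refine adapted_clean (p := p) (e := d'.e) (fun l hl0 hl => ?_) h9
        have := h1.coef_ordGE_weight hl0 hl (I := I) (by rwa [h3]) hw
        simpa only [hmu] using this
  -- after so many steps an order `≥ n` implies an order above all thresholds
  obtain ⟨n, hn⟩ := exists_nat_ge ((d.q : ℚ) * ∑ i ∈ d.young, d.mu i)
  obtain ⟨d', h1, h2, h3, h4, h5, h6, h7, h8⟩ := step n
  refine ⟨d', h1, h2, h3, h4, h5, h6, h7, fun w I hI hw => (h8 w I hI hw).elim id fun h => ?_⟩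
  refine Or.inl (h.mono (le_trans ?_ hn))
  refine mul_le_mul_of_nonneg_left (Finset.sum_le_sum_of_subset_of_nonneg hI fun i _ _ => ?_)
    (by positivity)
  rw [mu]; positivity

end MonomialDatum

end Idealistic

namespace Idealistic

open MvPowerSeries IsLocalRing

/-! ### Existence of well-adapted data -/

section Pure

variable {k O : Type*} [Field k] [CommRing O] [IsLocalRing O] [Algebra k O]

/-- The pure part of the leading algebra is that of one generator in degree `p ^ e`. -/
def HasPureRank (k : Type*) (p : ℕ) {O : Type*} [Field k] [CommRing O] [IsLocalRing O]
    [Algebra k O] (R : ℕ → Ideal O) (e : ℕ) : Prop :=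
  (∀ i < e, leadPure k (diffSat k R) (p ^ i) = ⊥) ∧
    ∀ i, e ≤ i → Module.finrank k (leadPure k (diffSat k R) (p ^ i)) = 1

theorem IsLGS.hasPureRank {p : ℕ} {R : ℕ → Ideal O} {h : O} {e : ℕ} (H : IsLGS k p R h e) :
    HasPureRank k p R e := by
  refine ⟨H.2.2.1, fun i hi => ?_⟩
  obtain ⟨h1, h2⟩ := H.2.2.2 i hi
  rw [h2, finrank_span_singleton]
  rwa [Ne, Ideal.Quotient.eq_zero_iff_mem]

/-- The invariant `σ` records the dimensions of the pure part, hence whether it has a single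
generator. -/
theorem HasPureRank.of_sigma_eq {O' : Type*} [CommRing O'] [IsLocalRing O'] [Algebra k O']
    (X' : MvPowerSeries (Fin 3) k ≃ₐ[k] O') {p : ℕ} {R : ℕ → Ideal O} {R' : ℕ → Ideal O'} {e : ℕ}
    (H : HasPureRank k p R e) (h : sigma k p R' = sigma k p R) : HasPureRank k p R' e := by
  have h1 : ∀ i, Module.finrank k (leadPure k (diffSat k R') (p ^ i)) =
      Module.finrank k (leadPure k (diffSat k R) (p ^ i)) := fun i => by
    have := congrFun h i
    rw [sigma, sigma] at this
    omega
  refine ⟨fun i hi => leadPure_eq_bot_of_finrank_eq_zero X' ?_, fun i hi => ?_⟩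
  · rw [h1, H.1 i hi, finrank_bot]
  · rw [h1, H.2 i hi]

theorem HasPureRank.unique {p : ℕ} {R : ℕ → Ideal O} {e e' : ℕ} (H : HasPureRank k p R e)
    (H' : HasPureRank k p R e') : e = e' := by
  have key : ∀ {a b : ℕ}, HasPureRank k p R a → HasPureRank k p R b → ¬ a < b := by
    intro a b ha hb hlt
    have := ha.2 a le_rfl
    rw [hb.1 a hlt, finrank_bot] at this
    exact zero_ne_one this
  exact le_antisymm (not_lt.mp (key H' H)) (not_lt.mp (key H H'))

theorem IsFiltration.pow_mem {O : Type*} [CommRing O] {R : ℕ → Ideal O} (hR : IsFiltration R) {f : O} {n : ℕ}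
    (hf : f ∈ R n) (i : ℕ) : f ^ i ∈ R (n * i) := by
  induction i with
  | zero => rw [mul_zero, hR.1]; trivial
  | succ i ih => rw [pow_succ, mul_add, mul_one]; exact hR.2.2 _ _ (Ideal.mul_mem_mul ih hf)

theorem isFiltration_transform {O O' : Type*} [CommRing O] [Algebra k O] [CommRing O'] [Algebra k O'] (φ : O →ₐ[k] O')
    (exc : O') {R : ℕ → Ideal O} (hR : IsFiltration R) :
    IsFiltration (transformFiltration φ exc R) := by
  refine ⟨?_, fun m n hmn => Ideal.span_mono ?_, fun m n => ?_⟩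
  · rw [Ideal.eq_top_iff_one]
    exact Ideal.subset_span ⟨0, le_rfl, 1, by rw [hR.1]; trivial, by simp⟩
  · rintro g ⟨l, hl, h⟩
    exact ⟨l, hmn.trans hl, h⟩
  · rw [transformFiltration, transformFiltration, Ideal.span_mul_span', Ideal.span_le]
    rintro _ ⟨g, ⟨l, hl, f, hf, hg⟩, g', ⟨l', hl', f', hf', hg'⟩, rfl⟩
    refine Ideal.subset_span ⟨l + l', add_le_add hl hl', f * f',
      hR.2.2 _ _ (Ideal.mul_mem_mul hf hf'), ?_⟩
    rw [map_mul, hg, hg', pow_add]; ring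

end Pure

namespace MonomialDatum

variable {k : Type*} {p : ℕ} {O : Type*} [Field k] [CommRing O] [Algebra k O]

theorem M_eq (d : MonomialDatum k p O) :
    d.M = d.X (monomial (∑ i ∈ d.young, Finsupp.single i (d.m i)) 1) := by
  rw [M]
  simp only [x, ← map_pow, ← map_prod, X_pow_eq]
  congr 1
  rw [MvPowerSeries.prod_monomial, Finset.prod_const_one]

variable [IsLocalRing O] {d : MonomialDatum k p O} {R : ℕ → Ideal O} {E : Set (Ideal O)}
  [IsAlgClosed k] [hp : Fact p.Prime] [CharP k p]

/-- The order of the boundary monomial is at least its level, since `P` is a singular point, and not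
equal to it: otherwise differentiation would produce a second pure generator, in `x₁` or `x₂`. -/
theorem IsPreCase.lt_sum (hd : d.IsPreCase R E) (hR : IsFiltration R)
    (hS : ∀ n, R n ≤ maximalIdeal O ^ n) (hpure : HasPureRank k p R d.e) :
    d.a < ∑ i ∈ d.young, d.m i := by
  set s : Fin 3 →₀ ℕ := ∑ i ∈ d.young, Finsupp.single i (d.m i) with hs
  have hdeg : s.degree = ∑ i ∈ d.young, d.m i := by simp [hs, map_sum]
  have hs0 : s 0 = 0 := by
    rw [hs, Finsupp.finsetSum_apply]
    exact Finset.sum_eq_zero fun i hi => Finsupp.single_eq_of_ne (hd.ne_zero hi).symm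
  have hM := hd.monomial_mem
  rw [M_eq] at hM
  have h1 : d.a ≤ s.degree := by
    by_contra! hlt
    have h2 := hS _ hM
    rw [map_mem_maximalIdeal_pow, mem_pow_iff] at h2
    have := h2 s hlt
    rw [coeff_monomial_same] at this
    exact one_ne_zero this
  have h2 : s.degree ≠ d.a := by
    refine degree_ne_of_monomial_mem (isDiffClosed_diffSat (k := k) (R := R)) d.X hpure.1 hpure.2
      (h := d.hS) (fun i => ?_) hd.hS_mem (coeff_hS_top d hd.coef_xy) hs0 hd.a_pos
      (le_diffSat _ hM)
    refine le_diffSat _ ?_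
    rw [map_pow, X_hS, pow_add]
    exact hR.pow_mem hd.h_mem _
  omega

/-- Adaptedness at the point restores the conditions on initial forms that are missing in the weak form
of the monomial case. -/
theorem IsPreCase.isMonomialCase (hd : d.IsPreCase R E) (hR : IsFiltration R)
    (hS : ∀ n, R n ≤ maximalIdeal O ^ n) (hpure : HasPureRank k p R d.e)
    (had : d.WellAdaptedPoint) : d.IsMonomialCase R E := by
  have hlt := hd.lt_sum hR hS hpure
  have ha : (0 : ℚ) < d.a := by exact_mod_cast hd.a_pos
  have hmu : 1 < d.muPoint := by
    rw [muPoint]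
    simp only [mu]
    rw [← Finset.sum_div, lt_div_iff₀ ha, one_mul]
    exact_mod_cast hlt
  have hqI : d.q ∈ Finset.Icc 1 d.q := Finset.mem_Icc.mpr ⟨q_pos d, le_rfl⟩
  have hord : ∀ l ∈ Finset.Icc 1 d.q, OrdGE (fun _ => 1) (l + 1 : ℕ) (d.coef l) := by
    intro l hl
    obtain ⟨hl1, hlq⟩ := Finset.mem_Icc.mp hl
    have hl0 : (0 : ℚ) < l := by exact_mod_cast hl1
    rcases hlq.lt_or_eq with hlq | rfl
    · intro s hs
      have h1 := hd.coef_ordGE_weight hl1 hlq (I := d.young) subset_rfl (w := fun _ => 1)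
        (fun _ _ => le_rfl) s hs
      have h2 : (l : ℚ) < (Finsupp.weight (fun _ => 1) s : ℕ) := by
        refine lt_of_lt_of_le ?_ h1
        change _ < d.muPoint * l
        nlinarith
      exact_mod_cast h2
    · rcases (wellAdaptedPoint_iff d).mp had with h | ⟨s, hs, hsd, -, hsF⟩
      · intro s hs
        have h1 := h s hs
        have h2 : (d.q : ℚ) < (Finsupp.weight (fun _ => 1) s : ℕ) :=
          lt_of_lt_of_le (by nlinarith) h1
        exact_mod_cast h2
      · refine hsF.mono ?_
        have h1 : d.q ≤ s.degree := by
          by_contra! h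
          exact hs (mem_pow_iff.mp (hd.coef_mem hqI) s h)
        rw [weight_one]
        rcases h1.lt_or_eq with h1 | h1
        · exact_mod_cast h1
        · exfalso
          -- a term of `a_q` of degree exactly `q` would be a `q`-th power by `form_additive`
          have hs0 := hd.coef_xy _ hqI s hs
          have e1 := coeff_hS d hd.coef_xy hqI (s := s) (by rw [hs0, Nat.sub_self])
          rw [erase_zero_of_zero hs0] at e1
          have hh : d.X d.hS ∈ diffSat k R (p ^ d.e) := le_diffSat _ (by
            rw [X_hS]; exact hd.h_mem)
          obtain ⟨i, hi⟩ := form_additive (isDiffClosed_diffSat (k := k) (R := R)) d.X hpure.1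
            hh hd.hS_mem s h1.symm (by rw [e1]; exact hs)
          refine hsd fun j => ?_
          rw [hi, Finsupp.single_apply]
          split_ifs
          · exact dvd_rfl
          · exact dvd_zero _
  have hinit : d.h - d.x 0 ^ d.q ∈ maximalIdeal O ^ (d.q + 1) := by
    have e : d.h - d.x 0 ^ d.q = d.X d.tail := by
      rw [← X_hS, MonomialDatum.hS, map_add, map_pow]
      exact add_sub_cancel_left _ _
    rw [e, map_mem_maximalIdeal_pow, tail]
    refine Ideal.sum_mem _ fun l hl => ?_
    have := Ideal.mul_mem_mul (mem_pow_of_order fun s hs => (hord l hl).coeff_eq_zero (s := s)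
      (by rw [weight_one]; exact_mod_cast hs)) (Ideal.pow_mem_pow (X_mem_maximalIdeal (k := k) (0 : Fin 3)) (d.q - l))
    rw [← pow_add] at this
    have e2 : l + 1 + (d.q - l) = d.q + 1 := by have := Finset.mem_Icc.mp hl; omega
    rwa [e2] at this
  have hx0 : d.x 0 ∈ maximalIdeal O := (map_mem_maximalIdeal d.X).mpr (constantCoeff_X 0)
  refine ⟨hd.z_notMem, hd.boundary, hd.coef_xy, fun l hl => ?_, ⟨hd.h_mem, ⟨d.x 0, hx0, hinit⟩,
    hpure.1, fun i hi => ?_⟩, hinit, hd.a_pos, hd.monomial_mem, hlt, ?_, hd.deriv_mem⟩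
  · have := ordGE_nat_iff.mp (hord l hl)
    rw [← order_eq_weightedOrder] at this
    exact lt_of_lt_of_le (by exact_mod_cast Nat.lt_succ_self l) this
  · obtain ⟨j, rfl⟩ := Nat.exists_eq_add_of_le hi
    rw [Nat.add_sub_cancel_left]
    have hnot : d.h ^ p ^ j ∉ maximalIdeal O ^ (p ^ (d.e + j) + 1) := by
      rw [← X_hS, ← map_pow, map_mem_maximalIdeal_pow]
      intro h
      have h1 := mem_pow_iff.mp h (p ^ j • Finsupp.single 0 d.q) (by
        rw [map_nsmul, Finsupp.degree_single, smul_eq_mul, q, pow_add]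
        nlinarith)
      rw [coeff_smul_pow, coeff_hS_top d hd.coef_xy, one_pow] at h1
      exact one_ne_zero h1
    refine ⟨hnot, ?_⟩
    have hmem : Ideal.Quotient.mk (maximalIdeal O ^ (p ^ (d.e + j) + 1)) (d.h ^ p ^ j) ∈
        leadPure k (diffSat k R) (p ^ (d.e + j)) := by
      refine Submodule.subset_span ⟨_, le_diffSat _ ?_, ⟨d.x 0, hx0, ?_⟩, rfl⟩
      · rw [pow_add]; exact hR.pow_mem hd.h_mem _
      · have : CharP O p := charP_of_injective_algebraMap (algebraMap k O).injective p
        rw [pow_add p, pow_mul, ← sub_pow_char_pow]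
        have h3 := Ideal.pow_mem_pow hinit (p ^ j)
        rw [← pow_mul] at h3
        refine Ideal.pow_le_pow_right ?_ h3
        have : 0 < p ^ j := pow_pos hp.out.pos j
        change _ ≤ (p ^ d.e + 1) * p ^ j
        nlinarith
    have hne : (⟨_, hmem⟩ : leadPure k (diffSat k R) (p ^ (d.e + j))) ≠ 0 := by
      intro h
      rw [Submodule.mk_eq_zero, Ideal.Quotient.eq_zero_iff_mem] at h
      exact hnot h
    refine le_antisymm (fun v hv => ?_) ((Submodule.span_singleton_le_iff_mem _ _).mpr hmem)
    obtain ⟨c, hc⟩ := (finrank_eq_one_iff_of_nonzero' _ hne).mp (hpure.2 _ hi) ⟨v, hv⟩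
    exact Submodule.mem_span_singleton.mpr ⟨c, congrArg Subtype.val hc⟩
  · exact fun l f hf c hc i hi => hd.dvd_constant_term hf hc hi

/-- The weak form of the monomial case leads to well-adapted data, if the pure part of the leading
algebra is as in the monomial case with `τ = 1`. -/
theorem IsPreCase.exists_wellAdapted (hd : d.IsPreCase R E) (hR : IsFiltration R)
    (hS : ∀ n, R n ≤ maximalIdeal O ^ n) (hpure : HasPureRank k p R d.e) :
    ∃ d' : MonomialDatum k p O, d'.IsWellAdaptedCase R E := by
  obtain ⟨d', h1, h2, h3, h4, h5, h6, h7, h8⟩ := hd.exists_adapted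
  have hq : d'.q = d.q := by rw [q, q, h2]
  have hmu : ∀ i, d'.mu i = d.mu i := fun i => by rw [mu, mu, h4, h5]
  have hP : d'.WellAdaptedPoint := by
    rw [wellAdaptedPoint_iff, hq, muPoint, h3]
    simp only [hmu]
    exact h8 _ _ subset_rfl fun _ _ => le_rfl
  refine ⟨d', h1.isMonomialCase hR hS (h2 ▸ hpure) hP, hP, fun i hi => ?_⟩
  rw [wellAdaptedAlong_iff, hq, hmu]
  have := h8 (Pi.single i 1) {i} (by rwa [← h3, Finset.singleton_subset_iff]) (by simp)
  rwa [Finset.sum_singleton] at this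

end MonomialDatum

end Idealistic

namespace Idealistic

open MvPowerSeries IsLocalRing

/-! ### Orders along arcs -/

section AlgHom

variable {σ τ k : Type*} [Field k]

theorem ordGE_X_pow {w : σ → ℕ} (i : σ) (n : ℕ) :
    OrdGE w (n * w i : ℕ) ((X i : MvPowerSeries σ k) ^ n) := by
  classical
  intro s hs
  rw [coeff_X_pow, ite_ne_right_iff] at hs
  rw [hs.1, Finsupp.weight_single, smul_eq_mul]

theorem OrdGE.algHom [Finite σ] [Finite τ] (φ : MvPowerSeries σ k →ₐ[k] MvPowerSeries τ k) {w : σ → ℕ}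
    {w' : τ → ℕ} (hφ : ∀ i, OrdGE w' (w i : ℕ) (φ (X i))) {c : ℚ} {f : MvPowerSeries σ k}
    (hf : OrdGE w c f) : OrdGE w' c (φ f) := by
  intro t ht
  by_contra! hlt
  let L : MvPowerSeries σ k →ₗ[k] MvPowerSeries τ k :=
    (monomial 0) ∘ₗ (coeff t) ∘ₗ φ.toLinearMap
  have hL : L f = 0 := by
    refine linearMap_eq_zero L (fun N => ⟨t.degree + 1, fun g hg u _ => ?_⟩) f fun s hs => ?_
    · change coeff u (monomial 0 (coeff t (φ g))) = 0
      rw [mem_pow_iff.mp (algHom_mem_pow φ (mem_pow_of_order hg)) t (Nat.lt_succ_self _), map_zero,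
        map_zero]
    · change monomial 0 (coeff t (φ (monomial s 1))) = 0
      have h1 : OrdGE w' (Finsupp.weight w s : ℕ) (φ (monomial s 1)) := by
        rw [algHom_monomial]
        have : ∀ I : Finset σ, OrdGE w' (∑ i ∈ I, s i * w i : ℕ) (∏ i ∈ I, φ (X i) ^ s i) := by
          classical
          intro I
          induction I using Finset.induction_on with
          | empty => exact OrdGE.of_nonpos (by simp)
          | insert i I hi ih =>
            rw [Finset.prod_insert hi, Finset.sum_insert hi]
            refine (((hφ i).pow (s i)).mul ih).mono (le_of_eq ?_)
            push_cast; ring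
        rw [Finsupp.weight_apply]
        exact this s.support
      rw [h1.coeff_eq_zero, map_zero]
      exact hlt.trans_le (hf s hs)
  apply ht
  have := congrArg (coeff 0) hL
  change coeff 0 (monomial 0 (coeff t (φ f))) = coeff 0 0 at this
  rwa [coeff_monomial_same, coeff_zero] at this

end AlgHom

section Exact

variable {k : Type*} [Field k]

/-- The power series `f` in one variable has order exactly `V`. -/
def ExactOrd (V : ℕ) (f : MvPowerSeries Unit k) : Prop :=
  OrdGE (fun _ => 1) V f ∧ coeff (Finsupp.single () V) f ≠ 0

theorem ExactOrd.add {V : ℕ} {f g : MvPowerSeries Unit k} (hf : ExactOrd V f) {c : ℚ}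
    (hc : (V : ℚ) < c) (hg : OrdGE (fun _ => 1) c g) : ExactOrd V (f + g) := by
  refine ⟨hf.1.add (hg.mono hc.le), ?_⟩
  rw [map_add, hg.coeff_eq_zero, add_zero]
  · exact hf.2
  · rw [weight_one, Finsupp.degree_single]; exact hc

theorem ExactOrd.unit_mul {V : ℕ} {f u : MvPowerSeries Unit k} (hf : ExactOrd V f)
    (hu : constantCoeff u ≠ 0) : ExactOrd V (u * f) := by
  have e : u * f = C (constantCoeff u) * f + (u - C (constantCoeff u)) * f := by ring
  have h1 : OrdGE (fun _ => 1) (1 : ℕ) (u - C (constantCoeff u)) := by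
    intro s hs
    rw [weight_one]
    have : s ≠ 0 := by
      rintro rfl
      apply hs
      rw [coeff_zero_eq_constantCoeff_apply, map_sub, constantCoeff_C, sub_self]
    exact_mod_cast Nat.one_le_iff_ne_zero.mpr (mt (Finsupp.degree_eq_zero_iff s).mp this)
  rw [e]
  refine ExactOrd.add ⟨hf.1.mul_left, ?_⟩ (c := 1 + V) (by linarith) ((h1.mul hf.1).mono (by simp))
  rw [coeff_C_mul]
  exact mul_ne_zero hu hf.2

/-- The value of `h = z ^ q + ∑ c_l z ^ (q - l) + F` along an arc, where `c_l` has order at least `μ l`: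
an order `V < μ q` that is not a multiple of `q` can only come from `F`. -/
theorem exactOrd_eq_of_sum {p : ℕ} [hp : Fact p.Prime] [CharP k p] {e : ℕ}
    {z F : MvPowerSeries Unit k} {c : ℕ → MvPowerSeries Unit k} {μ V' : ℚ} {V : ℕ}
    (hc : ∀ l, 0 < l → l < p ^ e → OrdGE (fun _ => 1) (μ * l) (c l))
    (hF : OrdGE (fun _ => 1) V' F) (hV : (V : ℚ) < μ * (p ^ e : ℕ)) (hq : ¬ p ^ e ∣ V)
    (hex : ExactOrd V (z ^ p ^ e + (∑ l ∈ Finset.Ico 1 (p ^ e), c l * z ^ (p ^ e - l)) + F)) :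
    V' ≤ V := by
  by_contra! hlt
  have hq0 : (0 : ℚ) < (p ^ e : ℕ) := by exact_mod_cast pow_pos hp.out.pos e
  have hVw : ((Finsupp.weight (fun _ => 1) (Finsupp.single () V) : ℕ) : ℚ) = V := by
    rw [weight_one, Finsupp.degree_single]
  rcases ordGE_or_exists (fun _ => 1) μ z with h | ⟨s, hs, hsμ, hsz⟩
  · -- if `z` has order at least `μ`, all summands have order greater than `V`
    have h1 : OrdGE (fun _ => 1) (min (μ * (p ^ e : ℕ)) V')
        (z ^ p ^ e + (∑ l ∈ Finset.Ico 1 (p ^ e), c l * z ^ (p ^ e - l)) + F) := by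
      refine OrdGE.add (OrdGE.mono (OrdGE.add ((h.pow _).mono (le_of_eq (by ring)))
        (OrdGE.sum fun l hl => ?_)) (min_le_left _ _)) (hF.mono (min_le_right _ _))
      obtain ⟨hl1, hl2⟩ := Finset.mem_Ico.mp hl
      refine ((hc l hl1 hl2).mul (h.pow _)).mono (le_of_eq ?_)
      rw [Nat.cast_sub hl2.le]; ring
    have h2 := h1 _ hex.2
    rw [hVw] at h2
    exact absurd h2 (not_le.mpr (lt_min hV hlt))
  · -- if `z` has order `ν < μ`, then `z ^ q` has the order `q * ν ≠ V`, and dominates the sum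
    set ν := Finsupp.weight (fun _ => 1) s with hν
    have h1 : OrdGE (fun _ => 1) (p ^ e * ν + 1 : ℕ)
        (∑ l ∈ Finset.Ico 1 (p ^ e), c l * z ^ (p ^ e - l)) := by
      refine OrdGE.sum fun l hl t ht => ?_
      obtain ⟨hl1, hl2⟩ := Finset.mem_Ico.mp hl
      have h2 := ((hc l hl1 hl2).mul (hsz.pow _)) t ht
      rw [Nat.cast_sub hl2.le] at h2
      have h3 : ((p ^ e * ν : ℕ) : ℚ) < (Finsupp.weight (fun _ => 1) t : ℕ) := by
        refine lt_of_lt_of_le ?_ h2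
        have hl0 : (0 : ℚ) < l := by exact_mod_cast hl1
        rw [Nat.cast_mul]
        nlinarith
      have h4 : p ^ e * ν < Finsupp.weight (fun _ => 1) t := by exact_mod_cast h3
      exact_mod_cast h4
    have hsw : Finsupp.weight (fun _ => 1) (p ^ e • s) = p ^ e * ν := by
      rw [map_nsmul, smul_eq_mul]
    have h5 : OrdGE (fun _ => 1) (p ^ e * ν : ℕ) (z ^ p ^ e) :=
      (hsz.pow _).mono (by push_cast; exact le_rfl)
    rcases lt_trichotomy (p ^ e * ν) V with h | h | h
    · have h2 : coeff (p ^ e • s)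
          (z ^ p ^ e + (∑ l ∈ Finset.Ico 1 (p ^ e), c l * z ^ (p ^ e - l)) + F) = 0 := by
        refine hex.1.coeff_eq_zero ?_
        rw [hsw]; exact_mod_cast h
      rw [map_add, map_add, coeff_smul_pow, h1.coeff_eq_zero, add_zero, hF.coeff_eq_zero,
        add_zero] at h2
      · exact pow_ne_zero _ hs h2
      · rw [hsw]
        refine lt_trans ?_ hlt
        exact_mod_cast h
      · rw [hsw]; push_cast; linarith
    · exact hq ⟨ν, h.symm⟩
    · apply hex.2
      rw [map_add, map_add, h5.coeff_eq_zero, h1.coeff_eq_zero, hF.coeff_eq_zero, add_zero,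
        add_zero]
      · rw [hVw]; exact hlt
      · rw [hVw]
        exact_mod_cast (by omega : V < p ^ e * ν + 1)
      · rw [hVw]; exact_mod_cast h

end Exact

section Arc

variable {k : Type*} [Field k]

/-- The index of the other one of the two parameters `x 1`, `x 2`. -/
def other (i : Fin 3) : Fin 3 := if i = 1 then 2 else 1

theorem other_ne {i : Fin 3} (hi : i ≠ 0) : other i ≠ 0 ∧ other i ≠ i := by
  revert hi; revert i; decide

theorem eq_or_other {i l : Fin 3} (hi : i ≠ 0) (hl : l ≠ 0) : l = i ∨ l = other i := by
  revert hi hl; revert i l; decide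

theorem other_other {i : Fin 3} (hi : i ≠ 0) : other (other i) = i := by
  revert hi; revert i; decide

/-- The weights of the parameters along an arc with a high order of contact `K` with
`{x_i = 0}`. -/
def arcWeight (i : Fin 3) (K : ℕ) : Fin 3 → ℕ := fun l => if l = 0 then 0 else if l = i then K else 1

theorem weight_arcWeight {i : Fin 3} (hi : i ≠ 0) (K : ℕ) (s : Fin 3 →₀ ℕ) :
    Finsupp.weight (arcWeight i K) s = K * s i + s (other i) := by
  rw [Finsupp.weight_apply, Finsupp.sum_fintype _ _ (fun i => by simp), Fin.sum_univ_three]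
  obtain rfl | rfl : i = 1 ∨ i = 2 := by revert hi; revert i; decide
  · simp [arcWeight, other]; ring
  · simp [arcWeight, other]; ring

/-- The term `x_i ^ r * x_j ^ n` of `F`, not a `q`-th power, is the only one of lowest order along
any arc with a high order of contact with `{x_i = 0}`. -/
structure IsReduced (F : MvPowerSeries (Fin 3) k) (q : ℕ) (i : Fin 3) (r n : ℕ) : Prop where
  le : ∀ s, coeff s F ≠ 0 → r ≤ s i ∧ (s i = r → n ≤ s (other i))
  ne : coeff (Finsupp.single i r + Finsupp.single (other i) n) F ≠ 0
  not_dvd : ¬ (q ∣ r ∧ q ∣ n)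

theorem IsReduced.ordGE {F : MvPowerSeries (Fin 3) k} {q : ℕ} {i : Fin 3} (hi : i ≠ 0) {r n : ℕ}
    (hF : IsReduced F q i r n) {K : ℕ} (hK : n ≤ K) :
    OrdGE (arcWeight i K) (K * r + n : ℕ) F := by
  intro s hs
  obtain ⟨h1, h2⟩ := hF.le s hs
  rw [weight_arcWeight hi]
  rcases h1.lt_or_eq with h | h
  · exact_mod_cast (by nlinarith : K * r + n ≤ K * s i + s (other i))
  · have := h2 h.symm
    rw [← h]
    exact_mod_cast (by omega : K * r + n ≤ K * r + s (other i))

theorem ordGE_arcWeight {F : MvPowerSeries (Fin 3) k} {i : Fin 3} (hi : i ≠ 0) {c : ℚ}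
    (hF : OrdGE (Pi.single i 1) c F) (K : ℕ) : OrdGE (arcWeight i K) (K * c) F := by
  intro s hs
  have h1 := hF s hs
  rw [weight_single_one] at h1
  rw [weight_arcWeight hi]
  push_cast
  have : (0 : ℚ) ≤ K := by positivity
  nlinarith [(Nat.cast_nonneg (s (other i)) : (0 : ℚ) ≤ s (other i))]

/-- The arc `z = 0`, `x_i = T ^ K`, `x_j = T`. -/
noncomputable def arc (k : Type*) [Field k] (i : Fin 3) (K : ℕ) (hK : 0 < K) :
    MvPowerSeries (Fin 3) k →ₐ[k] MvPowerSeries Unit k :=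
  substAlgHom (a := fun l : Fin 3 => if l = 0 then 0 else if l = i then (X () : MvPowerSeries Unit k) ^ K else X ())
    (hasSubst_of_constantCoeff_zero fun l => by split_ifs <;> simp [hK.ne'])

theorem arc_zero (i : Fin 3) (K : ℕ) (hK : 0 < K) : arc k i K hK (X 0) = 0 := by
  rw [arc, substAlgHom_X, if_pos rfl]

theorem arc_self {i : Fin 3} (hi : i ≠ 0) (K : ℕ) (hK : 0 < K) : arc k i K hK (X i) = X () ^ K := by
  rw [arc, substAlgHom_X, if_neg hi, if_pos rfl]

theorem arc_other {i : Fin 3} (hi : i ≠ 0) (K : ℕ) (hK : 0 < K) :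
    arc k i K hK (X (other i)) = X () := by
  rw [arc, substAlgHom_X, if_neg (other_ne hi).1, if_neg (other_ne hi).2]

theorem ordGE_arc {i : Fin 3} (hi : i ≠ 0) {K : ℕ} (hK : 0 < K) {c : ℚ}
    {f : MvPowerSeries (Fin 3) k} (hf : OrdGE (arcWeight i K) c f) :
    OrdGE (fun _ => 1) c (arc k i K hK f) := by
  refine hf.algHom _ fun l => ?_
  by_cases hl : l = 0
  · subst hl
    rw [arc_zero]
    exact OrdGE.zero
  · rcases eq_or_other hi hl with rfl | rfl
    · rw [arc_self hi]
      have := ordGE_X_pow (k := k) (w := fun _ => 1) () K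
      simpa [arcWeight, hi] using this
    · rw [arc_other hi]
      have := ordGE_X_pow (k := k) (w := fun _ => 1) () 1
      simpa [arcWeight, other_ne hi] using this

theorem IsReduced.exactOrd {F : MvPowerSeries (Fin 3) k} {q : ℕ} {i : Fin 3} (hi : i ≠ 0) {r n : ℕ}
    (hF : IsReduced F q i r n) (hz : F ∈ zFree k) {K : ℕ} (hK : 0 < K) (hKn : n < K) :
    ExactOrd (K * r + n) (arc k i K hK F) := by
  classical
  set s₀ : Fin 3 →₀ ℕ := Finsupp.single i r + Finsupp.single (other i) n with hs₀
  have hsi : s₀ i = r := by simp [hs₀, (other_ne hi).2]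
  have hsj : s₀ (other i) = n := by simp [hs₀, (other_ne hi).2]
  have hs0 : s₀ 0 = 0 := by simp [hs₀, hi.symm, (other_ne hi).1.symm]
  have h1 : OrdGE (arcWeight i K) (K * r + n + 1 : ℕ) (F - monomial s₀ (coeff s₀ F)) := by
    intro s hs
    rw [map_sub, coeff_monomial] at hs
    have hne : s ≠ s₀ := by rintro rfl; simp at hs
    rw [if_neg hne, sub_zero] at hs
    obtain ⟨h1, h2⟩ := hF.le s hs
    rw [weight_arcWeight hi]
    rcases h1.lt_or_eq with h | h
    · exact_mod_cast (by nlinarith : K * r + n + 1 ≤ K * s i + s (other i))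
    · have h3 := h2 h.symm
      have h4 : n ≠ s (other i) := by
        intro h'
        apply hne
        ext l
        by_cases hl : l = 0
        · subst hl; rw [hz s hs, hs0]
        · rcases eq_or_other hi hl with rfl | rfl
          · rw [hsi, h]
          · rw [hsj, h']
      rw [← h]
      exact_mod_cast (by omega : K * r + n + 1 ≤ K * r + s (other i))
  have e : arc k i K hK F = monomial (Finsupp.single () (K * r + n)) (coeff s₀ F) +
      arc k i K hK (F - monomial s₀ (coeff s₀ F)) := by
    have e2 : arc k i K hK (monomial s₀ (coeff s₀ F)) =
        monomial (Finsupp.single () (K * r + n)) (coeff s₀ F) := by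
      have e3 : ∀ (τ : Type) (t : τ →₀ ℕ) (c : k), monomial t c = c • monomial t (1 : k) :=
        fun τ t c => by rw [← map_smul, smul_eq_mul, mul_one]
      rw [e3, e3 Unit, map_smul, algHom_monomial, hs₀, Finsupp.prod_add_index' (by simp)
        (fun _ _ _ => pow_add _ _ _), Finsupp.prod_single_index (by simp),
        Finsupp.prod_single_index (by simp), arc_self hi, arc_other hi, ← pow_mul, ← pow_add,
        X_pow_eq]
    rw [map_sub, e2]; ring
  rw [e]
  refine ExactOrd.add ⟨?_, ?_⟩ (by push_cast; linarith) (ordGE_arc hi hK h1)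
  · intro t ht
    rw [coeff_monomial, ite_ne_right_iff] at ht
    rw [ht.1, weight_one, Finsupp.degree_single]
  · rw [coeff_monomial_same]; exact hF.ne

end Arc

end Idealistic

namespace Idealistic

open MvPowerSeries IsLocalRing

/-! ### Comparison of two choices of `h` -/

theorem ordGE_one_of_constantCoeff {σ k : Type*} [Field k] {f : MvPowerSeries σ k}
    (hf : constantCoeff f = 0) : OrdGE (fun _ => 1) (1 : ℕ) f := by
  intro s hs
  rw [weight_one]
  have : s ≠ 0 := by
    rintro rfl
    exact hs (by rwa [coeff_zero_eq_constantCoeff_apply])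
  exact_mod_cast Nat.one_le_iff_ne_zero.mpr (mt (Finsupp.degree_eq_zero_iff s).mp this)

theorem mem_pair_of_ne_zero {l : Fin 3} (h : l ≠ 0) : l ∈ ({1, 2} : Finset (Fin 3)) := by
  revert h; revert l; decide

section Kill

variable {k : Type*} [Field k]

/-- The restriction to the coordinate subspace where the variables in `I` vanish. -/
noncomputable def kill (k : Type*) [Field k] (I : Finset (Fin 3)) :
    MvPowerSeries (Fin 3) k →ₐ[k] MvPowerSeries (Fin 3) k :=
  substAlgHom (a := fun l : Fin 3 => if l ∈ I then 0 else X l)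
    (hasSubst_of_constantCoeff_zero fun l => by split_ifs <;> simp)

theorem kill_X (I : Finset (Fin 3)) (l : Fin 3) : kill k I (X l) = if l ∈ I then 0 else X l := by
  rw [kill, substAlgHom_X]

theorem kill_comp {I J : Finset (Fin 3)} (h : I ⊆ J) (f : MvPowerSeries (Fin 3) k) :
    kill k J (kill k I f) = kill k J f := by
  rw [← AlgHom.comp_apply]
  refine congrArg (fun φ : MvPowerSeries (Fin 3) k →ₐ[k] MvPowerSeries (Fin 3) k => φ f)
    (algHom_ext' fun l => ?_)
  rw [AlgHom.comp_apply, kill_X, kill_X]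
  by_cases hI : l ∈ I
  · rw [if_pos hI, if_pos (h hI), map_zero]
  · rw [if_neg hI, kill_X]

theorem kill_zFree {f : MvPowerSeries (Fin 3) k} (hz : f ∈ zFree k) (hf : constantCoeff f = 0) :
    kill k {1, 2} f = 0 := by
  have h1 : kill k {1, 2} f = kill k Finset.univ f := algHom_congr fun l ⟨s, hs, hl⟩ => by
    rw [kill_X, kill_X, if_pos (Finset.mem_univ _), if_pos]
    refine mem_pair_of_ne_zero ?_
    rintro rfl
    exact hl (hz s hs)
  rw [h1]
  refine ordGE_ext (w := fun _ => 1) fun n => ?_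
  have h2 : OrdGE (fun _ => n) (n : ℕ) f := by
    intro s hs
    have h3 := ordGE_one_of_constantCoeff hf s hs
    rw [weight_one, Finsupp.degree_eq_sum] at h3
    have h4 : 1 ≤ ∑ i, s i := by exact_mod_cast h3
    rw [Finsupp.weight_apply, Finsupp.sum_fintype _ _ (fun i => by simp)]
    simp only [smul_eq_mul, ← Finset.sum_mul]
    exact_mod_cast Nat.le_mul_of_pos_left n h4
  refine h2.algHom (kill k Finset.univ) fun l => ?_
  rw [kill_X, if_pos (Finset.mem_univ _)]
  exact OrdGE.zero

end Kill

namespace MonomialDatum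

variable {k : Type*} {p : ℕ} {O : Type*} [Field k] [CommRing O] [Algebra k O]

theorem hS_eq (d : MonomialDatum k p O) (hq : 0 < d.q) : d.hS = MvPowerSeries.X 0 ^ d.q +
    (∑ l ∈ Finset.Ico 1 d.q, d.coef l * MvPowerSeries.X 0 ^ (d.q - l)) + d.lastCoef := by
  rw [hS, tail, ← Finset.Ico_insert_right (Nat.one_le_iff_ne_zero.mpr hq.ne'),
    Finset.sum_insert (by simp), Nat.sub_self, pow_zero, mul_one, add_assoc, lastCoef,
    add_comm (d.coef d.q)]

variable [IsLocalRing O] {d d₁ d₂ : MonomialDatum k p O} {R : ℕ → Ideal O} {E : Set (Ideal O)}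

theorem IsPreCase.coef_constantCoeff (hd : d.IsPreCase R E) {l : ℕ} (hl : l ∈ Finset.Icc 1 d.q) :
    constantCoeff (d.coef l) = 0 := by
  rw [← mem_maximalIdeal_iff]
  exact Ideal.pow_le_self (by have := Finset.mem_Icc.mp hl; omega) (hd.coef_mem hl)

theorem IsPreCase.kill_hS (hd : d.IsPreCase R E) : kill k {1, 2} d.hS = MvPowerSeries.X 0 ^ d.q := by
  rw [hS, tail, map_add, map_pow, map_sum, kill_X, if_neg (by decide), Finset.sum_eq_zero, add_zero]
  intro l hl
  rw [map_mul, kill_zFree (hd.coef_xy l hl) (hd.coef_constantCoeff hl), zero_mul]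

variable [IsAlgClosed k] [hp : Fact p.Prime] [CharP k p]

theorem IsPreCase.one_lt_muPoint (hd : d.IsPreCase R E) (hR : IsFiltration R)
    (hS : ∀ n, R n ≤ maximalIdeal O ^ n) (hpure : HasPureRank k p R d.e) : 1 < d.muPoint := by
  have hlt := hd.lt_sum hR hS hpure
  have ha : (0 : ℚ) < d.a := by exact_mod_cast hd.a_pos
  rw [muPoint]
  simp only [mu]
  rw [← Finset.sum_div, lt_div_iff₀ ha, one_mul]
  exact_mod_cast hlt

/-- Two choices of `h` agree up to a unit and up to a multiple of the boundary monomial. -/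
theorem IsPreCase.h_eq (hd₁ : d₁.IsPreCase R E) (hd₂ : d₂.IsPreCase R E) (he : d₂.e = d₁.e)
    (hR : IsFiltration R) (hS : ∀ n, R n ≤ maximalIdeal O ^ n) (hpure : HasPureRank k p R d₁.e) :
    ∃ g c, d₂.h = g * d₁.h + d₁.X c ∧ IsUnit g ∧
      ∀ i ∈ d₁.young, OrdGE (Pi.single i 1) (d₁.mu i * d₁.q) c := by
  have hq : d₂.q = d₁.q := by rw [q, q, he]
  obtain ⟨c, ⟨g, hg⟩, hc⟩ := hd₁.control _ _ hd₂.h_mem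
  obtain ⟨c, rfl⟩ := d₁.X.surjective c
  have hc' : ∀ i ∈ d₁.young, OrdGE (Pi.single i 1) (d₁.mu i * d₁.q) c := fun i hi => by
    have := hc i hi
    rw [x_pow_dvd_X, X_pow_dvd_iff_ordGE, hq] at this
    refine this.mono ((le_of_eq ?_).trans (Nat.le_ceil _))
    rw [mu]; ring
  refine ⟨g, c, by linear_combination hg, ?_, hc'⟩
  -- `c` has order greater than `q`, because `μ(P) > 1`
  have hcm : c ∈ maximalIdeal (MvPowerSeries (Fin 3) k) ^ (d₁.q + 1) := by
    refine mem_pow_of_order fun s hs => ?_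
    by_contra hne
    have h1 : (d₁.q : ℚ) < s.degree := by
      have hq0 : (0 : ℚ) < d₁.q := by exact_mod_cast q_pos d₁
      calc (d₁.q : ℚ) < d₁.muPoint * d₁.q := by
            nlinarith [hd₁.one_lt_muPoint hR hS hpure]
        _ = ∑ i ∈ d₁.young, d₁.mu i * d₁.q := Finset.sum_mul ..
        _ ≤ ∑ i ∈ d₁.young, (s i : ℚ) := Finset.sum_le_sum fun i hi => by
            have := hc' i hi s hne
            rwa [weight_single_one] at this
        _ ≤ (Finsupp.weight (fun _ => 1) s : ℕ) := by
            exact_mod_cast sum_le_weight (fun _ _ => le_rfl) s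
        _ = _ := by rw [weight_one]
    have h2 : d₁.q < s.degree := by exact_mod_cast h1
    omega
  -- if `g` were not a unit, `h₂` would have order greater than `q`
  by_contra hg'
  have h1 : d₂.h ∈ maximalIdeal O ^ (d₁.q + 1) := by
    have e : d₂.h = g * d₁.h + d₁.X c := by linear_combination hg
    rw [e]
    refine Ideal.add_mem _ ?_ ((map_mem_maximalIdeal_pow d₁.X).mpr hcm)
    rw [pow_succ']
    exact Ideal.mul_mem_mul ((mem_maximalIdeal g).mpr hg') hd₁.h_order
  rw [← X_hS, map_mem_maximalIdeal_pow] at h1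
  have h2 := mem_pow_iff.mp h1 (Finsupp.single 0 d₂.q) (by simp [hq])
  rw [coeff_hS_top d₂ hd₂.coef_xy] at h2
  exact one_ne_zero h2

/-- The comparison of the orders of contact of two choices of `h` with an arc: if the term
`x_i ^ r * x_j ^ n` is reduced with respect to the first one, the last coefficient of the second one
cannot have a higher order along all arcs. -/
theorem IsPreCase.exists_arc_le (hd₁ : d₁.IsPreCase R E) (hd₂ : d₂.IsPreCase R E)
    (he : d₂.e = d₁.e) (hR : IsFiltration R) (hS : ∀ n, R n ≤ maximalIdeal O ^ n)
    (hpure : HasPureRank k p R d₁.e) {i₁ i₂ : Fin 3} (hi₁ : i₁ ∈ d₁.young) (hi₂ : i₂ ∈ d₂.young)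
    (hD : Ideal.span {d₁.x i₁} = Ideal.span {d₂.x i₂}) (hmu : d₂.mu i₂ = d₁.mu i₁) {r n : ℕ}
    (hred : IsReduced d₁.lastCoef d₁.q i₁ r n) (hr : (r : ℚ) < d₁.q * d₁.mu i₁) {c : ℕ → ℚ}
    {K₀ : ℕ} (hc : ∀ K, K₀ ≤ K → OrdGE (arcWeight i₂ K) (c K) d₂.lastCoef) :
    ∃ K, K₀ ≤ K ∧ c K ≤ K * r + n := by
  have hq : d₂.q = d₁.q := by rw [q, q, he]
  have hq0 := q_pos d₁
  have hi₁0 := hd₁.ne_zero hi₁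
  have hi₂0 := hd₂.ne_zero hi₂
  have hδ : (0 : ℚ) < d₁.q * d₁.mu i₁ - r := sub_pos.mpr hr
  -- `K` is so large that `K * r + n < K * μ * q`, and such that `q` does not divide `K * r + n`, so that
  -- `z ^ q` cannot contribute a term of this order
  obtain ⟨K₁, hK₁⟩ := exists_nat_gt ((n : ℚ) / (d₁.q * d₁.mu i₁ - r))
  obtain ⟨K, hK, hKd⟩ : ∃ K, K₀ + K₁ + n + 1 ≤ K ∧ ¬ d₁.q ∣ K * r + n := by
    by_cases hn : d₁.q ∣ n
    · refine ⟨d₁.q * (K₀ + K₁ + n + 1) + 1, by nlinarith, fun h => hred.not_dvd ⟨?_, hn⟩⟩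
      have h1 := (Nat.dvd_add_left hn).mp h
      rw [add_mul, one_mul, mul_assoc] at h1
      exact (Nat.dvd_add_right (dvd_mul_right _ _)).mp h1
    · refine ⟨d₁.q * (K₀ + K₁ + n + 1), by nlinarith, fun h => hn ?_⟩
      rw [mul_assoc] at h
      exact (Nat.dvd_add_right (dvd_mul_right _ _)).mp h
  have hK0 : 0 < K := by omega
  refine ⟨K, by omega, ?_⟩
  have hVlt : ((K * r + n : ℕ) : ℚ) < K * (d₁.mu i₁ * d₁.q) := by
    have h1 : (K₁ : ℚ) ≤ K := by exact_mod_cast (by omega : K₁ ≤ K)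
    have h2 := hK₁.trans_le h1
    rw [div_lt_iff₀ hδ] at h2
    push_cast
    linarith
  obtain ⟨g, b, hgb, hg, hb⟩ := hd₁.h_eq hd₂ he hR hS hpure
  -- the arc is `z = 0` in the first coordinates, but arbitrary in `z` for the second ones
  let θ : O →ₐ[k] MvPowerSeries Unit k := (arc k i₁ K hK0).comp (d₁.X.symm : O →ₐ[k] _)
  have hqI : d₁.q ∈ Finset.Icc 1 d₁.q := Finset.mem_Icc.mpr ⟨hq0, le_rfl⟩
  have h1 : ExactOrd (K * r + n) (θ d₁.h) := by
    have e : θ d₁.h = arc k i₁ K hK0 d₁.lastCoef := by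
      change arc k i₁ K hK0 (d₁.X.symm d₁.h) = _
      rw [← X_hS, AlgEquiv.symm_apply_apply, hS_eq d₁ hq0, map_add, map_add, map_pow, arc_zero,
        zero_pow hq0.ne', map_sum, Finset.sum_eq_zero, zero_add, zero_add]
      intro l hl
      have := Finset.mem_Ico.mp hl
      rw [map_mul, map_pow, arc_zero, zero_pow (by omega), mul_zero]
    rw [e]
    exact hred.exactOrd hi₁0 (hd₁.coef_xy _ hqI) hK0 (by omega)
  have h2 : ExactOrd (K * r + n) (θ d₂.h) := by
    rw [hgb, map_add, map_mul]
    refine (h1.unit_mul ?_).add hVlt ?_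
    · exact (isUnit_iff_constantCoeff.mp (hg.map θ)).ne_zero
    · change OrdGE _ _ (arc k i₁ K hK0 (d₁.X.symm (d₁.X b)))
      rw [AlgEquiv.symm_apply_apply]
      exact ordGE_arc hi₁0 hK0 (ordGE_arcWeight hi₁0 (hb i₁ hi₁) K)
  let θ₂ : MvPowerSeries (Fin 3) k →ₐ[k] MvPowerSeries Unit k := θ.comp (d₂.X : _ →ₐ[k] O)
  have hθ₂ : ∀ {c f}, OrdGE (arcWeight i₂ K) c f → OrdGE (fun _ => 1) c (θ₂ f) := by
    intro c f hf
    refine hf.algHom _ fun l => ?_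
    by_cases hl : l = 0
    · subst hl; exact OrdGE.of_nonpos (by simp [arcWeight])
    · rcases eq_or_other hi₂0 hl with rfl | rfl
      · have e1 : d₂.x l ∈ Ideal.span {d₁.x i₁} := hD ▸ Ideal.mem_span_singleton_self _
        obtain ⟨u, hu⟩ := Ideal.mem_span_singleton.mp e1
        change OrdGE _ _ (θ (d₂.x l))
        rw [hu, map_mul]
        have e2 : θ (d₁.x i₁) = MvPowerSeries.X () ^ K := by
          change arc k i₁ K hK0 (d₁.X.symm (d₁.X (MvPowerSeries.X i₁))) = _
          rw [AlgEquiv.symm_apply_apply, arc_self hi₁0]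
        rw [e2]
        have := ordGE_X_pow (k := k) (w := fun _ => 1) () K
        have e3 : arcWeight l K l = K * 1 := by simp [arcWeight, hi₂0]
        rw [e3]
        exact this.mul_right
      · have e3 : arcWeight i₂ K (other i₂) = 1 := by simp [arcWeight, other_ne hi₂0]
        rw [e3]
        refine ordGE_one_of_constantCoeff ?_
        rw [constantCoeff_algHom, constantCoeff_X]
  have h3 : θ d₂.h = θ₂ d₂.hS := by rw [← X_hS]; rfl
  rw [h3, hS_eq d₂ (q_pos d₂), map_add, map_add, map_pow, map_sum] at h2
  have h4 : (c K : ℚ) ≤ (K * r + n : ℕ) := by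
    refine exactOrd_eq_of_sum (p := p) (e := d₂.e) (z := θ₂ (MvPowerSeries.X 0))
      (c := fun l => θ₂ (d₂.coef l)) (μ := K * d₁.mu i₁) (fun l hl0 hl => ?_)
      (hθ₂ (hc K (by omega))) ?_ ?_ ?_
    · have := hθ₂ (ordGE_arcWeight hi₂0 (hd₂.coef_ordGE hl0 hl hi₂) K)
      refine this.mono (le_of_eq ?_)
      rw [hmu]; ring
    · change _ < _ * ((d₂.q : ℕ) : ℚ)
      rw [hq]; linarith
    · change ¬ d₂.q ∣ _
      rwa [hq]
    · simp only [map_mul, map_pow] at h2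
      exact h2
  exact_mod_cast h4

/-- The number `μ(ξ_D)` does not depend on the datum. Otherwise, dividing a power of the monomial of
the second datum by the first `h` would show that this `h`, restricted to `D`, divides a monomial in
`x₁, x₂`, although it is a `z`-regular element of order `q`. -/
theorem IsPreCase.mu_le (hd₁ : d₁.IsPreCase R E) (hd₂ : d₂.IsPreCase R E)
    (he : d₂.e = d₁.e) (hR : IsFiltration R) (hS : ∀ n, R n ≤ maximalIdeal O ^ n)
    (hpure : HasPureRank k p R d₁.e) {i₁ i₂ : Fin 3} (hi₁ : i₁ ∈ d₁.young) (hi₂ : i₂ ∈ d₂.young)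
    (hD : Ideal.span {d₁.x i₁} = Ideal.span {d₂.x i₂}) : d₁.mu i₁ ≤ d₂.mu i₂ := by
  have ha₁ : (0 : ℚ) < d₁.a := by exact_mod_cast hd₁.a_pos
  have ha₂ : (0 : ℚ) < d₂.a := by exact_mod_cast hd₂.a_pos
  have hi₁0 := hd₁.ne_zero hi₁
  have hi₂0 := hd₂.ne_zero hi₂
  rw [mu, mu, div_le_div_iff₀ ha₁ ha₂]
  by_contra! hlt
  have hlt' : d₂.m i₂ * d₁.a < d₁.m i₁ * d₂.a := by exact_mod_cast hlt
  obtain ⟨g, b, hgb, hg, hb⟩ := hd₁.h_eq hd₂ he hR hS hpure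
  set H := d₂.X.symm d₁.h with hH
  -- `x_{i₁}` is a multiple of `x_{i₂}`
  have hx : MvPowerSeries.X i₂ ∣ d₂.X.symm (d₁.x i₁) := by
    have : d₁.x i₁ ∈ Ideal.span {d₂.x i₂} := hD ▸ Ideal.mem_span_singleton_self _
    have h1 := map_dvd d₂.X.symm (Ideal.mem_span_singleton.mp this)
    rwa [x, AlgEquiv.symm_apply_apply] at h1
  have hI := mem_pair_of_ne_zero hi₂0
  have hbdvd : MvPowerSeries.X i₂ ∣ d₂.X.symm (d₁.X b) := by
    have hm : 0 < d₁.m i₁ := Nat.pos_of_ne_zero (by rintro h; rw [h] at hlt'; omega)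
    have h1 : MvPowerSeries.X i₁ ∣ b := by
      have h2 := (hb i₁ hi₁).X_pow_dvd
      refine (dvd_pow_self _ ?_).trans h2
      rw [← Nat.pos_iff_ne_zero, Nat.ceil_pos, mu]
      have : (0 : ℚ) < d₁.m i₁ := by exact_mod_cast hm
      have : (0 : ℚ) < d₁.q := by exact_mod_cast q_pos d₁
      positivity
    refine hx.trans ?_
    have := map_dvd d₂.X.symm (map_dvd d₁.X h1)
    exact this
  have hhS : d₂.hS = d₂.X.symm g * H + d₂.X.symm (d₁.X b) := by
    rw [hH, ← map_mul, ← map_add, ← hgb, ← X_hS, AlgEquiv.symm_apply_apply]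
  have hkill : ∀ I ⊆ ({1, 2} : Finset (Fin 3)), kill k I d₂.hS ≠ 0 := by
    intro I hI h
    have h1 := kill_comp hI d₂.hS
    rw [h, map_zero, hd₂.kill_hS] at h1
    exact pow_ne_zero _ (X_prime 0).ne_zero h1.symm
  have hkb : ∀ I : Finset (Fin 3), i₂ ∈ I → kill k I (d₂.X.symm (d₁.X b)) = 0 := by
    intro I hI
    obtain ⟨u, hu⟩ := hbdvd
    rw [hu, map_mul, kill_X, if_pos hI, zero_mul]
  have hH2 : ∀ I ⊆ ({1, 2} : Finset (Fin 3)), i₂ ∈ I → kill k I H ≠ 0 := by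
    intro I hI hiI h
    apply hkill I hI
    rw [hhS, map_add, map_mul, h, mul_zero, hkb I hiI, add_zero]
  have hnd : ¬ MvPowerSeries.X i₂ ∣ H := by
    rintro ⟨u, hu⟩
    refine hH2 {i₂} (by simpa using hI) (by simp) ?_
    rw [hu, map_mul, kill_X, if_pos (by simp), zero_mul]
  -- the remainder of a power of the second monomial modulo the first `h` is divisible by a higher power
  -- of `x_{i₂}` than this power itself
  have hM := hd₁.control _ _ (hR.pow_mem hd₂.monomial_mem d₁.a)
  obtain ⟨c, ⟨A, hA⟩, hc⟩ := hM
  have hc' : MvPowerSeries.X i₂ ^ (d₁.m i₁ * d₂.a) ∣ d₂.X.symm c := by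
    have h1 := hc i₁ hi₁
    have e : ((d₁.m i₁ * (d₂.a * d₁.a : ℕ) : ℚ) / d₁.a) = (d₁.m i₁ * d₂.a : ℕ) := by
      push_cast; field_simp
    rw [e, Nat.ceil_natCast] at h1
    refine (pow_dvd_pow_of_dvd hx _).trans ?_
    rw [← map_pow]
    exact map_dvd d₂.X.symm h1
  obtain ⟨B, hB⟩ := hc'
  obtain ⟨t, ht⟩ : ∃ t, d₂.X.symm (d₂.M ^ d₁.a) = MvPowerSeries.X i₂ ^ (d₂.m i₂ * d₁.a) *
      MvPowerSeries.X (other i₂) ^ t := by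
    have h1 : d₂.X.symm d₂.M = ∏ i ∈ d₂.young, MvPowerSeries.X i ^ d₂.m i := by
      rw [M, map_prod]
      refine Finset.prod_congr rfl fun i _ => ?_
      rw [map_pow, x, AlgEquiv.symm_apply_apply]
    rw [map_pow, h1, ← Finset.mul_prod_erase _ _ hi₂, mul_pow, ← pow_mul]
    have h2 : d₂.young.erase i₂ ⊆ {other i₂} := by
      intro l hl
      obtain ⟨h3, h4⟩ := Finset.mem_erase.mp hl
      exact Finset.mem_singleton.mpr ((eq_or_other hi₂0 (hd₂.ne_zero h4)).resolve_left h3)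
    rcases Finset.subset_singleton_iff.mp h2 with h3 | h3
    · exact ⟨0, by rw [h3]; simp⟩
    · exact ⟨d₂.m (other i₂) * d₁.a, by rw [h3, Finset.prod_singleton, ← pow_mul]⟩
  have hA' := congrArg d₂.X.symm hA
  rw [map_sub, map_mul, ht, hB, ← hH] at hA'
  have hN : d₁.m i₁ * d₂.a = d₂.m i₂ * d₁.a + (d₁.m i₁ * d₂.a - d₂.m i₂ * d₁.a) := by omega
  have hN1 : d₁.m i₁ * d₂.a - d₂.m i₂ * d₁.a ≠ 0 := by omega
  rw [hN, pow_add, mul_assoc, ← mul_sub] at hA'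
  have hdA : MvPowerSeries.X i₂ ^ (d₂.m i₂ * d₁.a) ∣ d₂.X.symm A :=
    (X_prime i₂).pow_dvd_of_dvd_mul_left _ hnd ⟨_, hA'.symm⟩
  obtain ⟨A', hAA⟩ := hdA
  rw [hAA, mul_left_comm] at hA'
  have hA'' := mul_left_cancel₀ (pow_ne_zero _ (X_prime (k := k) i₂).ne_zero) hA'
  have hk₁ : kill k {i₂} (MvPowerSeries.X (other i₂)) = MvPowerSeries.X (other i₂) := by
    rw [kill_X, if_neg (by simpa using (other_ne hi₂0).2)]
  have hk₂ : kill k {i₂} (MvPowerSeries.X i₂) = 0 := by rw [kill_X, if_pos (by simp)]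
  -- restricted to `x_{i₂} = 0`, `H` divides a power of the other variable
  have hk := congrArg (kill k {i₂}) hA''
  rw [map_sub, map_mul, map_pow, map_pow, map_mul, hk₁, hk₂, zero_pow hN1, zero_mul, sub_zero] at hk
  obtain ⟨j, -, hj⟩ := (dvd_prime_pow (X_prime (k := k) (other i₂)) t).mp ⟨_, hk⟩
  have hcH : constantCoeff (kill k {i₂} H) = 0 := by
    rw [constantCoeff_algHom, ← map_mem_maximalIdeal d₂.X, hH, AlgEquiv.apply_symm_apply]
    exact Ideal.pow_le_self (q_pos d₁).ne' hd₁.h_order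
  have hj0 : j ≠ 0 := by
    rintro rfl
    rw [pow_zero, associated_one_iff_isUnit, isUnit_iff_constantCoeff, hcH] at hj
    exact not_isUnit_zero hj
  -- hence `H` vanishes on the `z`-axis, where it equals `z ^ q` up to a unit
  have hdv : MvPowerSeries.X (other i₂) ∣ kill k {i₂} H := (dvd_pow_self _ hj0).trans hj.symm.dvd
  refine hH2 {1, 2} subset_rfl hI ?_
  rw [← kill_comp (I := {i₂}) (by simpa using hI) H]
  obtain ⟨u, hu⟩ := hdv
  rw [hu, map_mul, kill_X, if_pos (mem_pair_of_ne_zero (other_ne hi₂0).1), zero_mul]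

end MonomialDatum

end Idealistic

namespace Idealistic

open MvPowerSeries IsLocalRing

/-! ### Independence of the choice of the datum -/

namespace MonomialDatum

variable {k : Type*} {p : ℕ} {O : Type*} [Field k] [CommRing O] [Algebra k O]

theorem ordGE_of_slope_eq {d : MonomialDatum k p O} {i : Fin 3} (hq : 0 < d.q)
    (h : d.slope i = d.mu i) : OrdGE (Pi.single i 1) (d.q * d.mu i) d.lastCoef := by
  rcases ordGE_or_exists (Pi.single i 1) (d.q * d.mu i) d.lastCoef with h1 | ⟨s, hs, hlt, hsF⟩
  · exact h1
  · rw [slope, ordAlong_eq, slopeVal_eq_div hq hs hsF hlt,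
      div_eq_iff (by exact_mod_cast hq.ne'), mul_comm] at h
    exact absurd h hlt.ne

variable [IsLocalRing O]

/-- `μ(ξ_D) = μ` for some datum with exponent `e`. -/
def MuAt (k : Type*) (p : ℕ) {O : Type*} [Field k] [CommRing O] [Algebra k O] [IsLocalRing O]
    (R : ℕ → Ideal O) (E : Set (Ideal O)) (e : ℕ) (D : Ideal O) (μ : ℚ) : Prop :=
  ∃ d : MonomialDatum k p O, d.IsPreCase R E ∧ d.e = e ∧
    ∃ i ∈ d.young, D = Ideal.span {d.x i} ∧ d.mu i = μ

/-- The divisor `D` is bad for some datum with exponent `e`, with reduced initial term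
`x_i ^ r * x_j ^ n`. -/
def RedAt (k : Type*) (p : ℕ) {O : Type*} [Field k] [CommRing O] [Algebra k O] [IsLocalRing O]
    (R : ℕ → Ideal O) (E : Set (Ideal O)) (e : ℕ) (D : Ideal O) (r n : ℕ) : Prop :=
  ∃ d : MonomialDatum k p O, d.IsPreCase R E ∧ d.e = e ∧
    ∃ i ∈ d.young, D = Ideal.span {d.x i} ∧ (r : ℚ) < d.q * d.mu i ∧
      IsReduced d.lastCoef d.q i r n

/-- The divisor `D` is good for some datum with exponent `e`. -/
def GoodAt (k : Type*) (p : ℕ) {O : Type*} [Field k] [CommRing O] [Algebra k O] [IsLocalRing O]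
    (R : ℕ → Ideal O) (E : Set (Ideal O)) (e : ℕ) (D : Ideal O) : Prop :=
  ∃ d : MonomialDatum k p O, d.IsPreCase R E ∧ d.e = e ∧
    ∃ i ∈ d.young, D = Ideal.span {d.x i} ∧
      OrdGE (Pi.single i 1) (d.q * d.mu i) d.lastCoef

variable [IsAlgClosed k] [hp : Fact p.Prime] [CharP k p] {R : ℕ → Ideal O} {E : Set (Ideal O)}
  {e : ℕ} {D : Ideal O} {d : MonomialDatum k p O}

/-- Along each boundary component, `μ` depends on the filtration only. -/
theorem MuAt.unique (hR : IsFiltration R) (hS : ∀ n, R n ≤ maximalIdeal O ^ n)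
    (hpure : HasPureRank k p R e) {μ μ' : ℚ} (h : MuAt k p R E e D μ)
    (h' : MuAt k p R E e D μ') : μ = μ' := by
  obtain ⟨d, hd, rfl, i, hi, hD, rfl⟩ := h
  obtain ⟨d', hd', he, i', hi', hD', rfl⟩ := h'
  exact le_antisymm (hd.mu_le hd' he hR hS hpure hi hi' (hD ▸ hD'))
    (hd'.mu_le hd he.symm hR hS (he ▸ hpure) hi' hi (hD' ▸ hD))

/-- Whether a boundary component is good or bad depends on the filtration only. -/
theorem RedAt.not_goodAt (hR : IsFiltration R) (hS : ∀ n, R n ≤ maximalIdeal O ^ n)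
    (hpure : HasPureRank k p R e) {r n : ℕ} (h : RedAt k p R E e D r n) :
    ¬ GoodAt k p R E e D := by
  rintro ⟨d', hd', he', i', hi', hD', hgood⟩
  obtain ⟨d, hd, rfl, i, hi, hD, hr, hred⟩ := h
  have hmu : d'.mu i' = d.mu i := MuAt.unique hR hS hpure ⟨d', hd', he', i', hi', hD', rfl⟩
    ⟨d, hd, rfl, i, hi, hD, rfl⟩
  have hq : d'.q = d.q := by rw [q, q, he']
  have hδ : (0 : ℚ) < d.q * d.mu i - r := sub_pos.mpr hr
  obtain ⟨K₀, hK₀⟩ := exists_nat_gt ((n : ℚ) / (d.q * d.mu i - r))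
  obtain ⟨K, hK, hle⟩ := hd.exists_arc_le hd' he' hR hS hpure hi hi' (hD ▸ hD') hmu hred hr
    (K₀ := K₀) fun K _ => ordGE_arcWeight (hd'.ne_zero hi') hgood K
  have h1 : (K₀ : ℚ) ≤ K := by exact_mod_cast hK
  have h2 := hK₀.trans_le h1
  rw [div_lt_iff₀ hδ] at h2
  rw [hmu, hq] at hle
  linarith

/-- The order of `a_q` along a bad divisor and the degree of the lowest term that is not a `q`-th power
depend on the filtration only. -/
theorem RedAt.unique (hR : IsFiltration R) (hS : ∀ n, R n ≤ maximalIdeal O ^ n)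
    (hpure : HasPureRank k p R e) {r n r' n' : ℕ} (h : RedAt k p R E e D r n)
    (h' : RedAt k p R E e D r' n') : r = r' ∧ n = n' := by
  have key : ∀ {r n r' n' : ℕ}, RedAt k p R E e D r n → RedAt k p R E e D r' n' →
      r' ≤ r ∧ (r' = r → n' ≤ n) := by
    rintro r n r' n' ⟨d, hd, he, i, hi, hD, hr, hred⟩ ⟨d', hd', he', i', hi', hD', hr', hred'⟩
    have hmu : d'.mu i' = d.mu i := MuAt.unique hR hS hpure ⟨d', hd', he', i', hi', hD', rfl⟩
      ⟨d, hd, he, i, hi, hD, rfl⟩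
    obtain ⟨K, hK, hle⟩ := hd.exists_arc_le hd' (he'.trans he.symm) hR hS (he ▸ hpure) hi hi'
      (hD ▸ hD') hmu hred hr (K₀ := n + n' + 1) fun K hK => hred'.ordGE (hd'.ne_zero hi') (by omega)
    have h1 : K * r' + n' ≤ K * r + n := by exact_mod_cast hle
    refine ⟨?_, ?_⟩
    · by_contra! hlt
      nlinarith
    · rintro rfl
      omega
  have h1 := key h h'
  have h2 := key h' h
  have : r = r' := le_antisymm h2.1 h1.1
  exact ⟨this, le_antisymm (h2.2 this) (h1.2 this.symm)⟩

/-- After removing the `q`-th powers from the initial form of the last coefficient along a bad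
divisor, this initial form starts with a term that is not a `q`-th power. -/
theorem IsPreCase.exists_reduced (hd : d.IsPreCase R E) {i : Fin 3} (hi : i ∈ d.young)
    (had : d.WellAdaptedAlong i) (hbad : d.slope i < d.mu i) :
    ∃ (r n : ℕ) (b : MvPowerSeries (Fin 3) k) (hb : constantCoeff b = 0) (hz : b ∈ zFree k),
      d.slope i = (r : ℚ) / d.q ∧ (r : ℚ) < d.q * d.mu i ∧
      resOrd d.q (initAlong i d.lastCoef) = r + n ∧
      IsReduced (d.shift b hb hz).lastCoef d.q i r n := by
  classical
  have hq := q_pos d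
  have hq' : (0 : ℚ) < d.q := by exact_mod_cast hq
  have hi0 := hd.ne_zero hi
  have hqI : d.q ∈ Finset.Icc 1 d.q := Finset.mem_Icc.mpr ⟨hq, le_rfl⟩
  have hzF : d.lastCoef ∈ zFree k := hd.coef_xy _ hqI
  rcases (wellAdaptedAlong_iff d i).mp had with h | ⟨s, hs, hsd, hsc, hsF⟩
  · rw [slope, ordAlong_eq, slopeVal_eq_of_ordGE hq h] at hbad
    exact absurd hbad (lt_irrefl _)
  have hslope : d.slope i = (s i : ℚ) / d.q := by
    rw [slope, ordAlong_eq, slopeVal_eq_div hq hs hsF hsc, weight_single_one]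
  have hinit : ∀ t, coeff t (initAlong i d.lastCoef) =
      if t i = s i then coeff t d.lastCoef else 0 := by
    intro t
    rw [coeff_initAlong, weightedOrder_eq_of_ordGE hs hsF, ENat.toNat_natCast, weight_single_one,
      weight_single_one]
  rw [weight_single_one] at hsc hsF
  set r := s i with hr
  set G := initAlong i d.lastCoef with hG
  -- the lowest term of the initial form that is not a `q`-th power
  have hmem := Nat.sInf_mem (s := {n | ∃ t : Fin 3 →₀ ℕ, coeff t G ≠ 0 ∧ ¬ (∀ i, d.q ∣ t i) ∧
    n = t.degree}) ⟨_, s, by rw [hinit, if_pos rfl]; exact hs, hsd, rfl⟩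
  obtain ⟨t, ht, htd, hdeg⟩ := hmem
  change resOrd d.q G = _ at hdeg
  rw [hinit, ite_ne_right_iff] at ht
  have hdegree : ∀ u : Fin 3 →₀ ℕ, u 0 = 0 → u.degree = u i + u (other i) := by
    intro u hu
    rw [Finsupp.degree_eq_sum, Fin.sum_univ_three, hu, zero_add]
    obtain rfl | rfl : i = 1 ∨ i = 2 := by clear * - hi0; revert hi0; revert i; decide
    · rfl
    · exact add_comm _ _
  have htF := ht.2
  have ht0 := hzF t htF
  rw [hdegree t ht0, ht.1] at hdeg
  set n := t (other i) with hn
  have hGr : OrdGE (Pi.single i 1) r G := by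
    intro u hu
    rw [hinit, ite_ne_right_iff] at hu
    rw [weight_single_one, hu.1]
  have hbF : ∀ u, coeff u (qroot d.q G) ≠ 0 → coeff (d.q • u) d.lastCoef ≠ 0 := by
    intro u hu
    have := coeff_qroot_ne_zero hq hu
    rw [hinit, ite_ne_right_iff] at this
    exact this.2
  have hb : constantCoeff (qroot d.q G) = 0 := by
    by_contra h
    refine hbF 0 (by rwa [coeff_zero_eq_constantCoeff_apply]) ?_
    rw [smul_zero]
    exact mem_pow_iff.mp (hd.coef_mem hqI) 0 (by simpa using hq)
  have hz : qroot d.q G ∈ zFree k := by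
    intro u hu
    have h2 := hzF _ (hbF u hu)
    simpa [hq.ne'] using h2
  have hbr : OrdGE (Pi.single i 1) ((r : ℚ) / d.q) (-qroot d.q G) := (hGr.qroot hq).neg
  have hsum : OrdGE (Pi.single i 1) (r + 1 : ℕ)
      (∑ l ∈ Finset.Ico 1 d.q, d.coef l * (-qroot d.q G) ^ (d.q - l)) := by
    refine OrdGE.sum fun l hl u hu => ?_
    obtain ⟨hl1, hl2⟩ := Finset.mem_Ico.mp hl
    have h1 := ((hd.coef_ordGE hl1 hl2 hi).mul (hbr.pow (d.q - l))) u hu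
    rw [Nat.cast_sub hl2.le] at h1
    have h2 : (0 : ℚ) < d.mu i - r / d.q := by
      rw [sub_pos, div_lt_iff₀ hq', mul_comm]; exact hsc
    have h3 : d.mu i * l + (d.q - l : ℚ) * (r / d.q) = r + l * (d.mu i - r / d.q) := by
      field_simp; ring
    have hl0 : (0 : ℚ) < l := by exact_mod_cast hl1
    have h4 : (r : ℚ) < (Finsupp.weight (Pi.single i 1) u : ℕ) := by
      refine lt_of_lt_of_le ?_ h1
      rw [h3]; nlinarith
    have : r < Finsupp.weight (Pi.single i 1) u := by exact_mod_cast h4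
    exact_mod_cast this
  have hF' : ∀ u : Fin 3 →₀ ℕ, u i ≤ r → coeff u (d.shift _ hb hz).lastCoef =
      if u i = r then (if ∀ l, d.q ∣ u l then 0 else coeff u d.lastCoef) else 0 := by
    intro u hu
    have h1 : coeff u (∑ l ∈ Finset.Ico 1 d.q, d.coef l * (-qroot d.q G) ^ (d.q - l)) = 0 :=
      hsum.coeff_eq_zero (by rw [weight_single_one]; exact_mod_cast Nat.lt_succ_of_le hu)
    rw [shift_lastCoef hq, map_add, h1, add_zero]
    have e : (-qroot d.q G) ^ d.q + d.lastCoef =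
        ((-qroot d.q G) ^ d.q + G) + (d.lastCoef - G) := by ring
    have h2 := coeff_clean (p := p) (e := d.e) G u
    change coeff u ((-qroot d.q G) ^ d.q + G) = if ∀ l, d.q ∣ u l then 0 else coeff u G at h2
    rw [e, map_add, h2, map_sub, hinit]
    by_cases h3 : u i = r
    · rw [if_pos h3, if_pos h3, sub_self, add_zero]
    · have h4 : coeff u d.lastCoef = 0 := hsF.coeff_eq_zero (by
        rw [weight_single_one]
        exact_mod_cast lt_of_le_of_ne hu h3)
      rw [if_neg h3, if_neg h3, h4, ite_self, sub_zero, add_zero]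
  refine ⟨r, n, _, hb, hz, hslope, hsc, hdeg, fun u hu => ?_, ?_, ?_⟩
  · rcases le_or_gt (u i) r with hle | hlt
    · rw [hF' u hle, ite_ne_right_iff, ite_ne_left_iff] at hu
      obtain ⟨h1, h2, h3⟩ := hu
      refine ⟨h1.ge, fun _ => ?_⟩
      have h4 : resOrd d.q G ≤ u.degree :=
        Nat.sInf_le ⟨u, by rw [hinit, if_pos h1]; exact h3.symm, h2, rfl⟩
      rw [hdeg, hdegree u (hzF u h3.symm), h1] at h4
      omega
    · exact ⟨hlt.le, fun h => absurd h hlt.ne'⟩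
  · have e : Finsupp.single i r + Finsupp.single (other i) n = t := by
      ext l
      by_cases hl : l = 0
      · subst hl
        rw [ht0]; simp [hi0.symm, (other_ne hi0).1.symm]
      · rcases eq_or_other hi0 hl with rfl | rfl
        · simp [(other_ne hi0).2, ht.1]
        · simp [(other_ne hi0).2, hn]
    rw [e, hF' t ht.1.le, if_pos ht.1, if_neg htd]
    exact htF
  · rintro ⟨h1, h2⟩
    apply htd
    intro l
    by_cases hl : l = 0
    · subst hl; rw [ht0]; exact dvd_zero _
    · rcases eq_or_other hi0 hl with rfl | rfl
      · rw [ht.1]; exact h1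
      · exact h2

/-- Comparison of two data for the same filtration: a well-adapted datum computes the slope and
the residual order that can be read off from any reduced datum. -/
theorem IsPreCase.eq_of_redAt (hd : d.IsPreCase R E) (hR : IsFiltration R)
    (hS : ∀ n, R n ≤ maximalIdeal O ^ n) (hpure : HasPureRank k p R d.e) {i : Fin 3}
    (hi : i ∈ d.young) (had : d.WellAdaptedAlong i) {r n : ℕ}
    (h : RedAt k p R E d.e (Ideal.span {d.x i}) r n) :
    d.slope i < d.mu i ∧ d.slope i = (r : ℚ) / d.q ∧
      resOrd d.q (initAlong i d.lastCoef) = r + n := by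
  have hbad : d.slope i < d.mu i := lt_of_le_of_ne slopeVal_le fun h1 =>
    h.not_goodAt hR hS hpure ⟨d, hd, rfl, i, hi, rfl, ordGE_of_slope_eq (q_pos d) h1⟩
  obtain ⟨r', n', b, hb, hz, h1, h2, h3, h4⟩ := hd.exists_reduced hi had hbad
  have h5 : RedAt k p R E d.e (Ideal.span {d.x i}) r' n' :=
    ⟨d.shift b hb hz, hd.shift, rfl, i, hi, by rw [shift_x (hd.ne_zero hi)], h2, h4⟩
  obtain ⟨rfl, rfl⟩ := h5.unique hR hS hpure h
  exact ⟨hbad, h1, h3⟩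

theorem IsPreCase.slope_eq_of_goodAt (hd : d.IsPreCase R E) (hR : IsFiltration R)
    (hS : ∀ n, R n ≤ maximalIdeal O ^ n) (hpure : HasPureRank k p R d.e) {i : Fin 3}
    (hi : i ∈ d.young) (had : d.WellAdaptedAlong i)
    (h : GoodAt k p R E d.e (Ideal.span {d.x i})) : d.slope i = d.mu i := by
  by_contra hne
  obtain ⟨r, n, b, hb, hz, h1, h2, h3, h4⟩ :=
    hd.exists_reduced hi had (lt_of_le_of_ne slopeVal_le hne)
  have h5 : RedAt k p R E d.e (Ideal.span {d.x i}) r n :=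
    ⟨d.shift b hb hz, hd.shift, rfl, i, hi, by rw [shift_x (hd.ne_zero hi)], h2, h4⟩
  exact h5.not_goodAt hR hS hpure h

end MonomialDatum

end Idealistic

namespace Idealistic

open MvPowerSeries IsLocalRing

/-! ### Coordinates after a blow-up -/

namespace MonomialDatum

variable {k : Type*} {p : ℕ} {O O' : Type*} [Field k] [CommRing O] [Algebra k O] [CommRing O']
  [Algebra k O']

/-- The blow-up `φ` in the coordinates of the datum `d` and coordinates `X'` of the new local ring:
`φ z = x_i' z'`, `φ x_i = x_i'` and `φ x_j = x_i' ^ κ (x_j' + c)`, where `κ = 1` if the point is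
blown up and `κ = 0` if the curve `V(z, x_i)` is blown up. -/
structure IsChart (d : MonomialDatum k p O) (φ : O →ₐ[k] O') (exc : O') (i : Fin 3) (κ : ℕ) (c : k)
    (X' : MvPowerSeries (Fin 3) k ≃ₐ[k] O') : Prop where
  exc : ∃ w, IsUnit w ∧ X' (MvPowerSeries.X i) = exc * w
  zero : φ (d.x 0) = X' (MvPowerSeries.X i) * X' (MvPowerSeries.X 0)
  self : φ (d.x i) = X' (MvPowerSeries.X i)
  other : φ (d.x (other i)) = X' (MvPowerSeries.X i) ^ κ * (X' (MvPowerSeries.X (other i)) + algebraMap k O' c)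

theorem x_mem [IsLocalRing O] (d : MonomialDatum k p O) (i : Fin 3) : d.x i ∈ maximalIdeal O :=
  (map_mem_maximalIdeal d.X).mpr (constantCoeff_X i)

theorem exists_eq_sum_x [IsLocalRing O] (d : MonomialDatum k p O) {f : O} (hf : f ∈ maximalIdeal O) :
    ∃ g : Fin 3 → O, f = ∑ i, g i * d.x i := by
  obtain ⟨f, rfl⟩ := d.X.surjective f
  rw [map_mem_maximalIdeal] at hf
  obtain ⟨g, -, hg⟩ := exists_eq_sum_mul_X (n := 0) (f := f) fun s hs => by
    rw [zero_add, Nat.lt_one_iff, Finsupp.degree_eq_zero_iff] at hs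
    rw [hs, coeff_zero_eq_constantCoeff_apply, hf]
  refine ⟨fun i => d.X (g i), ?_⟩
  nth_rewrite 1 [hg]
  rw [map_sum]
  simp [x]

theorem maximalIdeal_eq_span [IsLocalRing O] (d : MonomialDatum k p O) :
    maximalIdeal O = Ideal.span (Set.range d.x) := by
  refine le_antisymm (fun f hf => ?_) (Ideal.span_le.mpr ?_)
  · obtain ⟨g, rfl⟩ := d.exists_eq_sum_x hf
    exact Ideal.sum_mem _ fun i _ => Ideal.mul_mem_left _ _ (Ideal.subset_span ⟨i, rfl⟩)
  · rintro _ ⟨i, rfl⟩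
    exact d.x_mem i

variable [IsLocalRing O] [IsLocalRing O']

theorem exists_sub_algebraMap_mem (d : MonomialDatum k p O) (f : O) :
    ∃ a : k, f - algebraMap k O a ∈ maximalIdeal O := by
  obtain ⟨f, rfl⟩ := d.X.surjective f
  refine ⟨constantCoeff f, ?_⟩
  rw [← d.X.commutes, ← map_sub, map_mem_maximalIdeal, map_sub, ← c_eq_algebraMap,
    constantCoeff_C, sub_self]

theorem isLocal_algHom (d : MonomialDatum k p O) (v : MvPowerSeries (Fin 3) k ≃ₐ[k] O')
    (φ : O →ₐ[k] O') {f : O} (hf : f ∈ maximalIdeal O) : φ f ∈ maximalIdeal O' := by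
  obtain ⟨f, rfl⟩ := d.X.surjective f
  rw [map_mem_maximalIdeal] at hf
  have h1 := constantCoeff_algHom
    ((v.symm : O' →ₐ[k] MvPowerSeries (Fin 3) k).comp (φ.comp (d.X : _ →ₐ[k] O))) f
  rw [hf] at h1
  have h2 := (map_mem_maximalIdeal v).mpr h1
  have h3 : v (((v.symm : O' →ₐ[k] MvPowerSeries (Fin 3) k).comp (φ.comp (d.X : _ →ₐ[k] O))) f) = φ (d.X f) :=
    v.apply_symm_apply _
  rwa [h3] at h2

/-- The elements `x_i'`, `x_j'` and `z'` read off from the blow-up form a regular system of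
parameters. -/
theorem exists_chart_of_unit (d : MonomialDatum k p O) {u : MvPowerSeries (Fin 3) k ≃ₐ[k] O}
    {v : MvPowerSeries (Fin 3) k ≃ₐ[k] O'} {φ : O →ₐ[k] O'} {J : Finset (Fin 3)} {j₀ : Fin 3}
    (hJ : ∀ l ∈ J, l ≠ j₀ → φ (u (MvPowerSeries.X l)) = v (MvPowerSeries.X j₀) * v (MvPowerSeries.X l))
    (hJ' : ∀ l, l ∉ J → φ (u (MvPowerSeries.X l)) = v (MvPowerSeries.X l))
    {T : Set O} (hT : Ideal.span {f | ∃ l ∈ J, f = u (MvPowerSeries.X l)} = Ideal.span T)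
    {i : Fin 3} (hi : i ≠ 0) {κ : ℕ} {c : k} {w z' y' : O'} (hw : IsUnit w)
    (hz' : z' ∈ maximalIdeal O') (hy' : y' ∈ maximalIdeal O')
    (hx0 : φ (d.x 0) = v (MvPowerSeries.X j₀) * w * z') (hxi : φ (d.x i) = v (MvPowerSeries.X j₀) * w)
    (hxj : φ (d.x (Idealistic.other i)) = (v (MvPowerSeries.X j₀) * w) ^ κ * (y' + algebraMap k O' c))
    (hκ : κ = 0 → c = 0)
    (hTf : ∀ f ∈ T, ∃ g a, φ f = v (MvPowerSeries.X j₀) * g ∧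
      g - algebraMap k O' a * w ∈ Ideal.span {v (MvPowerSeries.X j₀) * w, y', z'}) :
    ∃ X', d.IsChart φ (v (MvPowerSeries.X j₀)) i κ c X' := by
  set exc := v (MvPowerSeries.X j₀) with hexc
  set 𝔞 := Ideal.span {exc * w, y', z'} with h𝔞
  have m1 : exc * w ∈ 𝔞 := Ideal.subset_span (by simp)
  have m2 : y' ∈ 𝔞 := Ideal.subset_span (by simp)
  have m3 : z' ∈ 𝔞 := Ideal.subset_span (by simp)
  have mexc : exc ∈ 𝔞 := by
    obtain ⟨w, rfl⟩ := hw
    have := Ideal.mul_mem_right (↑w⁻¹ : O') _ m1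
    rwa [mul_assoc, Units.mul_inv, mul_one] at this
  have hexcm : exc ∈ maximalIdeal O' := (map_mem_maximalIdeal v).mpr (constantCoeff_X j₀)
  have h𝔞m : 𝔞 ≤ maximalIdeal O' := by
    rw [h𝔞, Ideal.span_le]
    rintro f (rfl | rfl | rfl)
    · exact Ideal.mul_mem_right _ _ hexcm
    · exact hy'
    · exact hz'
  have : IsDomain (MvPowerSeries (Fin 3) k) := NoZeroDivisors.to_isDomain _
  have hdom : IsDomain O' := v.symm.toMulEquiv.isDomain
  have hexc0 : exc ≠ 0 := by
    rw [hexc, Ne, map_eq_zero_iff _ v.injective]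
    exact (X_prime j₀).ne_zero
  have hm : ∀ f ∈ maximalIdeal O, φ f ∈ 𝔞 := by
    intro f hf
    obtain ⟨g, rfl⟩ := d.exists_eq_sum_x hf
    rw [map_sum]
    refine Ideal.sum_mem _ fun l _ => ?_
    rw [map_mul]
    refine Ideal.mul_mem_left _ _ ?_
    by_cases hl : l = 0
    · subst hl; rw [hx0]; exact Ideal.mul_mem_left _ _ m3
    · rcases eq_or_other hi hl with rfl | rfl
      · rw [hxi]; exact m1
      · rw [hxj]
        rcases Nat.eq_zero_or_pos κ with h0 | h0
        · rw [hκ h0, h0, pow_zero, one_mul, map_zero, add_zero]; exact m2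
        · exact Ideal.mul_mem_right _ _ (Ideal.pow_mem_of_mem _ m1 _ h0)
  have hC : ∀ f ∈ Ideal.span T, ∃ g a, φ f = exc * g ∧ g - algebraMap k O' a * w ∈ 𝔞 := by
    intro f hf
    induction hf using Submodule.span_induction with
    | mem f hf => exact hTf f hf
    | zero => exact ⟨0, 0, by simp, by simp⟩
    | add f f' _ _ h h' =>
      obtain ⟨g, a, h1, h2⟩ := h
      obtain ⟨g', a', h1', h2'⟩ := h'
      refine ⟨g + g', a + a', by rw [map_add, h1, h1', mul_add], ?_⟩
      rw [map_add]
      convert Ideal.add_mem _ h2 h2' using 1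
      ring
    | smul r f _ h =>
      obtain ⟨g, a, h1, h2⟩ := h
      obtain ⟨b, hb⟩ := d.exists_sub_algebraMap_mem r
      refine ⟨φ r * g, b * a, by rw [smul_eq_mul, map_mul, h1]; ring, ?_⟩
      have h3 := hm _ hb
      rw [map_sub, AlgHom.commutes] at h3
      have e : φ r * g - algebraMap k O' (b * a) * w = φ r * (g - algebraMap k O' a * w) +
          (φ r - algebraMap k O' b) * (algebraMap k O' a * w) := by rw [map_mul]; ring
      rw [e]
      exact Ideal.add_mem _ (Ideal.mul_mem_left _ _ h2) (Ideal.mul_mem_right _ _ h3)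
  have hspan : ∀ l, v (MvPowerSeries.X l) ∈ 𝔞 := by
    intro l
    by_cases hlJ : l ∈ J
    · by_cases hl : l = j₀
      · rw [hl]; exact mexc
      · have h1 : u (MvPowerSeries.X l) ∈ Ideal.span T := hT ▸ Ideal.subset_span ⟨l, hlJ, rfl⟩
        obtain ⟨g, a, h2, h3⟩ := hC _ h1
        rw [hJ l hlJ hl] at h2
        have h4 := mul_left_cancel₀ hexc0 h2
        rw [← h4] at h3
        have h5 : algebraMap k O' a * w ∈ maximalIdeal O' := by
          have h6 := Ideal.sub_mem _ ((map_mem_maximalIdeal v).mpr (constantCoeff_X l)) (h𝔞m h3)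
          rwa [sub_sub_cancel] at h6
        have ha : a = 0 := by
          by_contra ha
          have : IsUnit (algebraMap k O' a * w) := ((isUnit_iff_ne_zero.mpr ha).map _).mul hw
          exact (mem_maximalIdeal _).mp h5 this
        rw [ha, map_zero, zero_mul, sub_zero] at h3
        exact h3
    · rw [← hJ' l hlJ]
      exact hm _ ((map_mem_maximalIdeal u).mpr (constantCoeff_X l))
  let F : Fin 3 → O' := fun l => if l = 0 then z' else if l = i then exc * w else y'
  have hF0 : F 0 = z' := if_pos rfl
  have hFi : F i = exc * w := by simp [F, hi]
  have hFj : F (Idealistic.other i) = y' := by simp [F, other_ne hi]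
  have hFm : ∀ l, F l ∈ maximalIdeal O' := by
    intro l
    by_cases hl : l = 0
    · subst hl; rw [hF0]; exact hz'
    · rcases eq_or_other hi hl with rfl | rfl
      · rw [hFi]; exact Ideal.mul_mem_right _ _ hexcm
      · rw [hFj]; exact hy'
  have hrange : 𝔞 ≤ Ideal.span (Set.range F) := by
    rw [h𝔞, Ideal.span_le]
    rintro f (rfl | rfl | rfl)
    · exact hFi ▸ Ideal.subset_span ⟨i, rfl⟩
    · rw [← hFj]; exact Ideal.subset_span ⟨_, rfl⟩
    · rw [← hF0]; exact Ideal.subset_span ⟨_, rfl⟩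
  obtain ⟨X', hX'⟩ := exists_coords v F (fun l => by
    rw [← map_mem_maximalIdeal v, AlgEquiv.apply_symm_apply]; exact hFm l)
    fun l => hrange (hspan l)
  refine ⟨X', ⟨w, hw, by rw [hX', hFi]⟩, ?_, ?_, ?_⟩
  · rw [hX', hX', hFi, hF0, hx0]
  · rw [hX', hFi, hxi]
  · rw [hX', hX', hFi, hFj, hxj]

end MonomialDatum

end Idealistic

namespace Idealistic

open MvPowerSeries IsLocalRing

section Symbolic

variable {k : Type*} [Field k]

/-- The weights for which the ideal of the curve `V(z, x_i)` consists of the series of positive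
order. -/
def curveWeight (i : Fin 3) : Fin 3 → ℕ := fun l => if l = 0 then 1 else if l = i then 1 else 0

theorem weight_curveWeight {i : Fin 3} (hi : i ≠ 0) (s : Fin 3 →₀ ℕ) :
    Finsupp.weight (curveWeight i) s = s 0 + s i := by
  rw [Finsupp.weight_apply, Finsupp.sum_fintype _ _ (fun i => by simp), Fin.sum_univ_three]
  obtain rfl | rfl : i = 1 ∨ i = 2 := by revert hi; revert i; decide
  · simp [curveWeight]
  · simp [curveWeight]

theorem mem_curve_iff {i : Fin 3} (hi : i ≠ 0) {f : MvPowerSeries (Fin 3) k} :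
    f ∈ Ideal.span {X 0, X i} ↔ OrdGE (curveWeight i) (1 : ℕ) f := by
  classical
  have hX : ∀ l, l = 0 ∨ l = i → OrdGE (curveWeight i) (1 : ℕ) (X l : MvPowerSeries (Fin 3) k) := by
    intro l hl
    have := ordGE_X_pow (k := k) (w := curveWeight i) l 1
    have e : curveWeight i l = 1 := by rcases hl with rfl | rfl <;> simp [curveWeight]
    rwa [e, pow_one] at this
  constructor
  · rw [Ideal.mem_span_pair]
    rintro ⟨a, b, rfl⟩
    exact (hX 0 (Or.inl rfl)).mul_left.add (hX i (Or.inr rfl)).mul_left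
  · intro hf
    let g : MvPowerSeries (Fin 3) k := fun s => if s 0 = 0 then coeff s f else 0
    have hg : ∀ s, coeff s g = if s 0 = 0 then coeff s f else 0 := fun s => rfl
    have h1 : X i ∣ g := by
      rw [← pow_one (X i), X_pow_dvd_iff]
      intro s hs
      rw [hg, ite_eq_right_iff]
      intro h0
      refine hf.coeff_eq_zero ?_
      rw [weight_curveWeight hi]
      exact_mod_cast (by omega : s 0 + s i < 1)
    have h2 : X 0 ∣ f - g := by
      rw [← pow_one (X 0), X_pow_dvd_iff]
      intro s hs
      rw [map_sub, hg, if_pos (by omega), sub_self]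
    have e : f = (f - g) + g := by ring
    rw [e]
    refine Ideal.add_mem _ (Ideal.mem_of_dvd _ h2 (Ideal.subset_span (by simp)))
      (Ideal.mem_of_dvd _ h1 (Ideal.subset_span (by simp)))

theorem isPrime_curve {i : Fin 3} (hi : i ≠ 0) :
    (Ideal.span {X 0, X i} : Ideal (MvPowerSeries (Fin 3) k)).IsPrime := by
  refine ⟨fun h => ?_, fun {a b} hab => ?_⟩
  · rw [Ideal.eq_top_iff_one, mem_curve_iff hi] at h
    have := h 0 (by rw [coeff_zero_one]; exact one_ne_zero)
    simp at this
    linarith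
  · rw [mem_curve_iff hi, ordGE_nat_iff, weightedOrder_mul] at hab
    rw [mem_curve_iff hi, mem_curve_iff hi, ordGE_nat_iff, ordGE_nat_iff]
    by_contra! h
    rw [Nat.cast_one, Order.lt_one_iff, Order.lt_one_iff] at h
    simp [h.1, h.2] at hab

theorem ordGE_of_mem_curve_pow {i : Fin 3} (hi : i ≠ 0) {n : ℕ} {f : MvPowerSeries (Fin 3) k}
    (hf : f ∈ (Ideal.span {X 0, X i} : Ideal (MvPowerSeries (Fin 3) k)) ^ n) :
    OrdGE (curveWeight i) n f := by
  induction n generalizing f with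
  | zero => exact OrdGE.of_nonpos (by simp)
  | succ n ih =>
    rw [pow_succ] at hf
    refine Submodule.mul_induction_on hf (fun a ha b hb => ?_) fun a b ha hb => ha.add hb
    exact ((ih ha).mul ((mem_curve_iff hi).mp hb)).mono (by push_cast; exact le_rfl)

end Symbolic

namespace MonomialDatum

variable {k : Type*} {p : ℕ} {O O' : Type*} [Field k] [CommRing O] [Algebra k O] [CommRing O']
  [Algebra k O']

/-- If the curve `V(z, x_i)` lies in `Sing(R)`, the elements of level `n` have order at least `n`
along it. -/
theorem ordGE_of_curve_subset (d : MonomialDatum k p O) {R : ℕ → Ideal O} {i : Fin 3} (hi : i ≠ 0)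
    (hsing : PrimeSpectrum.zeroLocus (d.curve i : Set O) ⊆ singLocus R) {n : ℕ}
    {f : MvPowerSeries (Fin 3) k} (hf : d.X f ∈ R n) : OrdGE (curveWeight i) n f := by
  have : IsDomain (MvPowerSeries (Fin 3) k) := NoZeroDivisors.to_isDomain _
  have : IsDomain O := d.X.symm.toMulEquiv.isDomain
  have hcomap : d.curve i =
      (Ideal.span {MvPowerSeries.X 0, MvPowerSeries.X i}).comap (d.X.symm : O →+* MvPowerSeries (Fin 3) k) := by
    have h1 : d.curve i = (Ideal.span {MvPowerSeries.X 0, MvPowerSeries.X i}).map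
        (d.X : MvPowerSeries (Fin 3) k →+* O) := by
      rw [Ideal.map_span, curve, Set.image_pair]; rfl
    rw [h1]
    exact (Ideal.comap_symm (d.X : MvPowerSeries (Fin 3) k ≃+* O)).symm
  have hprime : (d.curve i).IsPrime := by
    have := isPrime_curve (k := k) hi
    rw [hcomap]; exact Ideal.comap_isPrime _ _
  have hmem : ∀ g, d.X g ∈ d.curve i ↔ g ∈ Ideal.span {MvPowerSeries.X 0, MvPowerSeries.X i} := by
    intro g
    rw [hcomap, Ideal.mem_comap]
    change d.X.symm (d.X g) ∈ _ ↔ _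
    rw [AlgEquiv.symm_apply_apply]
  have h1 : (⟨d.curve i, hprime⟩ : PrimeSpectrum O) ∈ singLocus R :=
    hsing ((PrimeSpectrum.mem_zeroLocus _ _).mpr le_rfl)
  have h2 := h1 n (Ideal.mem_map_of_mem _ hf)
  change _ ∈ maximalIdeal (Localization.AtPrime (d.curve i)) ^ n at h2
  rw [← Localization.AtPrime.map_eq_maximalIdeal, ← Ideal.map_pow,
    IsLocalization.mem_map_algebraMap_iff (d.curve i).primeCompl] at h2
  obtain ⟨⟨⟨g, hg⟩, ⟨t, ht⟩⟩, h3⟩ := h2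
  dsimp only at h3
  rw [← map_mul] at h3
  have h4 := IsLocalization.injective (Localization.AtPrime (d.curve i))
    (d.curve i).primeCompl_le_nonZeroDivisors h3
  obtain ⟨t, rfl⟩ := d.X.surjective t
  obtain ⟨g, rfl⟩ := d.X.surjective g
  have hg' : g ∈ (Ideal.span {MvPowerSeries.X 0, MvPowerSeries.X i}) ^ n := by
    have e : d.curve i ^ n = ((Ideal.span {MvPowerSeries.X 0, MvPowerSeries.X i}) ^ n).map
        (d.X : MvPowerSeries (Fin 3) k →+* O) := by
      rw [Ideal.map_pow, Ideal.map_span, curve, Set.image_pair]; rfl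
    rw [e] at hg
    have h5 := (Ideal.comap_symm (I := (Ideal.span {MvPowerSeries.X 0, MvPowerSeries.X i}) ^ n)
      (d.X : MvPowerSeries (Fin 3) k ≃+* O)).symm ▸ hg
    have h6 : d.X.symm (d.X g) ∈ (Ideal.span {MvPowerSeries.X 0, MvPowerSeries.X i}) ^ n := h5
    rwa [AlgEquiv.symm_apply_apply] at h6
  have ht' : ¬ OrdGE (curveWeight i) (1 : ℕ) t := by
    rw [← mem_curve_iff hi, ← hmem]; exact ht
  rw [← map_mul, d.X.injective.eq_iff] at h4
  have h5 := ordGE_of_mem_curve_pow hi hg'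
  rw [← h4, ordGE_nat_iff, weightedOrder_mul] at h5
  rw [ordGE_nat_iff, not_le, Nat.cast_one, Order.lt_one_iff] at ht'
  rw [ordGE_nat_iff]
  simpa [ht'] using h5

theorem IsBlowupGerm.exc_dvd {φ : O →ₐ[k] O'} {exc : O'} {C : Ideal O}
    (hb : IsBlowupGerm φ C exc) {f : O} (hf : f ∈ C) :
    exc ∣ φ f := by
  obtain ⟨u, v, J, j₀, -, hj₀, hC, hexc, h1, h2, h3⟩ := hb
  rw [hC] at hf
  have : C.map φ ≤ Ideal.span {exc} := by
    rw [hC, Ideal.map_span, Ideal.span_le]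
    rintro _ ⟨_, ⟨l, hl, rfl⟩, rfl⟩
    by_cases hlj : l = j₀
    · rw [hlj, h1, hexc]; exact Ideal.mem_span_singleton_self _
    · rw [h2 l hl hlj, hexc]
      exact Ideal.mem_span_singleton.mpr (dvd_mul_right _ _)
  exact Ideal.mem_span_singleton.mp (this (Ideal.mem_map_of_mem φ (hC ▸ hf)))

theorem IsBlowupGerm.isDomain {φ : O →ₐ[k] O'} {exc : O'} [IsLocalRing O'] {C : Ideal O}
    (hb : IsBlowupGerm φ C exc) :
    IsDomain O' ∧ exc ≠ 0 ∧ exc ∈ maximalIdeal O' := by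
  obtain ⟨u, v, J, j₀, -, hj₀, hC, hexc, -⟩ := hb
  have : IsDomain (MvPowerSeries (Fin 3) k) := NoZeroDivisors.to_isDomain _
  refine ⟨v.symm.toMulEquiv.isDomain, ?_, ?_⟩
  · rw [hexc, Ne, map_eq_zero_iff _ v.injective]
    exact (X_prime j₀).ne_zero
  · rw [hexc]
    exact (map_mem_maximalIdeal v).mpr (constantCoeff_X j₀)

variable [IsLocalRing O] [IsLocalRing O'] {d : MonomialDatum k p O} {R : ℕ → Ideal O}
  {E : Set (Ideal O)}

/-- As the initial form of `h` is `z ^ q`, the coefficient `a_l` has order greater than `l`. -/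
theorem IsPreCase.coef_mem_succ (hd : d.IsPreCase R E)
    (hinit : d.h - d.x 0 ^ d.q ∈ maximalIdeal O ^ (d.q + 1)) {l : ℕ} (hl : l ∈ Finset.Icc 1 d.q) :
    d.coef l ∈ maximalIdeal (MvPowerSeries (Fin 3) k) ^ (l + 1) := by
  classical
  have e : d.h - d.x 0 ^ d.q = d.X (d.hS - MvPowerSeries.X 0 ^ d.q) := by
    rw [map_sub, X_hS, map_pow]; rfl
  rw [e, map_mem_maximalIdeal_pow] at hinit
  refine mem_pow_of_order fun s hs => ?_
  by_contra hne
  have hs0 := hd.coef_xy l hl s hne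
  have hl' := Finset.mem_Icc.mp hl
  have e := coeff_hS d hd.coef_xy hl (s := s + Finsupp.single 0 (d.q - l)) (by simp [hs0])
  rw [Finsupp.erase_add, Finsupp.erase_single, add_zero, erase_zero_of_zero hs0] at e
  have h1 := mem_pow_iff.mp hinit (s + Finsupp.single 0 (d.q - l)) (by
    rw [map_add, Finsupp.degree_single]; omega)
  rw [map_sub, e, coeff_X_pow, if_neg, sub_zero] at h1
  · exact hne h1
  · intro h
    have := DFunLike.congr_fun h 0
    simp [hs0] at this
    omega

/-- If `V(z, x_i) ⊂ Sing(R)`, then `h` has order `q` along this curve. -/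
theorem IsPreCase.dvd_coef_of_curve (hd : d.IsPreCase R E) {i : Fin 3} (hi : i ≠ 0)
    (hsing : PrimeSpectrum.zeroLocus (d.curve i : Set O) ⊆ singLocus R) {l : ℕ}
    (hl : l ∈ Finset.Icc 1 d.q) : MvPowerSeries.X i ^ l ∣ d.coef l := by
  have h1 := d.ordGE_of_curve_subset hi hsing (f := d.hS) (by rw [X_hS]; exact hd.h_mem)
  rw [X_pow_dvd_iff]
  intro s hs
  by_contra hne
  have hs0 := hd.coef_xy l hl s hne
  have hl' := Finset.mem_Icc.mp hl
  have e := coeff_hS d hd.coef_xy hl (s := s + Finsupp.single 0 (d.q - l)) (by simp [hs0])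
  rw [Finsupp.erase_add, Finsupp.erase_single, add_zero, erase_zero_of_zero hs0] at e
  have h2 := h1 _ (e ▸ hne)
  rw [weight_curveWeight hi] at h2
  have h3 : d.q ≤ s 0 + (d.q - l) + s i := by
    have : d.q ≤ (s + Finsupp.single 0 (d.q - l) : Fin 3 →₀ ℕ) 0 +
        (s + Finsupp.single 0 (d.q - l) : Fin 3 →₀ ℕ) i := by exact_mod_cast h2
    simpa [hi.symm] using this
  omega

/-- If `V(z, x_i) ⊂ Sing(R)`, then `μ(ξ_D) ≥ 1` for `D = {x_i = 0}`. -/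
theorem IsPreCase.le_m_of_curve (hd : d.IsPreCase R E) {i : Fin 3} (hi : i ∈ d.young)
    (hsing : PrimeSpectrum.zeroLocus (d.curve i : Set O) ⊆ singLocus R) : d.a ≤ d.m i := by
  have hi0 := hd.ne_zero hi
  have hM := hd.monomial_mem
  rw [M_eq] at hM
  have h1 := d.ordGE_of_curve_subset hi0 hsing hM _ (by
    rw [coeff_monomial_same]; exact one_ne_zero)
  rw [weight_curveWeight hi0] at h1
  have h2 := Nat.cast_le.mp h1
  rw [Finsupp.finsetSum_apply, Finsupp.finsetSum_apply, Finset.sum_eq_zero, zero_add,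
    Finset.sum_eq_single i] at h2
  · simpa using h2
  · intro l _ hl
    exact Finsupp.single_eq_of_ne hl.symm
  · intro h; exact absurd hi h
  · intro l hl
    exact Finsupp.single_eq_of_ne (hd.ne_zero hl).symm

section Charts

variable {φ : O →ₐ[k] O'} {exc : O'}

/-- The new point lies on the strict transform of `{z = 0}`. -/
theorem IsPreCase.z_mem (hd : d.IsPreCase R E) (hq : 0 < d.q)
    (hS' : ∀ n, transformFiltration φ exc R n ≤ maximalIdeal O' ^ n) {z₁ : O'}
    (hz : φ (d.x 0) = exc * z₁)
    (ht : ∀ l ∈ Finset.Icc 1 d.q, ∃ t ∈ maximalIdeal O', φ (d.X (d.coef l)) = exc ^ l * t) :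
    z₁ ∈ maximalIdeal O' := by
  choose! t ht1 ht2 using ht
  have hh : φ d.h = exc ^ d.q * (z₁ ^ d.q + ∑ l ∈ Finset.Icc 1 d.q, t l * z₁ ^ (d.q - l)) := by
    rw [h, map_add, map_pow, hz, map_sum, mul_add, mul_pow, Finset.mul_sum]
    congr 1
    refine Finset.sum_congr rfl fun l hl => ?_
    have e : d.q = l + (d.q - l) := by have := Finset.mem_Icc.mp hl; omega
    rw [map_mul, map_pow, hz, ht2 l hl, mul_pow]
    nth_rewrite 3 [e]
    rw [pow_add]; ring
  have h1 := hS' d.q (Ideal.subset_span ⟨d.q, le_rfl, d.h, hd.h_mem, hh⟩)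
  have h2 := Ideal.pow_le_self hq.ne' h1
  have h3 : ∑ l ∈ Finset.Icc 1 d.q, t l * z₁ ^ (d.q - l) ∈ maximalIdeal O' :=
    Ideal.sum_mem _ fun l hl => Ideal.mul_mem_right _ _ (ht1 l hl)
  have h4 := Ideal.sub_mem _ h2 h3
  rw [add_sub_cancel_right] at h4
  exact Ideal.IsPrime.mem_of_pow_mem (maximalIdeal.isMaximal O').isPrime _ h4

theorem IsPreCase.z_mem_point (hd : d.IsPreCase R E) (hq : 0 < d.q)
    (hinit : d.h - d.x 0 ^ d.q ∈ maximalIdeal O ^ (d.q + 1))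
    (hb : IsBlowupGerm φ (maximalIdeal O) exc)
    (hS' : ∀ n, transformFiltration φ exc R n ≤ maximalIdeal O' ^ n) {z₁ : O'}
    (hz : φ (d.x 0) = exc * z₁) : z₁ ∈ maximalIdeal O' := by
  obtain ⟨hdom, hexc0, hexcm⟩ := IsBlowupGerm.isDomain hb
  refine hd.z_mem hq hS' hz fun l hl => ?_
  have h1 := (map_mem_maximalIdeal_pow d.X).mpr (hd.coef_mem_succ hinit hl)
  have h2 : (maximalIdeal O).map φ ≤ Ideal.span {exc} := by
    rw [Ideal.map_le_iff_le_comap]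
    exact fun f hf => Ideal.mem_span_singleton.mpr (IsBlowupGerm.exc_dvd hb hf)
  have h3 := Ideal.mem_map_of_mem φ h1
  rw [Ideal.map_pow] at h3
  have h4 := Ideal.pow_right_mono h2 _ h3
  rw [Ideal.span_singleton_pow, Ideal.mem_span_singleton] at h4
  obtain ⟨s, hs⟩ := h4
  exact ⟨exc * s, Ideal.mul_mem_right _ _ hexcm, by rw [hs, pow_succ]; ring⟩

/-- The chart of the blow-up of the closed point in which `x_i` generates the exceptional ideal. -/
theorem IsPreCase.point_chart (hd : d.IsPreCase R E) (hq : 0 < d.q)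
    (hinit : d.h - d.x 0 ^ d.q ∈ maximalIdeal O ^ (d.q + 1))
    (hb : IsBlowupGerm φ (maximalIdeal O) exc)
    (hS' : ∀ n, transformFiltration φ exc R n ≤ maximalIdeal O' ^ n) {i : Fin 3} (hi : i ≠ 0)
    {w y' : O'} {c : k} (hw : IsUnit w) (hxi : φ (d.x i) = exc * w) (hy' : y' ∈ maximalIdeal O')
    (hxj : φ (d.x (Idealistic.other i)) = φ (d.x i) * (y' + algebraMap k O' c)) :
    ∃ X', d.IsChart φ exc i 1 c X' := by
  obtain ⟨z₁, hz₁⟩ := IsBlowupGerm.exc_dvd hb (d.x_mem 0)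
  have hz₁m := hd.z_mem_point hq hinit hb hS' hz₁
  obtain ⟨u, v, J, j₀, -, hj₀, hC, rfl, h1, h2, h3⟩ := hb
  obtain ⟨w, rfl⟩ := hw
  set exc := v (MvPowerSeries.X j₀)
  have hz' : z₁ = w * (↑w⁻¹ * z₁) := by rw [← mul_assoc, Units.mul_inv, one_mul]
  refine d.exists_chart_of_unit h2 h3 (T := Set.range d.x) ?_ hi w.isUnit
    (z' := ↑w⁻¹ * z₁) (Ideal.mul_mem_left _ _ hz₁m) hy' ?_ hxi ?_ (by simp) ?_
  · rw [← hC, d.maximalIdeal_eq_span]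
  · rw [hz₁, mul_assoc, ← hz']
  · rw [hxj, hxi, pow_one]
  · rintro _ ⟨l, rfl⟩
    by_cases hl : l = 0
    · subst hl
      refine ⟨z₁, 0, hz₁, ?_⟩
      rw [map_zero, zero_mul, sub_zero, hz']
      exact Ideal.mul_mem_left _ _ (Ideal.subset_span (by simp))
    · rcases eq_or_other hi hl with rfl | rfl
      · exact ⟨w, 1, hxi, by simp⟩
      · refine ⟨w * (y' + algebraMap k O' c), c, by rw [hxj, hxi, mul_assoc], ?_⟩
        have e : (w : O') * (y' + algebraMap k O' c) - algebraMap k O' c * w = w * y' := by ring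
        rw [e]
        exact Ideal.mul_mem_left _ _ (Ideal.subset_span (by simp))

/-- A chart for the blow-up of the closed point.  The parameter `x_i` that defines the exceptional
divisor is a given one unless the new point lies on the strict transform of that one. -/
theorem IsPreCase.exists_point_chart (hd : d.IsPreCase R E) (hq : 0 < d.q) {l₀ : Fin 3} (hl₀ : l₀ ≠ 0)
    (hinit : d.h - d.x 0 ^ d.q ∈ maximalIdeal O ^ (d.q + 1))
    (hb : IsBlowupGerm φ (maximalIdeal O) exc)
    (hS' : ∀ n, transformFiltration φ exc R n ≤ maximalIdeal O' ^ n) :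
    ∃ i, i ≠ 0 ∧ ∃ c X', d.IsChart φ exc i 1 c X' ∧ (i = l₀ ∨ c = 0) := by
  obtain ⟨hdom, hexc0, hexcm⟩ := IsBlowupGerm.isDomain hb
  choose w hw using fun l => IsBlowupGerm.exc_dvd hb (d.x_mem l)
  have hz₁m := hd.z_mem_point hq hinit hb hS' (hw 0)
  have hunit : ∃ i, i ≠ 0 ∧ IsUnit (w i) := by
    by_contra! hcon
    obtain ⟨u, v, J, j₀, -, hj₀, hC, rfl, h1, h2, h3⟩ := hb
    obtain ⟨g, hg⟩ := d.exists_eq_sum_x (f := u (MvPowerSeries.X j₀))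
      ((map_mem_maximalIdeal u).mpr (constantCoeff_X j₀))
    have h4 := congrArg φ hg
    rw [h1, map_sum] at h4
    have h5 : v (MvPowerSeries.X j₀) * 1 = v (MvPowerSeries.X j₀) * ∑ l, φ (g l) * w l := by
      rw [mul_one, Finset.mul_sum]
      nth_rewrite 1 [h4]
      refine Finset.sum_congr rfl fun l _ => ?_
      rw [map_mul, hw l]; ring
    have h6 := mul_left_cancel₀ hexc0 h5
    have h7 : (1 : O') ∈ maximalIdeal O' := by
      rw [h6]
      refine Ideal.sum_mem _ fun l _ => Ideal.mul_mem_left _ _ ?_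
      by_cases hl : l = 0
      · subst hl; exact hz₁m
      · exact (mem_maximalIdeal _).mpr (hcon l hl)
    exact (mem_maximalIdeal _).mp h7 isUnit_one
  by_cases hl : IsUnit (w l₀)
  · obtain ⟨v⟩ : Nonempty (MvPowerSeries (Fin 3) k ≃ₐ[k] O') := by
      obtain ⟨u, v, -⟩ := hb; exact ⟨v⟩
    obtain ⟨ω, hω⟩ := hl
    let d' : MonomialDatum k p O' := ⟨v, 0, 0, ∅, 0, 0⟩
    obtain ⟨c, hc⟩ := d'.exists_sub_algebraMap_mem (↑ω⁻¹ * w (Idealistic.other l₀))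
    obtain ⟨X', hX'⟩ := hd.point_chart hq hinit hb hS' hl₀ (hω ▸ ω.isUnit) (hw l₀) hc (c := c) (by
      rw [hw, hw, ← hω, sub_add_cancel, mul_assoc, ← mul_assoc (ω : O'), Units.mul_inv, one_mul])
    exact ⟨l₀, hl₀, c, X', hX', Or.inl rfl⟩
  · obtain ⟨i, hi, hwi⟩ := hunit
    obtain rfl : l₀ = Idealistic.other i :=
      (eq_or_other hi hl₀).resolve_left fun h => hl (h ▸ hwi)
    obtain ⟨ω, hω⟩ := hwi
    obtain ⟨X', hX'⟩ := hd.point_chart hq hinit hb hS' hi (hω ▸ ω.isUnit) (hw i)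
      (y' := ↑ω⁻¹ * w (Idealistic.other i)) (c := 0)
      (Ideal.mul_mem_left _ _ ((mem_maximalIdeal _).mpr hl)) (by
      rw [hw, hw, ← hω, map_zero, add_zero, mul_assoc, ← mul_assoc (ω : O'), Units.mul_inv, one_mul])
    exact ⟨i, hi, 0, X', hX', Or.inr rfl⟩

/-- The blow-up of the curve `V(z, x_i)`: the new point lies on the strict transform of `{z = 0}`, so
`x_i` generates the exceptional ideal. -/
theorem IsPreCase.exists_curve_chart (hd : d.IsPreCase R E) (hq : 0 < d.q)
    (hinit : d.h - d.x 0 ^ d.q ∈ maximalIdeal O ^ (d.q + 1)) {i : Fin 3} (hi : i ≠ 0)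
    (hsing : PrimeSpectrum.zeroLocus (d.curve i : Set O) ⊆ singLocus R)
    (hb : IsBlowupGerm φ (d.curve i) exc)
    (hS' : ∀ n, transformFiltration φ exc R n ≤ maximalIdeal O' ^ n) :
    ∃ X', d.IsChart φ exc i 0 0 X' := by
  obtain ⟨hdom, hexc0, hexcm⟩ := IsBlowupGerm.isDomain hb
  obtain ⟨z₁, hz₁⟩ := IsBlowupGerm.exc_dvd hb (f := d.x 0) (Ideal.subset_span (by simp))
  obtain ⟨w, hw⟩ := IsBlowupGerm.exc_dvd hb (f := d.x i) (Ideal.subset_span (by simp))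
  obtain ⟨v'⟩ : Nonempty (MvPowerSeries (Fin 3) k ≃ₐ[k] O') := by
    obtain ⟨u, v, -⟩ := hb; exact ⟨v⟩
  have hz₁m : z₁ ∈ maximalIdeal O' := by
    refine hd.z_mem hq hS' hz₁ fun l hl => ?_
    obtain ⟨b, hbl⟩ := hd.dvd_coef_of_curve hi hsing hl
    refine ⟨w ^ l * φ (d.X b), Ideal.mul_mem_left _ _ (d.isLocal_algHom v' φ ?_), ?_⟩
    · rw [map_mem_maximalIdeal]
      have h1 := mem_pow_iff.mp (hd.coef_mem_succ hinit hl) (Finsupp.single i l) (by simp)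
      rw [hbl, X_pow_eq] at h1
      have h2 := coeff_add_monomial_mul (Finsupp.single i l) 0 b (1 : k)
      rw [add_zero, h1, one_mul, coeff_zero_eq_constantCoeff_apply] at h2
      exact h2.symm
    · rw [hbl, map_mul, map_mul, map_pow, map_pow]
      change φ (d.x i) ^ l * _ = _
      rw [hw, mul_pow]; ring
  have hwu : IsUnit w := by
    by_contra hcon
    obtain ⟨u, v, J, j₀, -, hj₀, hC, rfl, h1, h2, h3⟩ := hb
    have h4 : u (MvPowerSeries.X j₀) ∈ d.curve i := hC ▸ Ideal.subset_span ⟨j₀, hj₀, rfl⟩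
    rw [curve, Ideal.mem_span_pair] at h4
    obtain ⟨a, b, hab⟩ := h4
    have h5 := congrArg φ hab
    rw [h1, map_add, map_mul, map_mul, hz₁, hw] at h5
    have h6 := mul_left_cancel₀ hexc0 (show v (MvPowerSeries.X j₀) * (φ a * z₁ + φ b * w) =
      v (MvPowerSeries.X j₀) * 1 by linear_combination h5)
    have h7 : (1 : O') ∈ maximalIdeal O' := by
      rw [← h6]
      exact Ideal.add_mem _ (Ideal.mul_mem_left _ _ hz₁m)
        (Ideal.mul_mem_left _ _ ((mem_maximalIdeal _).mpr hcon))
    exact (mem_maximalIdeal _).mp h7 isUnit_one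
  have hy := d.isLocal_algHom v' φ (d.x_mem (Idealistic.other i))
  obtain ⟨u, v, J, j₀, -, hj₀, hC, rfl, h1, h2, h3⟩ := hb
  obtain ⟨w, rfl⟩ := hwu
  set exc := v (MvPowerSeries.X j₀)
  have hz' : z₁ = w * (↑w⁻¹ * z₁) := by rw [← mul_assoc, Units.mul_inv, one_mul]
  exact d.exists_chart_of_unit h2 h3 (T := {d.x 0, d.x i}) hC.symm hi w.isUnit
    (z' := ↑w⁻¹ * z₁) (κ := 0) (c := 0) (Ideal.mul_mem_left _ _ hz₁m) hy
    (by rw [hz₁, mul_assoc, ← hz']) hw (by simp) (by simp) (by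
      rintro f (rfl | rfl)
      · refine ⟨z₁, 0, hz₁, ?_⟩
        rw [map_zero, zero_mul, sub_zero, hz']
        exact Ideal.mul_mem_left _ _ (Ideal.subset_span (by simp))
      · exact ⟨w, 1, hw, by simp⟩)

end Charts

end MonomialDatum

end Idealistic

namespace Idealistic

open MvPowerSeries IsLocalRing

/-! ### The transform of a datum -/

section Transform

variable {k : Type*} {O O' : Type*} [Field k] [CommRing O] [Algebra k O] [CommRing O']
  [Algebra k O'] (φ : O →ₐ[k] O') (exc : O')

theorem transformFiltration_mul_unit (R : ℕ → Ideal O) (w : O'ˣ) :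
    transformFiltration φ (exc * w) R = transformFiltration φ exc R := by
  have key : ∀ (ε : O') (w : O'ˣ) n,
      transformFiltration φ ε R n ≤ transformFiltration φ (ε * w) R n := by
    intro ε w n
    refine Ideal.span_le.mpr ?_
    rintro g ⟨m, hnm, f, hf, h⟩
    have e : g = (w : O') ^ m * ((↑w⁻¹ : O') ^ m * g) := by
      rw [← mul_assoc, ← mul_pow, Units.mul_inv, one_pow, one_mul]
    rw [e]
    refine Ideal.mul_mem_left _ _ (Ideal.subset_span ⟨m, hnm, f, hf, ?_⟩)
    rw [h, mul_pow, mul_assoc]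
    nth_rewrite 1 [e]
    rfl
  refine funext fun n => le_antisymm ?_ (key _ _ _)
  have := key (exc * w) w⁻¹ n
  rwa [mul_assoc, Units.mul_inv, mul_one] at this

theorem strictTransform_mul_unit (D : Ideal O) (w : O'ˣ) :
    strictTransform φ (exc * w) D = strictTransform φ exc D := by
  have key : ∀ (ε : O') (w : O'ˣ), strictTransform φ ε D ≤ strictTransform φ (ε * w) D := by
    intro ε w
    refine Ideal.span_mono ?_
    rintro g ⟨n, h⟩
    refine ⟨n, ?_⟩
    rw [mul_pow, mul_comm (ε ^ n), mul_assoc]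
    exact Ideal.mul_mem_left _ _ h
  refine le_antisymm ?_ (key _ _)
  have := key (exc * w) w⁻¹
  rwa [mul_assoc, Units.mul_inv, mul_one] at this

theorem transformBoundary_mul_unit (E : Set (Ideal O)) (w : O'ˣ) :
    transformBoundary φ (exc * w) E = transformBoundary φ exc E := by
  simp only [transformBoundary, strictTransform_mul_unit, Ideal.span_singleton_mul_right_unit w.isUnit]

end Transform

section ZCoef

variable {k : Type*} [Field k]

theorem exists_zFree_sum {q : ℕ} {f : MvPowerSeries (Fin 3) k} (hf : ∀ s, coeff s f ≠ 0 → s 0 < q) :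
    ∃ a : ℕ → MvPowerSeries (Fin 3) k, (∀ l, a l ∈ zFree k) ∧
      f = ∑ l ∈ Finset.range q, a l * X 0 ^ l := by
  classical
  let a : ℕ → MvPowerSeries (Fin 3) k := fun l s =>
    if s 0 = 0 then coeff (s + Finsupp.single 0 l) f else 0
  have ha : ∀ l s, coeff s (a l) = if s 0 = 0 then coeff (s + Finsupp.single 0 l) f else 0 :=
    fun _ _ => rfl
  have haz : ∀ l, a l ∈ zFree k := by
    intro l s hs
    rw [ha, ite_ne_right_iff] at hs
    exact hs.1
  refine ⟨a, haz, ?_⟩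
  ext s
  rw [map_sum]
  have h1 : ∀ l, coeff s (a l * X 0 ^ l) = if s 0 = l then coeff s f else 0 := by
    intro l
    rw [coeff_mul_X_zero_pow (haz l)]
    split_ifs with h
    · rw [ha, if_pos (by simp), ← h, Finsupp.erase_add_single]
    · rfl
  simp only [h1]
  rw [Finset.sum_ite_eq]
  split_ifs with h
  · rfl
  · by_contra hne
    exact h (Finset.mem_range.mpr (hf s hne))

@[to_additive]
theorem prod_eq_of_zero_notMem {M : Type*} [CommMonoid M] {Y : Finset (Fin 3)} (h0 : (0 : Fin 3) ∉ Y) {i : Fin 3}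
    (hi : i ≠ 0) (F : Fin 3 → M) :
    ∏ l ∈ Y, F l = (if i ∈ Y then F i else 1) * (if other i ∈ Y then F (other i) else 1) := by
  have h1 : ∏ l ∈ Y, F l = ∏ l, if l ∈ Y then F l else 1 := by
    rw [Finset.prod_ite_mem, Finset.univ_inter]
  rw [h1, Fin.prod_univ_three, if_neg h0, one_mul]
  obtain rfl | rfl : i = 1 ∨ i = 2 := by clear * - hi; revert hi; revert i; decide
  · rfl
  · exact mul_comm _ _

end ZCoef

namespace MonomialDatum

variable {k : Type*} {p : ℕ} {O O' : Type*} [Field k] [CommRing O] [Algebra k O] [CommRing O']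
  [Algebra k O']

/-- The blow-up in coordinates, as a homomorphism of power series rings. -/
noncomputable def chartHom (d : MonomialDatum k p O) (φ : O →ₐ[k] O')
    (X' : MvPowerSeries (Fin 3) k ≃ₐ[k] O') : MvPowerSeries (Fin 3) k →ₐ[k] MvPowerSeries (Fin 3) k :=
  (X'.symm : O' →ₐ[k] MvPowerSeries (Fin 3) k).comp (φ.comp (d.X : MvPowerSeries (Fin 3) k →ₐ[k] O))

/-- The exponent of `x_i` in the monomial, `0` if `{x_i = 0}` does not belong to the boundary. -/
def expo (d : MonomialDatum k p O) (i : Fin 3) : ℕ := if i ∈ d.young then d.m i else 0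

/-- The datum of the transform in a chart of the blow-up, for given coefficients `a_l / x_i ^ l` of
the transform of `h`. -/
noncomputable def blowup (d : MonomialDatum k p O) (X' : MvPowerSeries (Fin 3) k ≃ₐ[k] O')
    (i : Fin 3) (κ : ℕ) (c : k) (coef' : ℕ → MvPowerSeries (Fin 3) k) : MonomialDatum k p O' where
  X := X'
  e := d.e
  coef := coef'
  young := open Classical in
    insert i (if other i ∈ d.young ∧ c = 0 then {other i} else ∅)
  m := fun l => if l = i then d.expo i + κ * d.expo (other i) - d.a else d.m l
  a := d.a

variable {d : MonomialDatum k p O} {φ : O →ₐ[k] O'} {exc : O'} {i : Fin 3} {κ : ℕ} {c : k}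
  {X' : MvPowerSeries (Fin 3) k ≃ₐ[k] O'} {coef' : ℕ → MvPowerSeries (Fin 3) k}

theorem apply_chartHom (f : MvPowerSeries (Fin 3) k) : X' (d.chartHom φ X' f) = φ (d.X f) :=
  X'.apply_symm_apply _

namespace IsChart

theorem chartHom_zero (hX : d.IsChart φ exc i κ c X') :
    d.chartHom φ X' (MvPowerSeries.X 0) = MvPowerSeries.X i * MvPowerSeries.X 0 := by
  apply X'.injective
  rw [apply_chartHom, map_mul]; exact hX.zero

theorem chartHom_self (hX : d.IsChart φ exc i κ c X') :
    d.chartHom φ X' (MvPowerSeries.X i) = MvPowerSeries.X i := by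
  apply X'.injective
  rw [apply_chartHom]; exact hX.self

theorem chartHom_other (hX : d.IsChart φ exc i κ c X') :
    d.chartHom φ X' (MvPowerSeries.X (Idealistic.other i)) =
      MvPowerSeries.X i ^ κ * (MvPowerSeries.X (Idealistic.other i) + C c) := by
  apply X'.injective
  rw [apply_chartHom, map_mul, map_add, map_pow, c_eq_algebraMap, AlgEquiv.commutes]
  exact hX.other

theorem chartHom_mem_zFree (hX : d.IsChart φ exc i κ c X') (hi : i ≠ 0)
    {f : MvPowerSeries (Fin 3) k} (hf : f ∈ zFree k) : d.chartHom φ X' f ∈ zFree k := by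
  refine map_mem_zFree _ (fun l hl => ?_) hf
  rcases eq_or_other hi hl with rfl | rfl
  · rw [hX.chartHom_self]; exact X_mem_zFree hi
  · rw [hX.chartHom_other]
    exact mul_mem (pow_mem (X_mem_zFree hi) _) (add_mem (X_mem_zFree hl) (C_mem_zFree c))

/-- The behaviour of weighted orders under the blow-up. -/
theorem ordGE (hX : d.IsChart φ exc i κ c X') (hi : i ≠ 0) {w w' : Fin 3 → ℕ}
    (h0 : w 0 ≤ w' i + w' 0) (h1 : w i ≤ w' i)
    (h2 : w (Idealistic.other i) ≤ κ * w' i ∨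
      c = 0 ∧ w (Idealistic.other i) ≤ κ * w' i + w' (Idealistic.other i))
    {N : ℚ} {f : MvPowerSeries (Fin 3) k} (hf : OrdGE w N f) : OrdGE w' N (d.chartHom φ X' f) := by
  classical
  have hXl : ∀ l, OrdGE w' (w' l : ℕ) (MvPowerSeries.X l : MvPowerSeries (Fin 3) k) := fun l => by
    have := ordGE_X_pow (k := k) (w := w') l 1
    rwa [pow_one, one_mul] at this
  refine OrdGE.algHom _ (fun l => ?_) hf
  by_cases hl : l = 0
  · subst hl
    rw [hX.chartHom_zero]
    exact ((hXl i).mul (hXl 0)).mono (by exact_mod_cast h0)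
  · rcases eq_or_other hi hl with rfl | rfl
    · rw [hX.chartHom_self]
      exact (hXl l).mono (by exact_mod_cast h1)
    · rw [hX.chartHom_other]
      rcases h2 with h2 | ⟨rfl, h2⟩
      · exact (((hXl i).pow κ).mono (by exact_mod_cast h2)).mul_right
      · rw [map_zero, add_zero]
        exact (((hXl i).pow κ).mul (hXl _)).mono (by exact_mod_cast h2)

theorem chartHom_deg (hX : d.IsChart φ exc i κ c X') (hi : i ≠ 0) {q : ℕ}
    {f : MvPowerSeries (Fin 3) k} (hf : ∀ s, coeff s f ≠ 0 → s 0 < q) :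
    ∀ s, coeff s (d.chartHom φ X' f) ≠ 0 → s 0 < q := by
  obtain ⟨a, ha, hfa⟩ := exists_zFree_sum hf
  intro s hs
  rw [hfa, map_sum, map_sum] at hs
  obtain ⟨l, hl, hne⟩ := Finset.exists_ne_zero_of_sum_ne_zero hs
  have e : d.chartHom φ X' (a l * MvPowerSeries.X 0 ^ l) =
      (d.chartHom φ X' (a l) * MvPowerSeries.X i ^ l) * MvPowerSeries.X 0 ^ l := by
    rw [map_mul, map_pow, hX.chartHom_zero, mul_pow]; ring
  rw [e, coeff_mul_X_zero_pow (mul_mem (hX.chartHom_mem_zFree hi (ha l))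
    (pow_mem (X_mem_zFree hi) _)), ite_ne_right_iff] at hne
  rw [hne.1]
  exact Finset.mem_range.mp hl

theorem chartHom_hS (hX : d.IsChart φ exc i κ c X')
    (hcoef : ∀ l ∈ Finset.Icc 1 d.q, d.chartHom φ X' (d.coef l) = MvPowerSeries.X i ^ l * coef' l) :
    d.chartHom φ X' d.hS = MvPowerSeries.X i ^ d.q * (d.blowup X' i κ c coef').hS := by
  have hq : (d.blowup X' i κ c coef').q = d.q := rfl
  have hcf : (d.blowup X' i κ c coef').coef = coef' := rfl
  rw [hS, hS, tail, tail, map_add, map_pow, hX.chartHom_zero, map_sum, mul_add, mul_pow,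
    Finset.mul_sum, hq, hcf]
  congr 1
  refine Finset.sum_congr rfl fun l hl => ?_
  have e : d.q = l + (d.q - l) := by have := Finset.mem_Icc.mp hl; omega
  rw [map_mul, map_pow, hX.chartHom_zero, hcoef l hl, mul_pow]
  nth_rewrite 3 [e]
  rw [pow_add]; ring

end IsChart

end MonomialDatum

end Idealistic

namespace Idealistic

open MvPowerSeries IsLocalRing

theorem mem_zFree_of_X_pow_mul {k : Type*} [Field k] {i : Fin 3} (hi : i ≠ 0) {n : ℕ}
    {f : MvPowerSeries (Fin 3) k} (h : X i ^ n * f ∈ zFree k) : f ∈ zFree k := by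
  intro s hs
  have h1 := h (Finsupp.single i n + s) (by
    rwa [X_pow_eq, coeff_add_monomial_mul, one_mul])
  simpa [Finsupp.single_eq_of_ne (Ne.symm hi)] using h1

theorem X_add_C_isUnit {k : Type*} [Field k] (j : Fin 3) {c : k} (hc : c ≠ 0) :
    IsUnit (X j + C c : MvPowerSeries (Fin 3) k) := by
  rw [isUnit_iff_constantCoeff, map_add, constantCoeff_X, constantCoeff_C, zero_add]
  exact isUnit_iff_ne_zero.mpr hc

namespace MonomialDatum

variable {k : Type*} {p : ℕ} {O O' : Type*} [Field k] [CommRing O] [Algebra k O] [CommRing O']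
  [Algebra k O'] {d : MonomialDatum k p O} {φ : O →ₐ[k] O'} {exc : O'} {i : Fin 3} {κ : ℕ} {c : k}
  {X' : MvPowerSeries (Fin 3) k ≃ₐ[k] O'} {coef' : ℕ → MvPowerSeries (Fin 3) k}
  {R : ℕ → Ideal O} {E : Set (Ideal O)}

theorem mem_blowup_young {l : Fin 3} : l ∈ (d.blowup X' i κ c coef').young ↔
    l = i ∨ (l = Idealistic.other i ∧ Idealistic.other i ∈ d.young ∧ c = 0) := by
  classical
  change l ∈ insert i (if Idealistic.other i ∈ d.young ∧ c = 0 then {Idealistic.other i} else ∅) ↔ _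
  rw [Finset.mem_insert]
  split_ifs with h
  · simp [h]
  · simp [h]

namespace IsChart

theorem transformFiltration_eq (hX : d.IsChart φ exc i κ c X') (R : ℕ → Ideal O) :
    transformFiltration φ exc R = transformFiltration φ (X' (MvPowerSeries.X i)) R := by
  obtain ⟨w, ⟨w, rfl⟩, h⟩ := hX.exc
  rw [h, transformFiltration_mul_unit]

theorem transformBoundary_eq (hX : d.IsChart φ exc i κ c X') (E : Set (Ideal O)) :
    transformBoundary φ exc E = transformBoundary φ (X' (MvPowerSeries.X i)) E := by
  obtain ⟨w, ⟨w, rfl⟩, h⟩ := hX.exc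
  rw [h, transformBoundary_mul_unit]

theorem span_exc (hX : d.IsChart φ exc i κ c X') :
    Ideal.span {X' (MvPowerSeries.X i)} = Ideal.span {exc} := by
  obtain ⟨w, hw, h⟩ := hX.exc
  rw [h, Ideal.span_singleton_mul_right_unit hw]

theorem strictTransform_self (hX : d.IsChart φ exc i κ c X') :
    strictTransform φ (X' (MvPowerSeries.X i)) (Ideal.span {d.x i}) = ⊤ := by
  rw [Ideal.eq_top_iff_one]
  refine Ideal.subset_span ⟨1, ?_⟩
  rw [pow_one, mul_one, ← hX.self]
  exact Ideal.mem_map_of_mem _ (Ideal.mem_span_singleton_self _)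

theorem strictTransform_other (hX : d.IsChart φ exc i κ c X') (hi : i ≠ 0) :
    strictTransform φ (X' (MvPowerSeries.X i)) (Ideal.span {d.x (Idealistic.other i)}) =
      Ideal.span {X' (MvPowerSeries.X (Idealistic.other i) + C c)} := by
  have hm : (Ideal.span {d.x (Idealistic.other i)}).map φ =
      Ideal.span {X' (MvPowerSeries.X i ^ κ * (MvPowerSeries.X (Idealistic.other i) + C c))} := by
    rw [Ideal.map_span, Set.image_singleton, ← hX.chartHom_other, apply_chartHom]; rfl
  rw [strictTransform, hm]
  refine le_antisymm (Ideal.span_le.mpr ?_) ((Ideal.span_singleton_le_iff_mem _).mpr ?_)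
  · rintro g ⟨n, hg⟩
    obtain ⟨g, rfl⟩ := X'.surjective g
    rw [← map_pow, ← map_mul, Ideal.mem_span_singleton, map_dvd_iff] at hg
    rw [SetLike.mem_coe, Ideal.mem_span_singleton, map_dvd_iff]
    rcases eq_or_ne c 0 with rfl | hc
    · rw [map_zero, add_zero] at hg ⊢
      have hp := X_prime (k := k) (Idealistic.other i)
      refine (hp.dvd_or_dvd ((dvd_mul_left _ _).trans hg)).resolve_left fun h => ?_
      have h1 := hp.dvd_of_dvd_pow h
      rw [← pow_one (MvPowerSeries.X _), X_pow_dvd_iff] at h1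
      have h2 := h1 (Finsupp.single i 1) (by
        rw [Finsupp.single_eq_of_ne (other_ne hi).2]; exact one_pos)
      rw [coeff_index_single_self_X] at h2
      exact one_ne_zero h2
    · exact (X_add_C_isUnit _ hc).dvd
  · refine Ideal.subset_span ⟨κ, ?_⟩
    rw [map_mul, map_pow]
    exact Ideal.mem_span_singleton_self _

theorem boundary (hX : d.IsChart φ exc i κ c X') [IsLocalRing O'] (hi : i ≠ 0)
    (h0 : (0 : Fin 3) ∉ d.young) :
    transformBoundary φ exc {D | ∃ l ∈ d.young, D = Ideal.span {d.x l}} =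
      {D' | ∃ l ∈ (d.blowup X' i κ c coef').young,
        D' = Ideal.span {(d.blowup X' i κ c coef').x l}} := by
  rw [hX.transformBoundary_eq]
  ext D'
  constructor
  · rintro (rfl | ⟨_, ⟨l, hl, rfl⟩, rfl, hne⟩)
    · exact ⟨i, mem_blowup_young.mpr (Or.inl rfl), rfl⟩
    · have hl0 : l ≠ 0 := fun h => h0 (h ▸ hl)
      rcases eq_or_other hi hl0 with rfl | rfl
      · exact absurd hX.strictTransform_self hne
      · rw [hX.strictTransform_other hi] at hne ⊢
        have hc : c = 0 := by
          by_contra hc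
          exact hne (Ideal.span_singleton_eq_top.mpr ((X_add_C_isUnit _ hc).map X'))
        refine ⟨Idealistic.other i, mem_blowup_young.mpr (Or.inr ⟨rfl, hl, hc⟩), ?_⟩
        rw [hc, map_zero, add_zero]; rfl
  · rintro ⟨l, hl, rfl⟩
    rcases mem_blowup_young.mp hl with rfl | ⟨rfl, hj, rfl⟩
    · exact Or.inl rfl
    · refine Or.inr ⟨_, ⟨_, hj, rfl⟩, ?_, ?_⟩
      · rw [hX.strictTransform_other hi, map_zero, add_zero]; rfl
      · rw [Ne, Ideal.span_singleton_eq_top]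
        intro h
        have h1 := (mem_maximalIdeal _).mp ((map_mem_maximalIdeal X').mpr
          (constantCoeff_X (R := k) (Idealistic.other i)))
        exact h1 h

theorem monomial_mem (hX : d.IsChart φ exc i κ c X') (hi : i ≠ 0) (h0 : (0 : Fin 3) ∉ d.young)
    (hM : d.M ∈ R d.a) (hle : d.a ≤ d.expo i + κ * d.expo (Idealistic.other i)) :
    (d.blowup X' i κ c coef').M ∈ transformFiltration φ exc R d.a := by
  rw [hX.transformFiltration_eq]
  set ε := X' (MvPowerSeries.X i) with hε
  set y := X' (MvPowerSeries.X (Idealistic.other i)) + algebraMap k O' c with hy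
  set N := d.expo i + κ * d.expo (Idealistic.other i) - d.a with hN
  have hMφ : φ d.M = ε ^ d.a * (ε ^ N * y ^ d.expo (Idealistic.other i)) := by
    have e1 : d.M = d.x i ^ d.expo i * d.x (Idealistic.other i) ^ d.expo (Idealistic.other i) := by
      rw [M, prod_eq_of_zero_notMem h0 hi, expo, expo]
      split_ifs <;> simp
    rw [e1, map_mul, map_pow, map_pow, hX.self, hX.other, mul_pow, ← pow_mul, ← mul_assoc,
      ← mul_assoc, ← pow_add, ← pow_add, hN, Nat.add_sub_cancel' hle]
  have h1 : ε ^ N * y ^ d.expo (Idealistic.other i) ∈ transformFiltration φ ε R d.a :=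
    Ideal.subset_span ⟨d.a, le_rfl, d.M, hM, hMφ⟩
  have h0' : (0 : Fin 3) ∉ (d.blowup X' i κ c coef').young := by
    rw [mem_blowup_young]
    rintro (h | ⟨h, -⟩)
    · exact hi h.symm
    · exact (other_ne hi).1 h.symm
  rw [M, prod_eq_of_zero_notMem h0' hi, if_pos (mem_blowup_young.mpr (Or.inl rfl))]
  have hmi : (d.blowup X' i κ c coef').m i = N := if_pos rfl
  have hmj : (d.blowup X' i κ c coef').m (Idealistic.other i) = d.m (Idealistic.other i) :=
    if_neg (other_ne hi).2
  rw [hmi, hmj]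
  change ε ^ N * _ ∈ _
  split_ifs with hj
  · rw [mem_blowup_young] at hj
    obtain ⟨-, hj', rfl⟩ := hj.resolve_left (other_ne hi).2
    rw [hy, map_zero, add_zero, expo, if_pos hj'] at h1
    exact h1
  · rw [mul_one]
    by_cases hj' : Idealistic.other i ∈ d.young
    · have hc : c ≠ 0 := fun hc => hj (mem_blowup_young.mpr (Or.inr ⟨rfl, hj', hc⟩))
      have hu : IsUnit y := by
        have := (X_add_C_isUnit (Idealistic.other i) hc).map X'
        rwa [map_add, c_eq_algebraMap, AlgEquiv.commutes] at this
      exact (Ideal.mul_unit_mem_iff_mem _ (hu.pow _)).mp h1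
    · rwa [expo, if_neg hj', pow_zero, mul_one] at h1

/-- The transform is closed under `∂_z'`, since `x_i' ^ n ∂_z ^ [n] = ∂_z' ^ [n]` for `z = x_i' z'`. -/
theorem deriv_mem (hX : d.IsChart φ exc i κ c X') (hi : i ≠ 0) (hR : IsFiltration R)
    (hd : ∀ l, ∀ f ∈ R l, ∀ n, d.X (hasseZ n (d.X.symm f)) ∈ R (l - n)) (l : ℕ) {g : O'}
    (hg : g ∈ transformFiltration φ exc R l) (n : ℕ) :
    X' (hasseZ n (X'.symm g)) ∈ transformFiltration φ exc R (l - n) := by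
  have hR' := isFiltration_transform φ exc hR
  rw [hX.transformFiltration_eq] at hg hR' ⊢
  have : IsDomain (MvPowerSeries (Fin 3) k) := NoZeroDivisors.to_isDomain _
  rw [transformFiltration] at hg
  induction hg using Submodule.span_induction generalizing n with
  | mem g hg =>
    obtain ⟨m, hlm, f, hf, h⟩ := hg
    rcases le_or_gt n m with hnm | hnm
    · refine Ideal.subset_span ⟨m - n, by omega, _, hd m f hf n, ?_⟩
      rw [← apply_chartHom (X' := X'), ← map_pow, ← map_mul]
      congr 1
      have h1 : d.chartHom φ X' (d.X.symm f) = MvPowerSeries.X i ^ m * X'.symm g := by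
        apply X'.injective
        rw [apply_chartHom, map_mul, map_pow, AlgEquiv.apply_symm_apply, AlgEquiv.apply_symm_apply, h]
      have h2 := hasse_affine (d.chartHom φ X') (α := MvPowerSeries.X i) (β := 0) (X_mem_zFree hi)
        (zero_mem _) (by rw [add_zero, hX.chartHom_zero])
        (fun l hl => hX.chartHom_mem_zFree hi (X_mem_zFree hl)) n (d.X.symm f)
      rw [h1, mul_comm, hasse_mul_zFree _ (pow_mem (X_mem_zFree hi) _)] at h2
      rw [hasseZ_eq, hasseZ_eq]
      have h3 : (MvPowerSeries.X i : MvPowerSeries (Fin 3) k) ^ n ≠ 0 := pow_ne_zero _ (X_prime i).ne_zero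
      apply mul_left_cancel₀ h3
      rw [← h2, ← mul_assoc, ← pow_add, Nat.add_sub_cancel' hnm, mul_comm]
    · rw [show l - n = 0 by omega, hR'.1]; trivial
  | zero =>
    rw [map_zero, hasseZ_eq, map_zero, map_zero]; exact zero_mem _
  | add g g' _ _ h h' =>
    have e : X' (hasseZ n (X'.symm (g + g'))) =
        X' (hasseZ n (X'.symm g)) + X' (hasseZ n (X'.symm g')) := by
      simp only [hasseZ_eq, map_add]
    rw [e]
    exact Ideal.add_mem _ (h n) (h' n)
  | smul a g _ h =>
    rw [smul_eq_mul, map_mul, hasseZ_eq, hasse_mul, map_sum]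
    refine Ideal.sum_mem _ fun b hb => ?_
    rw [Finset.HasAntidiagonal.mem_antidiagonal] at hb
    rw [map_mul]
    have h1 := h b.2
    rw [hasseZ_eq] at h1
    exact Ideal.mul_mem_left _ _ (hR'.2.1 (by omega) h1)

end IsChart

variable [IsLocalRing O]

/-- The divisibility of remainders modulo `h` passes to the transform: the remainder of `φ f` is the
transform of the remainder of `f`. -/
theorem IsPreCase.blowup_control (hd : d.IsPreCase R E) (hX : d.IsChart φ exc i κ c X') (hi : i ≠ 0)
    (hcoef : ∀ l ∈ Finset.Icc 1 d.q, d.chartHom φ X' (d.coef l) = MvPowerSeries.X i ^ l * coef' l)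
    (hA : OrdGE (distWeight d.q) (d.q + 1) (d.blowup X' i κ c coef').tail)
    (hle : d.a ≤ d.expo i + κ * d.expo (Idealistic.other i)) (l : ℕ) {g : O'}
    (hg : g ∈ transformFiltration φ exc R l) :
    ∃ t, (d.blowup X' i κ c coef').h ∣ g - t ∧ ∀ j ∈ (d.blowup X' i κ c coef').young,
      (d.blowup X' i κ c coef').x j ^
        ⌈((d.blowup X' i κ c coef').m j * l : ℚ) / (d.blowup X' i κ c coef').a⌉₊ ∣ t := by
  set d' := d.blowup X' i κ c coef' with hd'
  have ha : (0 : ℚ) < d.a := by exact_mod_cast hd.a_pos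
  have : IsDomain (MvPowerSeries (Fin 3) k) := NoZeroDivisors.to_isDomain _
  rw [hX.transformFiltration_eq, transformFiltration] at hg
  induction hg using Submodule.span_induction with
  | mem g hg =>
    obtain ⟨m, hlm, f, hf, h⟩ := hg
    obtain ⟨f, rfl⟩ := d.X.surjective f
    obtain ⟨g, rfl⟩ := X'.surjective g
    obtain ⟨g₀, r, hfr, hr⟩ := exists_weierstrass_div hd.tail_ord f
    obtain ⟨g₁, r', hgr, hr'⟩ := exists_weierstrass_div hA g
    have h1 : d.chartHom φ X' f = MvPowerSeries.X i ^ m * g := by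
      apply X'.injective
      rw [apply_chartHom, map_mul, map_pow, h]
    have hrX : ∀ j ∈ d.young, OrdGE (Pi.single j 1) (d.m j * m / d.a : ℚ) r := by
      intro j hj
      obtain ⟨t, ht1, ht2⟩ := hd.control m _ hf
      have h2 : MvPowerSeries.X j ^ ⌈(d.m j * m : ℚ) / d.a⌉₊ ∣ r := by
        refine hd.X_pow_dvd hr (c := t) ?_ hj (ht2 j hj)
        have e : d.X r - t = (d.X f - t) - d.X g₀ * d.h := by
          rw [hfr, map_add, map_mul, ← X_hS, hS]; ring
        rw [e]
        exact dvd_sub ht1 (dvd_mul_left _ _)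
      exact (X_pow_dvd_iff_ordGE.mp h2).mono (Nat.le_ceil _)
    have hrX' : ∀ j, OrdGE (Pi.single j 1) (d.expo j * m / d.a : ℚ) r := by
      intro j
      rw [expo]
      split_ifs with hj
      · exact hrX j hj
      · exact OrdGE.of_nonpos (by simp)
    -- the remainders correspond to each other
    have h2 : d.chartHom φ X' r = MvPowerSeries.X i ^ m * r' := by
      rw [← sub_eq_zero]
      apply eq_zero_of_dvd_of_deg hA
      · intro s hs
        by_cases h : coeff s (d.chartHom φ X' r) = 0
        · classical
          rw [map_sub, h, zero_sub, neg_ne_zero, X_pow_eq, coeff_monomial_mul, one_mul,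
            ite_ne_right_iff] at hs
          have := hr' _ hs.2
          simpa [Finsupp.single_eq_of_ne (Ne.symm hi)] using this
        · exact hX.chartHom_deg hi hr s h
      · have h3 : d.chartHom φ X' f = d.chartHom φ X' g₀ * (MvPowerSeries.X i ^ d.q * d'.hS) +
            d.chartHom φ X' r := by
          rw [← hX.chartHom_hS hcoef, ← map_mul, ← map_add, hS, ← hfr]
        have hhS : d'.hS = MvPowerSeries.X 0 ^ d.q + d'.tail := rfl
        have e : d.chartHom φ X' r - MvPowerSeries.X i ^ m * r' =
            (MvPowerSeries.X 0 ^ d.q + d'.tail) *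
              (MvPowerSeries.X i ^ m * g₁ - d.chartHom φ X' g₀ * MvPowerSeries.X i ^ d.q) := by
          rw [h1, hgr, hhS] at h3
          linear_combination -h3
        rw [e]
        exact dvd_mul_right _ _
    have hml : (l : ℚ) ≤ m := by exact_mod_cast hlm
    refine ⟨X' r', ?_, fun j hj => ?_⟩
    · have e : d'.h = X' (MvPowerSeries.X 0 ^ d.q + d'.tail) := (X_hS d').symm
      rw [e, ← map_sub, hgr, add_sub_cancel_right]
      exact map_dvd _ (dvd_mul_left _ _)
    · change X' (MvPowerSeries.X j) ^ _ ∣ _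
      rw [← map_pow]
      refine map_dvd _ ?_
      change MvPowerSeries.X j ^ ⌈((if j = i then d.expo i + κ * d.expo (Idealistic.other i) - d.a
        else d.m j : ℕ) * l : ℚ) / d.a⌉₊ ∣ r'
      rcases mem_blowup_young.mp hj with rfl | ⟨rfl, hj', rfl⟩
      · rw [if_pos rfl, Nat.cast_sub hle]
        push_cast
        apply OrdGE.X_pow_dvd
        -- `x_j` and the other parameter have orders `1` and `κ` along the exceptional divisor
        have h3 : OrdGE (fun l => if l = j then 1 else if l = 0 then 0 else κ)
            (d.expo j * m / d.a + κ * (d.expo (Idealistic.other j) * m / d.a) : ℚ) r := by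
          intro s hs
          have e : Finsupp.weight (fun l => if l = j then 1 else if l = 0 then 0 else κ) s =
              s j + κ * s (Idealistic.other j) := by
            rw [Finsupp.weight_apply, Finsupp.sum_fintype _ _ (fun i => by simp), Fin.sum_univ_three]
            obtain rfl | rfl : j = 1 ∨ j = 2 := by clear * - hi; revert hi; revert j; decide
            · simp [Idealistic.other, mul_comm]
            · simp [Idealistic.other, mul_comm, add_comm]
          have h4 := hrX' j s hs
          have h5 := hrX' (Idealistic.other j) s hs
          rw [weight_single_one] at h4 h5
          rw [e]
          push_cast
          have hκ : (0 : ℚ) ≤ κ := Nat.cast_nonneg _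
          nlinarith [mul_le_mul_of_nonneg_left h5 hκ]
        have h4 := hX.ordGE hi (w' := Pi.single j 1) (by simp [hi.symm]) (by simp)
          (Or.inl (by simp [other_ne hi])) h3
        rw [h2] at h4
        intro s hs
        have h5 := h4 (Finsupp.single j m + s) (by
          rwa [X_pow_eq, coeff_add_monomial_mul, one_mul])
        rw [weight_single_one, Finsupp.add_apply, Finsupp.single_eq_same] at h5
        rw [weight_single_one]
        push_cast at h5
        have h6 : ((d.expo j + κ * d.expo (Idealistic.other j) - d.a : ℚ)) * l / d.a ≤
            ((d.expo j + κ * d.expo (Idealistic.other j) - d.a : ℚ)) * m / d.a := by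
          have : (d.a : ℚ) ≤ d.expo j + κ * d.expo (Idealistic.other j) := by exact_mod_cast hle
          gcongr
        refine h6.trans ?_
        have h7 : ((d.expo j + κ * d.expo (Idealistic.other j) - d.a : ℚ)) * m / d.a =
            d.expo j * m / d.a + κ * (d.expo (Idealistic.other j) * m / d.a) - m := by
          field_simp
        rw [h7]
        linarith
      · rw [if_neg (other_ne hi).2]
        apply OrdGE.X_pow_dvd
        have h4 := hX.ordGE hi (w' := Pi.single (Idealistic.other i) 1)
          (by simp [(other_ne hi).1.symm]) (by simp [(other_ne hi).2.symm]) (Or.inr ⟨rfl, by simp⟩)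
          (hrX _ hj')
        rw [h2] at h4
        intro s hs
        have h5 := h4 (Finsupp.single i m + s) (by
          rwa [X_pow_eq, coeff_add_monomial_mul, one_mul])
        rw [weight_single_one, Finsupp.add_apply, Finsupp.single_eq_of_ne (other_ne hi).2,
          zero_add] at h5
        rw [weight_single_one]
        refine le_trans ?_ h5
        gcongr
  | zero => exact ⟨0, by simp, fun _ _ => dvd_zero _⟩
  | add g g' _ _ h h' =>
    obtain ⟨t, h1, h2⟩ := h
    obtain ⟨t', h1', h2'⟩ := h'
    refine ⟨t + t', ?_, fun j hj => dvd_add (h2 j hj) (h2' j hj)⟩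
    rw [add_sub_add_comm]
    exact dvd_add h1 h1'
  | smul a g _ h =>
    obtain ⟨t, h1, h2⟩ := h
    refine ⟨a * t, ?_, fun j hj => (h2 j hj).mul_left a⟩
    rw [smul_eq_mul, ← mul_sub]
    exact h1.mul_left a

variable [IsLocalRing O']

/-- The transform of the datum of a monomial case satisfies the conditions that do not refer to
initial forms. -/
theorem IsPreCase.blowup (hd : d.IsPreCase R E) (hR : IsFiltration R)
    (hX : d.IsChart φ exc i κ c X') (hi : i ≠ 0)
    (hcoef : ∀ l ∈ Finset.Icc 1 d.q, d.chartHom φ X' (d.coef l) = MvPowerSeries.X i ^ l * coef' l)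
    (hS' : ∀ n, transformFiltration φ exc R n ≤ maximalIdeal O' ^ n)
    (hle : d.a ≤ d.expo i + κ * d.expo (Idealistic.other i)) :
    (d.blowup X' i κ c coef').IsPreCase (transformFiltration φ exc R)
      (transformBoundary φ exc E) := by
  have hz : ∀ l ∈ Finset.Icc 1 d.q, coef' l ∈ zFree k := fun l hl =>
    mem_zFree_of_X_pow_mul hi (hcoef l hl ▸ hX.chartHom_mem_zFree hi (hd.coef_xy l hl))
  have hh : (d.blowup X' i κ c coef').h ∈ transformFiltration φ exc R d.q := by
    rw [hX.transformFiltration_eq]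
    refine Ideal.subset_span ⟨d.q, le_rfl, d.h, hd.h_mem, ?_⟩
    have h1 := congrArg X' (hX.chartHom_hS hcoef)
    rw [apply_chartHom, X_hS, map_mul, map_pow] at h1
    rw [h1, ← X_hS]; rfl
  have hho := hS' _ hh
  have hA := tail_ordGE (d := d.blowup X' i κ c coef') hz (by
    rw [← map_mem_maximalIdeal_pow X']
    have := X_hS (d.blowup X' i κ c coef')
    change X' _ = _ at this
    rw [this]; exact hho)
  refine ⟨?_, ?_, hz, hh, hho, hd.a_pos, hX.monomial_mem hi hd.z_notMem hd.monomial_mem hle,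
    fun l g hg => hd.blowup_control hX hi hcoef hA hle l hg,
    fun l g hg n => hX.deriv_mem hi hR hd.deriv_mem l hg n⟩
  · rw [mem_blowup_young]
    rintro (h | ⟨h, -⟩)
    · exact hi h.symm
    · exact (other_ne hi).1 h.symm
  · rw [hd.boundary]
    exact hX.boundary hi hd.z_notMem

end MonomialDatum

end Idealistic

namespace Idealistic

open MvPowerSeries IsLocalRing

/-! ### Lowest terms that are not `q`-th powers -/

section Lead

variable {k : Type*} [Field k]

/-- Along `{x_i = 0}` the series `F` has order `r`, and `x_i ^ r * x_j ^ n` is the lowest term of its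
initial form that is not a `q`-th power. -/
structure IsLead (F : MvPowerSeries (Fin 3) k) (q : ℕ) (i : Fin 3) (r n : ℕ) : Prop where
  ordGE : OrdGE (Pi.single i 1) r F
  not_dvd : ¬ (q ∣ r ∧ q ∣ n)
  exists_term : ∃ s, coeff s F ≠ 0 ∧ s i = r ∧ s (other i) = n
  min : ∀ s, coeff s F ≠ 0 → s i = r → ¬ (q ∣ r ∧ q ∣ s (other i)) → n ≤ s (other i)

theorem forall_dvd_iff {q : ℕ} {s : Fin 3 →₀ ℕ} (h0 : s 0 = 0) {i : Fin 3} (hi : i ≠ 0) :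
    (∀ l, q ∣ s l) ↔ q ∣ s i ∧ q ∣ s (other i) := by
  refine ⟨fun h => ⟨h _, h _⟩, fun h l => ?_⟩
  by_cases hl : l = 0
  · subst hl; rw [h0]; exact dvd_zero _
  · rcases eq_or_other hi hl with rfl | rfl
    · exact h.1
    · exact h.2

theorem degree_eq_add {s : Fin 3 →₀ ℕ} (h0 : s 0 = 0) {i : Fin 3} (hi : i ≠ 0) :
    s.degree = s i + s (other i) := by
  rw [Finsupp.degree_eq_sum, Fin.sum_univ_three, h0, zero_add]
  obtain rfl | rfl : i = 1 ∨ i = 2 := by clear * - hi; revert hi; revert i; decide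
  · rfl
  · exact add_comm _ _

theorem exists_isLead {F : MvPowerSeries (Fin 3) k} {q : ℕ} {i : Fin 3} {r : ℕ}
    (hF : OrdGE (Pi.single i 1) r F) {s : Fin 3 →₀ ℕ} (hs : coeff s F ≠ 0) (hsi : s i = r)
    (hd : ¬ (q ∣ r ∧ q ∣ s (other i))) : ∃ n ≤ s (other i), IsLead F q i r n := by
  classical
  have hex : ∃ n, ∃ t, coeff t F ≠ 0 ∧ t i = r ∧ t (other i) = n ∧ ¬ (q ∣ r ∧ q ∣ n) :=
    ⟨_, s, hs, hsi, rfl, hd⟩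
  obtain ⟨t, h1, h2, h3, h4⟩ := Nat.find_spec hex
  exact ⟨_, Nat.find_min' hex ⟨s, hs, hsi, rfl, hd⟩, hF, h4, ⟨t, h1, h2, h3⟩,
    fun u hu hui hud => Nat.find_min' hex ⟨u, hu, hui, rfl, hud⟩⟩

/-- The residual order of the initial form is the degree of its lowest term that is not a `q`-th
power. -/
theorem IsLead.resOrd_eq {F : MvPowerSeries (Fin 3) k} (hz : F ∈ zFree k) {q : ℕ} {i : Fin 3}
    (hi : i ≠ 0) {r n : ℕ} (h : IsLead F q i r n) : resOrd q (initAlong i F) = r + n := by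
  obtain ⟨s, hs, rfl, rfl⟩ := h.exists_term
  have hinit : ∀ t, coeff t (initAlong i F) = if t i = s i then coeff t F else 0 := by
    intro t
    rw [coeff_initAlong, weightedOrder_eq_of_ordGE hs (by rw [weight_single_one]; exact h.ordGE),
      ENat.toNat_natCast, weight_single_one, weight_single_one]
  refine le_antisymm (Nat.sInf_le ⟨s, ?_, ?_, ?_⟩) (le_csInf ?_ ?_)
  · rw [hinit, if_pos rfl]; exact hs
  · rw [forall_dvd_iff (hz s hs) hi]; exact h.not_dvd
  · rw [degree_eq_add (hz s hs) hi]
  · exact ⟨_, s, by rw [hinit, if_pos rfl]; exact hs,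
      by rw [forall_dvd_iff (hz s hs) hi]; exact h.not_dvd, rfl⟩
  · rintro _ ⟨t, ht, htd, rfl⟩
    rw [hinit, ite_ne_right_iff] at ht
    have h0 := hz t ht.2
    rw [forall_dvd_iff h0 hi, ht.1] at htd
    rw [degree_eq_add h0 hi, ht.1]
    have := h.min t ht.2 ht.1 htd
    omega

end Lead

namespace MonomialDatum

variable {k : Type*} {p : ℕ} {O : Type*} [Field k] [CommRing O] [Algebra k O] [IsLocalRing O]
  {R : ℕ → Ideal O} {E : Set (Ideal O)} {d : MonomialDatum k p O} [hp : Fact p.Prime]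

theorem IsPreCase.lastCoef_mem_zFree (hd : d.IsPreCase R E) : d.lastCoef ∈ zFree k :=
  hd.coef_xy _ (Finset.mem_Icc.mpr ⟨q_pos d, le_rfl⟩)

variable [IsAlgClosed k] [CharP k p]

/-- Reading off slope and residual order from the last coefficient along a bad divisor. -/
theorem IsPreCase.exists_isLead (hd : d.IsPreCase R E) {i : Fin 3} (hi : i ∈ d.young)
    (had : d.WellAdaptedAlong i) (hbad : d.slope i < d.mu i) :
    ∃ r n, IsLead d.lastCoef d.q i r n ∧ d.slope i = (r : ℚ) / d.q ∧ (r : ℚ) < d.q * d.mu i ∧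
      resOrd d.q (initAlong i d.lastCoef) = r + n := by
  have hq := q_pos d
  have hi0 := hd.ne_zero hi
  rcases (wellAdaptedAlong_iff d i).mp had with h | ⟨s, hs, hsd, hsc, hsF⟩
  · rw [slope, ordAlong_eq, slopeVal_eq_of_ordGE hq h] at hbad
    exact absurd hbad (lt_irrefl _)
  have hz := hd.lastCoef_mem_zFree
  have hslope : d.slope i = (s i : ℚ) / d.q := by
    rw [slope, ordAlong_eq, slopeVal_eq_div hq hs hsF hsc, weight_single_one]
  rw [weight_single_one] at hsc hsF
  rw [forall_dvd_iff (hz s hs) hi0] at hsd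
  obtain ⟨n, -, hn⟩ := Idealistic.exists_isLead hsF hs rfl hsd
  exact ⟨s i, n, hn, hslope, hsc, hn.resOrd_eq hz hi0⟩

/-- A datum need not be well-adapted elsewhere to determine the invariants along a divisor where its
last coefficient has a lowest term that is not a `q`-th power. -/
theorem IsPreCase.redAt_of_isLead (hd : d.IsPreCase R E) {i : Fin 3} (hi : i ∈ d.young) {r n : ℕ}
    (h : IsLead d.lastCoef d.q i r n) (hr : (r : ℚ) < d.q * d.mu i) :
    RedAt k p R E d.e (Ideal.span {d.x i}) r n := by
  have hq := q_pos d
  have hq' : (0 : ℚ) < d.q := by exact_mod_cast hq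
  have hi0 := hd.ne_zero hi
  have hz := hd.lastCoef_mem_zFree
  have hres := h.resOrd_eq hz hi0
  obtain ⟨s, hs, hsi, hsj⟩ := h.exists_term
  have hsF : OrdGE (Pi.single i 1) (Finsupp.weight (Pi.single i 1) s : ℕ) d.lastCoef := by
    rw [weight_single_one, hsi]; exact h.ordGE
  have hsc : ((Finsupp.weight (Pi.single i 1) s : ℕ) : ℚ) < d.q * d.mu i := by
    rw [weight_single_one, hsi]; exact hr
  have had : d.WellAdaptedAlong i := (wellAdaptedAlong_iff d i).mpr (Or.inr ⟨s, hs, by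
    rw [forall_dvd_iff (hz s hs) hi0, hsi, hsj]; exact h.not_dvd, hsc, hsF⟩)
  have hslope : d.slope i = (r : ℚ) / d.q := by
    rw [slope, ordAlong_eq, slopeVal_eq_div hq hs hsF hsc, weight_single_one, hsi]
  have hbad : d.slope i < d.mu i := by
    rw [hslope, div_lt_iff₀ hq', mul_comm]; exact hr
  obtain ⟨r', n', b, hb, hz', h1, h2, h3, h4⟩ := hd.exists_reduced hi had hbad
  rw [hslope, div_left_inj' hq'.ne', Nat.cast_inj] at h1
  subst h1
  have : n' = n := by omega
  subst this
  exact ⟨d.shift b hb hz', hd.shift, rfl, i, hi, by rw [shift_x hi0], h2, h4⟩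

end MonomialDatum

section ChartCoeff

variable {k : Type*} [Field k] {p : ℕ} {O O' : Type*} [CommRing O] [Algebra k O] [CommRing O']
  [Algebra k O'] {d : MonomialDatum k p O} {φ : O →ₐ[k] O'} {exc : O'} {i : Fin 3} {κ : ℕ} {c : k}
  {X' : MvPowerSeries (Fin 3) k ≃ₐ[k] O'}

theorem eq_single_add_single {s : Fin 3 →₀ ℕ} (h0 : s 0 = 0) {i : Fin 3} (hi : i ≠ 0) :
    s = Finsupp.single i (s i) + Finsupp.single (other i) (s (other i)) := by
  ext l
  by_cases hl : l = 0
  · subst hl; simp [h0, hi.symm, (other_ne hi).1.symm]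
  · rcases eq_or_other hi hl with rfl | rfl <;> simp [(other_ne hi).2, (other_ne hi).2.symm]

theorem chartHom_monomial (hX : d.IsChart φ exc i κ c X')
    (a n : ℕ) : d.chartHom φ X' (monomial (Finsupp.single i a + Finsupp.single (other i) n) 1) =
      X i ^ (a + κ * n) * (X (other i) + C c) ^ n := by
  rw [← one_mul (1 : k), ← monomial_mul_monomial, ← X_pow_eq, ← X_pow_eq, map_mul, map_pow, map_pow,
    hX.chartHom_self, hX.chartHom_other, mul_pow, pow_add, pow_mul]
  ring

/-- The monomial substitution on exponents. -/
theorem coeff_chartHom (hX : d.IsChart φ exc i κ 0 X') (hi : i ≠ 0)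
    {f : MvPowerSeries (Fin 3) k} (hf : f ∈ zFree k) (a n : ℕ) :
    coeff (Finsupp.single i a + Finsupp.single (other i) n) (d.chartHom φ X' f) =
      if κ * n ≤ a then coeff (Finsupp.single i (a - κ * n) + Finsupp.single (other i) n) f else 0 := by
  classical
  set t : Fin 3 →₀ ℕ := Finsupp.single i a + Finsupp.single (other i) n with ht
  set u : Fin 3 →₀ ℕ := Finsupp.single i (a - κ * n) + Finsupp.single (other i) n with hu
  let L : MvPowerSeries (Fin 3) k →ₗ[k] MvPowerSeries (Fin 3) k :=
    monomial 0 ∘ₗ (coeff t ∘ₗ (d.chartHom φ X').toLinearMap -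
      if κ * n ≤ a then coeff u else 0)
  have hLe : ∀ g, L g = monomial 0 (coeff t (d.chartHom φ X' g) -
      if κ * n ≤ a then coeff u g else 0) := by
    intro g
    change monomial 0 (coeff t (d.chartHom φ X' g) -
      (if κ * n ≤ a then coeff u else (0 : MvPowerSeries (Fin 3) k →ₗ[k] k)) g) = _
    split_ifs <;> rfl
  have hL : L f = 0 := by
    refine linearMap_eq_zero L (fun N => ⟨t.degree + u.degree + 1, fun g hg v _ => ?_⟩) f fun s hs => ?_
    · rw [hLe, mem_pow_iff.mp (algHom_mem_pow _ (mem_pow_of_order hg)) t (by omega),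
        hg u (by omega), ite_self, sub_zero, map_zero, map_zero]
    · have h0 := hf s hs
      rw [hLe]
      have e := eq_single_add_single h0 hi
      have h1 : coeff t (d.chartHom φ X' (monomial s 1)) =
          if a = s i + κ * s (other i) ∧ n = s (other i) then 1 else 0 := by
        rw [e, chartHom_monomial hX, map_zero, add_zero, X_pow_eq, X_pow_eq, monomial_mul_monomial,
          coeff_monomial, one_mul, ← e]
        refine if_congr ⟨fun h => ?_, fun h => by rw [ht, h.1, h.2]⟩ rfl rfl
        have h2 := DFunLike.congr_fun h i
        have h3 := DFunLike.congr_fun h (other i)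
        simp [ht, (other_ne hi).2, (other_ne hi).2.symm] at h2 h3
        exact ⟨h2, h3⟩
      have h2 : coeff u (monomial s (1 : k)) = if a - κ * n = s i ∧ n = s (other i) then 1 else 0 := by
        rw [coeff_monomial]
        refine if_congr ⟨fun h => ?_, fun h => by rw [hu, h.1, h.2, ← e]⟩ rfl rfl
        have h2 := DFunLike.congr_fun h i
        have h3 := DFunLike.congr_fun h (other i)
        simp [hu, (other_ne hi).2, (other_ne hi).2.symm] at h2 h3
        exact ⟨h2, h3⟩
      have h3 : (a = s i + κ * s (other i) ∧ n = s (other i)) ↔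
          (κ * n ≤ a ∧ a - κ * n = s i ∧ n = s (other i)) := by
        constructor
        · rintro ⟨rfl, rfl⟩
          omega
        · rintro ⟨h1, h2, rfl⟩
          omega
      rw [h1, h2, ← ite_and, if_congr h3 rfl rfl, sub_self, map_zero]
  rw [hLe] at hL
  have := congrArg (coeff 0) hL
  rw [coeff_monomial_same, coeff_zero] at this
  exact sub_eq_zero.mp this

end ChartCoeff

end Idealistic

namespace Idealistic

open MvPowerSeries IsLocalRing

/-! ### Lowest terms under blow-ups -/

section LeadBlowup

variable {k : Type*} [Field k] {p : ℕ} {O O' : Type*} [CommRing O] [Algebra k O] [CommRing O']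
  [Algebra k O'] {d : MonomialDatum k p O} {φ : O →ₐ[k] O'} {exc : O'} {i : Fin 3} {κ : ℕ} {c : k}
  {X' : MvPowerSeries (Fin 3) k ≃ₐ[k] O'} {F F' : MvPowerSeries (Fin 3) k} {q : ℕ}

/-- For `c = 0` the blow-up is monomial: the terms of `F'` correspond to those of `F`. The converse is
`exists_term_blowup`. -/
theorem exists_term_of_blowup (hX : d.IsChart φ exc i κ 0 X') (hi : i ≠ 0) (hF : F ∈ zFree k)
    (hF' : d.chartHom φ X' F = X i ^ q * F') {t : Fin 3 →₀ ℕ} (ht : coeff t F' ≠ 0) :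
    ∃ s, coeff s F ≠ 0 ∧ s (other i) = t (other i) ∧ s i + κ * s (other i) = t i + q := by
  have h0 : t 0 = 0 := (mem_zFree_of_X_pow_mul hi (hF' ▸ hX.chartHom_mem_zFree hi hF)) t ht
  have h1 : coeff (Finsupp.single i (q + t i) + Finsupp.single (other i) (t (other i)))
      (d.chartHom φ X' F) ≠ 0 := by
    have e : Finsupp.single i (q + t i) + Finsupp.single (other i) (t (other i)) =
        Finsupp.single i q + t := by
      rw [Finsupp.single_add, add_assoc, ← eq_single_add_single h0 hi]
    rwa [e, hF', X_pow_eq, coeff_add_monomial_mul, one_mul]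
  rw [coeff_chartHom hX hi hF, ite_ne_right_iff] at h1
  obtain ⟨h1, h2⟩ := h1
  refine ⟨_, h2, by simp [(other_ne hi).2], ?_⟩
  simp [(other_ne hi).2]
  omega

theorem exists_term_blowup (hX : d.IsChart φ exc i κ 0 X') (hi : i ≠ 0) (hF : F ∈ zFree k)
    (hF' : d.chartHom φ X' F = X i ^ q * F') {s : Fin 3 →₀ ℕ} (hs : coeff s F ≠ 0) :
    ∃ t, coeff t F' ≠ 0 ∧ t (other i) = s (other i) ∧ t i + q = s i + κ * s (other i) := by
  classical
  have h1 := coeff_chartHom hX hi hF (s i + κ * s (other i)) (s (other i))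
  rw [if_pos (by omega), Nat.add_sub_cancel, ← eq_single_add_single (hF s hs) hi, hF', X_pow_eq,
    coeff_monomial_mul, one_mul] at h1
  split_ifs at h1 with hle
  · rw [Finsupp.single_le_iff] at hle
    refine ⟨_, h1 ▸ hs, ?_, ?_⟩
    · simp [(other_ne hi).2]
    · simp [(other_ne hi).2] at hle ⊢
      omega
  · exact absurd h1.symm hs

/-- The lowest term along the strict transform of `{x_j = 0}`. -/
theorem IsLead.blowup_other (hX : d.IsChart φ exc i κ 0 X') (hi : i ≠ 0) (hF : F ∈ zFree k)
    (hF' : d.chartHom φ X' F = X i ^ q * F') {r n : ℕ} (h : IsLead F q (other i) r n) :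
    ∃ n', n' + q = n + κ * r ∧ IsLead F' q (other i) r n' := by
  obtain ⟨s, hs, rfl, hsn⟩ := h.exists_term
  rw [other_other hi] at hsn
  subst hsn
  obtain ⟨t, ht, htj, hti⟩ := exists_term_blowup hX hi hF hF' hs
  refine ⟨t i, hti, fun u hu => ?_, fun hdvd => h.not_dvd ⟨hdvd.1, ?_⟩, ⟨t, ht, htj, by rw [other_other hi]⟩,
    fun u hu huj hud => ?_⟩
  · obtain ⟨v, hv, h1, h2⟩ := exists_term_of_blowup hX hi hF hF' hu
    have := h.ordGE v hv
    rw [weight_single_one] at this ⊢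
    rwa [← h1]
  · have h1 : q ∣ s i + κ * s (other i) := hti ▸ dvd_add hdvd.2 dvd_rfl
    exact (Nat.dvd_add_left (hdvd.1.mul_left κ)).mp h1
  · obtain ⟨v, hv, h1, h2⟩ := exists_term_of_blowup hX hi hF hF' hu
    rw [other_other hi] at hud ⊢
    have h3 := h.min v hv (h1.trans huj) fun h3 => hud ⟨h3.1, by
      rw [other_other hi] at h3
      have h4 : q ∣ v i + κ * v (other i) := dvd_add h3.2 (by
        rw [h1, huj]; exact h3.1.mul_left κ)
      rw [h2] at h4
      exact (Nat.dvd_add_left dvd_rfl).mp h4⟩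
    rw [other_other hi] at h3
    rw [h1, huj] at h2
    omega

/-- The lowest term along the exceptional divisor of the blow-up of the curve `V(z, x_i)`. -/
theorem IsLead.blowup_curve (hX : d.IsChart φ exc i 0 0 X') (hi : i ≠ 0) (hF : F ∈ zFree k)
    (hF' : d.chartHom φ X' F = X i ^ q * F') {r n : ℕ} (h : IsLead F q i r n) :
    ∃ r', r' + q = r ∧ IsLead F' q i r' n := by
  obtain ⟨s, hs, rfl, rfl⟩ := h.exists_term
  obtain ⟨t, ht, htj, hti⟩ := exists_term_blowup hX hi hF hF' hs
  rw [zero_mul, add_zero] at hti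
  have hdvd : q ∣ t i ↔ q ∣ s i := by rw [← hti]; exact (Nat.dvd_add_left dvd_rfl).symm
  refine ⟨t i, hti, fun u hu => ?_, ?_, ⟨t, ht, rfl, htj⟩, fun u hu hui hud => ?_⟩
  · obtain ⟨v, hv, h1, h2⟩ := exists_term_of_blowup hX hi hF hF' hu
    rw [zero_mul, add_zero] at h2
    have h3 := h.ordGE v hv
    rw [weight_single_one] at h3 ⊢
    have h4 : s i ≤ v i := by exact_mod_cast h3
    exact_mod_cast (by omega : t i ≤ u i)
  · rw [hdvd]; exact h.not_dvd
  · obtain ⟨v, hv, h1, h2⟩ := exists_term_of_blowup hX hi hF hF' hu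
    rw [zero_mul, add_zero] at h2
    rw [hdvd, ← h1] at hud
    rw [← h1]
    exact h.min v hv (by omega) hud

end LeadBlowup

section Translate

variable {k : Type*} [Field k] {p : ℕ} [hp : Fact p.Prime] [CharP k p] {e : ℕ}

/-- A translation turns a polynomial that is not a `q`-th power into one that is not a `q`-th
power. -/
theorem exists_taylor_coeff_ne_zero {c : k} {G : Polynomial k} {n : ℕ} (hn : G.coeff n ≠ 0)
    (hd : ¬ p ^ e ∣ n) : ∃ m, (Polynomial.taylor c G).coeff m ≠ 0 ∧ ¬ p ^ e ∣ m := by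
  by_contra! h
  have hq : 0 < p ^ e := pow_pos hp.out.pos e
  set H := Polynomial.taylor c G with hH
  set K := Polynomial.contract (p ^ e) H with hK
  have h1 : H = Polynomial.expand k (p ^ e) K := by
    ext m
    rw [Polynomial.coeff_expand hq]
    split_ifs with hm
    · rw [hK, Polynomial.coeff_contract hq.ne', Nat.div_mul_cancel hm]
    · by_contra hne
      exact hm (h m hne)
  have h2 : G = Polynomial.expand k (p ^ e) (K.comp (Polynomial.X - Polynomial.C (c ^ p ^ e))) := by
    have h3 : G = H.comp (Polynomial.X - Polynomial.C c) := by
      rw [hH, Polynomial.taylor_apply, Polynomial.comp_assoc]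
      simp
    rw [h3, h1, Polynomial.expand_eq_comp_X_pow, Polynomial.expand_eq_comp_X_pow,
      Polynomial.comp_assoc, Polynomial.comp_assoc]
    congr 1
    simp [sub_pow_char_pow, Polynomial.C_pow]
  apply hn
  rw [h2, Polynomial.coeff_expand hq, if_neg hd]

end Translate

section PointLead

variable {k : Type*} [Field k] {p : ℕ} {O O' : Type*} [CommRing O] [Algebra k O] [CommRing O']
  [Algebra k O'] {d : MonomialDatum k p O} {φ : O →ₐ[k] O'} {exc : O'} {i : Fin 3} {κ : ℕ} {c : k}
  {X' : MvPowerSeries (Fin 3) k ≃ₐ[k] O'} {F F' : MvPowerSeries (Fin 3) k} {q : ℕ}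

/-- The dehomogenization of the homogeneous part of degree `ρ` of a series in `x_1, x_2`. -/
noncomputable def dehom (i : Fin 3) (ρ : ℕ) (F : MvPowerSeries (Fin 3) k) : Polynomial k :=
  ∑ n ∈ Finset.range (ρ + 1), Polynomial.monomial n
    (coeff (Finsupp.single i (ρ - n) + Finsupp.single (other i) n) F)

theorem coeff_dehom (i : Fin 3) (ρ : ℕ) (F : MvPowerSeries (Fin 3) k) (n : ℕ) :
    (dehom i ρ F).coeff n = if n ≤ ρ then
      coeff (Finsupp.single i (ρ - n) + Finsupp.single (other i) n) F else 0 := by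
  rw [dehom, Polynomial.finsetSum_coeff]
  simp only [Polynomial.coeff_monomial]
  rw [Finset.sum_ite_eq']
  simp only [Finset.mem_range, Nat.lt_succ_iff]

/-- The lowest coefficients along the exceptional divisor of the blow-up of the point are those of the
dehomogenized initial form, translated by `c`. -/
theorem coeff_chartHom_point (hX : d.IsChart φ exc i 1 c X') (hi : i ≠ 0) (hF : F ∈ zFree k) {ρ : ℕ}
    (hρ : OrdGE (fun _ => 1) ρ F) (m : ℕ) :
    coeff (Finsupp.single i ρ + Finsupp.single (other i) m) (d.chartHom φ X' F) =
      (Polynomial.taylor c (dehom i ρ F)).coeff m := by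
  classical
  set t : Fin 3 →₀ ℕ := Finsupp.single i ρ + Finsupp.single (other i) m with ht
  let A : MvPowerSeries (Fin 3) k →ₗ[k] k :=
    { toFun := fun g => (Polynomial.taylor c (dehom i ρ g)).coeff m
      map_add' := fun a b => by
        rw [← Polynomial.coeff_add, ← map_add]
        congr 2
        ext n
        rw [Polynomial.coeff_add, coeff_dehom, coeff_dehom, coeff_dehom]
        split_ifs <;> simp
      map_smul' := fun r a => by
        rw [RingHom.id_apply, ← Polynomial.coeff_smul, ← map_smul]
        congr 2
        ext n
        rw [Polynomial.coeff_smul, coeff_dehom, coeff_dehom]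
        split_ifs <;> simp }
  have hA : ∀ g, A g = (Polynomial.taylor c (dehom i ρ g)).coeff m := fun _ => rfl
  let L : MvPowerSeries (Fin 3) k →ₗ[k] MvPowerSeries (Fin 3) k :=
    monomial 0 ∘ₗ (coeff t ∘ₗ (d.chartHom φ X').toLinearMap - A)
  have hLe : ∀ g, L g = monomial 0 (coeff t (d.chartHom φ X' g) - A g) := fun _ => rfl
  have hL : L F = 0 := by
    refine linearMap_eq_zero L (fun N => ⟨t.degree + ρ + 1, fun g hg v _ => ?_⟩) F fun s hs => ?_
    · have h1 : dehom i ρ g = 0 := by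
        ext n
        rw [coeff_dehom, Polynomial.coeff_zero]
        split_ifs with h
        · exact hg _ (by rw [map_add, Finsupp.degree_single, Finsupp.degree_single]; omega)
        · rfl
      rw [hLe, hA, mem_pow_iff.mp (algHom_mem_pow _ (mem_pow_of_order hg)) t (by omega), h1]
      simp
    · have h0 := hF s hs
      have hsρ : ρ ≤ s i + s (other i) := by
        have := hρ s hs
        rw [weight_one, degree_eq_add h0 hi] at this
        exact_mod_cast this
      rw [hLe, hA]
      have e := eq_single_add_single h0 hi
      have e1 : d.chartHom φ X' (monomial s 1) =
          monomial (Finsupp.single i (s i + s (other i))) 1 * (X (other i) + C c) ^ s (other i) := by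
        nth_rewrite 1 [e]
        rw [chartHom_monomial hX, one_mul, X_pow_eq]
      have e2 : dehom i ρ (monomial s (1 : k)) = if ρ = s i + s (other i) then Polynomial.X ^ s (other i) else 0 := by
        ext n
        rw [coeff_dehom, coeff_monomial, ← ite_and]
        have h3 : (n ≤ ρ ∧ Finsupp.single i (ρ - n) + Finsupp.single (other i) n = s) ↔
            (ρ = s i + s (other i) ∧ n = s (other i)) := by
          constructor
          · rintro ⟨h, rfl⟩
            simp [(other_ne hi).2, (other_ne hi).2.symm]
            omega
          · rintro ⟨h1, rfl⟩
            refine ⟨by omega, ?_⟩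
            rw [h1, Nat.add_sub_cancel, ← e]
        rw [if_congr h3 rfl rfl, ite_and]
        split_ifs with h4 h5
        · rw [h5, Polynomial.coeff_X_pow_self]
        · rw [Polynomial.coeff_X_pow, if_neg h5]
        · rw [Polynomial.coeff_zero]
      have e3 : ∀ n m : ℕ, coeff (Finsupp.single (other i) m) ((X (other i) + C c : MvPowerSeries (Fin 3) k) ^ n) =
          (Polynomial.taylor c (Polynomial.X ^ n)).coeff m := by
        intro n m
        have : (X (other i) + C c : MvPowerSeries (Fin 3) k) ^ n =
            Polynomial.aeval (X (other i)) (Polynomial.taylor c (Polynomial.X ^ n)) := by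
          rw [Polynomial.taylor_apply, Polynomial.X_pow_comp]
          simp [c_eq_algebraMap]
        rw [this, Polynomial.aeval_eq_sum_range, map_sum]
        have h6 : ∀ l, coeff (Finsupp.single (other i) m) ((X (other i) : MvPowerSeries (Fin 3) k) ^ l) =
            if m = l then 1 else 0 := fun l => by
          rw [coeff_X_pow]
          exact if_congr (Finsupp.single_injective _).eq_iff rfl rfl
        simp only [map_smul, h6, smul_eq_mul, mul_ite, mul_one, mul_zero]
        rw [Finset.sum_ite_eq]
        split_ifs with h7
        · rfl
        · rw [Finset.mem_range, Nat.lt_succ_iff, not_le] at h7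
          exact (Polynomial.coeff_eq_zero_of_natDegree_lt h7).symm
      rw [e1, e2]
      rcases hsρ.lt_or_eq with h | h
      · rw [if_neg h.ne, coeff_monomial_mul, if_neg, map_zero, Polynomial.coeff_zero, sub_zero,
          map_zero]
        rw [Finsupp.single_le_iff]
        simp [ht, (other_ne hi).2]
        exact h
      · rw [if_pos h, ht, h, coeff_add_monomial_mul, one_mul, e3, sub_self, map_zero]
  rw [hLe] at hL
  have := congrArg (coeff 0) hL
  rw [coeff_monomial_same, coeff_zero] at this
  exact sub_eq_zero.mp this

/-- The lowest term along the exceptional divisor of the blow-up of a bad point, where the initial form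
of `F` is not a `q`-th power. If `x_i ^ σ` divides `F`, the dehomogenized initial form has degree at
most `deg s - σ`, which bounds the exponent `n`. -/
theorem exists_isLead_point [hp : Fact p.Prime] [CharP k p] {e : ℕ} (hX : d.IsChart φ exc i 1 c X')
    (hi : i ≠ 0) (hF : F ∈ zFree k) (hF' : d.chartHom φ X' F = X i ^ p ^ e * F') {s : Fin 3 →₀ ℕ}
    (hs : coeff s F ≠ 0) (hsd : ¬ ∀ l, p ^ e ∣ s l) (hsF : OrdGE (fun _ => 1) (s.degree : ℕ) F) {σ : ℚ}
    (hσ : OrdGE (Pi.single i 1) σ F) :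
    ∃ r n, r + p ^ e = s.degree ∧ IsLead F' (p ^ e) i r n ∧ (n : ℚ) + σ ≤ s.degree := by
  set q := p ^ e with hq
  set ρ := s.degree with hρ
  have h0 := hF s hs
  have hρs : ρ = s i + s (other i) := degree_eq_add h0 hi
  set G := dehom i ρ F with hG
  have hGs : G.coeff (s (other i)) ≠ 0 := by
    rw [hG, coeff_dehom, if_pos (by omega), hρs, Nat.add_sub_cancel, ← eq_single_add_single h0 hi]
    exact hs
  -- a term of the translated polynomial that does not come from a `q`-th power
  obtain ⟨m, hm, hmd⟩ : ∃ m, (Polynomial.taylor c G).coeff m ≠ 0 ∧ ¬ (q ∣ ρ ∧ q ∣ m) := by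
    by_cases hqρ : q ∣ ρ
    · rw [forall_dvd_iff h0 hi] at hsd
      obtain ⟨m, h1, h2⟩ := exists_taylor_coeff_ne_zero (p := p) (e := e) (c := c) hGs fun h => hsd
        ⟨(Nat.dvd_add_left h).mp (hρs ▸ hqρ), h⟩
      exact ⟨m, h1, fun h => h2 h.2⟩
    · have h1 : Polynomial.taylor c G ≠ 0 := by
        intro h
        rw [Polynomial.taylor_eq_zero] at h
        rw [h, Polynomial.coeff_zero] at hGs
        exact hGs rfl
      exact ⟨_, Polynomial.leadingCoeff_ne_zero.mpr h1, fun h => hqρ h.1⟩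
  -- translation does not change the degree
  have hmσ : (m : ℚ) + σ ≤ ρ := by
    have h1 : m ≤ G.natDegree := by
      rw [← Polynomial.natDegree_taylor G c]
      exact Polynomial.le_natDegree_of_ne_zero hm
    have h2 : G.coeff G.natDegree ≠ 0 := by
      refine Polynomial.leadingCoeff_ne_zero.mpr fun h => ?_
      rw [h, Polynomial.coeff_zero] at hGs
      exact hGs rfl
    rw [hG, coeff_dehom, ← hG, ite_ne_right_iff] at h2
    have h3 := hσ _ h2.2
    rw [weight_single_one, Finsupp.add_apply, Finsupp.single_eq_same,
      Finsupp.single_eq_of_ne (other_ne hi).2.symm, add_zero, Nat.cast_sub h2.1] at h3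
    have h4 : (m : ℚ) ≤ G.natDegree := by exact_mod_cast h1
    linarith
  have h1 := coeff_chartHom_point hX hi hF (ρ := ρ) hsF m
  have h2 : coeff (Finsupp.single i ρ + Finsupp.single (other i) m) (X i ^ q * F') ≠ 0 := by
    rw [← hF', h1]; exact hm
  classical
  rw [X_pow_eq, coeff_monomial_mul, one_mul, ite_ne_right_iff, Finsupp.single_le_iff] at h2
  obtain ⟨h2, h3⟩ := h2
  simp [(other_ne hi).2.symm] at h2
  have hord : OrdGE (Pi.single i 1) (ρ - q : ℕ) F' := by
    have h4 := hX.ordGE hi (w' := Pi.single i 1) (by simp [hi.symm]) (by simp) (Or.inl (by simp)) hsF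
    rw [hF'] at h4
    intro t ht
    have h5 := h4 (Finsupp.single i q + t) (by rwa [X_pow_eq, coeff_add_monomial_mul, one_mul])
    rw [weight_single_one, Finsupp.add_apply, Finsupp.single_eq_same] at h5
    rw [weight_single_one]
    have h6 : ρ ≤ q + t i := by exact_mod_cast h5
    exact_mod_cast (by omega : ρ - q ≤ t i)
  set t := Finsupp.single i ρ + Finsupp.single (other i) m - Finsupp.single i q with ht
  have hti : t i = ρ - q := by simp [ht, (other_ne hi).2.symm]
  have htj : t (other i) = m := by simp [ht, (other_ne hi).2]
  obtain ⟨n, hn, hlead⟩ := exists_isLead (q := q) hord h3 hti (by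
    rw [htj]
    rintro ⟨h4, h5⟩
    refine hmd ⟨?_, h5⟩
    have := dvd_add h4 (dvd_refl q)
    rwa [Nat.sub_add_cancel h2] at this)
  rw [htj] at hn
  refine ⟨ρ - q, n, Nat.sub_add_cancel h2, hlead, ?_⟩
  have : (n : ℚ) ≤ m := by exact_mod_cast hn
  linarith

end PointLead

end Idealistic

namespace Idealistic

/-! ### Words -/

section Words

/-- Two words lined up in increasing order, or the smallest pair if one of them is the smallest
word. -/
noncomputable def linedUp (A B : List ℚ) : List ℚ ×ₗ List ℚ :=
  open Classical in if A = [] ∨ B = [] then toLex ([], []) else toLex (min A B, max A B)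

theorem linedUp_comm (A B : List ℚ) : linedUp A B = linedUp B A := by
  rw [linedUp, linedUp]
  exact if_congr or_comm rfl (by rw [min_comm, max_comm])

theorem nil_lt_of_ne {A : List ℚ} (h : A ≠ []) : [] < A := by
  cases A with
  | nil => exact absurd rfl h
  | cons a A => exact List.nil_lt_cons a A

theorem nil_le_word (A : List ℚ) : [] ≤ A := by
  rcases eq_or_ne A [] with rfl | h
  · exact le_rfl
  · exact (nil_lt_of_ne h).le

/-- The pair decreases if the smaller word does; this includes the case that the new pair is the
smallest one by convention. -/
theorem linedUp_lt_of_min_lt {A B A' B' : List ℚ} (hA : A ≠ []) (hB : B ≠ [])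
    (h : min A' B' < min A B) : linedUp A' B' < linedUp A B := by
  rw [linedUp, linedUp, if_neg (show ¬ (A = [] ∨ B = []) by simp [hA, hB])]
  split_ifs
  · refine Prod.Lex.toLex_lt_toLex.mpr (Or.inl (nil_lt_of_ne ?_))
    rcases min_choice A B with h | h <;> rw [h] <;> assumption
  · exact Prod.Lex.toLex_lt_toLex.mpr (Or.inl h)

/-- The pair decreases if one word decreases and the other one does not increase. -/
theorem linedUp_lt {A B A' B' : List ℚ} (hA : A ≠ []) (hB : B ≠ [])
    (h1 : A' ≤ A) (h2 : B' < B) : linedUp A' B' < linedUp A B := by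
  rcases (min_le_min h1 h2.le).lt_or_eq with h | h
  · exact linedUp_lt_of_min_lt hA hB h
  rw [linedUp, linedUp, if_neg (show ¬ (A = [] ∨ B = []) by simp [hA, hB])]
  split_ifs
  · refine Prod.Lex.toLex_lt_toLex.mpr (Or.inl (nil_lt_of_ne ?_))
    rcases min_choice A B with h | h <;> rw [h] <;> assumption
  · refine Prod.Lex.toLex_lt_toLex.mpr (Or.inr ⟨h, ?_⟩)
    dsimp only
    rcases le_total A' B' with h3 | h3 <;> rcases le_total A B with h4 | h4
    · rwa [max_eq_right h3, max_eq_right h4]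
    · rw [min_eq_left h3, min_eq_right h4] at h
      exact absurd (h ▸ h3) h2.not_ge
    · rw [min_eq_right h3, min_eq_left h4] at h
      rw [max_eq_left h3, max_eq_right h4]
      exact lt_of_le_of_lt (h1.trans h.ge) h2
    · rw [min_eq_right h3, min_eq_right h4] at h
      exact absurd h h2.ne

theorem sort_lt_cons {L : Multiset ℚ} {x a : ℚ} (hx : x ∈ L) (h : x < a) (l : List ℚ) :
    L.sort (· ≤ ·) < a :: l := by
  have h1 := L.pairwise_sort (· ≤ ·)
  have h2 : x ∈ L.sort (· ≤ ·) := (Multiset.mem_sort _).mpr hx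
  cases hL : L.sort (· ≤ ·) with
  | nil => exact List.nil_lt_cons _ _
  | cons b t =>
    rw [hL] at h1 h2
    refine List.cons_lt_cons_iff.mpr (Or.inl ?_)
    rcases List.mem_cons.mp h2 with rfl | h2
    · exact h
    · exact ((List.pairwise_cons.mp h1).1 x h2).trans_lt h

theorem sort_pair (a b : ℚ) :
    (({a, b} : Multiset ℚ)).sort (· ≤ ·) = [min a b, max a b] := by
  have key : ∀ {a b : ℚ}, a ≤ b → (({a, b} : Multiset ℚ)).sort (· ≤ ·) = [a, b] := by
    intro a b h
    rw [Multiset.insert_eq_cons, Multiset.sort_cons, Multiset.sort_singleton]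
    intro c hc
    rw [Multiset.mem_singleton.mp hc]; exact h
  rcases le_total a b with h | h
  · rw [key h, min_eq_left h, max_eq_right h]
  · rw [Multiset.pair_comm, key h, min_eq_right h, max_eq_left h]

theorem sort_pair_lt {a b a' b' : ℚ} (ha : a' ≤ a) (hb : b' < b) :
    (({a', b'} : Multiset ℚ)).sort (· ≤ ·) < (({a, b} : Multiset ℚ)).sort (· ≤ ·) := by
  rw [sort_pair, sort_pair, List.cons_lt_cons_iff]
  rcases (min_le_min ha hb.le).lt_or_eq with h | h
  · exact Or.inl h
  · refine Or.inr ⟨h, List.cons_lt_cons_iff.mpr (Or.inl ?_)⟩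
    have h1 := min_add_max a b
    have h2 := min_add_max a' b'
    linarith

theorem le_sort_pair {a b β : ℚ} (ha : β ≤ a) (hb : β ≤ b) :
    [β] ≤ (({a, b} : Multiset ℚ)).sort (· ≤ ·) := by
  rw [sort_pair]
  refine le_of_lt (List.cons_lt_cons_iff.mpr ?_)
  rcases (le_min ha hb).lt_or_eq with h | h
  · exact Or.inl h
  · exact Or.inr ⟨h, List.nil_lt_cons _ _⟩

theorem sort_singleton_le {a a' : ℚ} (h : a' ≤ a) :
    (({a'} : Multiset ℚ)).sort (· ≤ ·) ≤ (({a} : Multiset ℚ)).sort (· ≤ ·) := by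
  rw [Multiset.sort_singleton, Multiset.sort_singleton]
  rcases h.lt_or_eq with h | h
  · exact le_of_lt (List.cons_lt_cons_iff.mpr (Or.inl h))
  · rw [h]

end Words

namespace MonomialDatum

variable {k : Type*} {p : ℕ} {O : Type*} [Field k] [CommRing O] [Algebra k O]
  {d : MonomialDatum k p O}

theorem invSpade_eq (d : MonomialDatum k p O) : d.invSpade = linedUp d.wordA d.wordB := rfl

theorem wordA_le_sort (d : MonomialDatum k p O) : d.wordA ≤ d.letters.sort (· ≤ ·) := by
  rw [wordA]
  split_ifs
  · exact nil_le_word _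
  · exact le_rfl

theorem wordA_eq_sort (h : d.wordA ≠ []) : (0 : ℚ) ∉ d.letters ∧ d.wordA = d.letters.sort (· ≤ ·) := by
  rw [wordA] at h ⊢
  split_ifs at h ⊢ with h1
  · exact absurd rfl h
  · exact ⟨h1, rfl⟩

theorem wordB_eq (h : d.wordB ≠ []) : d.wordB = [d.muPoint - d.ordTight] := by
  rw [wordB] at h ⊢
  split_ifs at h ⊢
  · exact absurd rfl h
  · rfl

theorem wordB_lt {β : ℚ} (h : d.muPoint - d.ordTight < β) : d.wordB < [β] := by
  rw [wordB]
  split_ifs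
  · exact List.nil_lt_cons _ _
  · exact List.cons_lt_cons_iff.mpr (Or.inl h)

theorem words_ne_nil (h : d.invSpade ≠ zeroPair) : d.wordA ≠ [] ∧ d.wordB ≠ [] := by
  constructor
  · intro h1; exact h (by rw [invSpade, if_pos (Or.inl h1)])
  · intro h1; exact h (by rw [invSpade, if_pos (Or.inr h1)])

theorem invSpade_of_letters_eq_zero (h : d.letters = 0) : d.invSpade = zeroPair := by
  rw [invSpade, if_pos (Or.inl ?_)]
  rw [wordA, h, if_neg (by simp), Multiset.sort_zero]

theorem zeroPair_lt (h : d.invSpade ≠ zeroPair) : zeroPair < d.invSpade := by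
  obtain ⟨h1, h2⟩ := words_ne_nil h
  rw [invSpade_eq, linedUp, if_neg (by simp [h1, h2])]
  refine Prod.Lex.toLex_lt_toLex.mpr (Or.inl (nil_lt_of_ne ?_))
  rcases min_choice d.wordA d.wordB with h | h <;> rw [h] <;> assumption

theorem mem_badDivisors {l : Fin 3} : l ∈ d.badDivisors ↔ l ∈ d.young ∧ d.slope l < d.mu l := by
  rw [badDivisors, Finset.mem_filter]

theorem letters_eq (h0 : (0 : Fin 3) ∉ d.young) {i : Fin 3} (hi : i ≠ 0) :
    d.letters = (if i ∈ d.badDivisors then {d.wrho i} else 0) +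
      if Idealistic.other i ∈ d.badDivisors then {d.wrho (Idealistic.other i)} else 0 := by
  have h1 : d.letters = ∑ l ∈ d.badDivisors, {d.wrho l} := by
    rw [letters, Finset.sum]
    exact (Multiset.sum_map_singleton _).symm.trans (by rw [Multiset.map_map]; rfl)
  rw [h1, sum_eq_of_zero_notMem (fun h => h0 (mem_badDivisors.mp h).1) hi]

theorem card_badDivisors (h0 : (0 : Fin 3) ∉ d.young) {i : Fin 3} (hi : i ≠ 0) :
    d.badDivisors.card = (if i ∈ d.badDivisors then 1 else 0) +
      if Idealistic.other i ∈ d.badDivisors then 1 else 0 := by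
  rw [Finset.card_eq_sum_ones, sum_eq_of_zero_notMem (fun h => h0 (mem_badDivisors.mp h).1) hi]

theorem card_young (h0 : (0 : Fin 3) ∉ d.young) {i : Fin 3} (hi : i ≠ 0) :
    d.young.card = (if i ∈ d.young then 1 else 0) +
      if Idealistic.other i ∈ d.young then 1 else 0 := by
  rw [Finset.card_eq_sum_ones, sum_eq_of_zero_notMem h0 hi]

end MonomialDatum

end Idealistic

namespace Idealistic

open MvPowerSeries IsLocalRing

/-! ### The invariants of a datum -/

namespace MonomialDatum

section Basic

variable {k : Type*} {p : ℕ} {O : Type*} [Field k] [CommRing O] [Algebra k O]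
  {d d₁ d₂ : MonomialDatum k p O}

theorem span_x_ne (d : MonomialDatum k p O) {l l' : Fin 3} (h : l ≠ l') :
    Ideal.span {d.x l} ≠ Ideal.span {d.x l'} := by
  intro he
  have h1 : d.x l ∈ Ideal.span {d.x l'} := he ▸ Ideal.mem_span_singleton_self _
  rw [Ideal.mem_span_singleton, x, x, map_dvd_iff, ← pow_one (MvPowerSeries.X l'), X_pow_dvd_iff] at h1
  have h2 := h1 (Finsupp.single l 1) (by rw [Finsupp.single_eq_of_ne h.symm]; exact one_pos)
  rw [coeff_index_single_self_X] at h2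
  exact one_ne_zero h2

/-- The lowest degree of a term in the initial form along `{x_i = 0}` that is not a `q`-th power,
divided by `q`. -/
noncomputable def rho (d : MonomialDatum k p O) (i : Fin 3) : ℚ :=
  (resOrd d.q (initAlong i d.lastCoef) : ℚ) / d.q

theorem wrho_eq (d : MonomialDatum k p O) (i : Fin 3) : d.wrho i = d.rho i - d.ordTight := rfl

/-- The contribution of `{x_i = 0}` to the order of the tight monomial. -/
noncomputable def tight (d : MonomialDatum k p O) (i : Fin 3) : ℚ :=
  if i ∈ d.young then d.slope i else 0

variable [IsLocalRing O] {R : ℕ → Ideal O} {E : Set (Ideal O)}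

theorem IsPreCase.ordTight_eq (hd : d.IsPreCase R E) {i : Fin 3} (hi : i ≠ 0) :
    d.ordTight = d.tight i + d.tight (Idealistic.other i) :=
  sum_eq_of_zero_notMem hd.z_notMem hi d.slope

/-- The components of the boundary for two data at the same point correspond to each other. -/
theorem IsPreCase.exists_index (hd₁ : d₁.IsPreCase R E) (hd₂ : d₂.IsPreCase R E) {i : Fin 3}
    (hi : i ∈ d₁.young) : ∃ i' ∈ d₂.young, Ideal.span {d₂.x i'} = Ideal.span {d₁.x i} ∧
      (Idealistic.other i' ∈ d₂.young ↔ Idealistic.other i ∈ d₁.young) ∧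
      (Idealistic.other i ∈ d₁.young →
        Ideal.span {d₂.x (Idealistic.other i')} = Ideal.span {d₁.x (Idealistic.other i)}) := by
  have key : ∀ {d₁ d₂ : MonomialDatum k p O}, d₁.IsPreCase R E → d₂.IsPreCase R E → ∀ i ∈ d₁.young,
      ∃ i' ∈ d₂.young, Ideal.span {d₂.x i'} = Ideal.span {d₁.x i} := by
    intro d₁ d₂ h₁ h₂ i hi
    have h : Ideal.span {d₁.x i} ∈ E := h₁.boundary ▸ ⟨i, hi, rfl⟩
    rw [h₂.boundary] at h
    obtain ⟨i', hi', h⟩ := h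
    exact ⟨i', hi', h.symm⟩
  obtain ⟨i', hi', h⟩ := key hd₁ hd₂ i hi
  have key2 : ∀ {d₁ d₂ : MonomialDatum k p O}, d₁.IsPreCase R E → d₂.IsPreCase R E → ∀ {i i'},
      i ∈ d₁.young → i' ∈ d₂.young → Ideal.span {d₂.x i'} = Ideal.span {d₁.x i} →
      Idealistic.other i ∈ d₁.young → Idealistic.other i' ∈ d₂.young ∧
        Ideal.span {d₂.x (Idealistic.other i')} = Ideal.span {d₁.x (Idealistic.other i)} := by
    intro d₁ d₂ h₁ h₂ i i' hi hi' h hj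
    obtain ⟨j', hj', h2⟩ := key h₁ h₂ _ hj
    have hne : j' ≠ i' := by
      rintro rfl
      exact d₁.span_x_ne (other_ne (h₁.ne_zero hi)).2 (h2.symm.trans h)
    obtain rfl : j' = Idealistic.other i' :=
      (eq_or_other (h₂.ne_zero hi') (h₂.ne_zero hj')).resolve_left hne
    exact ⟨hj', h2⟩
  exact ⟨i', hi', h, ⟨fun hj => (key2 hd₂ hd₁ hi' hi h.symm hj).1,
    fun hj => (key2 hd₁ hd₂ hi hi' h hj).1⟩, fun hj => (key2 hd₁ hd₂ hi hi' h hj).2⟩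

end Basic

section WellAdapted

variable {k : Type*} {p : ℕ} {O : Type*} [Field k] [CommRing O] [Algebra k O]
  {d d₁ : MonomialDatum k p O} [hp : Fact p.Prime]

theorem ordGE_slope (i : Fin 3) : OrdGE (Pi.single i 1) (d.q * d.slope i) d.lastCoef := by
  have hq : (d.q : ℚ) ≠ 0 := by exact_mod_cast (q_pos d).ne'
  rcases ordGE_or_exists (Pi.single i 1) (d.q * d.mu i) d.lastCoef with h | ⟨s, hs, hlt, hsF⟩
  · exact h.mono (mul_le_mul_of_nonneg_left slopeVal_le (Nat.cast_nonneg _))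
  · rw [slope, ordAlong_eq, slopeVal_eq_div (q_pos d) hs hsF hlt, mul_div_cancel₀ _ hq]
    exact hsF

theorem ordGE_slopePoint (d : MonomialDatum k p O) :
    OrdGE (fun _ => 1) (d.q * d.slopePoint) d.lastCoef := by
  have hq : (d.q : ℚ) ≠ 0 := by exact_mod_cast (q_pos d).ne'
  rcases ordGE_or_exists (fun _ => 1) (d.q * d.muPoint) d.lastCoef with h | ⟨s, hs, hlt, hsF⟩
  · exact h.mono (mul_le_mul_of_nonneg_left slopeVal_le (Nat.cast_nonneg _))
  · rw [slopePoint, order_eq_weightedOrder, slopeVal_eq_div (q_pos d) hs hsF hlt,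
      mul_div_cancel₀ _ hq]
    exact hsF

theorem ordGE_tight (i : Fin 3) : OrdGE (Pi.single i 1) (d.q * d.tight i) d.lastCoef := by
  rw [tight]
  split_ifs
  · exact ordGE_slope i
  · exact OrdGE.of_nonpos (by simp)

variable [IsAlgClosed k] [CharP k p]

/-- At a bad point `a_q` has a term of degree `q H(P)` that is not a `q`-th power. -/
theorem exists_term_of_bad_point (had : d.WellAdaptedPoint) (hbad : d.slopePoint < d.muPoint) :
    ∃ s, coeff s d.lastCoef ≠ 0 ∧ (¬ ∀ l, d.q ∣ s l) ∧ (s.degree : ℚ) = d.q * d.slopePoint ∧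
      OrdGE (fun _ => 1) (s.degree : ℕ) d.lastCoef := by
  have hq : (d.q : ℚ) ≠ 0 := by exact_mod_cast (q_pos d).ne'
  rcases (wellAdaptedPoint_iff d).mp had with h | ⟨s, hs, hsd, hsc, hsF⟩
  · rw [slopePoint, order_eq_weightedOrder, slopeVal_eq_of_ordGE (q_pos d) h] at hbad
    exact absurd hbad (lt_irrefl _)
  · refine ⟨s, hs, hsd, ?_, by rwa [weight_one] at hsF⟩
    rw [slopePoint, order_eq_weightedOrder, slopeVal_eq_div (q_pos d) hs hsF hsc,
      mul_div_cancel₀ _ hq, weight_one]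

variable [IsLocalRing O] {R : ℕ → Ideal O} {E : Set (Ideal O)}

/-- The residual order along a bad divisor is the degree of a term of `a_q`, hence at least `q H(P)`. -/
theorem IsPreCase.slopePoint_le_rho (hd : d.IsPreCase R E) {i : Fin 3} (hi : i ∈ d.young)
    (had : d.WellAdaptedAlong i) (hbad : d.slope i < d.mu i) : d.slopePoint ≤ d.rho i := by
  have hq : (0 : ℚ) < d.q := by exact_mod_cast q_pos d
  obtain ⟨r, n, hl, -, -, hres⟩ := hd.exists_isLead hi had hbad
  obtain ⟨s, hs, rfl, rfl⟩ := hl.exists_term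
  have h1 := ordGE_slopePoint d s hs
  rw [weight_one, degree_eq_add (hd.lastCoef_mem_zFree s hs) (hd.ne_zero hi)] at h1
  rw [rho, hres, le_div_iff₀ hq, mul_comm]
  exact h1

/-- At a bad point on a bad divisor with nonzero letter, the order of the tight monomial is strictly smaller than `H(P)`. Otherwise a lowest term of `a_q` at `P` that is not a `q`-th power would
be the `q`-th power of the tight monomial (in the sense of rational exponents), and as a term of the
initial form along each bad divisor it would make the letter of that divisor vanish. -/
theorem IsPreCase.ordTight_lt (hd : d.IsPreCase R E) (hadP : d.WellAdaptedPoint)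
    (hP : d.slopePoint < d.muPoint) {i : Fin 3} (hi : i ∈ d.young)
    (had : d.WellAdaptedAlong i) (hbad : d.slope i < d.mu i) (h0 : d.wrho i ≠ 0) :
    d.ordTight < d.slopePoint := by
  have hq : (0 : ℚ) < d.q := by exact_mod_cast q_pos d
  have hi0 := hd.ne_zero hi
  obtain ⟨s, hs, hsd, hsdeg, -⟩ := exists_term_of_bad_point hadP hP
  have hz := hd.lastCoef_mem_zFree s hs
  rw [degree_eq_add hz hi0, Nat.cast_add] at hsdeg
  have h1 := ordGE_tight i s hs
  have h2 := ordGE_tight (Idealistic.other i) s hs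
  rw [weight_single_one] at h1 h2
  have hT := hd.ordTight_eq hi0
  by_contra! hle
  have h4 : (d.q : ℚ) * d.slopePoint ≤ d.q * d.ordTight := mul_le_mul_of_nonneg_left hle hq.le
  rw [hT, mul_add] at h4
  have h5 : (s i : ℚ) = d.q * d.tight i := by linarith
  have h6 : (s (Idealistic.other i) : ℚ) = d.q * d.tight (Idealistic.other i) := by linarith
  obtain ⟨r, n, hl, hslope, -, hres⟩ := hd.exists_isLead hi had hbad
  have h7 : (r : ℚ) = s i := by
    rw [h5, tight, if_pos hi, hslope, mul_div_cancel₀ _ hq.ne']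
  have h7' : s i = r := by exact_mod_cast h7.symm
  rw [forall_dvd_iff hz hi0, h7'] at hsd
  have h8 : (n : ℚ) ≤ s (Idealistic.other i) := by exact_mod_cast hl.min s hs h7' hsd
  have h9 := hd.slopePoint_le_rho hi had hbad
  have h10 : d.rho i ≤ d.ordTight := by
    rw [rho, hres, div_le_iff₀ hq, hT, Nat.cast_add]
    linarith
  have h11 : d.ordTight ≤ d.slopePoint := by
    have : (d.q : ℚ) * d.ordTight ≤ d.q * d.slopePoint := by rw [hT, mul_add]; linarith
    exact le_of_mul_le_mul_left this hq
  exact h0 (by rw [wrho_eq]; linarith)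

/-- Reading off the invariants of a well-adapted datum from another datum. -/
theorem IsPreCase.of_isLead (hd : d.IsPreCase R E) (hd₁ : d₁.IsPreCase R E) (he : d₁.e = d.e)
    (hR : IsFiltration R) (hS : ∀ n, R n ≤ maximalIdeal O ^ n) (hpure : HasPureRank k p R d.e)
    {i i₁ : Fin 3} (hi : i ∈ d.young) (hi₁ : i₁ ∈ d₁.young)
    (hD : Ideal.span {d.x i} = Ideal.span {d₁.x i₁}) (had : d.WellAdaptedAlong i) {r n : ℕ}
    (h : IsLead d₁.lastCoef d₁.q i₁ r n) (hr : (r : ℚ) < d₁.q * d₁.mu i₁) :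
    d.slope i < d.mu i ∧ d.slope i = (r : ℚ) / d.q ∧ d.rho i = ((r + n : ℕ) : ℚ) / d.q := by
  have h1 := hd₁.redAt_of_isLead hi₁ h hr
  rw [he, ← hD] at h1
  obtain ⟨h2, h3, h4⟩ := hd.eq_of_redAt hR hS hpure hi had h1
  exact ⟨h2, h3, by rw [rho, h4]⟩

theorem IsPreCase.mu_eq (hd : d.IsPreCase R E) (hd₁ : d₁.IsPreCase R E) (he : d₁.e = d.e)
    (hR : IsFiltration R) (hS : ∀ n, R n ≤ maximalIdeal O ^ n) (hpure : HasPureRank k p R d.e)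
    {i i₁ : Fin 3} (hi : i ∈ d.young) (hi₁ : i₁ ∈ d₁.young)
    (hD : Ideal.span {d.x i} = Ideal.span {d₁.x i₁}) : d.mu i = d₁.mu i₁ :=
  MuAt.unique hR hS hpure ⟨d, hd, rfl, i, hi, rfl, rfl⟩ ⟨d₁, hd₁, he, i₁, hi₁, hD, rfl⟩

theorem IsPreCase.slope_eq_of_ordGE (hd : d.IsPreCase R E) (hd₁ : d₁.IsPreCase R E) (he : d₁.e = d.e)
    (hR : IsFiltration R) (hS : ∀ n, R n ≤ maximalIdeal O ^ n) (hpure : HasPureRank k p R d.e)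
    {i i₁ : Fin 3} (hi : i ∈ d.young) (hi₁ : i₁ ∈ d₁.young)
    (hD : Ideal.span {d.x i} = Ideal.span {d₁.x i₁}) (had : d.WellAdaptedAlong i)
    (h : OrdGE (Pi.single i₁ 1) (d₁.q * d₁.mu i₁) d₁.lastCoef) : d.slope i = d.mu i :=
  hd.slope_eq_of_goodAt hR hS hpure hi had ⟨d₁, hd₁, he, i₁, hi₁, hD, h⟩

end WellAdapted

end MonomialDatum

end Idealistic

namespace Idealistic

open MvPowerSeries IsLocalRing

/-! ### Comparison of the invariants before and after a blow-up -/

namespace MonomialDatum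

section Usual

variable {k : Type*} {p : ℕ} {O : Type*} [Field k] [CommRing O] [Algebra k O]

/-- The contribution of `{x_i = 0}` to `μ(P)`. -/
noncomputable def usual (d : MonomialDatum k p O) (i : Fin 3) : ℚ :=
  if i ∈ d.young then d.mu i else 0

theorem usual_eq (d : MonomialDatum k p O) (i : Fin 3) : d.usual i = (d.expo i : ℚ) / d.a := by
  rw [usual, expo, mu]
  split_ifs <;> simp

end Usual

variable {k : Type*} {p : ℕ} {O O' : Type*} [Field k] [CommRing O] [Algebra k O] [CommRing O']
  [Algebra k O'] [IsLocalRing O] [IsLocalRing O'] [IsAlgClosed k] [hp : Fact p.Prime] [CharP k p]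
  {d : MonomialDatum k p O} {φ : O →ₐ[k] O'} {exc : O'} {i : Fin 3} {κ : ℕ} {c : k}
  {X' : MvPowerSeries (Fin 3) k ≃ₐ[k] O'} {d' : MonomialDatum k p O'}
  {R : ℕ → Ideal O} {E : Set (Ideal O)}

/-- The comparison of well-adapted data before and after the blow-up.  The invariants along the
exceptional divisor `{x_i' = 0}` are those of the transform `F'` of the last coefficient; the
invariants along the strict transform of `{x_j = 0}` are expressed by those of `{x_j = 0}`. -/
theorem IsPreCase.blowup_laws (hd : d.IsPreCase R E) (hwa : ∀ l ∈ d.young, d.WellAdaptedAlong l)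
    (hR : IsFiltration R) (hX : d.IsChart φ exc i κ c X') (hi : i ≠ 0)
    (hdvd : ∀ l ∈ Finset.Icc 1 d.q, MvPowerSeries.X i ^ l ∣ d.chartHom φ X' (d.coef l))
    (hle : d.a ≤ d.expo i + κ * d.expo (Idealistic.other i))
    (hS' : ∀ n, transformFiltration φ exc R n ≤ maximalIdeal O' ^ n)
    (hd' : d'.IsPreCase (transformFiltration φ exc R) (transformBoundary φ exc E))
    (hwa' : ∀ l ∈ d'.young, d'.WellAdaptedAlong l) (he : d'.e = d.e)
    (hpure : HasPureRank k p (transformFiltration φ exc R) d'.e) :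
    ∃ F' i', d.chartHom φ X' d.lastCoef = MvPowerSeries.X i ^ d.q * F' ∧ i' ∈ d'.young ∧
      Ideal.span {d'.x i'} = Ideal.span {exc} ∧
      d'.mu i' = d.usual i + κ * d.usual (Idealistic.other i) - 1 ∧
      (∀ r n, IsLead F' d.q i r n → (r : ℚ) < d.q * d'.mu i' →
        d'.slope i' < d'.mu i' ∧ d'.slope i' = (r : ℚ) / d.q ∧
          d'.rho i' = ((r + n : ℕ) : ℚ) / d.q) ∧
      (OrdGE (Pi.single i 1) (d.q * d'.mu i') F' → d'.slope i' = d'.mu i') ∧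
      (Idealistic.other i' ∈ d'.young ↔ Idealistic.other i ∈ d.young ∧ c = 0) ∧
      (Idealistic.other i' ∈ d'.young →
        d'.mu (Idealistic.other i') = d.mu (Idealistic.other i) ∧
        d'.slope (Idealistic.other i') = d.slope (Idealistic.other i) ∧
        (d.slope (Idealistic.other i) < d.mu (Idealistic.other i) →
          d'.rho (Idealistic.other i') =
            d.rho (Idealistic.other i) + κ * d.slope (Idealistic.other i) - 1)) := by
  choose! coef' hcoef using hdvd
  have hq := q_pos d
  have hq' : (0 : ℚ) < d.q := by exact_mod_cast hq
  have hqe : d'.q = d.q := by rw [q, q, he]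
  have hqI : d.q ∈ Finset.Icc 1 d.q := Finset.mem_Icc.mpr ⟨hq, le_rfl⟩
  have ha : (0 : ℚ) < d.a := by exact_mod_cast hd.a_pos
  have hR' := isFiltration_transform φ exc hR
  set B := d.blowup X' i κ c coef' with hBdef
  have hB : B.IsPreCase (transformFiltration φ exc R) (transformBoundary φ exc E) :=
    hd.blowup hR hX hi hcoef hS' hle
  have hBe : B.e = d'.e := he.symm
  have hBq : B.q = d.q := rfl
  have hBi : i ∈ B.young := mem_blowup_young.mpr (Or.inl rfl)
  have hBF : B.lastCoef = coef' d.q := rfl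
  have hF' : d.chartHom φ X' d.lastCoef = MvPowerSeries.X i ^ d.q * coef' d.q := hcoef _ hqI
  have hBj : Idealistic.other i ∈ B.young ↔ Idealistic.other i ∈ d.young ∧ c = 0 := by
    rw [mem_blowup_young]
    simp [(other_ne hi).2]
  obtain ⟨i', hi', hD, hiff, hDj⟩ := hB.exists_index hd' hBi
  have hmui : d'.mu i' = B.mu i := hd'.mu_eq hB hBe hR' hS' hpure hi' hBi hD
  refine ⟨coef' d.q, i', hF', hi', hD.trans hX.span_exc, ?_, fun r n hl hr => ?_, fun h => ?_,
    hiff.trans hBj, fun hj' => ?_⟩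
  · have e : B.mu i = ((d.expo i + κ * d.expo (Idealistic.other i) - d.a : ℕ) : ℚ) / d.a := by
      change ((if i = i then _ else _ : ℕ) : ℚ) / d.a = _
      rw [if_pos rfl]
    rw [hmui, e, usual_eq, usual_eq, Nat.cast_sub hle]
    push_cast
    field_simp
  · have := hd'.of_isLead hB hBe hR' hS' hpure hi' hBi hD (hwa' i' hi') (r := r) (n := n) hl
      (by rw [← hmui]; exact hr)
    rwa [hqe] at this
  · exact hd'.slope_eq_of_ordGE hB hBe hR' hS' hpure hi' hBi hD (hwa' i' hi')
      (by rw [← hmui]; exact h)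
  · obtain ⟨hj, hc⟩ := hBj.mp (hiff.mp hj')
    subst hc
    have hjB := hiff.mp hj'
    have hDj := hDj hjB
    have hmuB : B.mu (Idealistic.other i) = d.mu (Idealistic.other i) := by
      change ((if Idealistic.other i = i then _ else _ : ℕ) : ℚ) / d.a = _
      rw [if_neg (other_ne hi).2]; rfl
    have hmuj : d'.mu (Idealistic.other i') = d.mu (Idealistic.other i) :=
      (hd'.mu_eq hB hBe hR' hS' hpure hj' hjB hDj).trans hmuB
    refine ⟨hmuj, ?_⟩
    rcases lt_or_eq_of_le (show d.slope (Idealistic.other i) ≤ d.mu (Idealistic.other i) from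
      slopeVal_le) with hbad | hgood
    · obtain ⟨r, n, hl, hsl, hr, hres⟩ := hd.exists_isLead hj (hwa _ hj) hbad
      obtain ⟨n', hn', hl'⟩ := hl.blowup_other hX hi hd.lastCoef_mem_zFree hF'
      obtain ⟨-, h1, h2⟩ := hd'.of_isLead hB hBe hR' hS' hpure hj' hjB hDj (hwa' _ hj') (r := r)
        (n := n') hl' (by rw [hmuB]; exact hr)
      rw [hqe] at h1 h2
      refine ⟨h1.trans hsl.symm, fun _ => ?_⟩
      have hn : (n' : ℚ) = n + κ * r - d.q := by
        have : ((n' + d.q : ℕ) : ℚ) = (n + κ * r : ℕ) := by rw [hn']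
        push_cast at this
        linarith
      rw [h2, hsl, rho, hres]
      push_cast
      rw [hn]
      field_simp
      ring
    · refine ⟨?_, fun h => absurd hgood h.ne⟩
      rw [hgood, ← hmuj]
      refine hd'.slope_eq_of_ordGE hB hBe hR' hS' hpure hj' hjB hDj (hwa' _ hj') ?_
      have h1 := hX.ordGE hi (w' := Pi.single (Idealistic.other i) 1)
        (by simp [(other_ne hi).1.symm]) (by simp [(other_ne hi).2.symm]) (Or.inr ⟨rfl, by simp⟩)
        (ordGE_of_slope_eq (q_pos d) hgood)
      rw [hF'] at h1
      rw [hmuB, hBF, hBq]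
      intro t ht
      have h2 := h1 (Finsupp.single i d.q + t) (by
        rwa [X_pow_eq, coeff_add_monomial_mul, one_mul])
      rw [weight_single_one, Finsupp.add_apply, Finsupp.single_eq_of_ne (other_ne hi).2,
        zero_add] at h2
      rw [weight_single_one]
      exact h2

end MonomialDatum

end Idealistic

namespace Idealistic

/-! ### Arithmetic of the invariant -/

namespace MonomialDatum

variable {k : Type*} {p : ℕ} {O O' : Type*} [Field k] [CommRing O] [Algebra k O] [CommRing O']
  [Algebra k O']

section Single

variable {d : MonomialDatum k p O}

theorem slope_le_mu (l : Fin 3) : d.slope l ≤ d.mu l := slopeVal_le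

theorem wordA_of_letters_eq_zero (h : d.letters = 0) : d.wordA = [] := by
  rw [wordA, h, if_neg (by simp), Multiset.sort_zero]

theorem wordB_le {β : ℚ} (h : d.muPoint - d.ordTight ≤ β) : d.wordB ≤ [β] := by
  rcases h.lt_or_eq with h | h
  · exact (wordB_lt h).le
  · rw [wordB, h]
    split_ifs
    · exact nil_le_word _
    · exact le_rfl

theorem tight_eq_usual {l : Fin 3} (h : l ∉ d.badDivisors) : d.tight l = d.usual l := by
  rw [tight, usual]
  split_ifs with hl
  · rw [mem_badDivisors, not_and, not_lt] at h
    exact le_antisymm (slope_le_mu l) (h hl)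
  · rfl

theorem tight_of_mem {l : Fin 3} (h : l ∈ d.young) : d.tight l = d.slope l := if_pos h

theorem usual_of_mem {l : Fin 3} (h : l ∈ d.young) : d.usual l = d.mu l := if_pos h

theorem wrho_mem_letters {l : Fin 3} (h : l ∈ d.badDivisors) : d.wrho l ∈ d.letters :=
  Multiset.mem_map_of_mem _ h

variable [IsLocalRing O] {R : ℕ → Ideal O} {E : Set (Ideal O)}

theorem IsPreCase.muPoint_eq (hd : d.IsPreCase R E) {i : Fin 3} (hi : i ≠ 0) :
    d.muPoint = d.usual i + d.usual (Idealistic.other i) :=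
  sum_eq_of_zero_notMem hd.z_notMem hi d.mu

end Single

/-- The relations between well-adapted data before and after the blow-up of the point: `{x_i' = 0}`
is the exceptional divisor, and `{x_j' = 0}` the strict transform of `{x_j = 0}`, if it passes
through the new point. -/
structure IsPointTransform (d : MonomialDatum k p O) (d' : MonomialDatum k p O') (i i' : Fin 3)
    (c : k) : Prop where
  mem : i' ∈ d'.young
  mu : d'.mu i' = d.muPoint - 1
  good : d.slopePoint = d.muPoint → d'.slope i' = d'.mu i'
  bad : d.slopePoint < d.muPoint → d'.slope i' < d'.mu i' ∧ d'.slope i' = d.slopePoint - 1 ∧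
    d'.rho i' + d.tight i ≤ 2 * d.slopePoint - 1
  other_mem : Idealistic.other i' ∈ d'.young ↔ Idealistic.other i ∈ d.young ∧ c = 0
  other : Idealistic.other i' ∈ d'.young →
    d'.mu (Idealistic.other i') = d.mu (Idealistic.other i) ∧
    d'.slope (Idealistic.other i') = d.slope (Idealistic.other i) ∧
    (d.slope (Idealistic.other i) < d.mu (Idealistic.other i) →
      d'.rho (Idealistic.other i') =
        d.rho (Idealistic.other i) + d.slope (Idealistic.other i) - 1)

/-- The relations between well-adapted data before and after the blow-up of the curve
`V(z, x_i)`. -/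
structure IsCurveTransform (d : MonomialDatum k p O) (d' : MonomialDatum k p O') (i i' : Fin 3) :
    Prop where
  mem : i' ∈ d'.young
  mu : d'.mu i' = d.mu i - 1
  slope : d'.slope i' = d.slope i - 1
  rho : d.slope i < d.mu i → d'.rho i' = d.rho i - 1
  other_mem : Idealistic.other i' ∈ d'.young ↔ Idealistic.other i ∈ d.young
  other : Idealistic.other i' ∈ d'.young →
    d'.mu (Idealistic.other i') = d.mu (Idealistic.other i) ∧
    d'.slope (Idealistic.other i') = d.slope (Idealistic.other i) ∧
    (d.slope (Idealistic.other i) < d.mu (Idealistic.other i) →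
      d'.rho (Idealistic.other i') = d.rho (Idealistic.other i) - 1)

variable [IsLocalRing O] [IsLocalRing O'] {d : MonomialDatum k p O} {d' : MonomialDatum k p O'}
  {R : ℕ → Ideal O} {E : Set (Ideal O)} {R' : ℕ → Ideal O'} {E' : Set (Ideal O')} {i i' : Fin 3}
  {c : k}

/-- Blowing up a curve lowers `μ(P)`, the order of the tight monomial and all the `ρ` by `1`; the words
only involve differences of these numbers. -/
theorem IsCurveTransform.invSpade_eq (h : IsCurveTransform d d' i i') (hd : d.IsPreCase R E)
    (hd' : d'.IsPreCase R' E') (hi : i ∈ d.young) : d.invSpade = d'.invSpade := by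
  have hi0 := hd.ne_zero hi
  have hi0' := hd'.ne_zero h.mem
  have hT := hd.ordTight_eq hi0
  have hT' := hd'.ordTight_eq hi0'
  have hμ := hd.muPoint_eq hi0
  have hμ' := hd'.muPoint_eq hi0'
  rw [tight_of_mem hi] at hT
  rw [tight_of_mem h.mem, h.slope] at hT'
  rw [usual_of_mem hi] at hμ
  rw [usual_of_mem h.mem, h.mu] at hμ'
  have h1 : d'.tight (Idealistic.other i') = d.tight (Idealistic.other i) ∧
      d'.usual (Idealistic.other i') = d.usual (Idealistic.other i) ∧
      (Idealistic.other i' ∈ d'.badDivisors ↔ Idealistic.other i ∈ d.badDivisors) := by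
    rw [mem_badDivisors, mem_badDivisors, tight, tight, usual, usual]
    by_cases hj : Idealistic.other i' ∈ d'.young
    · obtain ⟨h2, h3, -⟩ := h.other hj
      have hj' := h.other_mem.mp hj
      rw [if_pos hj, if_pos hj', if_pos hj, if_pos hj', h2, h3]
      exact ⟨rfl, rfl, by simp only [hj, hj', true_and]⟩
    · have hj' : Idealistic.other i ∉ d.young := fun h' => hj (h.other_mem.mpr h')
      rw [if_neg hj, if_neg hj', if_neg hj, if_neg hj']
      exact ⟨rfl, rfl, by simp only [hj, hj', false_and]⟩
  obtain ⟨h1, h2, h3⟩ := h1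
  rw [h1] at hT'
  rw [h2] at hμ'
  have hTT : d'.ordTight = d.ordTight - 1 := by linarith
  have h4 : i' ∈ d'.badDivisors ↔ i ∈ d.badDivisors := by
    rw [mem_badDivisors, mem_badDivisors, h.mu, h.slope]
    simp only [h.mem, hi, true_and, sub_lt_sub_iff_right]
  have h5 : i ∈ d.badDivisors → d'.wrho i' = d.wrho i := fun hb => by
    rw [wrho_eq, wrho_eq, h.rho (mem_badDivisors.mp hb).2, hTT]; ring
  have h6 : Idealistic.other i ∈ d.badDivisors →
      d'.wrho (Idealistic.other i') = d.wrho (Idealistic.other i) := fun hb => by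
    have hj := (h.other_mem.mpr (mem_badDivisors.mp hb).1)
    rw [wrho_eq, wrho_eq, (h.other hj).2.2 (mem_badDivisors.mp hb).2, hTT]; ring
  have hL : d'.letters = d.letters := by
    rw [letters_eq hd'.z_notMem hi0', letters_eq hd.z_notMem hi0]
    simp only [h3, h4]
    congr 1
    · split_ifs with hb
      · rw [h5 hb]
      · rfl
    · split_ifs with hb
      · rw [h6 hb]
      · rfl
  have hβ : d'.muPoint - d'.ordTight = d.muPoint - d.ordTight := by linarith
  rw [MonomialDatum.invSpade_eq, MonomialDatum.invSpade_eq, wordA, wordA, wordB, wordB, hL, hβ]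

variable [IsAlgClosed k] [hp : Fact p.Prime] [CharP k p]

/-- The behaviour of the invariant under the blow-up of the point: the regular decrease, without an
increase of the word `A`; a transition to a single bad divisor, where only the word `B` is certain to
decrease; or a good point on two bad divisors, where `B ≤ A` and again `B` decreases. By `hchart`,
`{x_i = 0}` belongs to the boundary unless the strict transform of `{x_j = 0}` passes through the new
point; so if no old component is kept and `{x_j = 0}` belongs to the boundary, there were two
components. -/
theorem IsPointTransform.invSpade_lt (h : IsPointTransform d d' i i' c) (hd : d.IsPreCase R E)
    (hd' : d'.IsPreCase R' E') (hwaP : d.WellAdaptedPoint)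
    (hwa : ∀ l ∈ d.young, d.WellAdaptedAlong l) (hinv : d.invSpade ≠ zeroPair) (hi0 : i ≠ 0)
    (hchart : i ∈ d.young ∨ c = 0) :
    (d'.invSpade < d.invSpade ∧ ¬ d.wordA < d'.wordA) ∨
    ((d.config = 4 ∨ d.config = 5) ∧ d'.config = 3 ∧
      (d'.wordA ≤ d.wordA → d'.invSpade < d.invSpade)) ∨
    (d.config = 5 ∧ d.IsGoodPoint ∧ d'.config = 4 ∧ d'.invSpade < d.invSpade) := by
  obtain ⟨hAne, hBne⟩ := words_ne_nil hinv
  obtain ⟨hA0, hA⟩ := wordA_eq_sort hAne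
  have hB := wordB_eq hBne
  have hi0' := hd'.ne_zero h.mem
  have hT := hd.ordTight_eq hi0
  have hT' := hd'.ordTight_eq hi0'
  have hμ := hd.muPoint_eq hi0
  have hμ' := hd'.muPoint_eq hi0'
  have hL := letters_eq hd.z_notMem hi0
  have hL' := letters_eq hd'.z_notMem hi0'
  have hcY := card_young hd.z_notMem hi0
  have hcY' := card_young hd'.z_notMem hi0'
  have hcB := card_badDivisors hd.z_notMem hi0
  have hcB' := card_badDivisors hd'.z_notMem hi0'
  rw [tight_of_mem h.mem] at hT'
  rw [usual_of_mem h.mem, h.mu] at hμ'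
  rw [if_pos h.mem] at hcY'
  set j := Idealistic.other i with hj
  set j' := Idealistic.other i' with hj'
  have hsome : i ∈ d.badDivisors ∨ j ∈ d.badDivisors := by
    by_contra! hcon
    rw [if_neg hcon.1, if_neg hcon.2, add_zero] at hL
    exact hAne (wordA_of_letters_eq_zero hL)
  have hne : ∀ {l}, l ∈ d.badDivisors → d.wrho l ≠ 0 := fun hl h0 => hA0 (h0 ▸ wrho_mem_letters hl)
  have hbad : ∀ {l}, l ∈ d.badDivisors → l ∈ d.young ∧ d.slope l < d.mu l ∧ d.tight l = d.slope l ∧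
      d.usual l = d.mu l ∧ d.slopePoint ≤ d.rho l := fun {l} hl => by
    obtain ⟨h1, h2⟩ := mem_badDivisors.mp hl
    exact ⟨h1, h2, tight_of_mem h1, usual_of_mem h1, hd.slopePoint_le_rho h1 (hwa _ h1) h2⟩
  have hle : ∀ l, d.tight l ≤ d.usual l := fun l => by
    rw [tight, usual]; split_ifs
    · exact slope_le_mu l
    · exact le_rfl
  have hβ : d.ordTight < d.muPoint := by
    rcases hsome with h1 | h1
    · obtain ⟨-, h2, h3, h4, -⟩ := hbad h1
      linarith [hle j]
    · obtain ⟨-, h2, h3, h4, -⟩ := hbad h1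
      linarith [hle i]
  have hkept : j' ∈ d'.young → j ∈ d.young ∧ d'.tight j' = d.slope j ∧ d'.usual j' = d.mu j ∧
      d.tight j = d.slope j ∧ d.usual j = d.mu j ∧ (j' ∈ d'.badDivisors ↔ j ∈ d.badDivisors) ∧
      (j ∈ d.badDivisors → d'.rho j' = d.rho j + d.slope j - 1) := fun h1 => by
    obtain ⟨h2, h3, h4⟩ := h.other h1
    have h5 := (h.other_mem.mp h1).1
    refine ⟨h5, by rw [tight_of_mem h1, h3], by rw [usual_of_mem h1, h2], tight_of_mem h5,
      usual_of_mem h5, ?_, fun hb => h4 (mem_badDivisors.mp hb).2⟩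
    rw [mem_badDivisors, mem_badDivisors, h2, h3]
    simp only [h1, h5, hj, true_and]
  rw [MonomialDatum.invSpade_eq d, MonomialDatum.invSpade_eq d']
  rcases lt_or_eq_of_le (show d.slopePoint ≤ d.muPoint from slopeVal_le) with hP | hP
  · -- the point is bad: the exceptional divisor is bad
    obtain ⟨hs1, hs2, hs3⟩ := h.bad hP
    have hTH : d.ordTight < d.slopePoint := by
      rcases hsome with h1 | h1
      · exact hd.ordTight_lt hwaP hP (hbad h1).1 (hwa _ (hbad h1).1) (hbad h1).2.1 (hne h1)
      · exact hd.ordTight_lt hwaP hP (hbad h1).1 (hwa _ (hbad h1).1) (hbad h1).2.1 (hne h1)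
    have hib' : i' ∈ d'.badDivisors := mem_badDivisors.mpr ⟨h.mem, hs1⟩
    rw [if_pos hib'] at hL' hcB'
    rw [hs2] at hT'
    by_cases hk : j' ∈ d'.young
    · -- the strict transform of `{x_j = 0}` passes through the new point
      obtain ⟨hjY, h1, h2, h3, h4, h5, h6⟩ := hkept hk
      rw [h1] at hT'
      rw [h2] at hμ'
      rw [h3] at hT
      rw [h4] at hμ
      have hw : d'.wrho i' ≤ d.slopePoint - d.ordTight := by rw [wrho_eq]; linarith
      left
      by_cases hjb : j ∈ d.badDivisors
      · rw [if_pos (h5.mpr hjb)] at hL'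
        have hwj : d'.wrho j' < d.wrho j := by
          rw [wrho_eq, wrho_eq, h6 hjb]; linarith
        have hL'' : d'.letters = {d'.wrho i', d'.wrho j'} := hL'
        have hAB : d'.wordA < d.wordB := by
          rw [hB]
          refine d'.wordA_le_sort.trans_lt (sort_lt_cons (x := d'.wrho i') ?_ (by linarith) [])
          rw [hL'']; simp
        have hAA : d'.wordA < d.wordA := by
          refine d'.wordA_le_sort.trans_lt ?_
          rw [hA]
          by_cases hib : i ∈ d.badDivisors
          · rw [if_pos hib, if_pos hjb] at hL
            have hL2 : d.letters = {d.wrho i, d.wrho j} := hL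
            rw [hL'', hL2]
            refine sort_pair_lt ?_ hwj
            have := (hbad hib).2.2.2.2
            rw [wrho_eq d]
            linarith
          · rw [if_neg hib, if_pos hjb, zero_add] at hL
            rw [hL, Multiset.sort_singleton]
            refine sort_lt_cons (x := d'.wrho j') ?_ hwj []
            rw [hL'']; simp
        exact ⟨linedUp_lt_of_min_lt hAne hBne ((min_le_left _ _).trans_lt (lt_min hAA hAB)),
          hAA.not_gt⟩
      · have hib := hsome.resolve_right hjb
        rw [if_pos hib, if_neg hjb, add_zero] at hL
        rw [if_neg (fun h => hjb (h5.mp h)), add_zero] at hL'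
        have hjt := tight_eq_usual hjb
        rw [h3, h4] at hjt
        have hAA : d'.wordA ≤ d.wordA := by
          refine d'.wordA_le_sort.trans ?_
          rw [hA, hL, hL']
          refine sort_singleton_le (hw.trans ?_)
          have := (hbad hib).2.2.2.2
          rw [wrho_eq d]
          linarith
        have hBB : d'.wordB < d.wordB := by
          rw [hB]
          exact wordB_lt (by linarith)
        exact ⟨linedUp_lt hAne hBne hAA hBB, hAA.not_gt⟩
    · -- the exceptional divisor is the only component
      have hj0' : d'.tight j' = 0 := if_neg hk
      have hju' : d'.usual j' = 0 := if_neg hk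
      have hjb' : j' ∉ d'.badDivisors := fun h => hk (mem_badDivisors.mp h).1
      rw [hj0', add_zero] at hT'
      rw [hju', add_zero] at hμ'
      rw [if_neg hjb', add_zero] at hL' hcB'
      rw [if_neg hk, add_zero] at hcY'
      have hBB : d'.wordB < d.wordB := by
        rw [hB]
        exact wordB_lt (by linarith)
      have hc3 : d'.config = 3 := by rw [config, hcY', hcB']; rfl
      by_cases hjY : j ∈ d.young
      · -- `{x_j = 0}` is lost, and the word `A` is not controlled
        have hiY : i ∈ d.young := hchart.resolve_right fun hc => hk (h.other_mem.mpr ⟨hjY, hc⟩)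
        refine Or.inr (Or.inl ⟨?_, hc3, fun hAA => linedUp_lt hAne hBne hAA hBB⟩)
        rw [if_pos hiY, if_pos hjY] at hcY
        rw [config, hcY, hcB]
        by_cases hib : i ∈ d.badDivisors <;> by_cases hjb : j ∈ d.badDivisors
        · right; rw [if_pos hib, if_pos hjb]; rfl
        · left; rw [if_pos hib, if_neg hjb]; rfl
        · left; rw [if_neg hib, if_pos hjb]; rfl
        · exact absurd hsome (by simp [hib, hjb])
      · have hjb : j ∉ d.badDivisors := fun h => hjY (mem_badDivisors.mp h).1
        have hib := hsome.resolve_right hjb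
        have hjt : d.tight j = 0 := if_neg hjY
        rw [hjt] at hT
        rw [if_pos hib, if_neg hjb, add_zero] at hL
        have hAA : d'.wordA ≤ d.wordA := by
          refine d'.wordA_le_sort.trans ?_
          rw [hA, hL, hL']
          refine sort_singleton_le ?_
          have := (hbad hib).2.2.2.2
          rw [wrho_eq d, wrho_eq d']
          linarith
        exact Or.inl ⟨linedUp_lt hAne hBne hAA hBB, hAA.not_gt⟩
  · -- the point is good: the exceptional divisor is good
    have hs := h.good hP
    have hib' : i' ∉ d'.badDivisors := fun hb => (mem_badDivisors.mp hb).2.ne hs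
    rw [if_neg hib', zero_add] at hL' hcB'
    rw [hs, h.mu] at hT'
    by_cases hjb' : j' ∈ d'.badDivisors
    · have hk := (mem_badDivisors.mp hjb').1
      obtain ⟨hjY, h1, h2, h3, h4, h5, h6⟩ := hkept hk
      have hjb := h5.mp hjb'
      rw [h1] at hT'
      rw [h2] at hμ'
      rw [h3] at hT
      rw [h4] at hμ
      rw [if_pos hjb'] at hL' hcB'
      rw [if_pos hk] at hcY'
      have hwj : d'.wrho j' < d.wrho j := by
        rw [wrho_eq, wrho_eq, h6 hjb]; linarith
      by_cases hib : i ∈ d.badDivisors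
      · -- both components are bad, and `A` may increase
        obtain ⟨hiY, hi2, hi3, hi4, hi5⟩ := hbad hib
        rw [if_pos hib, if_pos hjb] at hL hcB
        rw [if_pos hiY, if_pos hjY] at hcY
        have hL2 : d.letters = {d.wrho i, d.wrho j} := hL
        -- `B ≤ A`, because `μ(P) = H(P) ≤ ρ_D` for all bad `D`
        have hBA : d.wordB ≤ d.wordA := by
          rw [hB, hA, hL2]
          have := (hbad hjb).2.2.2.2
          refine le_sort_pair ?_ ?_ <;> · rw [wrho_eq]; linarith
        have hBB : d'.wordB < d.wordB := by
          rw [hB]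
          exact wordB_lt (by linarith)
        exact Or.inr (Or.inr ⟨by rw [config, hcY, hcB]; rfl, hP, by rw [config, hcY', hcB']; rfl,
          linedUp_lt_of_min_lt hAne hBne
            ((min_le_right _ _).trans_lt (lt_min (hBB.trans_le hBA) hBB))⟩)
      · have hit := tight_eq_usual hib
        rw [if_neg hib, if_pos hjb, zero_add] at hL
        have hAA : d'.wordA < d.wordA := by
          refine d'.wordA_le_sort.trans_lt ?_
          rw [hA, hL, Multiset.sort_singleton]
          refine sort_lt_cons (x := d'.wrho j') ?_ hwj []
          rw [hL']; simp
        have hBB : d'.wordB ≤ d.wordB := by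
          rw [hB]
          exact wordB_le (by linarith)
        refine Or.inl ⟨?_, hAA.not_gt⟩
        rw [linedUp_comm, linedUp_comm d.wordA]
        exact linedUp_lt hBne hAne hBB hAA
    · rw [if_neg hjb'] at hL'
      have hA' := wordA_of_letters_eq_zero hL'
      left
      refine ⟨?_, by rw [hA']; exact (nil_le_word _).not_gt⟩
      rw [← MonomialDatum.invSpade_eq, ← MonomialDatum.invSpade_eq, invSpade_of_letters_eq_zero hL']
      exact zeroPair_lt hinv

end MonomialDatum

end Idealistic

namespace Idealistic

open MvPowerSeries IsLocalRing

/-! ### The transformation laws for points and curves -/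

theorem OrdGE.of_X_pow_mul {k : Type*} [Field k] {i : Fin 3} {n : ℕ} {c : ℚ}
    {F : MvPowerSeries (Fin 3) k} (h : OrdGE (Pi.single i 1) c (X i ^ n * F)) :
    OrdGE (Pi.single i 1) (c - n) F := by
  intro t ht
  have h2 := h (Finsupp.single i n + t) (by rwa [X_pow_eq, coeff_add_monomial_mul, one_mul])
  rw [weight_single_one, Finsupp.add_apply, Finsupp.single_eq_same, Nat.cast_add] at h2
  rw [weight_single_one]
  linarith

namespace MonomialDatum

variable {k : Type*} {p : ℕ} {O O' : Type*} [Field k] [CommRing O] [Algebra k O] [CommRing O']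
  [Algebra k O'] [IsLocalRing O] {d : MonomialDatum k p O} {φ : O →ₐ[k] O'} {exc : O'} {i : Fin 3}
  {c : k} {X' : MvPowerSeries (Fin 3) k ≃ₐ[k] O'} {R : ℕ → Ideal O} {E : Set (Ideal O)}

theorem IsPreCase.dvd_chartHom_point (hd : d.IsPreCase R E) (hX : d.IsChart φ exc i 1 c X')
    (hi : i ≠ 0) : ∀ l ∈ Finset.Icc 1 d.q, MvPowerSeries.X i ^ l ∣ d.chartHom φ X' (d.coef l) := by
  intro l hl
  rw [X_pow_dvd_iff_ordGE]
  refine hX.ordGE hi (w := fun _ => 1) (by simp) (by simp) (Or.inl (by simp)) ?_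
  exact ordGE_degree_iff.mpr (hd.coef_mem hl)

theorem IsPreCase.le_expo_point (hd : d.IsPreCase R E) (hi : i ≠ 0)
    (hlt : d.a < ∑ l ∈ d.young, d.m l) : d.a ≤ d.expo i + 1 * d.expo (Idealistic.other i) := by
  rw [one_mul]
  exact hlt.le.trans_eq (sum_eq_of_zero_notMem hd.z_notMem hi d.m)

theorem IsPreCase.dvd_chartHom_curve (hd : d.IsPreCase R E) (hX : d.IsChart φ exc i 0 0 X')
    (hi : i ≠ 0) (hsing : PrimeSpectrum.zeroLocus (d.curve i : Set O) ⊆ singLocus R) :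
    ∀ l ∈ Finset.Icc 1 d.q, MvPowerSeries.X i ^ l ∣ d.chartHom φ X' (d.coef l) := by
  intro l hl
  have h := map_dvd (d.chartHom φ X') (hd.dvd_coef_of_curve hi hsing hl)
  rwa [map_pow, hX.chartHom_self] at h

theorem IsPreCase.le_expo_curve (hd : d.IsPreCase R E) (hi : i ∈ d.young)
    (hsing : PrimeSpectrum.zeroLocus (d.curve i : Set O) ⊆ singLocus R) :
    d.a ≤ d.expo i + 0 * d.expo (Idealistic.other i) := by
  rw [zero_mul, add_zero, expo, if_pos hi]
  exact hd.le_m_of_curve hi hsing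

/-- The transform of a monomial case is a monomial case, with well-adapted data. -/
theorem IsPreCase.exists_wellAdapted_blowup [IsLocalRing O'] [IsAlgClosed k] [Fact p.Prime]
    [CharP k p] {κ : ℕ} (hd : d.IsPreCase R E)
    (hR : IsFiltration R) (hX : d.IsChart φ exc i κ c X') (hi : i ≠ 0)
    (hdvd : ∀ l ∈ Finset.Icc 1 d.q, MvPowerSeries.X i ^ l ∣ d.chartHom φ X' (d.coef l))
    (hle : d.a ≤ d.expo i + κ * d.expo (Idealistic.other i))
    (hS' : ∀ n, transformFiltration φ exc R n ≤ maximalIdeal O' ^ n)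
    (hpure : HasPureRank k p (transformFiltration φ exc R) d.e) :
    ∃ d' : MonomialDatum k p O',
      d'.IsWellAdaptedCase (transformFiltration φ exc R) (transformBoundary φ exc E) := by
  choose! coef' hcoef using hdvd
  have hB := hd.blowup hR hX hi hcoef hS' hle
  exact hB.exists_wellAdapted (isFiltration_transform φ exc hR) hS' hpure

variable [IsLocalRing O'] [IsAlgClosed k] [hp : Fact p.Prime] [CharP k p]
  {d' : MonomialDatum k p O'}

/-- The transformation laws for the blow-up of the point. -/
theorem IsPreCase.isPointTransform (hd : d.IsPreCase R E) (hwaP : d.WellAdaptedPoint)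
    (hwa : ∀ l ∈ d.young, d.WellAdaptedAlong l) (hlt : d.a < ∑ l ∈ d.young, d.m l)
    (hR : IsFiltration R) (hX : d.IsChart φ exc i 1 c X') (hi : i ≠ 0)
    (hS' : ∀ n, transformFiltration φ exc R n ≤ maximalIdeal O' ^ n)
    (hd' : d'.IsPreCase (transformFiltration φ exc R) (transformBoundary φ exc E))
    (hwa' : ∀ l ∈ d'.young, d'.WellAdaptedAlong l) (he : d'.e = d.e)
    (hpure : HasPureRank k p (transformFiltration φ exc R) d'.e) :
    ∃ i', IsPointTransform d d' i i' c := by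
  have hq : (0 : ℚ) < d.q := by exact_mod_cast q_pos d
  have hz := hd.lastCoef_mem_zFree
  obtain ⟨F', i', hF', hi', -, hmu, hlead, hgood, hmem, hother⟩ := hd.blowup_laws hwa hR hX hi
    (hd.dvd_chartHom_point hX hi) (hd.le_expo_point hi hlt) hS' hd' hwa' he hpure
  rw [Nat.cast_one, one_mul, ← hd.muPoint_eq hi] at hmu
  refine ⟨i', hi', hmu, fun hP => hgood ?_, fun hP => ?_, hmem, fun hj => ?_⟩
  · have h1 := hX.ordGE hi (w := fun _ => 1) (w' := Pi.single i 1) (by simp) (by simp)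
      (Or.inl (by simp)) (ordGE_slopePoint d)
    rw [hF'] at h1
    have h2 := h1.of_X_pow_mul
    rwa [hP, ← mul_sub_one, ← hmu] at h2
  · obtain ⟨s, hs, hsd, hsdeg, hsF⟩ := exists_term_of_bad_point hwaP hP
    obtain ⟨r, n, hr, hl, hn⟩ := exists_isLead_point (e := d.e) hX hi hz hF' hs hsd hsF (ordGE_tight i)
    have hr' : (r : ℚ) = d.q * (d.slopePoint - 1) := by
      rw [mul_sub_one, ← hsdeg, ← hr]; push_cast [q]; ring
    rw [hsdeg] at hn
    obtain ⟨h1, h2, h3⟩ := hlead r n hl (by rw [hr', hmu]; gcongr)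
    refine ⟨h1, by rw [h2, hr', mul_div_cancel_left₀ _ hq.ne'], ?_⟩
    rw [h3, Nat.cast_add, hr', add_div, mul_div_cancel_left₀ _ hq.ne']
    have h4 : (n : ℚ) / d.q ≤ d.slopePoint - d.tight i := by
      rw [div_le_iff₀ hq]; linarith
    linarith
  · have h := hother hj
    rwa [Nat.cast_one, one_mul] at h

/-- The transformation laws for the blow-up of a curve `V(z, x_i)` in `Sing(R)`. -/
theorem IsPreCase.isCurveTransform (hd : d.IsPreCase R E)
    (hwa : ∀ l ∈ d.young, d.WellAdaptedAlong l)
    (hR : IsFiltration R) (hX : d.IsChart φ exc i 0 0 X') (hi : i ∈ d.young)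
    (hsing : PrimeSpectrum.zeroLocus (d.curve i : Set O) ⊆ singLocus R)
    (hS' : ∀ n, transformFiltration φ exc R n ≤ maximalIdeal O' ^ n)
    (hd' : d'.IsPreCase (transformFiltration φ exc R) (transformBoundary φ exc E))
    (hwa' : ∀ l ∈ d'.young, d'.WellAdaptedAlong l) (he : d'.e = d.e)
    (hpure : HasPureRank k p (transformFiltration φ exc R) d'.e) :
    ∃ i', Ideal.span {d'.x i'} = Ideal.span {exc} ∧ IsCurveTransform d d' i i' := by
  have hq : (0 : ℚ) < d.q := by exact_mod_cast q_pos d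
  have hi0 := hd.ne_zero hi
  have hz := hd.lastCoef_mem_zFree
  obtain ⟨F', i', hF', hi', hexc, hmu, hlead, hgood, hmem, hother⟩ := hd.blowup_laws hwa hR hX hi0
    (hd.dvd_chartHom_curve hX hi0 hsing) (hd.le_expo_curve hi hsing) hS' hd' hwa' he hpure
  rw [Nat.cast_zero, zero_mul, add_zero, usual_of_mem hi] at hmu
  have hslope : d'.slope i' = d.slope i - 1 ∧
      (d.slope i < d.mu i → d'.rho i' = d.rho i - 1) := by
    rcases lt_or_eq_of_le (slope_le_mu (d := d) i) with hbad | hgd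
    · obtain ⟨r, n, hl, hsl, hr, hres⟩ := hd.exists_isLead hi (hwa _ hi) hbad
      obtain ⟨r', hrr, hl'⟩ := hl.blowup_curve hX hi0 hz hF'
      have hr' : (r : ℚ) = r' + d.q := by rw [← hrr]; push_cast; ring
      obtain ⟨-, h1, h2⟩ := hlead r' n hl' (by rw [hmu]; linarith)
      refine ⟨by rw [h1, hsl, hr', add_div, div_self hq.ne']; ring, fun _ => ?_⟩
      rw [h2, rho, hres]
      push_cast
      rw [hr']
      field_simp
      ring
    · refine ⟨?_, fun h => absurd hgd h.ne⟩
      rw [hgd, ← hmu]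
      refine hgood ?_
      have h1 := hX.ordGE hi0 (w' := Pi.single i 1) (by simp [hi0.symm]) (by simp)
        (Or.inl (by simp [(other_ne hi0).2])) (ordGE_of_slope_eq (q_pos d) hgd)
      rw [hF'] at h1
      have h2 := h1.of_X_pow_mul
      rwa [← mul_sub_one, ← hmu] at h2
  refine ⟨i', hexc, hi', hmu, hslope.1, hslope.2, by simpa using hmem, fun hj => ?_⟩
  have h := hother hj
  rwa [Nat.cast_zero, zero_mul, add_zero] at h

end MonomialDatum

end Idealistic

namespace Idealistic

open MvPowerSeries IsLocalRing

/-! ### Configurations -/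

namespace MonomialDatum

variable {k : Type*} {p : ℕ} {O : Type*} [Field k] [CommRing O] [Algebra k O]
  {d : MonomialDatum k p O}

theorem card_badDivisors_eq_zero (h : d.config = 1 ∨ d.config = 2) : d.badDivisors.card = 0 := by
  rw [config] at h
  split at h <;> first | assumption | omega

theorem card_badDivisors_ne_zero (h : d.config = 3 ∨ d.config = 4 ∨ d.config = 5) :
    d.badDivisors.card ≠ 0 := by
  rw [config] at h
  split at h <;> omega

theorem three_le_config (h : d.config = 4 ∨ d.config = 5) : 3 ≤ d.config := by omega

/-- Without bad divisors the last coefficient is divisible by `(M^(1/a))^q`, so that the usual and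
the tight monomial agree and `P` is a good point. -/
theorem isTight_of_badDivisors_eq_empty (hq : 0 < d.q) (hb : d.badDivisors = ∅) : d.IsTight := by
  have hs : ∀ l ∈ d.young, d.slope l = d.mu l := fun l hl => by
    have h : l ∉ d.badDivisors := by simp [hb]
    rw [mem_badDivisors, not_and, not_lt] at h
    exact le_antisymm (slope_le_mu l) (h hl)
  have hT : d.ordTight = d.muPoint := Finset.sum_congr rfl hs
  rw [IsTight, invHeart, hT, sub_eq_zero, slopePoint, order_eq_weightedOrder]
  refine slopeVal_eq_of_ordGE hq fun s hs' => ?_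
  rw [weight_one, muPoint, Finset.mul_sum, Finsupp.degree_eq_sum, Nat.cast_sum]
  calc ∑ l ∈ d.young, (d.q : ℚ) * d.mu l ≤ ∑ l ∈ d.young, (s l : ℚ) :=
        Finset.sum_le_sum fun l hl => by
          have := ordGE_of_slope_eq hq (hs l hl) s hs'
          rwa [weight_single_one] at this
    _ ≤ ∑ l, (s l : ℚ) :=
        Finset.sum_le_sum_of_subset_of_nonneg (Finset.subset_univ _) fun _ _ _ => Nat.cast_nonneg _

/-- If `q = 1`, every series is a `q`-th power, so that well-adaptedness rules out bad divisors. -/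
theorem badDivisors_eq_empty_of_eq_one (hq : d.q = 1) (hwa : ∀ l ∈ d.young, d.WellAdaptedAlong l) :
    d.badDivisors = ∅ := by
  ext l
  rw [mem_badDivisors]
  simp only [Finset.notMem_empty, iff_false, not_and, not_lt]
  intro hl
  rcases hwa l hl with h | ⟨-, h⟩
  · exact h.ge
  · exact absurd ⟨initAlong l d.lastCoef, by rw [hq, pow_one]⟩ h

variable [IsLocalRing O]

theorem curve_ne_maximalIdeal {i : Fin 3} (hi : i ≠ 0) : d.curve i ≠ maximalIdeal O := by
  intro h
  have h1 : d.x (Idealistic.other i) ∈ d.curve i := h ▸ d.x_mem _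
  have h3 : Idealistic.other i ≠ 0 := (other_ne hi).1
  rw [curve, Ideal.mem_span_pair] at h1
  obtain ⟨a, b, hab⟩ := h1
  have h4 : MvPowerSeries.X (Idealistic.other i) ∈
      Ideal.span {(MvPowerSeries.X 0 : MvPowerSeries (Fin 3) k), MvPowerSeries.X i} := by
    rw [Ideal.mem_span_pair]
    refine ⟨d.X.symm a, d.X.symm b, d.X.injective ?_⟩
    rw [map_add, map_mul, map_mul, AlgEquiv.apply_symm_apply, AlgEquiv.apply_symm_apply]
    exact hab
  rw [mem_curve_iff hi] at h4
  have h5 := h4 (Finsupp.single (Idealistic.other i) 1) (by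
    rw [coeff_index_single_self_X]; exact one_ne_zero)
  rw [weight_curveWeight hi] at h5
  simp [h3, (other_ne hi).2] at h5
  norm_num at h5

end MonomialDatum

end Idealistic

open Idealistic MonomialDatum

theorem proposition4 {k : Type*} [Field k] [IsAlgClosed k] (p : ℕ) [ExpChar k p]
    {O : Type*} [CommRing O] [IsLocalRing O] [Algebra k O]
    (R : ℕ → Ideal O) (hR : Idealistic.IsIdealisticFiltration R)
    (E : Set (Ideal O)) (idx : Ideal O → ℕ) (hidx : Set.InjOn idx E)
    -- the closed point `P` belongs to `Sing(R)`
    (hP : ∀ n, R n ≤ IsLocalRing.maximalIdeal O ^ n)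
    (d : Idealistic.MonomialDatum k p O) (hd : d.IsWellAdaptedCase R E) :
    -- part 1
    (d.config = 1 ∨ d.config = 2 →
      d.invSpade = Idealistic.MonomialDatum.zeroPair ∧ d.IsTight) ∧
    -- part 2
    (d.config = 3 ∨ d.config = 4 ∨ d.config = 5 →
      d.invSpade ≠ Idealistic.MonomialDatum.zeroPair →
      ∀ C : Ideal O, d.IsAlgorithmCenter R idx C →
      ∀ {O' : Type*} [CommRing O'] [IsLocalRing O'] [Algebra k O'] (φ : O →ₐ[k] O') (exc : O'),
        Idealistic.IsBlowupGerm φ C exc →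
        -- the new closed point `P'` belongs to the singular locus of the transform
        (∀ n, Idealistic.transformFiltration φ exc R n ≤ IsLocalRing.maximalIdeal O' ^ n) →
        -- the invariant `σ` stays the same
        Idealistic.sigma k p (Idealistic.transformFiltration φ exc R) = Idealistic.sigma k p R →
        -- `P'` is again in the monomial case with `τ = 1`, and the invariants at `P'` make sense
        (∃ d' : Idealistic.MonomialDatum k p O',
          d'.IsWellAdaptedCase (Idealistic.transformFiltration φ exc R)
            (Idealistic.transformBoundary φ exc E)) ∧
        ∀ d' : Idealistic.MonomialDatum k p O',
          d'.IsWellAdaptedCase (Idealistic.transformFiltration φ exc R)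
            (Idealistic.transformBoundary φ exc E) →
          -- case (a): the center is a curve
          (∀ i ∈ d.young, C = d.curve i →
            d.invSpade = d'.invSpade ∧
            ∃ j ∈ d'.young, Ideal.span {d'.x j} = Ideal.span {exc} ∧
              d'.mu j = d.mu i - 1 ∧ d'.mu j < d.mu i) ∧
          -- case (b): the center is the point `P`
          (C = IsLocalRing.maximalIdeal O →
            (¬ d.IsEsoteric d' → d'.invSpade < d.invSpade) ∧
            (d.IsEsoteric d' →
              ((d.config = 4 ∨ d.config = 5) ∧ d'.config = 3) ∨
              (d.config = 5 ∧ d.IsGoodPoint ∧ d'.config = 4 ∧ d'.invSpade < d.invSpade)))) := by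
  obtain ⟨hcase, hwaP, hwa⟩ := hd
  have hpre := hcase.isPreCase
  constructor
  · intro hc
    have hb := Finset.card_eq_zero.mp (card_badDivisors_eq_zero hc)
    exact ⟨invSpade_of_letters_eq_zero (by rw [letters, hb]; rfl),
      isTight_of_badDivisors_eq_empty (pow_pos (expChar_pos k p) _) hb⟩
  intro hc hinv C hC O' _ _ _ φ exc hb hS' hσ
  cases ‹ExpChar k p› with
  | zero =>
    exact absurd (Finset.card_eq_zero.mpr (badDivisors_eq_empty_of_eq_one (one_pow _) hwa))
      (card_badDivisors_ne_zero hc)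
  | prime hp =>
    have : Fact p.Prime := ⟨hp⟩
    have hq := q_pos d
    have hR' := hR.1
    have hpureP := hcase.lgs.hasPureRank
    obtain ⟨v⟩ : Nonempty (MvPowerSeries (Fin 3) k ≃ₐ[k] O') := by
      obtain ⟨-, v, -⟩ := hb; exact ⟨v⟩
    have hpure := hpureP.of_sigma_eq v hσ
    have he : ∀ d' : MonomialDatum k p O', d'.IsWellAdaptedCase (transformFiltration φ exc R)
        (transformBoundary φ exc E) → d'.e = d.e := fun d' hd' =>
      hd'.1.lgs.hasPureRank.unique hpure
    rcases hC with ⟨-, i, hi, rfl, hsing, -⟩ | ⟨-, rfl⟩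
    · -- the center is a curve
      have hi0 := hpre.ne_zero hi
      constructor
      · obtain ⟨X', hX⟩ := hpre.exists_curve_chart hq hcase.lgs_initial hi0 hsing hb hS'
        exact hpre.exists_wellAdapted_blowup hR' hX hi0 (hpre.dvd_chartHom_curve hX hi0 hsing)
          (hpre.le_expo_curve hi hsing) hS' hpure
      intro d' hd'
      refine ⟨fun j hj hCj => ?_, fun h => absurd h (curve_ne_maximalIdeal hi0)⟩
      rw [hCj] at hsing hb
      obtain ⟨X', hX⟩ := hpre.exists_curve_chart hq hcase.lgs_initial (hpre.ne_zero hj) hsing hb hS'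
      obtain ⟨j', hexc, h⟩ := hpre.isCurveTransform hwa hR' hX hj hsing hS' hd'.1.isPreCase hd'.2.2
        (he d' hd') (he d' hd' ▸ hpure)
      exact ⟨h.invSpade_eq hpre hd'.1.isPreCase hj, j', h.mem, hexc, h.mu, by rw [h.mu]; linarith⟩
    · -- the center is the point
      obtain ⟨l, hl⟩ := Finset.card_ne_zero.mp (card_badDivisors_ne_zero hc)
      have hl := (mem_badDivisors.mp hl).1
      obtain ⟨i, hi, c, X', hX, hil⟩ := hpre.exists_point_chart hq (hpre.ne_zero hl)
        hcase.lgs_initial hb hS'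
      refine ⟨hpre.exists_wellAdapted_blowup hR' hX hi (hpre.dvd_chartHom_point hX hi)
        (hpre.le_expo_point hi hcase.monomial_order) hS' hpure, fun d' hd' => ?_⟩
      refine ⟨fun j hj h => absurd h.symm (curve_ne_maximalIdeal (hpre.ne_zero hj)), fun _ => ?_⟩
      obtain ⟨i', h⟩ := hpre.isPointTransform hwaP hwa hcase.monomial_order hR' hX hi hS'
        hd'.1.isPreCase hd'.2.2 (he d' hd') (he d' hd' ▸ hpure)
      rcases h.invSpade_lt hpre hd'.1.isPreCase hwaP hwa hinv hi
        (hil.imp_left fun h5 : i = l => h5 ▸ hl) with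
        ⟨h1, h2⟩ | ⟨h1, h2, h3⟩ | h
      · exact ⟨fun _ => h1, fun h => absurd h.2.2 h2⟩
      · refine ⟨fun h4 => h3 (not_lt.mp fun h5 => h4 ⟨three_le_config h1, h2.ge, h5⟩),
          fun _ => Or.inl ⟨h1, h2⟩⟩
      · exact ⟨fun _ => h.2.2.2, fun _ => Or.inr h⟩
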